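/- Let $X$ be a compact Riemannian spin manifold of even dimension $2m\ge 2$ with boundary $Y$, with spinor bundle $\mathcal S=\mathcal S^+\oplus\mathcal S^-$ graded by $\gamma_X=i^m c_X(e_1\cdots e_{2m})$, where $c_X(v)^2=-|v|^2$. Let $\mathcal E\to X$ be a flat hermitian (i.e. unitary flat) vector bundle and let $H\in\Omega^{4\bullet+3}(X,\mathbb R)\oplus i\,\Omega^{4\bullet+1}(X,\mathbb R)$ be a closed odd-degree form. The twisted Dirac operator is $D^{X,\mathcal E}_H=\sum_i c_X(e_i)\nabla^{\mathcal S\otimes\mathcal E}_{e_i}+c_X(H)$ on sections of $\mathcal S\otimes\mathcal E$, where $\nabla^{\mathcal S\otimes\mathcal E}$ is built from the lift of the Levi-Civita connection and the flat connection of $\mathcal E$, and $c_X(H)$ is Clifford multiplication by $H$; the operator $D^{Y,\mathcal E|_Y}_{H|_Y}$ is defined in the same way on $Y$, by means of the induced spin structure and metric, $\mathcal E|_Y$, and $H|_Y=i^*H$, where $i:Y\to X$ is the inclusion. Suppose that there is a collar neighbourhood $X_\epsilon\cong[0,\epsilon)\times Y$ of $Y$, with coordinate $r\in[0,\epsilon)$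 and projection $p:X_\epsilon\to Y$, on which the metric is the product $dr^2+g_Y$ and $H=p^*(i^*H)$. (The hermitian metric of $\mathcal E$ is then of product type on $X_\epsilon$ for the trivialisation of $\mathcal E$ along the lines in direction $r$ by parallel transport.) Let $\sigma=c_X(\partial/\partial r)$ be Clifford multiplication by the inward unit normal. Over $Y$ identify $\mathcal S_Y$ with $\mathcal S^+|_Y$ so that $c_Y(v)=-\sigma c_X(v)$ for $v\in TY$. Then this identification extends to the collar: spin frames of $Y$, completed by $\partial/\partial r$, and parallel unitary frames of $\mathcal E|_Y$ are carried continuously along the lines in direction $r$, and smooth sections of $\mathcal S^+\otimes\mathcal E$ over $X_\epsilon$ are thereby identified with smooth sections of $p^*(\mathcal S_Y\otimes\mathcal E|_Y)$, that is, with smooth families $(\varphi_r)_{r\in[0,\epsilon)}$ of sections of $\mathcal S_Y\otimes\mathcal E|_Y$. Under this identification the operator $D^{X,\mathcal E}_H$ on sections of $\mathcal S^+\otimes\mathcal E$ over $X_\epsilon$ is $$\sigma\left(\frac{\partial}{\partial r}+D^{Y,\mathcal E|_Y}_{H|_Y}\right).$$ Moreover $D^{Y,\mathcal E|_Y}_{H|_Y}$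 is elliptic and (formally) self-adjoint, i.e. symmetric on smooth sections for the $L^2$ product. -/

import Mathlib

open Set Manifold MeasureTheory
open scoped ContDiff BigOperators

noncomputable section

/-! ### Clifford algebra, spin group, spinor modules -/

/-- The quadratic form `v ↦ -|v|²` on `ℝ^d`; in its Clifford algebra `v * v = -|v|²`. -/
def cliffForm (d : ℕ) : QuadraticForm ℝ (Fin d → ℝ) :=
  QuadraticMap.weightedSumSquares ℝ (fun _ : Fin d => (-1 : ℝ))

/-- The topology of the finite-dimensional real vector space `Cl(ℝ^d)`. -/
instance cliffTopology (d : ℕ) : TopologicalSpace (CliffordAlgebra (cliffForm d)) :=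
  moduleTopology ℝ _

/-- The compact group `Spin(d)`, with the topology it inherits from the Clifford algebra. -/
abbrev SpinGrp (d : ℕ) : Type := spinGroup (cliffForm d)

/-- The inclusion `ℝ^n → ℝ^(n+1)`, `v ↦ (v, 0)`. -/
def inclVec (n : ℕ) : (Fin n → ℝ) →ₗ[ℝ] (Fin (n + 1) → ℝ) where
  toFun v := Fin.snoc v 0
  map_add' v w := by
    ext i
    refine Fin.lastCases ?_ (fun j => ?_) i <;> simp
  map_smul' a v := by
    ext i
    refine Fin.lastCases ?_ (fun j => ?_) i <;> simp

/-- The inclusion `ℝ^n → ℝ^(n+1)` as an isometry of quadratic spaces. -/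
def inclIsometry (n : ℕ) : cliffForm n →qᵢ cliffForm (n + 1) where
  toLinearMap := inclVec n
  map_app' v := by
    simp [cliffForm, inclVec, QuadraticMap.weightedSumSquares_apply, Fin.sum_univ_castSucc]

/-- The inclusion `Cl(ℝ^n) → Cl(ℝ^(n+1))`, which restricts to `Spin(n) → Spin(n+1)`. -/
def inclCliff (n : ℕ) :
    CliffordAlgebra (cliffForm n) →ₐ[ℝ] CliffordAlgebra (cliffForm (n + 1)) :=
  CliffordAlgebra.map (inclIsometry n)

/-- A model `Δ` of the complex spinor representation in dimension `d`: a hermitian Clifford module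
(`c v * c v = -|v|²`, `c v` skew-adjoint) of the dimension `2 ^ ⌊d/2⌋` of the irreducible ones. -/
structure SpinorModule (d : ℕ) (Δ : Type*) [NormedAddCommGroup Δ] [InnerProductSpace ℂ Δ] where
  c : (Fin d → ℝ) →ₗ[ℝ] Module.End ℂ Δ
  sq : ∀ v, c v * c v = algebraMap ℝ (Module.End ℂ Δ) (cliffForm d v)
  skew : ∀ v x y, inner ℂ (c v x) y = -inner ℂ x (c v y)
  finiteDimensional : FiniteDimensional ℂ Δ
  finrank_eq : Module.finrank ℂ Δ = 2 ^ (d / 2)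

namespace SpinorModule

variable {d : ℕ} {Δ : Type*} [NormedAddCommGroup Δ] [InnerProductSpace ℂ Δ]

/-- Clifford multiplication by the `i`-th vector of the standard basis. -/
def gen (C : SpinorModule d Δ) (i : Fin d) : Module.End ℂ Δ := C.c (Pi.single i 1)

/-- The representation of the Clifford algebra, in particular of `Spin(d)`, on spinors. -/
def rep (C : SpinorModule d Δ) : CliffordAlgebra (cliffForm d) →ₐ[ℝ] Module.End ℂ Δ :=
  CliffordAlgebra.lift (cliffForm d) ⟨C.c, C.sq⟩

/-- Clifford multiplication by `e_1 ⋯ e_d`. -/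
def volumeElement (C : SpinorModule d Δ) : Module.End ℂ Δ := (List.ofFn C.gen).prod

end SpinorModule

/-! ### Manifolds: metrics, differential forms -/

section Geometry

variable {d : ℕ} {H : Type*} [TopologicalSpace H]
  {I : ModelWithCorners ℝ (EuclideanSpace ℝ (Fin d)) H}
  {M : Type*} [TopologicalSpace M] [ChartedSpace H M] [IsManifold I ∞ M]

variable (I M) in
/-- Smooth Riemannian metrics on `M`. -/
abbrev RiemMetric : Type _ :=
  Bundle.ContMDiffRiemannianMetric I ∞ (EuclideanSpace ℝ (Fin d))
    (fun x : M => TangentSpace I x)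

/-- Smoothness of a vector field on a set. -/
def SmoothVF (I : ModelWithCorners ℝ (EuclideanSpace ℝ (Fin d)) H) {M : Type*}
    [TopologicalSpace M] [ChartedSpace H M] [IsManifold I ∞ M]
    (V : ∀ x : M, TangentSpace I x) (U : Set M) : Prop :=
  ContMDiffOn I I.tangent ∞ (fun x => (⟨x, V x⟩ : TangentBundle I M)) U

/-- `⟨∇_{e_i} e_j, e_l⟩` at `x` for the Levi-Civita connection `∇` and an orthonormal frame
`e`, by the Koszul formula (in which the derivatives of the constants `⟨e_a, e_b⟩` drop out). -/
def leviCivitaCoeff (g : RiemMetric I M) (e : Fin d → ∀ x : M, TangentSpace I x) (x : M)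
    (i j l : Fin d) : ℝ :=
  (g.inner x (VectorField.mlieBracket I (e i) (e j) x) (e l x)
    - g.inner x (VectorField.mlieBracket I (e j) (e l) x) (e i x)
    + g.inner x (VectorField.mlieBracket I (e l) (e i) x) (e j x)) / 2

variable (I M) in
/-- Complex differential forms of mixed degree: `η k` is the component of degree `k`. -/
abbrev MixedForm : Type _ :=
  ∀ (k : ℕ) (x : M), (TangentSpace I x) [⋀^Fin k]→L[ℝ] ℂ

/-- A form is smooth if it takes smooth values on smooth local vector fields. -/
def SmoothForm (η : MixedForm I M) : Prop :=
  ∀ (k : ℕ) (U : Set M), IsOpen U → ∀ V : Fin k → ∀ x : M, TangentSpace I x,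
    (∀ i, SmoothVF I (V i) U) →
      ContMDiffOn I 𝓘(ℝ, ℂ) ∞ (fun x => η k x (fun i => V i x)) U

/-- The component of degree `k` of `η` in the preferred chart at `x₀`. -/
def formInChart (η : MixedForm I M) (k : ℕ) (x₀ : M) (z : EuclideanSpace ℝ (Fin d)) :
    (EuclideanSpace ℝ (Fin d)) [⋀^Fin k]→L[ℝ] ℂ :=
  (η k ((extChartAt I x₀).symm z)).compContinuousLinearMap
    (mfderivWithin 𝓘(ℝ, EuclideanSpace ℝ (Fin d)) I (extChartAt I x₀).symm (range I) z)

/-- `dη = 0`, computed in charts. -/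
def ClosedForm (η : MixedForm I M) : Prop :=
  ∀ (k : ℕ) (x₀ : M), ∀ z ∈ (extChartAt I x₀).target,
    extDerivWithin (formInChart η k x₀) (range I) z = 0

/-- Closed smooth forms in `Ω^{4•+3}(M, ℝ) ⊕ i Ω^{4•+1}(M, ℝ)`. -/
structure IsFluxForm (η : MixedForm I M) : Prop where
  smooth : SmoothForm η
  closed : ClosedForm η
  odd : ∀ k, Even k → ∀ x, η k x = 0
  real_part : ∀ k, k % 4 = 3 → ∀ x v, (η k x v).im = 0
  imag_part : ∀ k, k % 4 = 1 → ∀ x v, (η k x v).re = 0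

/-- The volume measure of `g`: in each chart it is `√(det g_ij)` times Lebesgue measure. -/
def IsRiemannianVolume [MeasurableSpace M] (g : RiemMetric I M) (μ : Measure M) : Prop :=
  ∀ (x₀ : M) (A : Set M), A ⊆ (chartAt H x₀).source → MeasurableSet A →
    μ A = ∫⁻ z in (extChartAt I x₀) '' A, ENNReal.ofReal (Real.sqrt (Matrix.det
      (Matrix.of fun i j : Fin d => g.inner ((extChartAt I x₀).symm z)
        (mfderivWithin 𝓘(ℝ, EuclideanSpace ℝ (Fin d)) I (extChartAt I x₀).symm (range I) z
          (EuclideanSpace.single i (1 : ℝ)))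
        (mfderivWithin 𝓘(ℝ, EuclideanSpace ℝ (Fin d)) I (extChartAt I x₀).symm (range I) z
          (EuclideanSpace.single j (1 : ℝ))))))

/-! ### Spin structures and flat hermitian bundles -/

/-- The map from spin frames to `d`-tuples of tangent vectors. -/
def frameMap {Q : Type*} (proj : Q → M) (frame : ∀ q : Q, Fin d → TangentSpace I (proj q)) :
    Q → Fin d → TangentBundle I M :=
  fun q i => ⟨proj q, frame q i⟩

/-- A spin structure on the Riemannian manifold `(M, g)`: a principal `Spin(d)`-bundle `Q` (of
"spin frames") with an equivariant map to the orthonormal frames of `M` which is a covering of its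
image. The image is the bundle of positive orthonormal frames of the orientation of `M` that belongs
to the spin structure. -/
structure SpinStructure (g : RiemMetric I M) (Q : Type*) [TopologicalSpace Q] where
  proj : Q → M
  frame : ∀ q : Q, Fin d → TangentSpace I (proj q)
  act : Q → SpinGrp d → Q
  orthonormal : ∀ q i j, g.inner (proj q) (frame q i) (frame q j) = if i = j then 1 else 0
  surjective : Function.Surjective proj
  act_one : ∀ q, act q 1 = q
  act_mul : ∀ q a b, act q (a * b) = act (act q a) b
  act_continuous : Continuous (fun z : Q × SpinGrp d => act z.1 z.2)
  proj_act : ∀ q a, proj (act q a) = proj q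
  simply_transitive : ∀ q q', proj q = proj q' → ∃! a, act q a = q'
  /-- `frame (q·a) (v) = frame q (Ad(a) v)`, where `Ad(a) v = a v a⁻¹`. -/
  equivariant : ∀ (q : Q) (a : SpinGrp d) (v w : Fin d → ℝ),
    (a : CliffordAlgebra (cliffForm d)) * CliffordAlgebra.ι _ v
        = CliffordAlgebra.ι _ w * (a : CliffordAlgebra (cliffForm d)) →
      (⟨proj (act q a), ∑ i, v i • frame (act q a) i⟩ : TangentBundle I M)
        = ⟨proj q, ∑ i, w i • frame q i⟩
  covering : IsCoveringMap (rangeFactorization (frameMap (I := I) proj frame))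
  /-- Local triviality: smooth local sections exist through every point. -/
  exists_section : ∀ q : Q, ∃ (U : Set M) (s : M → Q) (e : Fin d → ∀ x : M, TangentSpace I x),
    IsOpen U ∧ proj q ∈ U ∧ s (proj q) = q ∧ ContinuousOn s U ∧ (∀ i, SmoothVF I (e i) U) ∧
      ∀ x ∈ U, proj (s x) = x ∧
        ∀ i, (⟨proj (s x), frame (s x) i⟩ : TangentBundle I M) = ⟨x, e i x⟩

/-- A flat hermitian vector bundle of rank `N`, given by the bundle `P` of its parallel unitary
frames: a principal bundle for the discrete group `U(N)`, i.e. a covering of `M` with a fibrewise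
simply transitive right action of `U(N)`. The vector bundle is `P ×_{U(N)} ℂ^N`, with the metric of
`ℂ^N` and with the canonical flat connection, for which the local sections of `P` are parallel
frames. -/
structure FlatHermitianBundle (M : Type*) [TopologicalSpace M] (N : ℕ) (P : Type*)
    [TopologicalSpace P] where
  proj : P → M
  act : P → Matrix.unitaryGroup (Fin N) ℂ → P
  surjective : Function.Surjective proj
  covering : IsCoveringMap proj
  act_one : ∀ f, act f 1 = f
  act_mul : ∀ f a b, act f (a * b) = act (act f a) b
  act_continuous : ∀ a, Continuous (fun f => act f a)
  proj_act : ∀ f a, proj (act f a) = proj f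
  simply_transitive : ∀ f f', proj f = proj f' → ∃! a, act f a = f'

/-! ### Twisted spinors and the twisted Dirac operator -/

variable {g : RiemMetric I M} {Q : Type*} [TopologicalSpace Q] {N : ℕ} {P : Type*}
  [TopologicalSpace P] {Δ : Type*} [NormedAddCommGroup Δ] [InnerProductSpace ℂ Δ]

/-- A smooth local spin frame together with a local parallel unitary frame of the flat bundle,
over an open set `U`; `vec` is the underlying orthonormal frame of the tangent bundle. -/
structure LocalFrame (S : SpinStructure g Q) (E : FlatHermitianBundle M N P) where
  U : Set M
  isOpen_U : IsOpen U
  spin : M → Q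
  flat : M → P
  vec : Fin d → ∀ x : M, TangentSpace I x
  spin_continuous : ContinuousOn spin U
  flat_continuous : ContinuousOn flat U
  vec_smooth : ∀ i, SmoothVF I (vec i) U
  spin_proj : ∀ x ∈ U, S.proj (spin x) = x
  flat_proj : ∀ x ∈ U, E.proj (flat x) = x
  frame_spin : ∀ x ∈ U, ∀ i,
    (⟨S.proj (spin x), S.frame (spin x) i⟩ : TangentBundle I M) = ⟨x, vec i x⟩

/-- A twisted spinor field, i.e. a section of `𝒮 ⊗ ℰ`, is the function that assigns to a spin frame
`q` and a unitary frame `f` over the same point the components in `Δ ⊗ ℂ^N = Δ^N` of the field at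
this point (values at pairs over different points play no role). -/
abbrev SpinorField (Q P Δ : Type*) (N : ℕ) : Type _ := Q → P → Fin N → Δ

/-- `ψ` is a smooth section of `𝒮 ⊗ ℰ` over the set `W`: it transforms by the spinor
representation and the standard representation of `U(N)`, and it is smooth in local frames. -/
structure IsSmoothSection (S : SpinStructure g Q) (E : FlatHermitianBundle M N P)
    (C : SpinorModule d Δ) (W : Set M) (ψ : SpinorField Q P Δ N) : Prop where
  equivariant : ∀ q f, S.proj q = E.proj f → S.proj q ∈ W →
    ∀ (a : SpinGrp d) (u : Matrix.unitaryGroup (Fin N) ℂ) (b : Fin N),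
      ψ q f b = ∑ b', (u : Matrix (Fin N) (Fin N) ℂ) b b' •
        C.rep (a : CliffordAlgebra (cliffForm d)) (ψ (S.act q a) (E.act f u) b')
  smooth : ∀ L : LocalFrame S E,
    ContMDiffOn I 𝓘(ℝ, Fin N → Δ) ∞ (fun x => ψ (L.spin x) (L.flat x)) (L.U ∩ W)

/-- Clifford multiplication by the form `η` at `x`, in the frame `e`:
`∑_k ∑_{i_1 < ... < i_k} η(e_{i_1}, ..., e_{i_k}) c(e_{i_1}) ⋯ c(e_{i_k})`. The inner sum is
written as `1 / k!` times the sum over all sequences of indices, whose terms with a repeated index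
vanish. -/
def cliffMul (C : SpinorModule d Δ) (η : MixedForm I M) (e : Fin d → ∀ x : M, TangentSpace I x)
    (x : M) : Module.End ℂ Δ :=
  ∑ k ∈ Finset.range (d + 1), ((k.factorial : ℂ)⁻¹) •
    ∑ i : Fin k → Fin d, η k x (fun j => e (i j) x) • (List.ofFn fun j => C.gen (i j)).prod

/-- The components at `x` of the covariant derivative `∇_{e_i} ψ` in a local frame, for the
spin connection on `𝒮`, the lift of the Levi-Civita connection, and the flat connection on `ℰ`:
`e_i(ψ) + (1/4) ∑_{j,l} ⟨∇_{e_i} e_j, e_l⟩ c(e_j) c(e_l) ψ`. -/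
def covDeriv (S : SpinStructure g Q) (E : FlatHermitianBundle M N P) (C : SpinorModule d Δ)
    (L : LocalFrame S E) (ψ : SpinorField Q P Δ N) (i : Fin d) (x : M) : Fin N → Δ :=
  fun b => (mfderiv I 𝓘(ℝ, Fin N → Δ) (fun x' => ψ (L.spin x') (L.flat x')) x (L.vec i x) :
      Fin N → Δ) b
    + (1 / 4 : ℝ) • ∑ j, ∑ l, leviCivitaCoeff g L.vec x i j l •
        (C.gen j * C.gen l) (ψ (L.spin x) (L.flat x) b)

/-- The components at `x` of `∑_i c(e_i) ∇_{e_i} ψ + c(η) ψ` in a local frame. -/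
def twistedDiracInFrame (S : SpinStructure g Q) (E : FlatHermitianBundle M N P)
    (C : SpinorModule d Δ) (η : MixedForm I M) (L : LocalFrame S E) (ψ : SpinorField Q P Δ N)
    (x : M) : Fin N → Δ :=
  fun b => ∑ i, C.gen i (covDeriv S E C L ψ i x b)
    + cliffMul C η L.vec x (ψ (L.spin x) (L.flat x) b)

open Classical in
/-- The twisted Dirac operator on sections of `𝒮 ⊗ ℰ`. Its components in the frames `q`, `f` are
computed in a local frame through `q` and `f`; for a smooth section the choice does not matter. -/
def twistedDirac (S : SpinStructure g Q) (E : FlatHermitianBundle M N P)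
    (C : SpinorModule d Δ) (η : MixedForm I M) (ψ : SpinorField Q P Δ N) : SpinorField Q P Δ N :=
  fun q f =>
    if h : ∃ L : LocalFrame S E, S.proj q ∈ L.U ∧ L.spin (S.proj q) = q ∧ L.flat (S.proj q) = f then
      twistedDiracInFrame S E C η h.choose ψ (S.proj q)
    else 0

/-- The pointwise hermitian product on `𝒮 ⊗ ℰ`, computed in some frames over `x`. -/
def spinorPairing (S : SpinStructure g Q) (E : FlatHermitianBundle M N P)
    (φ ψ : SpinorField Q P Δ N) (x : M) : ℂ :=
  ∑ b, inner ℂ (φ (Function.surjInv S.surjective x) (Function.surjInv E.surjective x) b)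
    (ψ (Function.surjInv S.surjective x) (Function.surjInv E.surjective x) b)

/-- An operator on smooth sections of `𝒮 ⊗ ℰ` is (formally) self-adjoint if it is symmetric for
the `L²` product given by the volume measure `μ`. -/
def IsFormallySelfAdjoint [MeasurableSpace M] (S : SpinStructure g Q)
    (E : FlatHermitianBundle M N P) (C : SpinorModule d Δ) (μ : Measure M)
    (D : SpinorField Q P Δ N → SpinorField Q P Δ N) : Prop :=
  ∀ φ ψ, IsSmoothSection S E C univ φ → IsSmoothSection S E C univ ψ →
    ∫ x, spinorPairing S E (D φ) ψ x ∂μ = ∫ x, spinorPairing S E φ (D ψ) x ∂μ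

/-- Ellipticity of a first-order operator: for `h` with `h(x) = 0` and `dh_x = ξ ≠ 0` the principal
symbol at `ξ`, which maps `φ(x)` to `D(h φ)(x)`, is injective on the fibre at `x`. -/
def IsEllipticFirstOrder (S : SpinStructure g Q) (E : FlatHermitianBundle M N P)
    (C : SpinorModule d Δ) (D : SpinorField Q P Δ N → SpinorField Q P Δ N) : Prop :=
  ∀ φ, IsSmoothSection S E C univ φ → ∀ h : M → ℝ, ContMDiff I 𝓘(ℝ, ℝ) ∞ h →
    ∀ q f, S.proj q = E.proj f → h (S.proj q) = 0 → mfderiv I 𝓘(ℝ, ℝ) h (S.proj q) ≠ 0 →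
      D (fun q' f' b => h (S.proj q') • φ q' f' b) q f = 0 → φ q f = 0

end Geometry

/-! ### Collars -/

section Collar

variable {n : ℕ} {X : Type*} [TopologicalSpace X] [ChartedSpace (EuclideanHalfSpace (n + 1)) X]
  [IsManifold (𝓡∂ (n + 1)) ∞ X]
  {Y : Type*} [TopologicalSpace Y] [ChartedSpace (EuclideanSpace ℝ (Fin n)) Y]
  [IsManifold (𝓡 n) ∞ Y]

variable (n X Y) in
/-- A collar of the boundary of `X`: a diffeomorphism `Φ` from `[0, ε) × Y` onto an open
neighbourhood `W` of `∂X`, with inverse `(r, p)`, under which `{0} × Y` is `∂X`. In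
particular `Φ 0` identifies `Y` with `∂X`. -/
structure Collar where
  ε : ℝ
  ε_pos : 0 < ε
  W : Set X
  isOpen_W : IsOpen W
  r : X → ℝ
  p : X → Y
  Φ : ℝ → Y → X
  r_smooth : ContMDiffOn (𝓡∂ (n + 1)) 𝓘(ℝ, ℝ) ∞ r W
  p_smooth : ContMDiffOn (𝓡∂ (n + 1)) (𝓡 n) ∞ p W
  Φ_smooth : ContMDiffOn (𝓘(ℝ, ℝ).prod (𝓡 n)) (𝓡∂ (n + 1)) ∞ (fun z : ℝ × Y => Φ z.1 z.2)
    (Ico 0 ε ×ˢ univ)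
  Φ_mem : ∀ t ∈ Ico 0 ε, ∀ y, Φ t y ∈ W
  r_Φ : ∀ t ∈ Ico 0 ε, ∀ y, r (Φ t y) = t
  p_Φ : ∀ t ∈ Ico 0 ε, ∀ y, p (Φ t y) = y
  r_mem : ∀ x ∈ W, r x ∈ Ico 0 ε
  Φ_r_p : ∀ x ∈ W, Φ (r x) (p x) = x
  boundary_iff : ∀ x, x ∈ (𝓡∂ (n + 1)).boundary X ↔ x ∈ W ∧ r x = 0

/-- The differential of the collar coordinate `r`. -/
def Collar.dr (col : Collar n X Y) (x : X) : TangentSpace (𝓡∂ (n + 1)) x →L[ℝ] ℝ :=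
  mfderiv (𝓡∂ (n + 1)) 𝓘(ℝ, ℝ) col.r x

/-- The differential of the collar projection `p` to `Y`. -/
def Collar.dp (col : Collar n X Y) (x : X) :
    TangentSpace (𝓡∂ (n + 1)) x →L[ℝ] TangentSpace (𝓡 n) (col.p x) :=
  mfderiv (𝓡∂ (n + 1)) (𝓡 n) col.p x

/-- The metric of `X` is the product metric `dr² + g_Y` on the collar. -/
def IsProductMetric (col : Collar n X Y) (gX : RiemMetric (𝓡∂ (n + 1)) X)
    (gY : RiemMetric (𝓡 n) Y) : Prop :=
  ∀ x ∈ col.W, ∀ v w : TangentSpace (𝓡∂ (n + 1)) x,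
    gX.inner x v w =
      col.dr x v * col.dr x w + gY.inner (col.p x) (col.dp x v) (col.dp x w)

/-- The restriction `i^*η` of a form to the boundary, where `i = Φ 0 : Y → X`. -/
def restrictForm (col : Collar n X Y) (η : MixedForm (𝓡∂ (n + 1)) X) : MixedForm (𝓡 n) Y :=
  fun k y => (η k (col.Φ 0 y)).compContinuousLinearMap
    (mfderiv (𝓡 n) (𝓡∂ (n + 1)) (col.Φ 0) y)

/-- `η` is boundary-compatible: `η = p^* (i^* η)` on the collar. -/
def IsBoundaryCompatible (col : Collar n X Y) (η : MixedForm (𝓡∂ (n + 1)) X) : Prop :=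
  ∀ (k : ℕ), ∀ x ∈ col.W, η k x =
    (restrictForm col η k (col.p x)).compContinuousLinearMap (col.dp x)

variable {gX : RiemMetric (𝓡∂ (n + 1)) X} {gY : RiemMetric (𝓡 n) Y}
  {QX QY : Type*} [TopologicalSpace QX] [TopologicalSpace QY]
  {N : ℕ} {PX PY : Type*} [TopologicalSpace PX] [TopologicalSpace PY]

/-- The spin frame `q` of `X` is adapted to the spin frame `q₀` of `Y`: its tangent frame is
`(e_1, ..., e_n, ∂/∂r)` with `e_1, ..., e_n` tangent to the slices `r = const` and mapped by `dp` to
the tangent frame of `q₀`. -/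
structure IsAdapted (col : Collar n X Y) (SX : SpinStructure gX QX) (SY : SpinStructure gY QY)
    (q : QX) (q₀ : QY) : Prop where
  dp_frame : ∀ i : Fin n,
    (⟨col.p (SX.proj q), col.dp (SX.proj q) (SX.frame q i.castSucc)⟩ : TangentBundle (𝓡 n) Y)
      = ⟨SY.proj q₀, SY.frame q₀ i⟩
  dr_frame : ∀ i : Fin n, col.dr (SX.proj q) (SX.frame q i.castSucc) = 0
  dp_last : col.dp (SX.proj q) (SX.frame q (Fin.last n)) = 0
  dr_last : col.dr (SX.proj q) (SX.frame q (Fin.last n)) = 1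

/-- The spin structure of `Y` is induced by that of `X`: the map `j` identifies it with the spin
frames of `X` over the boundary whose last vector is the inward unit normal `∂/∂r`, compatibly with
`Spin(n) → Spin(n+1)`. -/
structure IsInducedSpin (col : Collar n X Y) (SX : SpinStructure gX QX)
    (SY : SpinStructure gY QY) (j : QY → QX) : Prop where
  continuous : Continuous j
  proj_eq : ∀ q, SX.proj (j q) = col.Φ 0 (SY.proj q)
  adapted : ∀ q, IsAdapted col SX SY (j q) q
  equivariant : ∀ (q : QY) (a : SpinGrp n) (a' : SpinGrp (n + 1)),
    (a' : CliffordAlgebra (cliffForm (n + 1))) = inclCliff n (a : CliffordAlgebra (cliffForm n)) →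
      j (SY.act q a) = SX.act (j q) a'

/-- The flat hermitian bundle `EY` is the restriction of `EX` to the boundary, by means of `j`. -/
structure IsRestrictedBundle (col : Collar n X Y) (EX : FlatHermitianBundle X N PX)
    (EY : FlatHermitianBundle Y N PY) (j : PY → PX) : Prop where
  continuous : Continuous j
  proj_eq : ∀ f, EX.proj (j f) = col.Φ 0 (EY.proj f)
  equivariant : ∀ f u, j (EY.act f u) = EX.act (j f) u

/-- `T` extends the identification `j` of spin frames from `r = 0` to the collar: `T t q` is the
spin frame over `Φ t y` adapted to `q` and depending continuously on `t` and `q`. -/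
structure IsSpinTransport (col : Collar n X Y) (SX : SpinStructure gX QX)
    (SY : SpinStructure gY QY) (j : QY → QX) (T : ℝ → QY → QX) : Prop where
  continuousOn : ContinuousOn (fun z : ℝ × QY => T z.1 z.2) (Ico 0 col.ε ×ˢ univ)
  zero : ∀ q, T 0 q = j q
  proj_eq : ∀ t ∈ Ico 0 col.ε, ∀ q, SX.proj (T t q) = col.Φ t (SY.proj q)
  adapted : ∀ t ∈ Ico 0 col.ε, ∀ q, IsAdapted col SX SY (T t q) q

/-- `τ` is the parallel transport of unitary frames of `EX` along the lines `t ↦ Φ t y`. -/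
structure IsFlatTransport (col : Collar n X Y) (EX : FlatHermitianBundle X N PX)
    (EY : FlatHermitianBundle Y N PY) (j : PY → PX) (τ : ℝ → PY → PX) : Prop where
  continuousOn : ContinuousOn (fun z : ℝ × PY => τ z.1 z.2) (Ico 0 col.ε ×ˢ univ)
  zero : ∀ f, τ 0 f = j f
  proj_eq : ∀ t ∈ Ico 0 col.ε, ∀ f, EX.proj (τ t f) = col.Φ t (EY.proj f)

variable {ΔX ΔY : Type*} [NormedAddCommGroup ΔX] [InnerProductSpace ℂ ΔX]
  [NormedAddCommGroup ΔY] [InnerProductSpace ℂ ΔY]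

/-- Clifford multiplication by `∂/∂r` (the last vector of adapted frames). -/
def normalMul (CX : SpinorModule (n + 1) ΔX) : Module.End ℂ ΔX := CX.gen (Fin.last n)

/-- The grading involution `γ_X = i^m c(e_1 ⋯ e_{2m})` in dimension `n + 1 = 2m`. -/
def chirality (CX : SpinorModule (n + 1) ΔX) : Module.End ℂ ΔX :=
  (Complex.I ^ ((n + 1) / 2)) • CX.volumeElement

/-- The identification of the spinors of `Y` with the positive half-spinors of `X`, under which
`c_Y(v) = -σ c_X(v)`. -/
structure IsSpinorIdentification (CX : SpinorModule (n + 1) ΔX) (CY : SpinorModule n ΔY)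
    (κ : ΔY →ₗᵢ[ℂ] ΔX) : Prop where
  range_eq : ∀ x : ΔX, x ∈ range κ ↔ chirality CX x = x
  intertwines : ∀ (v : Fin n → ℝ) (x : ΔY),
    κ (CY.c v x) = -(normalMul CX (CX.c (inclVec n v) (κ x)))

/-- `ψ` is a smooth section of `𝒮⁺ ⊗ ℰ` over the collar neighbourhood. -/
def IsPositiveSection (col : Collar n X Y) (SX : SpinStructure gX QX)
    (EX : FlatHermitianBundle X N PX) (CX : SpinorModule (n + 1) ΔX)
    (ψ : SpinorField QX PX ΔX N) : Prop :=
  IsSmoothSection SX EX CX col.W ψ ∧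
    ∀ q f, SX.proj q = EX.proj f → SX.proj q ∈ col.W → ∀ b, chirality CX (ψ q f b) = ψ q f b

/-- `φ` is a smooth section of `p^*(𝒮_Y ⊗ ℰ|_Y)` over `[0, ε) × Y`, viewed as a smooth family
`(φ t)` of sections of `𝒮_Y ⊗ ℰ|_Y` over `Y`. -/
structure IsSmoothFamily (ε : ℝ) (SY : SpinStructure gY QY) (EY : FlatHermitianBundle Y N PY)
    (CY : SpinorModule n ΔY) (φ : ℝ → SpinorField QY PY ΔY N) : Prop where
  isSection : ∀ t ∈ Ico 0 ε, IsSmoothSection SY EY CY univ (φ t)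
  smooth : ∀ L : LocalFrame SY EY,
    ContMDiffOn (𝓘(ℝ, ℝ).prod (𝓡 n)) 𝓘(ℝ, Fin N → ΔY) ∞
      (fun z : ℝ × Y => φ z.1 (L.spin z.2) (L.flat z.2)) (Ico 0 ε ×ˢ L.U)

/-- `ψ` and `φ` correspond to each other under the identification of `𝒮⁺ ⊗ ℰ` over the collar with
`p^*(𝒮_Y ⊗ ℰ|_Y)` given by `T`, `τ` and `κ`. -/
def Corresponds (ε : ℝ) (SY : SpinStructure gY QY) (EY : FlatHermitianBundle Y N PY)
    (T : ℝ → QY → QX) (τ : ℝ → PY → PX) (κ : ΔY →ₗᵢ[ℂ] ΔX)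
    (φ : ℝ → SpinorField QY PY ΔY N) (ψ : SpinorField QX PX ΔX N) : Prop :=
  ∀ t ∈ Ico 0 ε, ∀ q f, SY.proj q = EY.proj f → ∀ b, ψ (T t q) (τ t f) b = κ (φ t q f b)

end Collar

end

/-! Put n = 2m+1. If e_1, ..., e_n is a local orthonormal frame on Y, the product metric makes e_1,
..., e_n, ∂/∂r orthonormal on the collar. These fields project under dp to e_1, ..., e_n, 0 and have
constant dr, so their brackets are tangent to the slices and project to the brackets on Y. Hence the
tangential Levi-Civita coefficients are those of Y, and every coefficient with a normal index
vanishes (`Collar.leviCivitaCoeff_frame_last`). The flux form is pulled back from Y, so a normal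
argument also kills it. Since c_Y = -σ c_X, since σ anticommutes with tangential Clifford
multiplication and since σ² = -1, an even product of tangential factors c_X corresponds under κ to
the same product of factors c_Y, and an odd product to σ times it
(`IsSpinorIdentification.prod_gen`). Apart from c_X(∂/∂r) times the normal derivative, each term of
D_X has an odd number of tangential factors: one in the derivative terms, three in the connection
terms, an odd number in the flux terms. So D_X becomes σ(∂/∂r + D_Y), which is
`twistedDirac_collar`.

This computation takes place in one adapted frame, while `twistedDirac` picks an arbitrary one, so
independence of the frame has to be proved. Constant changes of frame are pure tensor algebra. For
two frames that agree only at the point, the spin group element relating them must be shown to vary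
smoothly. The device is an average over the Clifford generators (`cliffAvg`), which expresses, up to
a scalar, any lift of a rotation as a polynomial in the rotation matrix (`spinLift_eq_smul`).
Normalised, it is smooth near the identity, and its derivative is the bivector of the derivative of
the matrix (`LocalFrame.dirDeriv_unitLift`). That is exactly the change of the Levi-Civita term, so
the two effects cancel.

The identification extends to the collar because spin frames and parallel frames are coverings:
families of lines starting at r = 0 lift uniquely (`IsCoveringMap.exists_lift_Ico`). For spin frames
one must know that every adapted tangent frame comes from a spin frame at all. This is a question of
orientation, settled by connectedness of [0, ε) (`exists_spin_adapted`).

Symmetry of D_Y is Green's formula: pointwise, ⟨Dφ,ψ⟩ - ⟨φ,Dψ⟩ is the divergence of the field with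
components ⟨c_l φ,ψ⟩ (`green_formula`). A partition of unity moves the integral into charts, where
the volume density times a frame field has the right Euclidean divergence (`eDiv_chartFrame`) and
compactly supported divergences integrate to zero. The flux contributes nothing, since degrees 3 mod
4 with real and 1 mod 4 with imaginary coefficients act symmetrically. Ellipticity is c(v)² = -|v|².
-/

noncomputable section

set_option linter.unusedSectionVars false

/-! ### The Clifford algebra of `ℝ^d` -/

section CliffordAlgebraBasis

variable {d : ℕ}

/-- The generator `e_i` of the Clifford algebra. -/
def cliffE (i : Fin d) : CliffordAlgebra (cliffForm d) :=
  CliffordAlgebra.ι (cliffForm d) (Pi.single i 1)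

lemma cliffForm_apply (v : Fin d → ℝ) : cliffForm d v = -∑ i, v i * v i := by
  simp [cliffForm, QuadraticMap.weightedSumSquares_apply]

lemma map_eq_sum_single {A : Type*} [AddCommGroup A] [Module ℝ A] (f : (Fin d → ℝ) →ₗ[ℝ] A)
    (v : Fin d → ℝ) : f v = ∑ i, v i • f (Pi.single i 1) := by
  conv_lhs => rw [pi_eq_sum_univ' v]
  rw [map_sum]
  refine Finset.sum_congr rfl fun i _ => ?_
  rw [map_smul]

lemma iota_eq_sum (v : Fin d → ℝ) :
    CliffordAlgebra.ι (cliffForm d) v = ∑ i, v i • cliffE i :=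
  map_eq_sum_single _ v

lemma cliffE_sq (i : Fin d) : cliffE i * cliffE i = -1 := by
  rw [cliffE, CliffordAlgebra.ι_sq_scalar, cliffForm_apply]
  simp [Pi.single_apply]

lemma cliffE_anticomm {i j : Fin d} (h : i ≠ j) : cliffE i * cliffE j = -(cliffE j * cliffE i) := by
  have := CliffordAlgebra.ι_mul_ι_add_swap (Q := cliffForm d) (Pi.single i 1) (Pi.single j 1)
  rw [eq_neg_iff_add_eq_zero]
  refine this.trans ?_
  rw [QuadraticMap.polar, cliffForm_apply, cliffForm_apply, cliffForm_apply]
  simp [Pi.single_apply, mul_add, Finset.sum_add_distrib, h, Ne.symm h]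

/-- The product of the generators indexed by a word. -/
def cliffWord (w : List (Fin d)) : CliffordAlgebra (cliffForm d) := (w.map cliffE).prod

/-- Moving `e_i` past a letter costs a sign unless that letter is `i`. The number of signs is
`length - count i`, which has the parity of `length + count i`. -/
lemma cliffE_mul_cliffWord (i : Fin d) (w : List (Fin d)) :
    cliffE i * cliffWord w = (-1 : ℝ) ^ (w.length + w.count i) • (cliffWord w * cliffE i) := by
  induction w with
  | nil => simp [cliffWord]
  | cons k w ih =>
    have hw : cliffWord (k :: w) = cliffE k * cliffWord w := by simp [cliffWord]
    rw [hw]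
    by_cases h : k = i
    · subst h
      have h2 : (-1 : ℝ) ^ ((k :: w).length + (k :: w).count k)
          = (-1 : ℝ) ^ (w.length + w.count k) := by
        rw [List.length_cons, List.count_cons_self]
        ring
      rw [h2, mul_assoc, ← mul_smul_comm, ← ih]
    · rw [List.length_cons, List.count_cons_of_ne h, ← mul_assoc,
        cliffE_anticomm (Ne.symm h), neg_mul, mul_assoc, ih, mul_smul_comm, mul_assoc,
        add_right_comm, pow_succ]
      simp

lemma cliffWord_append (u v : List (Fin d)) : cliffWord (u ++ v) = cliffWord u * cliffWord v := by
  simp [cliffWord]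

/-- The first letter must occur again; bringing the two copies together gives a sign and `e_i² =
-1`, and shortens the word by two without changing the parity of any count. -/
lemma cliffWord_eq_scalar : ∀ (n : ℕ) (w : List (Fin d)), w.length = n →
    (∀ i, Even (w.count i)) → ∃ r : ℝ, cliffWord w = algebraMap ℝ _ r := by
  intro n
  induction n using Nat.strong_induction_on with
  | _ n ih =>
    intro w hn hw
    match w with
    | [] => exact ⟨1, by simp [cliffWord]⟩
    | i :: w =>
      have h1 : i ∈ w := by
        have := hw i
        rw [List.count_cons_self] at this
        by_contra h
        rw [List.count_eq_zero_of_not_mem h] at this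
        exact absurd this (by decide)
      obtain ⟨u, v, rfl⟩ := List.append_of_mem h1
      obtain ⟨r, hr⟩ := ih (u ++ v).length (by simp at hn ⊢; omega) (u ++ v) rfl (by
        intro j
        have := hw j
        by_cases hj : i = j
        · subst hj
          simp only [List.count_cons_self, List.count_append] at this ⊢
          rw [Nat.even_iff] at this ⊢
          omega
        · simpa only [List.count_cons_of_ne hj, List.count_append] using this)
      refine ⟨(-1 : ℝ) ^ (u.length + u.count i) * (-1) * r, ?_⟩
      have e1 : cliffWord (i :: (u ++ i :: v))
          = cliffE i * cliffWord u * (cliffE i * cliffWord v) := by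
        simp [cliffWord, mul_assoc]
      rw [e1, cliffE_mul_cliffWord, smul_mul_assoc, mul_assoc, ← mul_assoc (cliffE i), cliffE_sq,
        map_mul, ← hr, cliffWord_append, ← Algebra.smul_def, mul_smul]
      simp

/-- Words may repeat letters and are only needed as a spanning set, so no basis of the Clifford
algebra is involved. -/
lemma even_mem_span_cliffWord {a : CliffordAlgebra (cliffForm d)}
    (ha : a ∈ CliffordAlgebra.even (cliffForm d)) :
    a ∈ Submodule.span ℝ (cliffWord '' {w : List (Fin d) | Even w.length}) := by
  induction a, ha using CliffordAlgebra.even_induction with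
  | algebraMap r =>
    rw [Algebra.algebraMap_eq_smul_one]
    exact Submodule.smul_mem _ _ (Submodule.subset_span ⟨[], by simp, by simp [cliffWord]⟩)
  | add x y hx hy ihx ihy => exact Submodule.add_mem _ ihx ihy
  | ι_mul_ι_mul m₁ m₂ x hx ih =>
    rw [iota_eq_sum m₁, iota_eq_sum m₂, Finset.sum_mul_sum, Finset.sum_mul]
    refine Submodule.sum_mem _ fun i _ => ?_
    rw [Finset.sum_mul]
    refine Submodule.sum_mem _ fun j _ => ?_
    rw [smul_mul_smul_comm, smul_mul_assoc]
    refine Submodule.smul_mem _ _ ?_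
    refine Submodule.span_induction
      (p := fun x _ => cliffE i * cliffE j * x ∈ Submodule.span ℝ (cliffWord '' _)) ?_ ?_ ?_ ?_ ih
    · rintro _ ⟨w, hw, rfl⟩
      refine Submodule.subset_span ⟨i :: j :: w, ?_, by simp [cliffWord, mul_assoc]⟩
      simpa [Nat.even_add_one] using hw
    · simp
    · intro x y _ _ hx hy
      rw [mul_add]
      exact Submodule.add_mem _ hx hy
    · intro r x _ hx
      rw [mul_smul_comm]
      exact Submodule.smul_mem _ _ hx

/-- The composition, over the indices `i` of a list, of the maps `b ↦ (b - v_i b e_i) / 2`. -/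
def cliffAvg {A : Type*} [Ring A] [Algebra ℝ A] (v e : Fin d → A) : List (Fin d) → A → A
  | [], b => b
  | i :: l, b => (1 / 2 : ℝ) • (cliffAvg v e l b - v i * cliffAvg v e l b * e i)

lemma cliffAvg_add {A : Type*} [Ring A] [Algebra ℝ A] (v e : Fin d → A) (l : List (Fin d))
    (a b : A) : cliffAvg v e l (a + b) = cliffAvg v e l a + cliffAvg v e l b := by
  induction l with
  | nil => rfl
  | cons i l ih => simp only [cliffAvg, ih, mul_add, add_mul, ← smul_add]; congr 1; abel

lemma cliffAvg_smul {A : Type*} [Ring A] [Algebra ℝ A] (v e : Fin d → A) (l : List (Fin d))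
    (r : ℝ) (b : A) : cliffAvg v e l (r • b) = r • cliffAvg v e l b := by
  induction l with
  | nil => rfl
  | cons i l ih =>
    simp only [cliffAvg, ih, mul_smul_comm, smul_mul_assoc, ← smul_sub]
    rw [smul_comm]

lemma map_cliffAvg {A B : Type*} [Ring A] [Algebra ℝ A] [Ring B] [Algebra ℝ B] (f : A →ₐ[ℝ] B)
    (v e : Fin d → A) (l : List (Fin d)) (b : A) :
    f (cliffAvg v e l b) = cliffAvg (fun i => f (v i)) (fun i => f (e i)) l (f b) := by
  induction l with
  | nil => rfl
  | cons i l ih => simp only [cliffAvg, map_smul, map_sub, map_mul, ih]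

/-- As `e_i⁻¹ = -e_i`, each step of `cliffAvg e e` is the mean of `b` and `e_i b e_i⁻¹`. Allowing a
second family on the left makes the average sensitive to a rotation: an element `a` that carries `v`
to `v'` passes through every step. This extracts an unknown spin element from its rotation alone. -/
lemma cliffAvg_mul_left {A : Type*} [Ring A] [Algebra ℝ A] {v v' e : Fin d → A} {a : A}
    (h : ∀ i, a * v i = v' i * a) (l : List (Fin d)) (b : A) :
    cliffAvg v' e l (a * b) = a * cliffAvg v e l b := by
  induction l with
  | nil => rfl
  | cons i l ih =>
    simp only [cliffAvg, ih, mul_smul_comm, mul_sub]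
    rw [← mul_assoc (v' i), ← h i]
    simp only [mul_assoc]

/-- An element which commutes with the `e_i` is fixed by the averaging over them. -/
lemma cliffAvg_of_commute {A : Type*} [Ring A] [Algebra ℝ A] {e : Fin d → A} {a : A}
    (he : ∀ i, e i * e i = -1) (h : ∀ i, a * e i = e i * a) (l : List (Fin d)) :
    cliffAvg e e l a = a := by
  induction l with
  | nil => rfl
  | cons i l ih =>
    simp only [cliffAvg, ih]
    rw [mul_assoc, h i, ← mul_assoc, he, neg_one_mul, sub_neg_eq_add, ← two_smul ℝ a, smul_smul]
    norm_num

/-- For even length, `e_i w e_i = -(-1)^(count i) w`, so the step belonging to `i` fixes `w` if `i`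
occurs evenly and cancels it otherwise. -/
lemma cliffAvg_cliffWord {w : List (Fin d)} (hw : Even w.length) (l : List (Fin d)) :
    cliffAvg cliffE cliffE l (cliffWord w)
      = if ∀ i ∈ l, Even (w.count i) then cliffWord w else 0 := by
  induction l with
  | nil => simp [cliffAvg]
  | cons i l ih =>
    simp only [cliffAvg, ih]
    by_cases h : ∀ i ∈ l, Even (w.count i)
    · rw [if_pos h]
      have e1 : cliffE i * cliffWord w * cliffE i = -((-1 : ℝ) ^ (w.count i) • cliffWord w) := by
        rw [cliffE_mul_cliffWord, smul_mul_assoc, mul_assoc, cliffE_sq, pow_add,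
          Even.neg_one_pow hw, one_mul]
        simp
      rw [e1]
      by_cases hi : Even (w.count i)
      · rw [if_pos (by simpa [hi] using h), Even.neg_one_pow hi, one_smul, sub_neg_eq_add,
          ← two_smul ℝ (cliffWord w), smul_smul]
        norm_num
      · rw [if_neg (by simp [hi]), Odd.neg_one_pow (Nat.not_even_iff_odd.1 hi)]
        simp
    · rw [if_neg h, if_neg (fun h' => h fun i hi => h' i (List.mem_cons_of_mem _ hi))]
      simp

/-- Only words with all multiplicities even survive, and these are scalars. Evenness of `a` matters:
in odd dimension the central volume element would survive too. -/
lemma cliffAvg_even {a : CliffordAlgebra (cliffForm d)}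
    (ha : a ∈ CliffordAlgebra.even (cliffForm d)) :
    ∃ r : ℝ, cliffAvg cliffE cliffE (List.finRange d) a = algebraMap ℝ _ r := by
  refine Submodule.span_induction
    (p := fun x _ => ∃ r : ℝ, cliffAvg cliffE cliffE (List.finRange d) x = algebraMap ℝ _ r)
    ?_ ?_ ?_ ?_ (even_mem_span_cliffWord ha)
  · rintro _ ⟨w, hw, rfl⟩
    rw [cliffAvg_cliffWord hw]
    split_ifs with h
    · exact cliffWord_eq_scalar _ w rfl fun i => h i (List.mem_finRange i)
    · exact ⟨0, by simp⟩
  · exact ⟨0, by simpa using cliffAvg_smul (cliffE (d := d)) cliffE (List.finRange d) 0 0⟩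
  · rintro x y _ _ ⟨r, hr⟩ ⟨r', hr'⟩
    exact ⟨r + r', by rw [cliffAvg_add, hr, hr', map_add]⟩
  · rintro c x _ ⟨r, hr⟩
    exact ⟨c * r, by rw [cliffAvg_smul, hr, map_mul, Algebra.smul_def]⟩

end CliffordAlgebraBasis

/-! ### The spin group and the rotation group -/

section SpinGroup

variable {d : ℕ}

lemma iota_mul_iota_swap (u w : Fin d → ℝ) :
    CliffordAlgebra.ι (cliffForm d) u * CliffordAlgebra.ι _ w
      = -(CliffordAlgebra.ι _ w * CliffordAlgebra.ι _ u)
        - algebraMap ℝ _ (2 * ∑ i, u i * w i) := by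
  have := CliffordAlgebra.ι_mul_ι_add_swap (Q := cliffForm d) u w
  rw [← eq_sub_iff_add_eq] at this
  have h : QuadraticMap.polar (cliffForm d) u w = -(2 * ∑ i, u i * w i) := by
    rw [QuadraticMap.polar, cliffForm_apply, cliffForm_apply, cliffForm_apply]
    simp only [Pi.add_apply, ← Finset.sum_neg_distrib, ← Finset.sum_sub_distrib, Finset.mul_sum]
    exact Finset.sum_congr rfl fun i _ => by ring
  rw [this, h, map_neg]
  abel

lemma iota_unit_mem_pinGroup {u : Fin d → ℝ} (hu : ∑ i, u i * u i = 1) :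
    CliffordAlgebra.ι (cliffForm d) u ∈ pinGroup (cliffForm d) := by
  have h1 : CliffordAlgebra.ι (cliffForm d) u * CliffordAlgebra.ι _ u = -1 := by
    rw [CliffordAlgebra.ι_sq_scalar, cliffForm_apply, hu]
    simp
  let x : (CliffordAlgebra (cliffForm d))ˣ :=
    ⟨CliffordAlgebra.ι _ u, -CliffordAlgebra.ι _ u, by simp [h1], by simp [h1]⟩
  refine ⟨⟨x, Subgroup.subset_closure ⟨u, rfl⟩, rfl⟩, ?_, ?_⟩
  · rw [CliffordAlgebra.star_ι, neg_mul, h1, neg_neg]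
  · rw [CliffordAlgebra.star_ι, mul_neg, h1, neg_neg]

/-- The element `x` is the product of the unit normals. One unit vector `u` satisfies `u w =
-(reflected w) u`, so each reflection adds one factor, one sign and one factor `-1` of the
determinant; `k` counts all three at once. -/
lemma exists_pin_of_reflections (l : List (EuclideanSpace ℝ (Fin d))) :
    ∃ (k : ℕ) (x : CliffordAlgebra (cliffForm d)), x ∈ pinGroup (cliffForm d) ∧
      x ∈ CliffordAlgebra.evenOdd (cliffForm d) (k : ZMod 2) ∧
      LinearMap.det ((l.map fun v => (Submodule.span ℝ {v})ᗮ.reflection).prod.toLinearEquiv :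
        EuclideanSpace ℝ (Fin d) →ₗ[ℝ] EuclideanSpace ℝ (Fin d)) = (-1) ^ k ∧
      ∀ w : EuclideanSpace ℝ (Fin d), x * CliffordAlgebra.ι _ w.ofLp
        = (-1 : ℝ) ^ k • (CliffordAlgebra.ι _
          ((l.map fun v => (Submodule.span ℝ {v})ᗮ.reflection).prod w).ofLp * x) := by
  induction l with
  | nil =>
    refine ⟨0, 1, one_mem _, ?_, ?_, ?_⟩
    · exact (CliffordAlgebra.even (cliffForm d)).one_mem
    · simp only [List.map_nil, List.prod_nil, pow_zero]
      exact LinearMap.det_id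
    · intro w
      simp
  | cons v l ih =>
    obtain ⟨k, x, hx, hxk, hdet, hact⟩ := ih
    set φ := (l.map fun v => (Submodule.span ℝ {v})ᗮ.reflection).prod with hφ
    simp only [List.map_cons, List.prod_cons]
    rw [← hφ]
    -- The list may contain zero vectors, whose reflection is the identity; these must not be
    -- counted in `k`.
    by_cases hv : v = 0
    · have : (Submodule.span ℝ {v})ᗮ.reflection = 1 := by
        ext w : 1
        refine (Submodule.reflection_eq_self_iff w).2 ?_
        rw [hv]
        simp
      rw [this, one_mul]
      exact ⟨k, x, hx, hxk, hdet, hact⟩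
    · set u : EuclideanSpace ℝ (Fin d) := ‖v‖⁻¹ • v with hu
      have hn : ‖v‖ ≠ 0 := norm_ne_zero_iff.2 hv
      have hu1 : ∑ i, u i * u i = 1 := by
        have h1 : ‖u‖ = 1 := by
          rw [hu, norm_smul, norm_inv, norm_norm, inv_mul_cancel₀ hn]
        have := EuclideanSpace.real_norm_sq_eq u
        rw [h1] at this
        rw [one_pow] at this
        rw [this]
        exact Finset.sum_congr rfl fun i _ => by ring
      have hr : ∀ w : EuclideanSpace ℝ (Fin d), ((Submodule.span ℝ {v})ᗮ.reflection w).ofLp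
          = w.ofLp - (2 * ∑ i, u i * w i) • u.ofLp := by
        intro w
        rw [Submodule.reflection_orthogonal_apply, Submodule.reflection_singleton_apply]
        have h2 : inner ℝ v w = ‖v‖ * ∑ i, u i * w i := by
          have : v = ‖v‖ • u := by rw [hu, smul_smul, mul_inv_cancel₀ hn, one_smul]
          conv_lhs => rw [this]
          rw [inner_smul_left, PiLp.inner_apply]
          simp [mul_comm]
        rw [h2, neg_sub]
        ext i
        simp only [hu, PiLp.sub_apply, PiLp.smul_apply, smul_eq_mul, nsmul_eq_mul, Pi.sub_apply,
          Pi.smul_apply, RCLike.ofReal_real_eq_id, id_eq]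
        field_simp
        norm_num
        ring
      refine ⟨k + 1, CliffordAlgebra.ι _ u.ofLp * x, mul_mem (iota_unit_mem_pinGroup hu1) hx,
        ?_, ?_, ?_⟩
      · rw [Nat.cast_add, Nat.cast_one, add_comm]
        exact SetLike.mul_mem_graded (CliffordAlgebra.ι_mem_evenOdd_one _ _) hxk
      · have h4 := Submodule.det_reflection (Submodule.span ℝ {v})ᗮ
        rw [Submodule.orthogonal_orthogonal, finrank_span_singleton hv, pow_one] at h4
        rw [pow_succ', ← hdet, ← h4]
        exact LinearMap.det_comp _ _
      · intro w
        rw [mul_assoc, hact w, mul_smul_comm, pow_succ, mul_smul, ← mul_assoc, ← mul_assoc]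
        congr 1
        have h5 : CliffordAlgebra.ι (cliffForm d) u.ofLp * CliffordAlgebra.ι _ u.ofLp = -1 := by
          rw [CliffordAlgebra.ι_sq_scalar, cliffForm_apply, hu1]
          simp
        have h6 : CliffordAlgebra.ι (cliffForm d) u.ofLp * CliffordAlgebra.ι _ (φ w).ofLp
            = -(CliffordAlgebra.ι _ ((Submodule.span ℝ {v})ᗮ.reflection (φ w)).ofLp
              * CliffordAlgebra.ι _ u.ofLp) := by
          rw [iota_mul_iota_swap, hr, map_sub, map_smul, sub_mul, smul_mul_assoc, h5,
            Algebra.algebraMap_eq_smul_one]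
          simp only [smul_neg, sub_neg_eq_add, neg_add]
          abel
        rw [h6, neg_mul, neg_one_smul]
        rfl

/-- By Cartan–Dieudonné the rotation is a product of reflections. Determinant one makes their number
even, so the product of normals lies in the even part and the sign in its action disappears. -/
lemma exists_spin_of_orthogonal {A : Matrix (Fin d) (Fin d) ℝ} (hA : A.transpose * A = 1)
    (hdet : A.det = 1) :
    ∃ a : SpinGrp d, ∀ v, (a : CliffordAlgebra (cliffForm d)) * CliffordAlgebra.ι _ v
      = CliffordAlgebra.ι _ (A.mulVec v) * (a : CliffordAlgebra (cliffForm d)) := by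
  have hA' : A ∈ Matrix.orthogonalGroup (Fin d) ℝ := by
    rw [Matrix.mem_orthogonalGroup_iff']
    exact hA
  let φ := Matrix.toEuclideanLin A
  have hφ : ∀ v, ‖φ v‖ = ‖v‖ := by
    intro v
    have h2 : ‖φ v‖ ^ 2 = ‖v‖ ^ 2 := by
      rw [EuclideanSpace.real_norm_sq_eq, EuclideanSpace.real_norm_sq_eq]
      have h3 : A.mulVec v.ofLp ⬝ᵥ A.mulVec v.ofLp = v.ofLp ⬝ᵥ v.ofLp := by
        rw [Matrix.dotProduct_mulVec, Matrix.vecMul_mulVec, hA, Matrix.vecMul_one]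
      simp only [dotProduct, ← sq] at h3
      exact h3
    exact (pow_left_inj₀ (norm_nonneg _) (norm_nonneg _) two_ne_zero).1 h2
  let Φ : EuclideanSpace ℝ (Fin d) ≃ₗᵢ[ℝ] EuclideanSpace ℝ (Fin d) :=
    LinearIsometry.toLinearIsometryEquiv ⟨φ, hφ⟩ rfl
  obtain ⟨l, -, hl⟩ := Φ.reflections_generate_dim
  obtain ⟨k, x, hx, hxk, hd, hact⟩ := exists_pin_of_reflections l
  rw [← hl] at hd hact
  have hd' : LinearMap.det (Φ.toLinearEquiv :
        EuclideanSpace ℝ (Fin d) →ₗ[ℝ] EuclideanSpace ℝ (Fin d)) = 1 := by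
    rw [← hdet, ← LinearMap.det_toLin (EuclideanSpace.basisFun (Fin d) ℝ).toBasis A]
    congr 1
  have hk : Even k := by
    rw [hd'] at hd
    by_contra h
    rw [Nat.not_even_iff_odd] at h
    rw [h.neg_one_pow] at hd
    norm_num at hd
  rw [hk.neg_one_pow] at hact
  have hk0 : (k : ZMod 2) = 0 := by
    rw [ZMod.natCast_eq_zero_iff]
    exact hk.two_dvd
  rw [hk0] at hxk
  refine ⟨⟨x, hx, hxk⟩, fun v => ?_⟩
  have := hact (WithLp.toLp 2 v)
  rw [one_smul] at this
  exact this

lemma exists_spin_mul_iota (a : SpinGrp d) (v : Fin d → ℝ) :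
    ∃ w, (a : CliffordAlgebra (cliffForm d)) * CliffordAlgebra.ι _ v
      = CliffordAlgebra.ι _ w * (a : CliffordAlgebra (cliffForm d)) := by
  let _ : Invertible (2 : ℝ) := invertibleOfNonzero two_ne_zero
  obtain ⟨w, hw⟩ := spinGroup.conjAct_smul_ι_mem_range_ι (Q := cliffForm d)
    (x := spinGroup.toUnits a) a.2 v
  refine ⟨w, ?_⟩
  rw [hw, ConjAct.units_smul_def, ConjAct.ofConjAct_toConjAct]
  have : ((spinGroup.toUnits a : (CliffordAlgebra (cliffForm d))ˣ) : CliffordAlgebra (cliffForm d))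
      = a := rfl
  rw [← this, mul_assoc, Units.inv_mul, mul_one]

lemma coe_spin_mul_inv (a : SpinGrp d) :
    (a : CliffordAlgebra (cliffForm d)) * ((a⁻¹ : SpinGrp d) : CliffordAlgebra (cliffForm d)) = 1 :=
  congrArg Subtype.val (mul_inv_cancel a)

/-- A unit vector squares to `-1`, and there is none for `d = 0`; the sign correction in
`exists_spin_transition` relies on this. -/
lemma neg_one_mem_spinGroup (hd : 0 < d) : (-1 : CliffordAlgebra (cliffForm d)) ∈ spinGroup _ := by
  have h : CliffordAlgebra.ι (cliffForm d) (Pi.single ⟨0, hd⟩ 1) ∈ pinGroup (cliffForm d) :=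
    iota_unit_mem_pinGroup (by simp [Pi.single_apply])
  have h2 := mul_mem h h
  rw [show CliffordAlgebra.ι (cliffForm d) (Pi.single ⟨0, hd⟩ 1) * CliffordAlgebra.ι _ _ = -1 from
    cliffE_sq _] at h2
  exact ⟨h2, (CliffordAlgebra.even (cliffForm d)).neg_mem (one_mem _)⟩

lemma inclCliff_star {n : ℕ} (x : CliffordAlgebra (cliffForm n)) :
    inclCliff n (star x) = star (inclCliff n x) := by
  induction x using CliffordAlgebra.induction with
  | algebraMap r => simp [inclCliff]
  | ι v => simp [inclCliff]
  | mul a b ha hb => rw [star_mul, map_mul, ha, hb, map_mul, star_mul]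
  | add a b ha hb => rw [star_add, map_add, ha, hb, map_add, star_add]

lemma inclCliff_mem_even {n : ℕ} {x : CliffordAlgebra (cliffForm n)}
    (hx : x ∈ CliffordAlgebra.even (cliffForm n)) :
    inclCliff n x ∈ CliffordAlgebra.even (cliffForm (n + 1)) := by
  induction x, hx using CliffordAlgebra.even_induction with
  | algebraMap r => rw [AlgHom.commutes]; exact Subalgebra.algebraMap_mem _ r
  | add x y hx hy ihx ihy => rw [map_add]; exact add_mem ihx ihy
  | ι_mul_ι_mul m₁ m₂ x hx ih =>
    rw [map_mul, map_mul]
    refine mul_mem ?_ ih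
    simp only [inclCliff, CliffordAlgebra.map_apply_ι]
    exact CliffordAlgebra.ι_mul_ι_mem_evenOdd_zero _ _ _

lemma inclCliff_mem_spinGroup {n : ℕ} (a : SpinGrp n) :
    inclCliff n (a : CliffordAlgebra (cliffForm n)) ∈ spinGroup (cliffForm (n + 1)) := by
  obtain ⟨a, ⟨⟨x, hx, rfl⟩, h1, h2⟩, h3⟩ := a
  refine ⟨⟨⟨Units.map (inclCliff n).toRingHom.toMonoidHom x, ?_, rfl⟩, ?_, ?_⟩,
    inclCliff_mem_even h3⟩
  · have : lipschitzGroup (cliffForm n) ≤ (lipschitzGroup (cliffForm (n + 1))).comap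
        (Units.map (inclCliff n).toRingHom.toMonoidHom) := by
      refine (Subgroup.closure_le _).2 ?_
      rintro y ⟨v, hv⟩
      refine Subgroup.subset_closure ⟨inclVec n v, ?_⟩
      change _ = inclCliff n (y : CliffordAlgebra (cliffForm n))
      rw [← hv]
      simp only [inclCliff, CliffordAlgebra.map_apply_ι]
      rfl
    exact this hx
  · rw [← inclCliff_star, ← map_mul]
    exact (congrArg _ h1).trans (map_one _)
  · rw [← inclCliff_star, ← map_mul]
    exact (congrArg _ h2).trans (map_one _)

/-- The inclusion `Spin(n) → Spin(n+1)`. -/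
def inclSpin (n : ℕ) (a : SpinGrp n) : SpinGrp (n + 1) := ⟨_, inclCliff_mem_spinGroup a⟩

end SpinGroup

/-! ### Spinor modules -/

namespace SpinorModule

variable {d : ℕ} {Δ : Type*} [NormedAddCommGroup Δ] [InnerProductSpace ℂ Δ] (C : SpinorModule d Δ)

lemma rep_iota (v : Fin d → ℝ) : C.rep (CliffordAlgebra.ι _ v) = C.c v :=
  CliffordAlgebra.lift_ι_apply _ _ _

lemma rep_cliffE (i : Fin d) : C.rep (cliffE i) = C.gen i := C.rep_iota _

lemma c_eq_sum (v : Fin d → ℝ) : C.c v = ∑ i, v i • C.gen i := map_eq_sum_single C.c v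

lemma gen_sq (i : Fin d) : C.gen i * C.gen i = -1 := by
  rw [← rep_cliffE, ← map_mul, cliffE_sq, map_neg, map_one]

lemma gen_anticomm {i j : Fin d} (h : i ≠ j) : C.gen i * C.gen j = -(C.gen j * C.gen i) := by
  simp only [← rep_cliffE, ← map_mul, ← map_neg, cliffE_anticomm h]

lemma gen_skew (i : Fin d) (x y : Δ) : inner ℂ (C.gen i x) y = -inner ℂ x (C.gen i y) :=
  C.skew _ x y

/-- `star` reverses products and sends `v` to `-v`, which matches taking adjoints because `c v` is
skew-adjoint; generators suffice. -/
lemma inner_rep (a : CliffordAlgebra (cliffForm d)) (x y : Δ) :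
    inner ℂ (C.rep a x) y = inner ℂ x (C.rep (star a) y) := by
  induction a using CliffordAlgebra.induction generalizing x y with
  | algebraMap r =>
    simp only [CliffordAlgebra.star_algebraMap, AlgHom.commutes, Module.algebraMap_end_apply]
    rw [inner_smul_left_eq_star_smul, inner_smul_right_eq_smul]
    simp
  | ι v => rw [CliffordAlgebra.star_ι, map_neg, rep_iota, C.skew, LinearMap.neg_apply, inner_neg_right]
  | mul a b ha hb =>
    rw [star_mul, map_mul, map_mul, Module.End.mul_apply, Module.End.mul_apply, ha, hb]
  | add a b ha hb =>
    rw [star_add, map_add, map_add, LinearMap.add_apply, LinearMap.add_apply, inner_add_left,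
      inner_add_right, ha, hb]

lemma inner_rep_spin (a : SpinGrp d) (x y : Δ) :
    inner ℂ (C.rep (a : CliffordAlgebra (cliffForm d)) x)
      (C.rep (a : CliffordAlgebra (cliffForm d)) y) = inner ℂ x y := by
  rw [inner_rep, ← Module.End.mul_apply, ← map_mul, spinGroup.star_mul_self_of_mem a.2, map_one,
    Module.End.one_apply]

lemma norm_rep_spin (a : SpinGrp d) (x : Δ) :
    ‖C.rep (a : CliffordAlgebra (cliffForm d)) x‖ = ‖x‖ := by
  have := C.inner_rep_spin a x x
  rw [inner_self_eq_norm_sq_to_K, inner_self_eq_norm_sq_to_K] at this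
  have h : ‖C.rep (a : CliffordAlgebra (cliffForm d)) x‖ ^ 2 = ‖x‖ ^ 2 := by exact_mod_cast this
  exact (pow_left_inj₀ (norm_nonneg _) (norm_nonneg _) two_ne_zero).1 h

lemma exists_norm_one (C : SpinorModule d Δ) : ∃ x : Δ, ‖x‖ = 1 := by
  have : Nontrivial Δ := by
    apply Module.nontrivial_of_finrank_pos (R := ℂ)
    rw [C.finrank_eq]
    positivity
  obtain ⟨x, hx⟩ := exists_ne (0 : Δ)
  exact ⟨(‖x‖⁻¹ : ℂ) • x, by rw [norm_smul]; simp [norm_ne_zero_iff.2 hx]⟩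

end SpinorModule

/-! ### Lifting rotations to the spin group near the identity -/

section SpinLift

variable {d : ℕ}

instance cliffIsModuleTopology : IsModuleTopology ℝ (CliffordAlgebra (cliffForm d)) := ⟨rfl⟩

/-- A multiple of the elements `a` of the spin group that satisfy `a e_i = (∑_j A_{ji} e_j) a`. -/
def spinLift (A : Fin d → Fin d → ℝ) : CliffordAlgebra (cliffForm d) :=
  cliffAvg (fun i => ∑ j, A j i • cliffE j) cliffE (List.finRange d) 1

/-- `a` lifts the rotation with matrix `A`. -/
def IsSpinLift (a : SpinGrp d) (A : Fin d → Fin d → ℝ) : Prop :=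
  ∀ i, (a : CliffordAlgebra (cliffForm d)) * cliffE i
    = (∑ j, A j i • cliffE j) * (a : CliffordAlgebra (cliffForm d))

/-- Write `1 = a a⁻¹` and pull `a` out of the average: what remains is the average of the even
element `a⁻¹`, a scalar. The scalar can vanish for rotations far from the identity, so the formula
is used only near it. -/
lemma spinLift_eq_smul {a : SpinGrp d} {A : Fin d → Fin d → ℝ} (h : IsSpinLift a A) :
    ∃ μ : ℝ, spinLift A = μ • (a : CliffordAlgebra (cliffForm d)) := by
  obtain ⟨r, hr⟩ := cliffAvg_even (spinGroup.mem_even (a⁻¹).2)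
  refine ⟨r, ?_⟩
  rw [spinLift, ← coe_spin_mul_inv a, cliffAvg_mul_left h, hr, ← Algebra.commutes,
    Algebra.smul_def]

lemma sum_ite_smul {B : Type*} [AddCommGroup B] [Module ℝ B] (f : Fin d → B) (i : Fin d) :
    ∑ j, (if j = i then (1 : ℝ) else 0) • f j = f i := by
  simp

lemma spinLift_one : spinLift (fun i j : Fin d => if i = j then 1 else 0) = 1 := by
  rw [spinLift]
  simp only [sum_ite_smul]
  exact cliffAvg_of_commute cliffE_sq (fun i => by simp) _

lemma continuous_spinLift : Continuous (spinLift (d := d)) := by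
  have := IsModuleTopology.topologicalAddGroup ℝ (CliffordAlgebra (cliffForm d))
  unfold spinLift
  induction List.finRange d with
  | nil => exact continuous_const
  | cons i l ih =>
    simp only [cliffAvg]
    refine ((ih).sub ?_).const_smul (1 / 2 : ℝ)
    simp only [Finset.sum_mul, smul_mul_assoc]
    refine continuous_finsetSum _ fun j _ => ?_
    refine Continuous.smul (continuous_apply_apply j i) ?_
    exact (IsModuleTopology.continuous_of_linearMap
      (LinearMap.mulRight ℝ (cliffE i) ∘ₗ LinearMap.mulLeft ℝ (cliffE j))).comp ih

end SpinLift

/-! ### Smooth dependence of lifts, and bivectors acting on spinors -/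

namespace SpinorModule

variable {d : ℕ} {Δ : Type*} [NormedAddCommGroup Δ] [InnerProductSpace ℂ Δ] (C : SpinorModule d Δ)

/-- The representation of the Clifford algebra by continuous linear maps. -/
def repL : CliffordAlgebra (cliffForm d) →ₐ[ℝ] (Δ →L[ℂ] Δ) :=
  letI := C.finiteDimensional
  { toFun := fun a => LinearMap.toContinuousLinearMap (C.rep a)
    map_one' := by ext; simp
    map_mul' := fun a b => by ext; simp
    map_zero' := by ext; simp
    map_add' := fun a b => by ext; simp
    commutes' := fun r => by ext; simp [Algebra.algebraMap_eq_smul_one] }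

@[simp]
lemma repL_apply (a : CliffordAlgebra (cliffForm d)) (x : Δ) : C.repL a x = C.rep a x := rfl

/-- Clifford multiplication by `e_i` as a continuous linear map. -/
def genL (i : Fin d) : Δ →L[ℂ] Δ := C.repL (cliffE i)

@[simp]
lemma genL_apply (i : Fin d) (x : Δ) : C.genL i x = C.gen i x := by
  rw [genL, repL_apply, rep_cliffE]

/-- Moves the average into the normed algebra of endomorphisms of `Δ`, where it is visibly
polynomial in `A` and derivatives make sense. -/
lemma repL_spinLift (A : Fin d → Fin d → ℝ) :
    C.repL (spinLift A)
      = cliffAvg (fun i => ∑ j, A j i • C.genL j) C.genL (List.finRange d) 1 := by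
  rw [spinLift, map_cliffAvg, map_one]
  simp only [map_sum, map_smul]
  rfl

lemma contDiff_repL_spinLift : ContDiff ℝ ∞ (fun A : Fin d → Fin d → ℝ => C.repL (spinLift A)) := by
  simp only [repL_spinLift]
  induction List.finRange d with
  | nil => exact contDiff_const
  | cons i l ih =>
    simp only [cliffAvg]
    refine ((ih).sub ?_).const_smul _
    refine ContDiff.mul (ContDiff.mul ?_ ih) contDiff_const
    refine ContDiff.sum fun j _ => ?_
    exact ContDiff.smul (contDiff_apply_apply ℝ ℝ j i) contDiff_const

/-- The bivector `(1/4) ∑_{j,l} b_{lj} c_j c_l`. -/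
def bivector (b : Fin d → Fin d → ℝ) : Module.End ℂ Δ :=
  (1 / 4 : ℝ) • ∑ j, ∑ l, b l j • (C.gen j * C.gen l)

lemma gen_comm_gen_mul (i j l : Fin d) :
    (C.gen j * C.gen l) * C.gen i - C.gen i * (C.gen j * C.gen l)
      = (if l = i then (-2 : ℝ) else 0) • C.gen j + (if j = i then (2 : ℝ) else 0) • C.gen l := by
  have key : ∀ a b : Fin d, C.gen a * C.gen b
      = -(C.gen b * C.gen a) + (if a = b then (-2 : ℝ) else 0) • 1 := by
    intro a b
    split_ifs with h
    · rw [h, gen_sq]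
      module
    · rw [C.gen_anticomm h]
      module
  have h1 : (C.gen j * C.gen l) * C.gen i = C.gen i * (C.gen j * C.gen l)
      + (if l = i then (-2 : ℝ) else 0) • C.gen j + (if j = i then (2 : ℝ) else 0) • C.gen l := by
    rw [mul_assoc, key l i, mul_add, mul_smul_comm, mul_one, mul_neg, ← mul_assoc, key j i,
      add_mul, neg_mul, smul_mul_assoc, one_mul, neg_add, neg_neg, mul_assoc]
    split_ifs <;> module
  rw [h1]
  abel

/-- This fixes the factor `1/4`: commuting `c_j c_l` with `c_i` gives two contraction terms with
coefficients `±2`, and antisymmetry of `b` makes them equal. Bivectors are thus the infinitesimal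
lifts of antisymmetric matrices. -/
lemma bivector_commutator {b : Fin d → Fin d → ℝ} (hb : ∀ j l, b l j = -b j l) (i : Fin d) :
    C.bivector b * C.gen i - C.gen i * C.bivector b = ∑ l, b l i • C.gen l := by
  have h1 : C.bivector b * C.gen i - C.gen i * C.bivector b
      = (1 / 4 : ℝ) • (∑ j, ∑ l, (if l = i then (b l j * -2) • C.gen j else 0)
        + ∑ l, ∑ j, (if j = i then (b l j * 2) • C.gen l else 0)) := by
    rw [Finset.sum_comm (f := fun l j => if j = i then (b l j * 2) • C.gen l else 0)]
    simp only [bivector, smul_mul_assoc, mul_smul_comm, Finset.sum_mul, Finset.mul_sum,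
      ← smul_sub, ← Finset.sum_sub_distrib, gen_comm_gen_mul, ← Finset.sum_add_distrib]
    congr 1
    refine Finset.sum_congr rfl fun j _ => Finset.sum_congr rfl fun l _ => ?_
    split_ifs <;> module
  rw [h1]
  simp only [Finset.sum_ite_eq', Finset.mem_univ, if_true]
  rw [← Finset.sum_add_distrib, Finset.smul_sum]
  refine Finset.sum_congr rfl fun l _ => ?_
  rw [hb l i]
  module

lemma inner_bivector {b : Fin d → Fin d → ℝ} (hb : ∀ j l, b l j = -b j l) (x y : Δ) :
    inner ℂ (C.bivector b x) y = -inner ℂ x (C.bivector b y) := by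
  have h0 : ∀ j, b j j = 0 := fun j => by have := hb j j; linarith
  simp only [bivector, LinearMap.smul_apply, LinearMap.sum_apply, Module.End.mul_apply,
    ← Complex.coe_smul, inner_smul_left, inner_smul_right, sum_inner, inner_sum, gen_skew,
    neg_neg, Complex.conj_ofReal]
  rw [← mul_neg, ← Finset.sum_neg_distrib, Finset.sum_comm]
  congr 1
  refine Finset.sum_congr rfl fun j _ => ?_
  rw [← Finset.sum_neg_distrib]
  refine Finset.sum_congr rfl fun l _ => ?_
  rw [hb l j, Complex.ofReal_neg, neg_mul]

/-- A skew-adjoint endomorphism that commutes with Clifford multiplication and lies in the image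
of the even Clifford algebra (as expressed by its average) vanishes. -/
lemma eq_zero_of_commute_of_skew (Z : Module.End ℂ Δ) (hc : ∀ i, Z * C.gen i = C.gen i * Z)
    (hs : ∀ x y, inner ℂ (Z x) y = -inner ℂ x (Z y))
    (hr : ∃ r : ℝ, cliffAvg C.gen C.gen (List.finRange d) Z = r • 1) : Z = 0 := by
  obtain ⟨r, hr⟩ := hr
  rw [cliffAvg_of_commute C.gen_sq hc] at hr
  obtain ⟨x, hx⟩ := C.exists_norm_one
  have := hs x x
  rw [hr] at this
  simp only [LinearMap.smul_apply, Module.End.one_apply, ← Complex.coe_smul, inner_smul_left,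
    inner_smul_right, Complex.conj_ofReal, inner_self_eq_norm_sq_to_K, hx] at this
  have h2 : (r : ℂ) = 0 := by
    have : (r : ℂ) = -r := by simpa using this
    linear_combination this / 2
  rw [hr, Complex.ofReal_eq_zero.1 h2, zero_smul]

lemma cliffAvg_rep_even {a : CliffordAlgebra (cliffForm d)}
    (ha : a ∈ CliffordAlgebra.even (cliffForm d)) :
    ∃ r : ℝ, cliffAvg C.gen C.gen (List.finRange d) (C.rep a) = r • 1 := by
  obtain ⟨r, hr⟩ := cliffAvg_even ha
  refine ⟨r, ?_⟩
  have := map_cliffAvg C.rep cliffE cliffE (List.finRange d) a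
  simp only [rep_cliffE] at this
  rw [← this, hr, AlgHom.commutes, Algebra.algebraMap_eq_smul_one]

lemma bivector_mem_even (b : Fin d → Fin d → ℝ) :
    ∃ a ∈ CliffordAlgebra.even (cliffForm d), C.rep a = C.bivector b := by
  refine ⟨(1 / 4 : ℝ) • ∑ j, ∑ l, b l j • (cliffE j * cliffE l), ?_, ?_⟩
  · refine Subalgebra.smul_mem _ (Subalgebra.sum_mem _ fun j _ => Subalgebra.sum_mem _ fun l _ =>
      Subalgebra.smul_mem _ ?_ _) _
    exact CliffordAlgebra.ι_mul_ι_mem_evenOdd_zero _ _ _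
  · simp only [map_smul, map_sum, map_mul, rep_cliffE]
    rfl

end SpinorModule

/-! ### Calculus with vector fields -/

section VectorFields

variable {d : ℕ} {H : Type*} [TopologicalSpace H]
  {I : ModelWithCorners ℝ (EuclideanSpace ℝ (Fin d)) H}
  {M : Type*} [TopologicalSpace M] [ChartedSpace H M] [IsManifold I ∞ M]
  {F : Type*} [NormedAddCommGroup F] [NormedSpace ℝ F]

/-- Every tangent space unfolds to the model space, so vectors at base points that are only provably
equal can be compared there without transport. -/
lemma tangentBundle_mk_eq_iff {x y : M} {v : TangentSpace I x} {w : TangentSpace I y} :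
    (⟨x, v⟩ : TangentBundle I M) = ⟨y, w⟩ ↔
      x = y ∧ (show EuclideanSpace ℝ (Fin d) from v) = (show EuclideanSpace ℝ (Fin d) from w) := by
  constructor
  · intro h
    cases h
    exact ⟨rfl, rfl⟩
  · rintro ⟨h1, h2⟩
    subst h1
    exact congrArg _ h2

variable {U : Set M} {x : M}

/-- The derivative of the vector-valued function `f` in the direction of the vector field `V`. -/
def dirDeriv (I : ModelWithCorners ℝ (EuclideanSpace ℝ (Fin d)) H) {M : Type*} [TopologicalSpace M]
    [ChartedSpace H M] (f : M → F) (V : ∀ x : M, TangentSpace I x) (x : M) : F :=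
  mfderiv I 𝓘(ℝ, F) f x (V x)

lemma mdifferentiableAt_of_contMDiffOn {N : Type*} {E' H' : Type*} [NormedAddCommGroup E']
    [NormedSpace ℝ E'] [TopologicalSpace H'] {I' : ModelWithCorners ℝ E' H'} [TopologicalSpace N]
    [ChartedSpace H' N] {f : M → N} (hf : ContMDiffOn I I' ∞ f U) (hU : IsOpen U) (hx : x ∈ U) :
    MDifferentiableAt I I' f x :=
  (hf.contMDiffAt (hU.mem_nhds hx)).mdifferentiableAt (by simp)

lemma SmoothVF.mono {V : ∀ x : M, TangentSpace I x} {U' : Set M} (h : SmoothVF I V U)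
    (hU : U' ⊆ U) : SmoothVF I V U' := ContMDiffOn.mono h hU

lemma SmoothVF.mdifferentiableAt {V : ∀ x : M, TangentSpace I x} (h : SmoothVF I V U)
    (hU : IsOpen U) (hx : x ∈ U) :
    MDifferentiableAt I I.tangent (fun x => (⟨x, V x⟩ : TangentBundle I M)) x :=
  mdifferentiableAt_of_contMDiffOn h hU hx

lemma SmoothVF.sum_smul {ι : Type*} [Fintype ι] {f : ι → M → ℝ}
    {V : ι → ∀ x : M, TangentSpace I x} (hf : ∀ i, ContMDiffOn I 𝓘(ℝ, ℝ) ∞ (f i) U)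
    (hV : ∀ i, SmoothVF I (V i) U) : SmoothVF I (fun x => ∑ i, f i x • V i x) U :=
  ContMDiffOn.sum_section (V := fun x : M => TangentSpace I x) (t := fun i x => f i x • V i x)
    fun i _ => ContMDiffOn.smul_section (V := fun x : M => TangentSpace I x) (hf i) (hV i)

lemma SmoothVF.mlieBracket {V W : ∀ x : M, TangentSpace I x} (hU : IsOpen U)
    (hV : SmoothVF I V U) (hW : SmoothVF I W U) :
    SmoothVF I (VectorField.mlieBracket I V W) U := by
  intro x hx
  refine ContMDiffAt.contMDiffWithinAt ?_
  have : IsManifold I (minSmoothness ℝ 2) M := by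
    simp only [minSmoothness_of_isRCLikeNormedField]; infer_instance
  have : IsManifold I ((⊤ : ℕ∞) + 1) M := by simpa using (inferInstance : IsManifold I ∞ M)
  exact ContMDiffAt.mlieBracket_vectorField (m := ⊤) (n := ⊤)
    (ContMDiffOn.contMDiffAt hV (hU.mem_nhds hx))
    (ContMDiffOn.contMDiffAt hW (hU.mem_nhds hx)) (by simp)

lemma RiemMetric.contMDiffOn_inner (g : RiemMetric I M) {V W : ∀ x : M, TangentSpace I x}
    (hV : SmoothVF I V U) (hW : SmoothVF I W U) :
    ContMDiffOn I 𝓘(ℝ, ℝ) ∞ (fun x => g.inner x (V x) (W x)) U := by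
  have h := ContMDiffOn.clm_bundle_apply₂ (E₁ := fun x : M => TangentSpace I x)
    (E₂ := fun x : M => TangentSpace I x) (E₃ := Bundle.Trivial M ℝ) (F₃ := ℝ) (b := id)
    (ψ := g.inner) (g.contMDiff.contMDiffOn (s := U)) hV hW
  intro x hx
  have := h x hx
  simp only [Bundle.contMDiffWithinAt_totalSpace] at this
  exact this.2

/-- The directional derivative is the fibre component of the tangent map of `f` composed with the
section `V`. -/
lemma contMDiffOn_dirDeriv {f : M → F} {V : ∀ x : M, TangentSpace I x} (hU : IsOpen U)
    (hf : ContMDiffOn I 𝓘(ℝ, F) ∞ f U) (hV : SmoothVF I V U) :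
    ContMDiffOn I 𝓘(ℝ, F) ∞ (dirDeriv I f V) U := by
  have h1 := hf.contMDiffOn_tangentMapWithin (m := ∞) (by simp) hU.uniqueMDiffOn
  have h2 : ContMDiffOn I (𝓘(ℝ, F)).tangent ∞
      (fun x => tangentMapWithin I 𝓘(ℝ, F) f U (⟨x, V x⟩ : TangentBundle I M)) U :=
    h1.comp hV (fun x hx => hx)
  have h3 := (contMDiff_snd_tangentBundle_modelSpace F 𝓘(ℝ, F) (n := ∞)).comp_contMDiffOn h2
  refine h3.congr fun x hx => ?_
  simp only [dirDeriv, Function.comp, tangentMapWithin]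
  rw [mfderivWithin_of_isOpen hU hx]

/-- A vector field acts on functions as a derivation, and the Lie bracket is the commutator. -/
lemma mfderiv_mlieBracket {f : M → F} {V W : ∀ x : M, TangentSpace I x} (hU : IsOpen U)
    (hx : x ∈ U) (hf : ContMDiffOn I 𝓘(ℝ, F) ∞ f U) (hV : SmoothVF I V U) (hW : SmoothVF I W U) :
    dirDeriv I f (VectorField.mlieBracket I V W) x
      = dirDeriv I (dirDeriv I f W) V x - dirDeriv I (dirDeriv I f V) W x := by
  set φ := extChartAt I x with hφ
  set V' := VectorField.mpullbackWithin 𝓘(ℝ, EuclideanSpace ℝ (Fin d)) I φ.symm V (range I) with hV'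
  set W' := VectorField.mpullbackWithin 𝓘(ℝ, EuclideanSpace ℝ (Fin d)) I φ.symm W (range I) with hW'
  set f' : EuclideanSpace ℝ (Fin d) → F := f ∘ φ.symm with hf'
  have hxt : φ x ∈ φ.target := mem_extChartAt_target (I := I) x
  have hinv : φ.symm (φ x) = x := extChartAt_to_inv (I := I) x
  have hnear : ∀ᶠ z in nhdsWithin (φ x) (range I), z ∈ φ.target ∧ φ.symm z ∈ U := by
    have h1 : ∀ᶠ z in nhdsWithin (φ x) (range I), z ∈ φ.target := extChartAt_target_mem_nhdsWithin x
    have h2 := (continuousAt_extChartAt_symm (I := I) x).continuousWithinAt (s := range I)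
    have h3 : U ∈ nhds (φ.symm (φ x)) := by rw [hinv]; exact hU.mem_nhds hx
    exact h1.and (h2 h3)
  -- In the chart, differentiation along `Z` becomes ordinary differentiation along the pulled-back
  -- field. Everything is taken within `range I`, since `x` may be a boundary point.
  have key : ∀ (h : M → F), ContMDiffOn I 𝓘(ℝ, F) ∞ h U → ∀ (Z : ∀ x : M, TangentSpace I x),
      ∀ z, z ∈ φ.target → φ.symm z ∈ U →
      fderivWithin ℝ (h ∘ φ.symm) (range I) z
        (VectorField.mpullbackWithin 𝓘(ℝ, EuclideanSpace ℝ (Fin d)) I φ.symm Z (range I) z)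
        = dirDeriv I h Z (φ.symm z) := by
    intro h hh Z z hz hzU
    have hzr : z ∈ range I := extChartAt_target_subset_range x hz
    have h1 : MDifferentiableAt I 𝓘(ℝ, F) h (φ.symm z) := mdifferentiableAt_of_contMDiffOn hh hU hzU
    have h2 : MDifferentiableWithinAt 𝓘(ℝ, EuclideanSpace ℝ (Fin d)) I φ.symm (range I) z :=
      mdifferentiableWithinAt_extChartAt_symm hz
    have h3 := mfderiv_comp_mfderivWithin (I := 𝓘(ℝ, EuclideanSpace ℝ (Fin d))) (I' := I)
      (I'' := 𝓘(ℝ, F)) (f := φ.symm) (g := h) (s := range I) z h1 h2 (I.uniqueMDiffOn z hzr)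
    rw [mfderivWithin_eq_fderivWithin] at h3
    rw [h3]
    simp only [VectorField.mpullbackWithin_apply, dirDeriv]
    have h4 := isInvertible_mfderivWithin_extChartAt_symm hz
    exact congrArg _ (h4.self_apply_inverse _)
  have hsm : ∀ (h : M → F), ContMDiffOn I 𝓘(ℝ, F) ∞ h U →
      ContDiffWithinAt ℝ ∞ (h ∘ φ.symm) (range I) (φ x) := by
    intro h hh
    have h1 : ContMDiffAt I 𝓘(ℝ, F) ∞ h (φ.symm (φ x)) := by
      rw [hinv]; exact hh.contMDiffAt (hU.mem_nhds hx)
    have h2 := h1.comp_contMDiffWithinAt (φ x) (contMDiffWithinAt_extChartAt_symm_range x hxt)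
    exact contMDiffWithinAt_iff_contDiffWithinAt.1 h2
  have hV1 : DifferentiableWithinAt ℝ V' (range I) (φ x) := by
    have h := MDifferentiableWithinAt.differentiableWithinAt_mpullbackWithin_vectorField
      ((hV.mdifferentiableAt hU hx).mdifferentiableWithinAt (s := univ))
    rwa [preimage_univ, univ_inter] at h
  have hW1 : DifferentiableWithinAt ℝ W' (range I) (φ x) := by
    have h := MDifferentiableWithinAt.differentiableWithinAt_mpullbackWithin_vectorField
      ((hW.mdifferentiableAt hU hx).mdifferentiableWithinAt (s := univ))
    rwa [preimage_univ, univ_inter] at h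
  -- Symmetry of second derivatives in the model space; boundary points are admissible as limits of
  -- interior points of `range I`.
  have hmain := VectorField.fderivWithin_apply_lieBracket (n := ∞) (hsm f hf)
    (by simp only [minSmoothness_of_isRCLikeNormedField]; exact ENat.LEInfty.out)
    I.uniqueDiffOn (I.range_subset_closure_interior (extChartAt_target_subset_range x hxt))
    (extChartAt_target_subset_range x hxt) hW1 hV1
  have e1 : ∀ Z : ∀ x : M, TangentSpace I x, SmoothVF I Z U →
      (fun z => fderivWithin ℝ f' (range I) z
        (VectorField.mpullbackWithin 𝓘(ℝ, EuclideanSpace ℝ (Fin d)) I φ.symm Z (range I) z))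
        =ᶠ[nhdsWithin (φ x) (range I)] dirDeriv I f Z ∘ φ.symm := by
    intro Z _
    filter_upwards [hnear] with z hz
    exact key f hf Z z hz.1 hz.2
  have hxr := extChartAt_target_subset_range x hxt
  have hxU : φ.symm (φ x) ∈ U := by rwa [hinv]
  rw [(e1 V hV).fderivWithin_eq_of_mem hxr, (e1 W hW).fderivWithin_eq_of_mem hxr] at hmain
  rw [key _ (contMDiffOn_dirDeriv hU hf hW) V _ hxt hxU,
    key _ (contMDiffOn_dirDeriv hU hf hV) W _ hxt hxU, hinv] at hmain
  rw [← hmain]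
  have h5 := key f hf (VectorField.mlieBracket I V W) (φ x) hxt hxU
  rw [hinv] at h5
  rw [← h5]
  congr 1
  -- The bracket on `M` is by definition the chart bracket at `x`, and the differential of the chart
  -- at its own centre is the identity.
  rw [VectorField.mpullbackWithin_apply, ← VectorField.mlieBracketWithin_univ,
    VectorField.mlieBracketWithin_apply, preimage_univ, univ_inter,
    mfderivWithin_range_extChartAt_symm, mfderiv_extChartAt_self]
  have hid : ∀ u : EuclideanSpace ℝ (Fin d),
      (ContinuousLinearMap.id ℝ (EuclideanSpace ℝ (Fin d))).inverse u = u := by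
    intro u; rw [ContinuousLinearMap.inverse_id]; rfl
  refine (hid _).trans ((hid _).trans ?_)
  change (VectorField.lieBracketWithin ℝ
    (VectorField.mpullbackWithin 𝓘(ℝ, EuclideanSpace ℝ (Fin d)) I
      (extChartAt I (φ.symm (φ x))).symm V (range I))
    (VectorField.mpullbackWithin 𝓘(ℝ, EuclideanSpace ℝ (Fin d)) I
      (extChartAt I (φ.symm (φ x))).symm W (range I)) (range I)
      (extChartAt I (φ.symm (φ x)) (φ.symm (φ x)))) = _
  rw [hinv]

lemma dirDeriv_comp {f : M → F} {G : Type*} [NormedAddCommGroup G] [NormedSpace ℝ G] {φ : F → G}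
    {V : ∀ x : M, TangentSpace I x} (hf : MDifferentiableAt I 𝓘(ℝ, F) f x)
    (hφ : DifferentiableAt ℝ φ (f x)) :
    dirDeriv I (fun y => φ (f y)) V x = fderiv ℝ φ (f x) (dirDeriv I f V x) := by
  unfold dirDeriv
  have := mfderiv_comp (I := I) (I' := 𝓘(ℝ, F)) (I'' := 𝓘(ℝ, G)) x hφ.mdifferentiableAt hf
  rw [show (fun y => φ (f y)) = φ ∘ f from rfl, this, mfderiv_eq_fderiv]
  rfl

lemma dirDeriv_clm {f : M → F} {G : Type*} [NormedAddCommGroup G] [NormedSpace ℝ G] (φ : F →L[ℝ] G)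
    {V : ∀ x : M, TangentSpace I x} (hf : MDifferentiableAt I 𝓘(ℝ, F) f x) :
    dirDeriv I (fun y => φ (f y)) V x = φ (dirDeriv I f V x) := by
  rw [dirDeriv_comp hf φ.differentiableAt, φ.fderiv]

lemma dirDeriv_congr {f f' : M → F} {V : ∀ x : M, TangentSpace I x} (h : f =ᶠ[nhds x] f') :
    dirDeriv I f V x = dirDeriv I f' V x := by
  unfold dirDeriv
  rw [h.mfderiv_eq]
  rfl

lemma dirDeriv_const (c : F) (V : ∀ x : M, TangentSpace I x) :
    dirDeriv I (fun _ : M => c) V x = 0 := by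
  unfold dirDeriv
  rw [mfderiv_const]
  rfl

lemma dirDeriv_add {f f' : M → F} {V : ∀ x : M, TangentSpace I x}
    (hf : MDifferentiableAt I 𝓘(ℝ, F) f x) (hf' : MDifferentiableAt I 𝓘(ℝ, F) f' x) :
    dirDeriv I (fun y => f y + f' y) V x = dirDeriv I f V x + dirDeriv I f' V x := by
  unfold dirDeriv
  rw [show (fun y => f y + f' y) = f + f' from rfl, mfderiv_add hf hf']
  rfl

lemma dirDeriv_bilin {E₁ E₂ G : Type*} [NormedAddCommGroup E₁] [NormedSpace ℝ E₁]
    [NormedAddCommGroup E₂] [NormedSpace ℝ E₂] [NormedAddCommGroup G] [NormedSpace ℝ G]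
    (B : E₁ →L[ℝ] E₂ →L[ℝ] G) {f : M → E₁} {f' : M → E₂} {V : ∀ x : M, TangentSpace I x}
    (hf : MDifferentiableAt I 𝓘(ℝ, E₁) f x) (hf' : MDifferentiableAt I 𝓘(ℝ, E₂) f' x) :
    dirDeriv I (fun y => B (f y) (f' y)) V x
      = B (dirDeriv I f V x) (f' x) + B (f x) (dirDeriv I f' V x) := by
  have h1 : HasFDerivAt (fun z : E₁ × E₂ => B z.1 z.2)
      (B.precompR (E₁ × E₂) (f x) (.snd ℝ E₁ E₂) + B.precompL (E₁ × E₂) (.fst ℝ E₁ E₂) (f' x))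
      (f x, f' x) :=
    B.hasFDerivAt_of_bilinear (x := (f x, f' x)) hasFDerivAt_fst hasFDerivAt_snd
  have hp := hf.prodMk_space hf'
  have h2 := dirDeriv_comp (V := V) hp h1.differentiableAt
  have h3 : dirDeriv I (fun y => (f y, f' y)) V x = (dirDeriv I f V x, dirDeriv I f' V x) := by
    have e1 := dirDeriv_clm (V := V) (.fst ℝ E₁ E₂) hp
    have e2 := dirDeriv_clm (V := V) (.snd ℝ E₁ E₂) hp
    exact Prod.ext e1.symm e2.symm
  rw [h2, h1.fderiv, h3]
  simp [add_comm]

lemma mdifferentiableAt_finset_sum {ι : Type*} (s : Finset ι) {f : ι → M → F}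
    (hf : ∀ i ∈ s, MDifferentiableAt I 𝓘(ℝ, F) (f i) x) :
    MDifferentiableAt I 𝓘(ℝ, F) (fun y => ∑ i ∈ s, f i y) x := by
  classical
  induction s using Finset.induction_on with
  | empty => simpa using mdifferentiableAt_const
  | insert a s ha ih =>
    simp only [Finset.sum_insert ha]
    exact (hf a (Finset.mem_insert_self a s)).add
      (ih fun i hi => hf i (Finset.mem_insert_of_mem hi))

lemma dirDeriv_sum {ι : Type*} (s : Finset ι) {f : ι → M → F} {V : ∀ x : M, TangentSpace I x}
    (hf : ∀ i ∈ s, MDifferentiableAt I 𝓘(ℝ, F) (f i) x) :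
    dirDeriv I (fun y => ∑ i ∈ s, f i y) V x = ∑ i ∈ s, dirDeriv I (f i) V x := by
  classical
  induction s using Finset.induction_on with
  | empty => simpa using dirDeriv_const (0 : F) V
  | insert a s ha ih =>
    have h2 := mdifferentiableAt_finset_sum s fun i hi => hf i (Finset.mem_insert_of_mem hi)
    simp only [Finset.sum_insert ha]
    rw [dirDeriv_add (hf a (Finset.mem_insert_self a s)) h2,
      ih fun i hi => hf i (Finset.mem_insert_of_mem hi)]

lemma dirDeriv_smul {f : M → ℝ} {f' : M → F} {V : ∀ x : M, TangentSpace I x}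
    (hf : MDifferentiableAt I 𝓘(ℝ, ℝ) f x) (hf' : MDifferentiableAt I 𝓘(ℝ, F) f' x) :
    dirDeriv I (fun y => f y • f' y) V x = dirDeriv I f V x • f' x + f x • dirDeriv I f' V x :=
  dirDeriv_bilin (.lsmul ℝ ℝ) hf hf'

lemma dirDeriv_vec_sum {ι : Type*} (s : Finset ι) (f : M → F) (a : ι → ℝ)
    (V : ι → ∀ x : M, TangentSpace I x) {W : ∀ x : M, TangentSpace I x}
    (h : W x = ∑ i ∈ s, a i • V i x) :
    dirDeriv I f W x = ∑ i ∈ s, a i • dirDeriv I f (V i) x := by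
  unfold dirDeriv
  rw [h, map_sum]
  exact Finset.sum_congr rfl fun i _ => map_smul _ _ _

/-- Tangent vectors at `x` are detected by their action on the chart at `x`, whose differential
there is the identity. This reduces identities between brackets to identities between derivatives of
one vector-valued function. -/
lemma ext_mfderiv_extChartAt {v w : TangentSpace I x}
    (h : mfderiv I 𝓘(ℝ, EuclideanSpace ℝ (Fin d)) (extChartAt I x) x v
      = mfderiv I 𝓘(ℝ, EuclideanSpace ℝ (Fin d)) (extChartAt I x) x w) : v = w := by
  rw [mfderiv_extChartAt_self] at h
  exact h

/-- The Lie bracket of combinations of vector fields with function coefficients. -/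
lemma mlieBracket_sum_smul {ι κ : Type*} [Fintype ι] [Fintype κ] {a : ι → M → ℝ} {b : κ → M → ℝ}
    {V : ι → ∀ x : M, TangentSpace I x} {W : κ → ∀ x : M, TangentSpace I x}
    (hU : IsOpen U) (hx : x ∈ U)
    (ha : ∀ i, ContMDiffOn I 𝓘(ℝ, ℝ) ∞ (a i) U) (hb : ∀ i, ContMDiffOn I 𝓘(ℝ, ℝ) ∞ (b i) U)
    (hV : ∀ i, SmoothVF I (V i) U) (hW : ∀ i, SmoothVF I (W i) U) :
    VectorField.mlieBracket I (fun y => ∑ i, a i y • V i y) (fun y => ∑ i, b i y • W i y) x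
      = ∑ i, ∑ k, (a i x * b k x) • VectorField.mlieBracket I (V i) (W k) x
        + ∑ k, (∑ i, a i x * dirDeriv I (b k) (V i) x) • W k x
        - ∑ i, (∑ k, b k x * dirDeriv I (a i) (W k) x) • V i x := by
  -- On the chart map the bracket is a commutator of derivatives. The Leibniz rule separates first
  -- derivatives of the coefficients from second derivatives, and the latter reassemble into the
  -- brackets of the `V i` and `W k`.
  apply ext_mfderiv_extChartAt
  set U' := U ∩ (chartAt H x).source with hU'
  have hoU' : IsOpen U' := hU.inter (chartAt H x).open_source
  have hxU' : x ∈ U' := ⟨hx, mem_chart_source H x⟩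
  have hφ : ContMDiffOn I 𝓘(ℝ, EuclideanSpace ℝ (Fin d)) ∞ (extChartAt I x) U' :=
    contMDiffOn_extChartAt.mono inter_subset_right
  have ha' := fun i => (ha i).mono (inter_subset_left (t := (chartAt H x).source))
  have hb' := fun i => (hb i).mono (inter_subset_left (t := (chartAt H x).source))
  have hV' := fun i => (hV i).mono (inter_subset_left (t := (chartAt H x).source))
  have hW' := fun i => (hW i).mono (inter_subset_left (t := (chartAt H x).source))
  have hdV := fun i => contMDiffOn_dirDeriv hoU' hφ (hV' i)
  have hdW := fun i => contMDiffOn_dirDeriv hoU' hφ (hW' i)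
  have e1 : ∀ (c : ι → M → ℝ), (dirDeriv I (extChartAt I x) fun y => ∑ i, c i y • V i y)
      = fun y => ∑ i, c i y • dirDeriv I (extChartAt I x) (V i) y := fun c => funext fun y =>
    dirDeriv_vec_sum Finset.univ (extChartAt I x) (fun i => c i y) V rfl
  have e2 : ∀ (c : κ → M → ℝ), (dirDeriv I (extChartAt I x) fun y => ∑ i, c i y • W i y)
      = fun y => ∑ i, c i y • dirDeriv I (extChartAt I x) (W i) y := fun c => funext fun y =>
    dirDeriv_vec_sum Finset.univ (extChartAt I x) (fun i => c i y) W rfl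
  have h1 := mfderiv_mlieBracket hoU' hxU' hφ (SmoothVF.sum_smul ha' hV')
    (SmoothVF.sum_smul hb' hW')
  refine h1.trans ?_
  rw [e1, e2, dirDeriv_vec_sum Finset.univ _ (fun i => a i x) V rfl,
    dirDeriv_vec_sum Finset.univ _ (fun i => b i x) W rfl]
  have md : ∀ {f : M → ℝ}, ContMDiffOn I 𝓘(ℝ, ℝ) ∞ f U' → MDifferentiableAt I 𝓘(ℝ, ℝ) f x :=
    fun h => mdifferentiableAt_of_contMDiffOn h hoU' hxU'
  have md' : ∀ {f : M → EuclideanSpace ℝ (Fin d)},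
      ContMDiffOn I 𝓘(ℝ, EuclideanSpace ℝ (Fin d)) ∞ f U' →
      MDifferentiableAt I 𝓘(ℝ, EuclideanSpace ℝ (Fin d)) f x :=
    fun h => mdifferentiableAt_of_contMDiffOn h hoU' hxU'
  have e3 : ∀ i, dirDeriv I (fun y => ∑ k, b k y • dirDeriv I (extChartAt I x) (W k) y) (V i) x
      = ∑ k, (dirDeriv I (b k) (V i) x • dirDeriv I (extChartAt I x) (W k) x
        + b k x • dirDeriv I (dirDeriv I (extChartAt I x) (W k)) (V i) x) := by
    intro i
    refine (dirDeriv_sum Finset.univ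
      (f := fun k y => b k y • dirDeriv I (extChartAt I x) (W k) y) (V := V i)
      fun k _ => (md (hb' k)).smul (md' (hdW k))).trans ?_
    exact Finset.sum_congr rfl fun k _ => dirDeriv_smul (md (hb' k)) (md' (hdW k))
  have e4 : ∀ k, dirDeriv I (fun y => ∑ i, a i y • dirDeriv I (extChartAt I x) (V i) y) (W k) x
      = ∑ i, (dirDeriv I (a i) (W k) x • dirDeriv I (extChartAt I x) (V i) x
        + a i x • dirDeriv I (dirDeriv I (extChartAt I x) (V i)) (W k) x) := by
    intro k
    refine (dirDeriv_sum Finset.univ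
      (f := fun i y => a i y • dirDeriv I (extChartAt I x) (V i) y) (V := W k)
      fun i _ => (md (ha' i)).smul (md' (hdV i))).trans ?_
    exact Finset.sum_congr rfl fun i _ => dirDeriv_smul (md (ha' i)) (md' (hdV i))
  have e5 : ∀ i k, dirDeriv I (extChartAt I x) (VectorField.mlieBracket I (V i) (W k)) x
      = dirDeriv I (dirDeriv I (extChartAt I x) (W k)) (V i) x
        - dirDeriv I (dirDeriv I (extChartAt I x) (V i)) (W k) x := fun i k =>
    mfderiv_mlieBracket hoU' hxU' hφ (hV' i) (hW' k)
  simp only [e3, e4, map_add, map_sub, map_sum, map_smul]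
  change _ = (∑ i, ∑ k, (a i x * b k x) • dirDeriv I (extChartAt I x)
      (VectorField.mlieBracket I (V i) (W k)) x)
    + (∑ k, (∑ i, a i x * dirDeriv I (b k) (V i) x) • dirDeriv I (extChartAt I x) (W k) x)
    - (∑ i, (∑ k, b k x * dirDeriv I (a i) (W k) x) • dirDeriv I (extChartAt I x) (V i) x)
  simp only [e5, Finset.smul_sum, Finset.sum_smul, smul_add, smul_sub, Finset.sum_add_distrib,
    Finset.sum_sub_distrib, smul_smul]
  rw [Finset.sum_comm (f := fun k i => (a i x * dirDeriv I (b k) (V i) x) • _),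
    Finset.sum_comm (f := fun k i => (b k x * a i x) • _),
    Finset.sum_comm (f := fun k i => (b k x * dirDeriv I (a i) (W k) x) • _)]
  simp only [mul_comm (b _ x) (a _ x)]
  abel

end VectorFields

/-! ### Related vector fields -/

section Related

variable {d d' : ℕ} {H H' : Type*} [TopologicalSpace H] [TopologicalSpace H']
  {I : ModelWithCorners ℝ (EuclideanSpace ℝ (Fin d)) H}
  {I' : ModelWithCorners ℝ (EuclideanSpace ℝ (Fin d')) H'}
  {M : Type*} [TopologicalSpace M] [ChartedSpace H M] [IsManifold I ∞ M]
  {M' : Type*} [TopologicalSpace M'] [ChartedSpace H' M'] [IsManifold I' ∞ M']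
  {F : Type*} [NormedAddCommGroup F] [NormedSpace ℝ F]
  {U : Set M} {U' : Set M'} {x : M} {f : M → M'}

lemma dirDeriv_comp_related {h : M' → F} {V : ∀ x : M, TangentSpace I x}
    {V' : ∀ x : M', TangentSpace I' x} (hh : MDifferentiableAt I' 𝓘(ℝ, F) h (f x))
    (hf : MDifferentiableAt I I' f x) (hV : mfderiv I I' f x (V x) = V' (f x)) :
    dirDeriv I (fun y => h (f y)) V x = dirDeriv I' h V' (f x) := by
  unfold dirDeriv
  have h1 := mfderiv_comp (I := I) (I' := I') (I'' := 𝓘(ℝ, F)) x hh hf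
  rw [show (fun y => h (f y)) = h ∘ f from rfl, h1, ← hV]
  rfl

/-- The brackets of `f`-related vector fields are `f`-related. -/
lemma mfderiv_mlieBracket_related {V W : ∀ x : M, TangentSpace I x}
    {V' W' : ∀ x : M', TangentSpace I' x} (hU : IsOpen U) (hU' : IsOpen U') (hx : x ∈ U)
    (hfU : MapsTo f U U') (hf : ContMDiffOn I I' ∞ f U) (hV : SmoothVF I V U)
    (hW : SmoothVF I W U) (hV' : SmoothVF I' V' U') (hW' : SmoothVF I' W' U')
    (rV : ∀ y ∈ U, mfderiv I I' f y (V y) = V' (f y))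
    (rW : ∀ y ∈ U, mfderiv I I' f y (W y) = W' (f y)) :
    mfderiv I I' f x (VectorField.mlieBracket I V W x)
      = VectorField.mlieBracket I' V' W' (f x) := by
  -- Test on the chart `χ` of the target: relatedness turns derivatives of `χ ∘ f` into derivatives
  -- of `χ`, and is used a second time on those derivatives.
  apply ext_mfderiv_extChartAt
  set χ := extChartAt I' (f x) with hχ
  set U2 := U' ∩ (chartAt H' (f x)).source with hU2
  have oU2 : IsOpen U2 := hU'.inter (chartAt H' (f x)).open_source
  set U1 := U ∩ f ⁻¹' U2 with hU1
  have oU1 : IsOpen U1 := hf.continuousOn.isOpen_inter_preimage hU oU2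
  have xU1 : x ∈ U1 := ⟨hx, hfU hx, mem_chart_source H' (f x)⟩
  have sχ : ContMDiffOn I' 𝓘(ℝ, EuclideanSpace ℝ (Fin d')) ∞ χ U2 :=
    contMDiffOn_extChartAt.mono inter_subset_right
  have sχf : ContMDiffOn I 𝓘(ℝ, EuclideanSpace ℝ (Fin d')) ∞ (fun y => χ (f y)) U1 :=
    sχ.comp (hf.mono inter_subset_left) fun y hy => hy.2
  have df : ∀ y ∈ U1, MDifferentiableAt I I' f y := fun y hy =>
    mdifferentiableAt_of_contMDiffOn hf hU hy.1
  have e1 : ∀ {h : M' → EuclideanSpace ℝ (Fin d')},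
      ContMDiffOn I' 𝓘(ℝ, EuclideanSpace ℝ (Fin d')) ∞ h U2 → ∀ y ∈ U1,
      ∀ {Z : ∀ x : M, TangentSpace I x} {Z' : ∀ x : M', TangentSpace I' x},
      (mfderiv I I' f y (Z y) = Z' (f y)) →
      dirDeriv I (fun y => h (f y)) Z y = dirDeriv I' h Z' (f y) := fun hh y hy _ _ hZ =>
    dirDeriv_comp_related (mdifferentiableAt_of_contMDiffOn hh oU2 hy.2) (df y hy) hZ
  have h1 := mfderiv_mlieBracket oU1 xU1 sχf (hV.mono inter_subset_left) (hW.mono inter_subset_left)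
  have h2 := mfderiv_mlieBracket oU2 (x := f x) xU1.2 sχ (hV'.mono inter_subset_left)
    (hW'.mono inter_subset_left)
  have c1 : ∀ {Z : ∀ x : M, TangentSpace I x} {Z' : ∀ x : M', TangentSpace I' x},
      (∀ y ∈ U, mfderiv I I' f y (Z y) = Z' (f y)) →
      dirDeriv I (fun y => χ (f y)) Z =ᶠ[nhds x] fun y => dirDeriv I' χ Z' (f y) := by
    intro Z Z' hZ
    filter_upwards [oU1.mem_nhds xU1] with y hy
    exact e1 sχ y hy (hZ y hy.1)
  rw [dirDeriv_congr (c1 rV), dirDeriv_congr (c1 rW),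
    e1 (contMDiffOn_dirDeriv oU2 sχ (hV'.mono inter_subset_left)) x xU1 (rW x hx),
    e1 (contMDiffOn_dirDeriv oU2 sχ (hW'.mono inter_subset_left)) x xU1 (rV x hx), ← h2] at h1
  refine Eq.trans ?_ h1
  have h3 := mfderiv_comp (I := I) (I' := I') (I'' := 𝓘(ℝ, EuclideanSpace ℝ (Fin d'))) x
    (mdifferentiableAt_of_contMDiffOn sχ oU2 xU1.2) (df x xU1)
  unfold dirDeriv
  rw [show (fun y => χ (f y)) = χ ∘ f from rfl, h3]
  rfl

end Related

/-! ### Orthonormal frames -/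

section Frames

variable {d : ℕ} {H : Type*} [TopologicalSpace H]
  {I : ModelWithCorners ℝ (EuclideanSpace ℝ (Fin d)) H}
  {M : Type*} [TopologicalSpace M] [ChartedSpace H M] [IsManifold I ∞ M]
  {g : RiemMetric I M} {x : M}

lemma inner_eq_of_mk_eq {p : M} {v w : TangentSpace I p} {v' w' : TangentSpace I x}
    (h1 : (⟨p, v⟩ : TangentBundle I M) = ⟨x, v'⟩) (h2 : (⟨p, w⟩ : TangentBundle I M) = ⟨x, w'⟩) :
    g.inner p v w = g.inner x v' w' := by
  cases h1
  cases h2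
  rfl

/-- Expansion of a tangent vector in an orthonormal frame. -/
lemma orthonormal_expansion {e : Fin d → TangentSpace I x}
    (he : ∀ i j, g.inner x (e i) (e j) = if i = j then 1 else 0) (v : TangentSpace I x) :
    v = ∑ i, g.inner x (e i) v • e i := by
  have hli : LinearIndependent ℝ e := by
    rw [Fintype.linearIndependent_iff]
    intro c hc i
    have := congrArg (g.inner x (e i)) hc
    simpa [map_sum, he] using this
  have hfr : Fintype.card (Fin d) = Module.finrank ℝ (TangentSpace I x) := by
    have : Module.finrank ℝ (EuclideanSpace ℝ (Fin d)) = d := by simp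
    rw [Fintype.card_fin]
    exact this.symm
  have : FiniteDimensional ℝ (TangentSpace I x) :=
    inferInstanceAs (FiniteDimensional ℝ (EuclideanSpace ℝ (Fin d)))
  have hspan := hli.span_eq_top_of_card_eq_finrank' hfr
  have hv : v ∈ Submodule.span ℝ (range e) := hspan ▸ Submodule.mem_top
  obtain ⟨c, rfl⟩ := (Submodule.mem_span_range_iff_exists_fun ℝ).1 hv
  refine Finset.sum_congr rfl fun i _ => ?_
  congr 1
  simp [map_sum, he]

variable {Q : Type*} [TopologicalSpace Q] {N : ℕ} {P : Type*}
  [TopologicalSpace P] {S : SpinStructure g Q} {E : FlatHermitianBundle M N P}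

/-- The matrix of the rotation covered by an element of the spin group. -/
lemma exists_isSpinLift (a : SpinGrp d) : ∃ A : Fin d → Fin d → ℝ, IsSpinLift a A := by
  choose w hw using fun i : Fin d => exists_spin_mul_iota a (Pi.single i 1)
  refine ⟨fun j i => w i j, fun i => ?_⟩
  rw [cliffE, hw, iota_eq_sum]

lemma SpinStructure.frame_act (S : SpinStructure g Q) {a : SpinGrp d} {A : Fin d → Fin d → ℝ}
    (h : IsSpinLift a A) (q : Q) (i : Fin d) :
    (⟨S.proj (S.act q a), S.frame (S.act q a) i⟩ : TangentBundle I M)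
      = ⟨S.proj q, ∑ j, A j i • S.frame q j⟩ := by
  have h1 := S.equivariant q a (Pi.single i 1) (fun j => A j i) (by
    rw [iota_eq_sum (fun j => A j i)]; exact h i)
  have h2 : ∑ k, (Pi.single i (1 : ℝ) : Fin d → ℝ) k • S.frame (S.act q a) k
      = S.frame (S.act q a) i := by simp [Pi.single_apply]
  rwa [h2] at h1

lemma frameMap_eq_iff {q q' : Q} :
    frameMap (I := I) S.proj S.frame q = frameMap S.proj S.frame q' ↔
      ∀ i, (⟨S.proj q, S.frame q i⟩ : TangentBundle I M) = ⟨S.proj q', S.frame q' i⟩ :=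
  funext_iff

namespace LocalFrame

lemma inner_vec (L : LocalFrame S E) (hx : x ∈ L.U) (i j : Fin d) :
    g.inner x (L.vec i x) (L.vec j x) = if i = j then 1 else 0 := by
  rw [← S.orthonormal (L.spin x) i j]
  exact (inner_eq_of_mk_eq (L.frame_spin x hx i) (L.frame_spin x hx j)).symm

/-- The matrix of the frame vectors of `L'` in terms of those of `L`. -/
def transition (L L' : LocalFrame S E) (x : M) (j i : Fin d) : ℝ :=
  g.inner x (L.vec j x) (L'.vec i x)

lemma vec_eq_sum (L L' : LocalFrame S E) (hx : x ∈ L.U) (i : Fin d) :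
    L'.vec i x = ∑ j, L.transition L' x j i • L.vec j x :=
  orthonormal_expansion (L.inner_vec hx) _

lemma contMDiffOn_transition (L L' : LocalFrame S E) (j i : Fin d) :
    ContMDiffOn I 𝓘(ℝ, ℝ) ∞ (fun x => L.transition L' x j i) (L.U ∩ L'.U) :=
  g.contMDiffOn_inner ((L.vec_smooth j).mono inter_subset_left)
    ((L'.vec_smooth i).mono inter_subset_right)

lemma transition_col_orthonormal (L L' : LocalFrame S E) (hx : x ∈ L.U) (hx' : x ∈ L'.U)
    (i j : Fin d) :
    ∑ k, L.transition L' x k i * L.transition L' x k j = if i = j then 1 else 0 := by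
  rw [← L'.inner_vec hx' i j]
  conv_rhs => rw [L.vec_eq_sum L' hx i]
  simp only [map_sum, map_smul, sum_apply, smul_apply, smul_eq_mul]
  rfl

lemma proj_spin_eq_proj_flat (L : LocalFrame S E) (hx : x ∈ L.U) :
    S.proj (L.spin x) = E.proj (L.flat x) := by
  rw [L.spin_proj x hx, L.flat_proj x hx]

/-- A spin group element that relates two local frames lifts the transition matrix. -/
lemma isSpinLift_transition (L L' : LocalFrame S E) (hx : x ∈ L.U) (hx' : x ∈ L'.U)
    {a : SpinGrp d} (ha : S.act (L.spin x) a = L'.spin x) : IsSpinLift a (L.transition L' x) := by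
  obtain ⟨A, hA⟩ := exists_isSpinLift a
  suffices h : ∀ j i, L.transition L' x j i = A j i by
    rwa [show L.transition L' x = A from funext fun j => funext fun i => h j i]
  intro j i
  have h1 := S.frame_act hA (L.spin x) i
  rw [ha, L'.frame_spin x hx' i] at h1
  have h2 : (⟨S.proj (L.spin x), ∑ j, A j i • S.frame (L.spin x) j⟩ : TangentBundle I M)
      = ⟨x, ∑ j, A j i • L.vec j x⟩ := by
    have hp := L.spin_proj x hx
    have hf := fun j => (tangentBundle_mk_eq_iff.1 (L.frame_spin x hx j)).2
    refine tangentBundle_mk_eq_iff.2 ⟨hp, ?_⟩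
    change ∑ j, A j i • (show EuclideanSpace ℝ (Fin d) from S.frame (L.spin x) j) = _
    simp only [hf]
    rfl
  rw [h2] at h1
  have h3 : L'.vec i x = ∑ j, A j i • L.vec j x := (tangentBundle_mk_eq_iff.1 h1).2
  rw [transition, h3]
  simp [map_sum, L.inner_vec hx]

/-- The local frame `L` changed by constant elements of the structure groups. -/
def translate (L : LocalFrame S E) (a : SpinGrp d) (u : Matrix.unitaryGroup (Fin N) ℂ) :
    LocalFrame S E where
  U := L.U
  isOpen_U := L.isOpen_U
  spin x := S.act (L.spin x) a
  flat x := E.act (L.flat x) u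
  vec i x := ∑ j, (exists_isSpinLift a).choose j i • L.vec j x
  spin_continuous := S.act_continuous.comp_continuousOn
    (L.spin_continuous.prodMk continuousOn_const)
  flat_continuous := (E.act_continuous u).comp_continuousOn L.flat_continuous
  vec_smooth i := SmoothVF.sum_smul (f := fun j _ => (exists_isSpinLift a).choose j i)
    (fun _ => contMDiffOn_const) L.vec_smooth
  spin_proj x hx := by rw [S.proj_act, L.spin_proj x hx]
  flat_proj x hx := by rw [E.proj_act, L.flat_proj x hx]
  frame_spin x hx i := by
    rw [S.frame_act (exists_isSpinLift a).choose_spec]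
    have hp := L.spin_proj x hx
    have hf := fun j => (tangentBundle_mk_eq_iff.1 (L.frame_spin x hx j)).2
    refine tangentBundle_mk_eq_iff.2 ⟨hp, ?_⟩
    change ∑ j, (exists_isSpinLift a).choose j i •
      (show EuclideanSpace ℝ (Fin d) from S.frame (L.spin x) j) = _
    simp only [hf]
    rfl

/-- Local frames exist through all pairs of frames. -/
lemma exists_through (S : SpinStructure g Q) (E : FlatHermitianBundle M N P) (q : Q) (f : P)
    (h : S.proj q = E.proj f) :
    ∃ L : LocalFrame S E, S.proj q ∈ L.U ∧ L.spin (S.proj q) = q ∧ L.flat (S.proj q) = f := by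
  obtain ⟨U, s, e, hU, hqU, hsq, hs, he, hse⟩ := S.exists_section q
  set σ := E.covering.isLocalHomeomorph.localInverseAt f with hσ
  refine ⟨⟨U ∩ σ.source, hU.inter σ.open_source, s, σ, e, hs.mono inter_subset_left,
    σ.continuousOn.mono inter_subset_right, fun i => (he i).mono inter_subset_left,
    fun x hx => (hse x hx.1).1, fun x hx =>
      E.covering.isLocalHomeomorph.apply_localInverseAt_of_mem hx.2,
    fun x hx i => (hse x hx.1).2 i⟩, ⟨hqU, ?_⟩, hsq, ?_⟩
  · rw [h]
    exact E.covering.isLocalHomeomorph.apply_self_mem_localInverseAt_source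
  · change σ (S.proj q) = f
    rw [h]
    exact E.covering.isLocalHomeomorph.localInverseAt_apply_self

/-- Parallel frames are sections of a covering, which is locally injective, so agreement at one
point spreads to a neighbourhood. -/
lemma flat_eventuallyEq (L L' : LocalFrame S E) (hx : x ∈ L.U) (hx' : x ∈ L'.U)
    (h : L.flat x = L'.flat x) : ∀ᶠ y in nhds x, L.flat y = L'.flat y := by
  obtain ⟨O, hO, hinj⟩ :=
    isLocallyInjective_iff_nhds.1 E.covering.isLocalHomeomorph.isLocallyInjective (L.flat x)
  have h1 := (L.flat_continuous.continuousAt (L.isOpen_U.mem_nhds hx)) hO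
  have h2 := (L'.flat_continuous.continuousAt (L'.isOpen_U.mem_nhds hx')) (h ▸ hO)
  filter_upwards [h1, h2, L.isOpen_U.mem_nhds hx, L'.isOpen_U.mem_nhds hx'] with y a b c e
  exact hinj a b (by rw [L.flat_proj y c, L'.flat_proj y e])

end LocalFrame

end Frames

/-! ### Infinitesimal changes of spin frames -/

namespace SpinorModule

variable {d : ℕ} {Δ : Type*} [NormedAddCommGroup Δ] [InnerProductSpace ℂ Δ]

/-- The normalised lift of the matrix `A` to spinors. -/
def unitLift (C : SpinorModule d Δ) (v₀ : Δ) (A : Fin d → Fin d → ℝ) : Δ →L[ℂ] Δ :=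
  ‖C.repL (spinLift A) v₀‖⁻¹ • C.repL (spinLift A)

variable (C : SpinorModule d Δ)

lemma unitLift_one {v₀ : Δ} (hv₀ : ‖v₀‖ = 1) :
    C.unitLift v₀ (fun i j => if i = j then 1 else 0) = 1 := by
  rw [unitLift, spinLift_one, map_one]
  simp [hv₀]

/-- Spin elements act isometrically, so for unit `v₀` the norm of `spinLift A v₀` is the absolute
value of the unknown scalar in `spinLift_eq_smul`. At the identity it is `1`, and dividing by it is
smooth nearby. -/
lemma contDiffAt_unitLift {v₀ : Δ} (hv₀ : ‖v₀‖ = 1) :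
    ContDiffAt ℝ ∞ (C.unitLift v₀) (fun i j => if i = j then 1 else 0) := by
  have h1 := (C.contDiff_repL_spinLift).contDiffAt
    (x := (fun i j => if i = j then 1 else 0 : Fin d → Fin d → ℝ))
  have h2 : ContDiffAt ℝ ∞ (fun A : Fin d → Fin d → ℝ => C.repL (spinLift A) v₀)
      (fun i j => if i = j then 1 else 0) :=
    ((ContinuousLinearMap.apply ℂ Δ v₀).restrictScalars ℝ).contDiff.contDiffAt.comp _ h1
  have h3 : C.repL (spinLift (fun i j : Fin d => if i = j then 1 else 0)) v₀ ≠ 0 := by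
    rw [spinLift_one, map_one]
    intro h
    rw [one_apply_eq_self] at h
    simp [h] at hv₀
  exact ((h2.norm ℂ h3).inv (norm_ne_zero_iff.2 h3)).smul h1

/-- The inclusion of continuous endomorphisms into endomorphisms. -/
def coeEnd (Δ : Type*) [NormedAddCommGroup Δ] [InnerProductSpace ℂ Δ] :
    (Δ →L[ℂ] Δ) →ₐ[ℝ] Module.End ℂ Δ :=
  { ContinuousLinearMap.toLinearMapRingHom with
    commutes' := fun r => by ext x; rfl }

lemma coeEnd_apply (T : Δ →L[ℂ] Δ) (x : Δ) : coeEnd Δ T x = T x := rfl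

lemma coeEnd_genL (i : Fin d) : coeEnd Δ (C.genL i) = C.gen i := by
  ext x
  rw [coeEnd_apply, genL_apply]

end SpinorModule

/-- Being continuous and linear in its last argument, the average commutes with differentiation. -/
lemma exists_clm_cliffAvg {d : ℕ} {A : Type*} [NormedRing A] [NormedAlgebra ℝ A] (v e : Fin d → A)
    (l : List (Fin d)) : ∃ K : A →L[ℝ] A, ∀ T, cliffAvg v e l T = K T := by
  induction l with
  | nil => exact ⟨.id ℝ A, fun _ => rfl⟩
  | cons i l ih =>
    obtain ⟨K, hK⟩ := ih
    refine ⟨(1 / 2 : ℝ) • (K - (ContinuousLinearMap.mulLeftRight ℝ A (v i) (e i)).comp K),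
      fun T => ?_⟩
    simp [cliffAvg, hK]

/-! ### Spin lifts of the transition between two local frames -/

section Frames

variable {d : ℕ} {H : Type*} [TopologicalSpace H]
  {I : ModelWithCorners ℝ (EuclideanSpace ℝ (Fin d)) H}
  {M : Type*} [TopologicalSpace M] [ChartedSpace H M] [IsManifold I ∞ M]
  {g : RiemMetric I M} {x : M}
  {Q : Type*} [TopologicalSpace Q] {N : ℕ} {P : Type*}
  [TopologicalSpace P] {S : SpinStructure g Q} {E : FlatHermitianBundle M N P}
  {Δ : Type*} [NormedAddCommGroup Δ] [InnerProductSpace ℂ Δ]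

namespace LocalFrame

lemma vec_eq_of_spin_eq {L L' : LocalFrame S E} (hx : x ∈ L.U) (hx' : x ∈ L'.U)
    (hs : L.spin x = L'.spin x) (i : Fin d) : L.vec i x = L'.vec i x := by
  have h1 := L.frame_spin x hx i
  rw [hs, L'.frame_spin x hx' i] at h1
  exact ((tangentBundle_mk_eq_iff.1 h1).2).symm

lemma transition_of_spin_eq {L L' : LocalFrame S E} (hx : x ∈ L.U) (hx' : x ∈ L'.U)
    (hs : L.spin x = L'.spin x) :
    L.transition L' x = fun i j => if i = j then 1 else 0 := by
  funext i j
  rw [transition, ← vec_eq_of_spin_eq hx hx' hs, L.inner_vec hx]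

/-- Two local frames with the same spin frame at `x` are related near `x` by a spin group valued
function that acts on spinors by a smooth function of the transition matrix. -/
lemma exists_spin_transition (hd : 0 < d) (C : SpinorModule d Δ) {L L' : LocalFrame S E}
    (hx : x ∈ L.U) (hx' : x ∈ L'.U) (hs : L.spin x = L'.spin x) {v₀ : Δ} (hv₀ : ‖v₀‖ = 1) :
    ∃ b : M → SpinGrp d, ∀ᶠ y in nhds x, y ∈ L.U ∧ y ∈ L'.U ∧
      S.act (L.spin y) (b y) = L'.spin y ∧ IsSpinLift (b y) (L.transition L' y) ∧
      C.repL (b y) = C.unitLift v₀ (L.transition L' y) := by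
  -- On the overlap `a y` is the element relating the two spin frames, about whose continuity
  -- nothing is known yet; off the overlap the value is arbitrary.
  have hma : ∀ y, ∃ a, y ∈ L.U ∩ L'.U → S.act (L.spin y) a = L'.spin y := by
    intro y
    by_cases hy : y ∈ L.U ∩ L'.U
    · obtain ⟨a, ha, -⟩ := S.simply_transitive (L.spin y) (L'.spin y)
        (by rw [L.spin_proj y hy.1, L'.spin_proj y hy.2])
      exact ⟨a, fun _ => ha⟩
    · exact ⟨1, fun h => absurd h hy⟩
  choose a ha using hma
  have hμ : ∀ y, ∃ μ : ℝ, y ∈ L.U ∩ L'.U →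
      spinLift (L.transition L' y) = μ • (a y : CliffordAlgebra (cliffForm d)) := by
    intro y
    by_cases hy : y ∈ L.U ∩ L'.U
    · obtain ⟨μ, h⟩ := spinLift_eq_smul (L.isSpinLift_transition L' hy.1 hy.2 (ha y hy))
      exact ⟨μ, fun _ => h⟩
    · exact ⟨1, fun h => absurd h hy⟩
  choose μ hμ using hμ
  let m1 : SpinGrp d := ⟨-1, neg_one_mem_spinGroup hd⟩
  -- Flipping the sign where `μ` is negative gives `spinLift = |μ| • b`. So near `x`, `b` is the
  -- explicit normalised lift, and it is continuous at `x`.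
  let b : M → SpinGrp d := fun y => if 0 ≤ μ y then a y else m1 * a y
  have hb : ∀ y, (b y : CliffordAlgebra (cliffForm d)) = a y ∧ 0 ≤ μ y ∨
      (b y : CliffordAlgebra (cliffForm d)) = -(a y : CliffordAlgebra (cliffForm d)) ∧ μ y < 0 := by
    intro y
    by_cases h : 0 ≤ μ y
    · exact Or.inl ⟨by simp [b, h], h⟩
    · exact Or.inr ⟨by simp [b, h, m1], not_le.1 h⟩
  have hblift : ∀ y ∈ L.U ∩ L'.U, IsSpinLift (b y) (L.transition L' y) := by
    intro y hy i
    have h := L.isSpinLift_transition L' hy.1 hy.2 (ha y hy) i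
    rcases hb y with ⟨e, -⟩ | ⟨e, -⟩
    · rw [e, h]
    · rw [e, neg_mul, h, mul_neg]
  have hbμ : ∀ y ∈ L.U ∩ L'.U,
      spinLift (L.transition L' y) = |μ y| • (b y : CliffordAlgebra (cliffForm d)) := by
    intro y hy
    rcases hb y with ⟨e, h⟩ | ⟨e, h⟩
    · rw [e, abs_of_nonneg h, hμ y hy]
    · rw [e, abs_of_neg h, hμ y hy, smul_neg, neg_smul, neg_neg]
  have hnorm : ∀ y ∈ L.U ∩ L'.U, ‖C.repL (spinLift (L.transition L' y)) v₀‖ = |μ y| := by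
    intro y hy
    rw [hbμ y hy, map_smul, smul_apply, norm_smul, C.repL_apply,
      C.norm_rep_spin, hv₀, mul_one, Real.norm_eq_abs, abs_abs]
  have hUU : L.U ∩ L'.U ∈ nhds x := (L.isOpen_U.inter L'.isOpen_U).mem_nhds ⟨hx, hx'⟩
  have hT : ContinuousAt (L.transition L') x := by
    refine continuousAt_pi.2 fun i => continuousAt_pi.2 fun j => ?_
    exact (L.contMDiffOn_transition L' i j).continuousOn.continuousAt hUU
  have hTx := transition_of_spin_eq hx hx' hs
  have hsl : ContinuousAt (fun y => spinLift (L.transition L' y)) x :=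
    continuous_spinLift.continuousAt.comp hT
  have hnl : ContinuousAt (fun y => ‖C.repL (spinLift (L.transition L' y)) v₀‖) x := by
    have h1 : Continuous fun A => ‖C.repL (spinLift A) v₀‖ :=
      ((ContinuousLinearMap.apply ℂ Δ v₀).continuous.comp C.contDiff_repL_spinLift.continuous).norm
    exact h1.continuousAt.comp hT
  have hn1 : ‖C.repL (spinLift (L.transition L' x)) v₀‖ = 1 := by
    rw [hTx, spinLift_one, map_one, one_apply_eq_self, hv₀]
  have hne : ∀ᶠ y in nhds x, |μ y| ≠ 0 := by
    filter_upwards [hnl.eventually_ne (by rw [hn1]; exact one_ne_zero), hUU] with y hy hyU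
    rwa [← hnorm y hyU]
  have hbs : ∀ᶠ y in nhds x, (b y : CliffordAlgebra (cliffForm d))
      = ‖C.repL (spinLift (L.transition L' y)) v₀‖⁻¹ • spinLift (L.transition L' y) := by
    filter_upwards [hne, hUU] with y hy hyU
    rw [hnorm y hyU, hbμ y hyU, smul_smul, inv_mul_cancel₀ hy, one_smul]
  have := IsModuleTopology.toContinuousSMul ℝ (CliffordAlgebra (cliffForm d))
  have hblim : Filter.Tendsto b (nhds x) (nhds 1) := by
    rw [tendsto_subtype_rng]
    refine Filter.Tendsto.congr' (Filter.EventuallyEq.symm hbs) ?_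
    have h1 := (hnl.inv₀ (by rw [hn1]; exact one_ne_zero)).smul hsl
    have h2 : Filter.Tendsto (fun y => ‖C.repL (spinLift (L.transition L' y)) v₀‖⁻¹ •
        spinLift (L.transition L' y)) (nhds x) (nhds (‖C.repL (spinLift (L.transition L' x)) v₀‖⁻¹ •
        spinLift (L.transition L' x))) := h1.tendsto
    rw [hn1, inv_one, one_smul, hTx, spinLift_one] at h2
    exact h2
  have hact : Filter.Tendsto (fun y => S.act (L.spin y) (b y)) (nhds x) (nhds (L.spin x)) := by
    have h1 := (L.spin_continuous.continuousAt (L.isOpen_U.mem_nhds hx)).tendsto.prodMk_nhds hblim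
    have h2 := (S.act_continuous.tendsto (L.spin x, 1)).comp h1
    rwa [S.act_one] at h2
  have hL' : Filter.Tendsto L'.spin (nhds x) (nhds (L.spin x)) := by
    rw [hs]
    exact L'.spin_continuous.continuousAt (L'.isOpen_U.mem_nhds hx')
  -- The translate of `L.spin` by `b` and the section `L'.spin` tend to the same spin frame at `x`
  -- and lie over the same tangent frames, so local injectivity of the covering identifies them near
  -- `x`.
  obtain ⟨O, hO, hinj⟩ := isLocallyInjective_iff_nhds.1
    S.covering.isLocalHomeomorph.isLocallyInjective (L.spin x)
  refine ⟨b, ?_⟩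
  filter_upwards [hact hO, hL' hO, hbs, hUU] with y h1 h2 h3 hy
  refine ⟨hy.1, hy.2, hinj h1 h2 (Subtype.ext ?_), hblift y hy, ?_⟩
  · refine frameMap_eq_iff.2 fun i => ?_
    rw [S.frame_act (hblift y hy), ← ha y hy,
      S.frame_act (L.isSpinLift_transition L' hy.1 hy.2 (ha y hy))]
  · rw [h3, map_smul]
    rfl

/-- The derivative at `x` of the change of spinor components between two local frames that agree
at `x`. -/
lemma dirDeriv_unitLift (hd : 0 < d) (C : SpinorModule d Δ) {L L' : LocalFrame S E}
    (hx : x ∈ L.U) (hx' : x ∈ L'.U) (hs : L.spin x = L'.spin x) {v₀ : Δ} (hv₀ : ‖v₀‖ = 1)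
    (V : ∀ x : M, TangentSpace I x) :
    ContMDiffAt I 𝓘(ℝ, Δ →L[ℂ] Δ) ∞ (fun y => C.unitLift v₀ (L.transition L' y)) x ∧
    SpinorModule.coeEnd Δ (dirDeriv I (fun y => C.unitLift v₀ (L.transition L' y)) V x)
      = C.bivector fun l j => dirDeriv I (fun y => L.transition L' y l j) V x := by
  have hUU : L.U ∩ L'.U ∈ nhds x := (L.isOpen_U.inter L'.isOpen_U).mem_nhds ⟨hx, hx'⟩
  have hTx := transition_of_spin_eq hx hx' hs
  have hTs : ∀ i j, ContMDiffAt I 𝓘(ℝ, ℝ) ∞ (fun y => L.transition L' y i j) x :=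
    fun i j => (L.contMDiffOn_transition L' i j).contMDiffAt hUU
  have hTd : ∀ i j, MDifferentiableAt I 𝓘(ℝ, ℝ) (fun y => L.transition L' y i j) x :=
    fun i j => (hTs i j).mdifferentiableAt (by simp)
  have hT : ContMDiffAt I 𝓘(ℝ, Fin d → Fin d → ℝ) ∞ (L.transition L') x :=
    contMDiffAt_pi_space.2 fun i => contMDiffAt_pi_space.2 fun j => hTs i j
  have hR : ContMDiffAt I 𝓘(ℝ, Δ →L[ℂ] Δ) ∞ (fun y => C.unitLift v₀ (L.transition L' y)) x := by
    have h1 := C.contDiffAt_unitLift hv₀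
    rw [← hTx] at h1
    exact h1.contMDiffAt.comp x hT
  refine ⟨hR, ?_⟩
  set R := fun y => C.unitLift v₀ (L.transition L' y) with hRdef
  have hRd : MDifferentiableAt I 𝓘(ℝ, Δ →L[ℂ] Δ) R x := hR.mdifferentiableAt (by simp)
  have hRx : R x = 1 := by rw [hRdef]; simp only [hTx]; exact C.unitLift_one hv₀
  set β := dirDeriv I R V x with hβ
  set Γ : Fin d → Fin d → ℝ := fun l j => dirDeriv I (fun y => L.transition L' y l j) V x with hΓ
  obtain ⟨b, hb⟩ := exists_spin_transition hd C hx hx' hs hv₀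
  -- The derivative of a family of orthogonal matrices at the identity is antisymmetric.
  have hΓanti : ∀ j l, Γ l j = -Γ j l := by
    intro j l
    have h1 : dirDeriv I (fun y => ∑ k, L.transition L' y k l • L.transition L' y k j) V x = 0 := by
      have : (fun y => ∑ k, L.transition L' y k l • L.transition L' y k j) =ᶠ[nhds x]
          fun _ => if l = j then (1 : ℝ) else 0 := by
        filter_upwards [hUU] with y hy
        exact L.transition_col_orthonormal L' hy.1 hy.2 l j
      rw [dirDeriv_congr this, dirDeriv_const]
    have h2 := dirDeriv_sum Finset.univ (V := V)
      (f := fun k y => L.transition L' y k l • L.transition L' y k j)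
      fun k _ => (hTd k l).smul (hTd k j)
    rw [h1] at h2
    simp only [dirDeriv_smul (hTd _ l) (hTd _ j), hTx] at h2
    simp only [smul_eq_mul, mul_ite, mul_one, mul_zero, ite_mul, one_mul, zero_mul,
      Finset.sum_add_distrib, Finset.sum_ite_eq', Finset.mem_univ, if_true] at h2
    simp only [hΓ]
    linarith
  -- Differentiate `R c_j = (∑ T_lj c_l) R` at `x`, where both `R` and the transition matrix are the
  -- identity.
  have hcomm : ∀ j, β * C.genL j = C.genL j * β + ∑ l, Γ l j • C.genL l := by
    intro j
    have e : (fun y => R y * C.genL j) =ᶠ[nhds x]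
        fun y => (∑ l, L.transition L' y l j • C.genL l) * R y := by
      filter_upwards [hb] with y hy
      obtain ⟨-, -, -, h1, h2⟩ := hy
      simp only [hRdef, ← h2]
      have := congrArg C.repL (h1 j)
      simpa [map_mul, map_sum, map_smul, SpinorModule.genL] using this
    have h1 := dirDeriv_clm (V := V) ((ContinuousLinearMap.mul ℝ (Δ →L[ℂ] Δ)).flip (C.genL j)) hRd
    simp only [ContinuousLinearMap.flip_apply, ContinuousLinearMap.mul_apply'] at h1
    have hgd : ∀ l, MDifferentiableAt I 𝓘(ℝ, Δ →L[ℂ] Δ)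
        (fun y => L.transition L' y l j • C.genL l) x :=
      fun l => (hTd l j).smul mdifferentiableAt_const
    have h2 := dirDeriv_bilin (V := V) (ContinuousLinearMap.mul ℝ (Δ →L[ℂ] Δ))
      (mdifferentiableAt_finset_sum Finset.univ fun l _ => hgd l) hRd
    simp only [ContinuousLinearMap.mul_apply'] at h2
    rw [dirDeriv_congr e, h2, hRx, mul_one, dirDeriv_sum _ fun l _ => hgd l] at h1
    simp only [dirDeriv_smul (hTd _ j) mdifferentiableAt_const, dirDeriv_const, smul_zero,
      add_zero, hTx, sum_ite_smul] at h1
    rw [← h1, add_comm]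
  -- Differentiate the fact that `R` preserves the hermitian product.
  have hskew : ∀ u v, inner ℂ (β u) v = -inner ℂ u (β v) := by
    intro u v
    have e : (fun y => inner ℂ (R y u) (R y v)) =ᶠ[nhds x] fun _ => inner ℂ u v := by
      filter_upwards [hb] with y hy
      obtain ⟨-, -, -, -, h2⟩ := hy
      simp only [hRdef, ← h2, C.repL_apply, C.inner_rep_spin]
    have ev : ∀ w : Δ, HasFDerivAt (𝕜 := ℝ) (fun T : Δ →L[ℂ] Δ => T w)
        ((ContinuousLinearMap.apply ℂ Δ w).restrictScalars ℝ) (R x) := fun w =>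
      ((ContinuousLinearMap.apply ℂ Δ w).restrictScalars ℝ).hasFDerivAt
    have h1 := dirDeriv_comp (V := V) (φ := fun T : Δ →L[ℂ] Δ => inner ℂ (T u) (T v)) hRd
      ((ev u).differentiableAt.inner ℂ (ev v).differentiableAt)
    rw [dirDeriv_congr e, dirDeriv_const,
      fderiv_inner_apply ℂ (ev u).differentiableAt (ev v).differentiableAt, (ev u).fderiv,
      (ev v).fderiv, hRx] at h1
    have h2 : (0 : ℂ) = inner ℂ u (β v) + inner ℂ (β u) v := h1
    linear_combination -h2
  -- `R y` represents an even element, so its average is a real multiple of `1`. With `φ` reading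
  -- off the multiple as `Re ⟨v₀, T v₀⟩`, this becomes the linear condition `Ψ (R y) = 0`, which
  -- passes to the derivative.
  have havg : ∃ r : ℝ, cliffAvg C.gen C.gen (List.finRange d) (SpinorModule.coeEnd Δ β)
      = r • 1 := by
    obtain ⟨K, hK⟩ := exists_clm_cliffAvg C.genL C.genL (List.finRange d)
    let φ : (Δ →L[ℂ] Δ) →L[ℝ] ℝ := Complex.reCLM.comp
      (((innerSL ℂ v₀).restrictScalars ℝ).comp ((ContinuousLinearMap.apply ℂ Δ v₀).restrictScalars ℝ))
    have hφ1 : φ 1 = 1 := by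
      have : inner ℂ v₀ v₀ = (1 : ℂ) := by
        rw [inner_self_eq_norm_sq_to_K, hv₀]; norm_num
      change (inner ℂ v₀ v₀).re = 1
      rw [this, Complex.one_re]
    let Ψ : (Δ →L[ℂ] Δ) →L[ℝ] (Δ →L[ℂ] Δ) := K - (φ.comp K).smulRight 1
    have hΨ : (fun y => Ψ (R y)) =ᶠ[nhds x] fun _ => 0 := by
      filter_upwards [hb] with y hy
      obtain ⟨-, -, -, -, h2⟩ := hy
      obtain ⟨r, hr⟩ := cliffAvg_even (spinGroup.mem_even (b y).2)
      have h3 := congrArg C.repL hr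
      rw [map_cliffAvg, show (fun i => C.repL (cliffE i)) = C.genL from rfl, hK, h2,
        AlgHom.commutes, Algebra.algebraMap_eq_smul_one] at h3
      change K (R y) - φ (K (R y)) • 1 = 0
      rw [h3, map_smul, hφ1, smul_eq_mul, mul_one, sub_self]
    have h1 := dirDeriv_clm (V := V) Ψ hRd
    rw [dirDeriv_congr hΨ, dirDeriv_const] at h1
    have h2 : K β = φ (K β) • 1 := sub_eq_zero.1 h1.symm
    refine ⟨φ (K β), ?_⟩
    have h3 := map_cliffAvg (SpinorModule.coeEnd Δ) C.genL C.genL (List.finRange d) β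
    simp only [C.coeEnd_genL] at h3
    rw [← h3, hK, h2, map_smul, map_one, map_smul, hφ1, smul_eq_mul, mul_one]
  -- `β` and the bivector have the same commutators with the generators. Their difference is
  -- central, skew and has a scalar average, hence is zero.
  rw [← sub_eq_zero]
  refine C.eq_zero_of_commute_of_skew _ ?_ ?_ ?_
  · intro j
    have h1 := congrArg (SpinorModule.coeEnd Δ) (hcomm j)
    simp only [map_mul, map_add, map_sum, map_smul, C.coeEnd_genL] at h1
    have h2 := C.bivector_commutator hΓanti j
    rw [sub_mul, mul_sub, h1, ← h2]
    abel
  · intro u v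
    rw [LinearMap.sub_apply, LinearMap.sub_apply, inner_sub_left, inner_sub_right,
      C.inner_bivector hΓanti]
    have := hskew u v
    rw [SpinorModule.coeEnd_apply, SpinorModule.coeEnd_apply, this]
    ring
  · obtain ⟨r, hr⟩ := havg
    obtain ⟨a, ha, hab⟩ := C.bivector_mem_even Γ
    obtain ⟨r', hr'⟩ := C.cliffAvg_rep_even ha
    refine ⟨r - r', ?_⟩
    rw [sub_eq_add_neg, ← neg_one_smul ℝ (C.bivector Γ), cliffAvg_add, cliffAvg_smul, hr, ← hab,
      hr', sub_smul]
    simp [sub_eq_add_neg]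

end LocalFrame

end Frames

/-! ### Sums over rotated bases -/

section Rotation

variable {d : ℕ} {A : Fin d → Fin d → ℝ}

lemma row_orthonormal (hA : ∀ i j, ∑ k, A k i * A k j = if i = j then 1 else 0) (p q : Fin d) :
    ∑ i, A p i * A q i = if p = q then 1 else 0 := by
  have h1 : (Matrix.of A).transpose * Matrix.of A = 1 := by
    ext i j
    rw [Matrix.mul_apply, Matrix.one_apply, ← hA i j]
    rfl
  have h2 := congrArg (fun B : Matrix (Fin d) (Fin d) ℝ => B p q) (mul_eq_one_comm.1 h1)
  simp only [Matrix.mul_apply, Matrix.one_apply] at h2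
  exact h2

/-- A contraction over an orthonormal basis does not depend on the basis; orthonormality of the rows
of `A` collapses the double sum. -/
lemma sum_rotate {W : Type*} [AddCommGroup W] [Module ℝ W]
    (hA : ∀ i j, ∑ k, A k i * A k j = if i = j then 1 else 0) (f : Fin d → ℝ) (c : Fin d → W) :
    ∑ l, (∑ r, A r l * f r) • (∑ s, A s l • c s) = ∑ l, f l • c l := by
  have h : ∀ l, (∑ r, A r l * f r) • (∑ s, A s l • c s)
      = ∑ r, ∑ s, (A r l * A s l) • f r • c s := by
    intro l
    rw [Finset.sum_smul]
    refine Finset.sum_congr rfl fun r _ => ?_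
    rw [Finset.smul_sum]
    refine Finset.sum_congr rfl fun s _ => ?_
    simp only [smul_smul]
    ring_nf
  simp only [h]
  rw [Finset.sum_comm]
  refine Finset.sum_congr rfl fun r _ => ?_
  rw [Finset.sum_comm]
  simp only [← Finset.sum_smul, row_orthonormal hA]
  simp

lemma sum_rotate_tensor {W : Type*} [AddCommGroup W] [Module ℂ W] {k : ℕ}
    (hA : ∀ i j, ∑ k, A k i * A k j = if i = j then 1 else 0) (f : (Fin k → Fin d) → ℂ)
    (c : (Fin k → Fin d) → W) :
    ∑ i : Fin k → Fin d, (∑ p : Fin k → Fin d, (∏ j, A (p j) (i j)) • f p)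
        • (∑ q : Fin k → Fin d, (∏ j, A (q j) (i j)) • c q)
      = ∑ p, f p • c p := by
  have h : ∀ i : Fin k → Fin d, (∑ p : Fin k → Fin d, (∏ j, A (p j) (i j)) • f p)
        • (∑ q : Fin k → Fin d, (∏ j, A (q j) (i j)) • c q)
      = ∑ p : Fin k → Fin d, ∑ q : Fin k → Fin d,
        (∏ j, A (p j) (i j) * A (q j) (i j)) • f p • c q := by
    intro i
    rw [Finset.sum_smul]
    refine Finset.sum_congr rfl fun p _ => ?_
    rw [Finset.smul_sum]
    refine Finset.sum_congr rfl fun q _ => ?_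
    rw [Finset.prod_mul_distrib, mul_smul, smul_assoc, smul_comm (f p)]
  simp only [h]
  rw [Finset.sum_comm]
  refine Finset.sum_congr rfl fun p _ => ?_
  rw [Finset.sum_comm]
  have h2 : ∀ q : Fin k → Fin d, ∑ i : Fin k → Fin d, (∏ j, A (p j) (i j) * A (q j) (i j))
      = if p = q then 1 else 0 := by
    intro q
    have := Finset.prod_univ_sum (fun _ : Fin k => (Finset.univ : Finset (Fin d)))
      (fun j i => A (p j) i * A (q j) i)
    rw [Fintype.piFinset_univ] at this
    rw [← this]
    simp only [row_orthonormal hA, Finset.prod_ite_zero, Finset.prod_const_one, Finset.mem_univ,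
      true_implies, funext_iff]
  simp only [← Finset.sum_smul, h2]
  simp

end Rotation

/-! ### Zeroth-order terms under changes of frame -/

section Frames

variable {d : ℕ} {H : Type*} [TopologicalSpace H]
  {I : ModelWithCorners ℝ (EuclideanSpace ℝ (Fin d)) H}
  {M : Type*} [TopologicalSpace M] [ChartedSpace H M] [IsManifold I ∞ M]
  {g : RiemMetric I M} {x : M}
  {Q : Type*} [TopologicalSpace Q] {N : ℕ} {P : Type*}
  [TopologicalSpace P] {S : SpinStructure g Q} {E : FlatHermitianBundle M N P}
  {Δ : Type*} [NormedAddCommGroup Δ] [InnerProductSpace ℂ Δ]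

/-- The terms of order zero of the twisted Dirac operator in the frame `e`. -/
def diracZeroth (g : RiemMetric I M) (C : SpinorModule d Δ) (η : MixedForm I M)
    (e : Fin d → ∀ x : M, TangentSpace I x) (x : M) : Module.End ℂ Δ :=
  ∑ i, C.gen i * C.bivector (fun l j => leviCivitaCoeff g e x i j l) + cliffMul C η e x

lemma IsSmoothSection.contMDiffAt {C : SpinorModule d Δ} {W : Set M} {ψ : SpinorField Q P Δ N}
    (hψ : IsSmoothSection S E C W ψ) (hW : IsOpen W) (hxW : x ∈ W) (L : LocalFrame S E)
    (hx : x ∈ L.U) :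
    ContMDiffAt I 𝓘(ℝ, Fin N → Δ) ∞ (fun y => ψ (L.spin y) (L.flat y)) x :=
  (hψ.smooth L).contMDiffAt ((L.isOpen_U.inter hW).mem_nhds ⟨hx, hxW⟩)

lemma IsSmoothSection.contMDiffAt_apply {C : SpinorModule d Δ} {W : Set M}
    {ψ : SpinorField Q P Δ N} (hψ : IsSmoothSection S E C W ψ) (hW : IsOpen W) (hxW : x ∈ W)
    (L : LocalFrame S E) (hx : x ∈ L.U) (b : Fin N) :
    ContMDiffAt I 𝓘(ℝ, Δ) ∞ (fun y => ψ (L.spin y) (L.flat y) b) x :=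
  contMDiffAt_pi_space.1 (hψ.contMDiffAt hW hxW L hx) b

lemma IsSmoothSection.mdifferentiableAt_apply {C : SpinorModule d Δ} {W : Set M}
    {ψ : SpinorField Q P Δ N} (hψ : IsSmoothSection S E C W ψ) (hW : IsOpen W) (hxW : x ∈ W)
    (L : LocalFrame S E) (hx : x ∈ L.U) (b : Fin N) :
    MDifferentiableAt I 𝓘(ℝ, Δ) (fun y => ψ (L.spin y) (L.flat y) b) x :=
  (hψ.contMDiffAt_apply hW hxW L hx b).mdifferentiableAt (by simp)

lemma twistedDiracInFrame_apply {C : SpinorModule d Δ} {W : Set M} {ψ : SpinorField Q P Δ N}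
    (hψ : IsSmoothSection S E C W ψ) (hW : IsOpen W) (hxW : x ∈ W) (η : MixedForm I M)
    (L : LocalFrame S E) (hx : x ∈ L.U) (b : Fin N) :
    twistedDiracInFrame S E C η L ψ x b
      = ∑ i, C.gen i (dirDeriv I (fun y => ψ (L.spin y) (L.flat y) b) (L.vec i) x)
        + diracZeroth g C η L.vec x (ψ (L.spin x) (L.flat x) b) := by
  have h1 : ∀ i, dirDeriv I (fun y => ψ (L.spin y) (L.flat y) b) (L.vec i) x
      = dirDeriv I (fun y => ψ (L.spin y) (L.flat y)) (L.vec i) x b := fun i =>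
    dirDeriv_clm (ContinuousLinearMap.proj (R := ℝ) b)
      ((hψ.contMDiffAt hW hxW L hx).mdifferentiableAt (by simp))
  simp only [h1]
  simp only [twistedDiracInFrame, covDeriv, diracZeroth, LinearMap.add_apply,
    LinearMap.sum_apply, Module.End.mul_apply, map_add, Finset.sum_add_distrib,
    SpinorModule.bivector, LinearMap.smul_apply, dirDeriv]
  rw [add_assoc]

namespace LocalFrame

/-- Leibniz rule for the frame `∑ T_ki e_k`. It is used in two opposite cases: `T` constant, where
the derivative terms vanish, and `T = 1` at `x`, where they are the only change. -/
lemma inner_mlieBracket (L L' : LocalFrame S E) (hx : x ∈ L.U) (hx' : x ∈ L'.U) (i j l : Fin d) :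
    g.inner x (VectorField.mlieBracket I (L'.vec i) (L'.vec j) x) (L'.vec l x)
      = ∑ r, L.transition L' x r l *
        (∑ p, ∑ q, L.transition L' x p i * L.transition L' x q j *
          g.inner x (VectorField.mlieBracket I (L.vec p) (L.vec q) x) (L.vec r x)
        + ∑ p, L.transition L' x p i * dirDeriv I (fun y => L.transition L' y r j) (L.vec p) x
        - ∑ q, L.transition L' x q j * dirDeriv I (fun y => L.transition L' y r i) (L.vec q) x) := by
  have hUU : L.U ∩ L'.U ∈ nhds x := (L.isOpen_U.inter L'.isOpen_U).mem_nhds ⟨hx, hx'⟩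
  have e : ∀ i, L'.vec i =ᶠ[nhds x] fun y => ∑ k, L.transition L' y k i • L.vec k y := by
    intro i
    filter_upwards [hUU] with y hy
    exact L.vec_eq_sum L' hy.1 i
  have h1 := ((e i).mlieBracket_vectorField_eq (e j)).trans
    (mlieBracket_sum_smul (L.isOpen_U.inter L'.isOpen_U) ⟨hx, hx'⟩
      (fun k => L.contMDiffOn_transition L' k i) (fun k => L.contMDiffOn_transition L' k j)
      (fun k => (L.vec_smooth k).mono inter_subset_left)
      (fun k => (L.vec_smooth k).mono inter_subset_left))
  rw [h1, L.vec_eq_sum L' hx l, map_sum]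
  refine Finset.sum_congr rfl fun r _ => ?_
  rw [map_smul, smul_eq_mul]
  simp only [map_add, map_sub, map_sum, map_smul, add_apply, sub_apply, sum_apply, smul_apply,
    smul_eq_mul, L.inner_vec hx]
  simp

/-- Change of the Levi-Civita coefficients between local frames that agree at `x`. -/
lemma leviCivitaCoeff_of_spin_eq {L L' : LocalFrame S E} (hx : x ∈ L.U) (hx' : x ∈ L'.U)
    (hs : L.spin x = L'.spin x) (i j l : Fin d) :
    leviCivitaCoeff g L'.vec x i j l = leviCivitaCoeff g L.vec x i j l
      + dirDeriv I (fun y => L.transition L' y l j) (L.vec i) x := by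
  have hUU : L.U ∩ L'.U ∈ nhds x := (L.isOpen_U.inter L'.isOpen_U).mem_nhds ⟨hx, hx'⟩
  have hTx := transition_of_spin_eq hx hx' hs
  have hTd : ∀ i j, MDifferentiableAt I 𝓘(ℝ, ℝ) (fun y => L.transition L' y i j) x :=
    fun i j => ((L.contMDiffOn_transition L' i j).contMDiffAt hUU).mdifferentiableAt (by simp)
  have hanti : ∀ (V : ∀ x : M, TangentSpace I x) (j l : Fin d),
      dirDeriv I (fun y => L.transition L' y l j) V x
        = -dirDeriv I (fun y => L.transition L' y j l) V x := by
    intro V j l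
    have h1 : dirDeriv I (fun y => ∑ k, L.transition L' y k l • L.transition L' y k j) V x = 0 := by
      have : (fun y => ∑ k, L.transition L' y k l • L.transition L' y k j) =ᶠ[nhds x]
          fun _ => if l = j then (1 : ℝ) else 0 := by
        filter_upwards [hUU] with y hy
        exact L.transition_col_orthonormal L' hy.1 hy.2 l j
      rw [dirDeriv_congr this, dirDeriv_const]
    have h2 := dirDeriv_sum Finset.univ (V := V)
      (f := fun k y => L.transition L' y k l • L.transition L' y k j)
      fun k _ => (hTd k l).smul (hTd k j)
    rw [h1] at h2
    simp only [dirDeriv_smul (hTd _ l) (hTd _ j), hTx] at h2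
    simp only [smul_eq_mul, mul_ite, mul_one, mul_zero, ite_mul, one_mul, zero_mul,
      Finset.sum_add_distrib, Finset.sum_ite_eq', Finset.mem_univ, if_true] at h2
    linarith
  have hb : ∀ i j l, g.inner x (VectorField.mlieBracket I (L'.vec i) (L'.vec j) x) (L'.vec l x)
      = g.inner x (VectorField.mlieBracket I (L.vec i) (L.vec j) x) (L.vec l x)
        + dirDeriv I (fun y => L.transition L' y l j) (L.vec i) x
        - dirDeriv I (fun y => L.transition L' y l i) (L.vec j) x := by
    intro i j l
    rw [L.inner_mlieBracket L' hx hx', hTx]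
    simp
  simp only [leviCivitaCoeff, hb]
  -- Six derivatives of the transition matrix enter the Koszul formula; by antisymmetry four cancel
  -- in pairs and the other two coincide, which absorbs the factor `1/2`.
  rw [hanti (L.vec j) l i, hanti (L.vec l) i j, hanti (L.vec i) j l]
  ring

/-- The matrix of the rotation by which `translate` changes the frame. -/
def transMatrix (a : SpinGrp d) : Fin d → Fin d → ℝ := (exists_isSpinLift a).choose

lemma isSpinLift_transMatrix (a : SpinGrp d) : IsSpinLift a (transMatrix a) :=
  (exists_isSpinLift a).choose_spec

lemma transition_translate (L : LocalFrame S E) (a : SpinGrp d)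
    (u : Matrix.unitaryGroup (Fin N) ℂ) (hx : x ∈ L.U) :
    L.transition (L.translate a u) x = transMatrix a := by
  funext j i
  change g.inner x (L.vec j x) (∑ k, transMatrix a k i • L.vec k x) = _
  simp [map_sum, L.inner_vec hx]

lemma transMatrix_orthonormal (L : LocalFrame S E) (hx : x ∈ L.U) (a : SpinGrp d) (i j : Fin d) :
    ∑ k, transMatrix a k i * transMatrix a k j = if i = j then 1 else 0 := by
  have := L.transition_col_orthonormal (L.translate a 1) hx hx i j
  rwa [L.transition_translate a 1 hx] at this

/-- A constant rotation produces no derivative terms, so the coefficients transform as a tensor.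
`h2` and `h3` only rename indices, so that the three Koszul terms share one summation. -/
lemma leviCivitaCoeff_translate (L : LocalFrame S E) (a : SpinGrp d)
    (u : Matrix.unitaryGroup (Fin N) ℂ) (hx : x ∈ L.U) (i j l : Fin d) :
    leviCivitaCoeff g (L.translate a u).vec x i j l
      = ∑ r, transMatrix a r l * ∑ q, transMatrix a q j * ∑ p, transMatrix a p i *
        leviCivitaCoeff g L.vec x p q r := by
  have hc : ∀ r j V, dirDeriv I (fun y => L.transition (L.translate a u) y r j) V x = 0 := by
    intro r j V
    have : (fun y => L.transition (L.translate a u) y r j) =ᶠ[nhds x]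
        fun _ => transMatrix a r j := by
      filter_upwards [L.isOpen_U.mem_nhds hx] with y hy
      rw [L.transition_translate a u hy]
    rw [dirDeriv_congr this, dirDeriv_const]
  have hb : ∀ i j l, g.inner x (VectorField.mlieBracket I ((L.translate a u).vec i)
        ((L.translate a u).vec j) x) ((L.translate a u).vec l x)
      = ∑ r, ∑ q, ∑ p, transMatrix a r l * transMatrix a q j * transMatrix a p i *
        g.inner x (VectorField.mlieBracket I (L.vec p) (L.vec q) x) (L.vec r x) := by
    intro i j l
    rw [L.inner_mlieBracket (L.translate a u) hx hx, L.transition_translate a u hx]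
    simp only [hc, mul_zero, Finset.sum_const_zero, add_zero, sub_zero, Finset.mul_sum]
    refine Finset.sum_congr rfl fun r _ => ?_
    rw [Finset.sum_comm]
    refine Finset.sum_congr rfl fun q _ => Finset.sum_congr rfl fun p _ => ?_
    ring
  simp only [leviCivitaCoeff, hb]
  have h2 : ∑ r, ∑ q, ∑ p, transMatrix a r i * transMatrix a q l * transMatrix a p j *
        g.inner x (VectorField.mlieBracket I (L.vec p) (L.vec q) x) (L.vec r x)
      = ∑ r, ∑ q, ∑ p, transMatrix a r l * transMatrix a q j * transMatrix a p i *
        g.inner x (VectorField.mlieBracket I (L.vec q) (L.vec r) x) (L.vec p x) := by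
    rw [Finset.sum_comm]
    refine Finset.sum_congr rfl fun r _ => ?_
    rw [Finset.sum_comm]
    refine Finset.sum_congr rfl fun q _ => Finset.sum_congr rfl fun p _ => ?_
    ring
  have h3 : ∑ r, ∑ q, ∑ p, transMatrix a r j * transMatrix a q i * transMatrix a p l *
        g.inner x (VectorField.mlieBracket I (L.vec p) (L.vec q) x) (L.vec r x)
      = ∑ r, ∑ q, ∑ p, transMatrix a r l * transMatrix a q j * transMatrix a p i *
        g.inner x (VectorField.mlieBracket I (L.vec r) (L.vec p) x) (L.vec q x) := by
    refine (Finset.sum_congr rfl fun r _ => Finset.sum_comm).trans (Finset.sum_comm.trans ?_)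
    refine Finset.sum_congr rfl fun r _ => Finset.sum_congr rfl fun q _ =>
      Finset.sum_congr rfl fun p _ => ?_
    ring
  rw [h2, h3]
  simp only [Finset.mul_sum, ← Finset.sum_sub_distrib, ← Finset.sum_add_distrib, Finset.sum_div]
  refine Finset.sum_congr rfl fun r _ => Finset.sum_congr rfl fun q _ =>
    Finset.sum_congr rfl fun p _ => ?_
  ring

end LocalFrame

lemma rep_mul_gen {C : SpinorModule d Δ} {a : SpinGrp d} {A : Fin d → Fin d → ℝ}
    (h : IsSpinLift a A) (i : Fin d) :
    C.rep (a : CliffordAlgebra (cliffForm d)) * C.gen i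
      = (∑ j, A j i • C.gen j) * C.rep (a : CliffordAlgebra (cliffForm d)) := by
  have := congrArg C.rep (h i)
  simpa [map_mul, map_sum, map_smul, C.rep_cliffE] using this

lemma rep_mul_ofFn_prod {C : SpinorModule d Δ} {a : SpinGrp d} {A : Fin d → Fin d → ℝ}
    (h : IsSpinLift a A) {k : ℕ} (i : Fin k → Fin d) :
    C.rep (a : CliffordAlgebra (cliffForm d)) * (List.ofFn fun j => C.gen (i j)).prod
      = (List.ofFn fun j => ∑ p, A p (i j) • C.gen p).prod
        * C.rep (a : CliffordAlgebra (cliffForm d)) := by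
  induction k with
  | zero => simp
  | succ k ih =>
    rw [List.ofFn_succ, List.prod_cons, List.ofFn_succ, List.prod_cons, ← mul_assoc,
      rep_mul_gen h, mul_assoc, ih fun j => i j.succ, mul_assoc]

lemma ofFn_prod_sum {B : Type*} [Ring B] [Algebra ℝ B] (A : Fin d → Fin d → ℝ) (c : Fin d → B)
    {k : ℕ} (i : Fin k → Fin d) :
    (List.ofFn fun j => ∑ p, A p (i j) • c p).prod
      = ∑ q : Fin k → Fin d, (∏ j, A (q j) (i j)) • (List.ofFn fun j => c (q j)).prod := by
  have h := (MultilinearMap.mkPiAlgebraFin ℝ k B).map_sum (fun j p => A p (i j) • c p)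
  simp only [MultilinearMap.map_smul_univ, MultilinearMap.mkPiAlgebraFin_apply] at h
  exact h

/-- The spin element rotates each generator by the same matrix that rotates each argument of `η`,
and the contraction over orthonormal multi-indices is invariant. -/
lemma cliffMul_translate (C : SpinorModule d Δ) (η : MixedForm I M) (L : LocalFrame S E)
    (a : SpinGrp d) (u : Matrix.unitaryGroup (Fin N) ℂ) (hx : x ∈ L.U) :
    C.rep (a : CliffordAlgebra (cliffForm d)) * cliffMul C η (L.translate a u).vec x
      = cliffMul C η L.vec x * C.rep (a : CliffordAlgebra (cliffForm d)) := by
  simp only [cliffMul, Finset.mul_sum, Finset.sum_mul, mul_smul_comm, smul_mul_assoc]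
  refine Finset.sum_congr rfl fun k _ => ?_
  congr 1
  simp only [rep_mul_ofFn_prod (LocalFrame.isSpinLift_transMatrix a), ofFn_prod_sum]
  refine Eq.trans ?_ (sum_rotate_tensor (L.transMatrix_orthonormal hx a)
    (fun p => η k x fun j => L.vec (p j) x)
    (fun p => (List.ofFn fun j => C.gen (p j)).prod * C.rep (a : CliffordAlgebra (cliffForm d))))
  refine Finset.sum_congr rfl fun i _ => ?_
  have h := (η k x).toMultilinearMap.map_sum (fun j p => LocalFrame.transMatrix a p (i j) • L.vec p x)
  simp only [MultilinearMap.map_smul_univ] at h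
  rw [Finset.sum_mul]
  simp only [smul_mul_assoc]
  exact congrArg (· • _) h

/-- The connection term is a contraction in three indices, which are rotated back one at a time in
`s1`, `s2`, `s3`. -/
lemma diracZeroth_translate (C : SpinorModule d Δ) (η : MixedForm I M) (L : LocalFrame S E)
    (a : SpinGrp d) (u : Matrix.unitaryGroup (Fin N) ℂ) (hx : x ∈ L.U) :
    C.rep (a : CliffordAlgebra (cliffForm d)) * diracZeroth g C η (L.translate a u).vec x
      = diracZeroth g C η L.vec x * C.rep (a : CliffordAlgebra (cliffForm d)) := by
  have hA := L.transMatrix_orthonormal hx a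
  have hR := rep_mul_gen (C := C) (LocalFrame.isSpinLift_transMatrix a)
  set A := LocalFrame.transMatrix a with hAdef
  set R := C.rep (a : CliffordAlgebra (cliffForm d)) with hRdef
  rw [diracZeroth, diracZeroth, mul_add, add_mul, cliffMul_translate C η L a u hx]
  congr 1
  set om := leviCivitaCoeff g L.vec x with hom
  set c' : Fin d → Module.End ℂ Δ := fun i => ∑ j, A j i • C.gen j with hc'
  have e0 : ∀ i j l, R * (C.gen i * (C.gen j * C.gen l)) = c' i * (c' j * c' l) * R := by
    intro i j l
    rw [← mul_assoc, hR, mul_assoc, ← mul_assoc R, hR, mul_assoc (∑ j', _), hR]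
    simp only [hc', mul_assoc]
  simp only [SpinorModule.bivector, mul_smul_comm, smul_mul_assoc, Finset.mul_sum, Finset.sum_mul,
    ← Finset.smul_sum, e0]
  congr 1
  simp only [← smul_mul_assoc, ← Finset.sum_mul]
  congr 1
  simp only [L.leviCivitaCoeff_translate a u hx]
  have s1 : ∀ i j, ∑ l, (∑ r, A r l * ∑ q, A q j * ∑ p, A p i * om p q r) • (c' i * (c' j * c' l))
      = ∑ l, (∑ q, A q j * ∑ p, A p i * om p q l) • (c' i * (c' j * C.gen l)) := by
    intro i j
    refine Eq.trans ?_ (sum_rotate hA (fun r => ∑ q, A q j * ∑ p, A p i * om p q r)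
      (fun s => c' i * (c' j * C.gen s)))
    refine Finset.sum_congr rfl fun l _ => congrArg _ ?_
    rw [show c' l = ∑ s, A s l • C.gen s from rfl]
    simp only [Finset.mul_sum, mul_smul_comm]
  have s2 : ∀ i l, ∑ j, (∑ q, A q j * ∑ p, A p i * om p q l) • (c' i * (c' j * C.gen l))
      = ∑ j, (∑ p, A p i * om p j l) • (c' i * (C.gen j * C.gen l)) := by
    intro i l
    refine Eq.trans ?_ (sum_rotate hA (fun q => ∑ p, A p i * om p q l)
      (fun s => c' i * (C.gen s * C.gen l)))
    refine Finset.sum_congr rfl fun j _ => congrArg _ ?_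
    rw [show c' j = ∑ s, A s j • C.gen s from rfl]
    simp only [Finset.mul_sum, Finset.sum_mul, mul_smul_comm, smul_mul_assoc]
  have s3 : ∀ j l, ∑ i, (∑ p, A p i * om p j l) • (c' i * (C.gen j * C.gen l))
      = ∑ i, om i j l • (C.gen i * (C.gen j * C.gen l)) := by
    intro j l
    refine Eq.trans ?_ (sum_rotate hA (fun p => om p j l)
      (fun s => C.gen s * (C.gen j * C.gen l)))
    refine Finset.sum_congr rfl fun i _ => congrArg _ ?_
    rw [show c' i = ∑ s, A s i • C.gen s from rfl]
    simp only [Finset.sum_mul, smul_mul_assoc]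
  calc ∑ i, ∑ j, ∑ l, (∑ r, A r l * ∑ q, A q j * ∑ p, A p i * om p q r) • (c' i * (c' j * c' l))
      = ∑ i, ∑ l, ∑ j, (∑ q, A q j * ∑ p, A p i * om p q l) • (c' i * (c' j * C.gen l)) := by
        simp only [s1]
        exact Finset.sum_congr rfl fun i _ => Finset.sum_comm
    _ = ∑ j, ∑ l, ∑ i, (∑ p, A p i * om p j l) • (c' i * (C.gen j * C.gen l)) := by
        simp only [s2]
        rw [Finset.sum_comm]
        simp only [Finset.sum_comm (s := (Finset.univ : Finset (Fin d))) (t := Finset.univ)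
          (f := fun i j => (∑ p, A p i * om p j _) • (c' i * (C.gen j * C.gen _)))]
        rw [Finset.sum_comm]
    _ = ∑ i, ∑ j, ∑ l, om i j l • (C.gen i * (C.gen j * C.gen l)) := by
        simp only [s3]
        have : ∀ j, ∑ l, ∑ i, om i j l • (C.gen i * (C.gen j * C.gen l))
            = ∑ i, ∑ l, om i j l • (C.gen i * (C.gen j * C.gen l)) := fun j => Finset.sum_comm
        simp only [this]
        rw [Finset.sum_comm]

end Frames

/-! ### The twisted Dirac operator does not depend on the local frame -/

section Frames

variable {d : ℕ} {H : Type*} [TopologicalSpace H]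
  {I : ModelWithCorners ℝ (EuclideanSpace ℝ (Fin d)) H}
  {M : Type*} [TopologicalSpace M] [ChartedSpace H M] [IsManifold I ∞ M]
  {g : RiemMetric I M} {x : M}
  {Q : Type*} [TopologicalSpace Q] {N : ℕ} {P : Type*}
  [TopologicalSpace P] {S : SpinStructure g Q} {E : FlatHermitianBundle M N P}
  {Δ : Type*} [NormedAddCommGroup Δ] [InnerProductSpace ℂ Δ]
  {C : SpinorModule d Δ} {W : Set M} {ψ : SpinorField Q P Δ N}

lemma IsSmoothSection.equivariant_spin (hψ : IsSmoothSection S E C W ψ) {q q' : Q} {f f' : P}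
    {a : SpinGrp d} (h : S.proj q = E.proj f) (hW : S.proj q ∈ W) (ha : S.act q a = q')
    (hf : f = f') (b : Fin N) :
    ψ q f b = C.rep (a : CliffordAlgebra (cliffForm d)) (ψ q' f' b) := by
  have := hψ.equivariant q f h hW a 1 b
  rw [E.act_one, ha, hf] at this
  rw [hf, this]
  simp [Matrix.one_apply, ite_smul]

lemma cliffMul_congr (C : SpinorModule d Δ) (η : MixedForm I M)
    {e e' : Fin d → ∀ x : M, TangentSpace I x} (h : ∀ i, e i x = e' i x) :
    cliffMul C η e x = cliffMul C η e' x := by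
  simp only [cliffMul, h]

/-- A continuous linear map over `ℂ` acts on vectors, as a real bilinear map. -/
def evalL (Δ : Type*) [NormedAddCommGroup Δ] [InnerProductSpace ℂ Δ] :
    (Δ →L[ℂ] Δ) →L[ℝ] Δ →L[ℝ] Δ := ContinuousLinearMap.restrictScalarsL ℂ Δ Δ ℝ ℝ

lemma evalL_apply (T : Δ →L[ℂ] Δ) (v : Δ) : evalL Δ T v = T v := rfl

/-- The frames agree at `x` but their derivatives differ. The bivector of the derivative of the
transition matrix appears for `L` in the derivative of the components and for `L'` in the
Levi-Civita coefficients, so the totals agree. -/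
lemma twistedDiracInFrame_of_spin_eq (hd : 0 < d) (hψ : IsSmoothSection S E C W ψ) (hW : IsOpen W)
    (hxW : x ∈ W) (η : MixedForm I M) {L L' : LocalFrame S E} (hx : x ∈ L.U) (hx' : x ∈ L'.U)
    (hs : L.spin x = L'.spin x) (hf : L.flat x = L'.flat x) :
    twistedDiracInFrame S E C η L ψ x = twistedDiracInFrame S E C η L' ψ x := by
  obtain ⟨v₀, hv₀⟩ := C.exists_norm_one
  obtain ⟨β, hβ⟩ := LocalFrame.exists_spin_transition hd C hx hx' hs hv₀
  funext b
  rw [twistedDiracInFrame_apply hψ hW hxW η L hx b, twistedDiracInFrame_apply hψ hW hxW η L' hx' b]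
  have hvec := LocalFrame.vec_eq_of_spin_eq hx hx' hs
  have hcomp : (fun y => ψ (L.spin y) (L.flat y) b) =ᶠ[nhds x]
      fun y => evalL Δ (C.unitLift v₀ (L.transition L' y)) (ψ (L'.spin y) (L'.flat y) b) := by
    filter_upwards [hβ, L.flat_eventuallyEq L' hx hx' hf, hW.mem_nhds hxW] with y hy hfy hyW
    obtain ⟨h1, h2, h3, -, h4⟩ := hy
    rw [hψ.equivariant_spin (L.proj_spin_eq_proj_flat h1) (by rwa [L.spin_proj y h1]) h3 hfy b,
      evalL_apply, ← h4, C.repL_apply]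
  have hder : ∀ i, dirDeriv I (fun y => ψ (L.spin y) (L.flat y) b) (L.vec i) x
      = C.bivector (fun l j => dirDeriv I (fun y => L.transition L' y l j) (L.vec i) x)
          (ψ (L'.spin x) (L'.flat x) b)
        + dirDeriv I (fun y => ψ (L'.spin y) (L'.flat y) b) (L'.vec i) x := by
    intro i
    obtain ⟨h1, h2⟩ := LocalFrame.dirDeriv_unitLift hd C hx hx' hs hv₀ (L.vec i)
    rw [dirDeriv_congr hcomp, dirDeriv_bilin _ (h1.mdifferentiableAt (by simp))
      (hψ.mdifferentiableAt_apply hW hxW L' hx' b), ← h2, evalL_apply, evalL_apply,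
      LocalFrame.transition_of_spin_eq hx hx' hs, C.unitLift_one hv₀]
    have : dirDeriv I (fun y => ψ (L'.spin y) (L'.flat y) b) (L.vec i) x
        = dirDeriv I (fun y => ψ (L'.spin y) (L'.flat y) b) (L'.vec i) x := by
      unfold dirDeriv
      rw [hvec]
    rw [this]
    rfl
  rw [hs, hf]
  simp only [hder, map_add, Finset.sum_add_distrib, diracZeroth, LinearMap.add_apply,
    LinearMap.sum_apply, Module.End.mul_apply, LocalFrame.leviCivitaCoeff_of_spin_eq hx hx' hs,
    cliffMul_congr C η hvec]
  have hbiv : ∀ (p q : Fin d → Fin d → ℝ) (v : Δ), C.bivector (fun l j => p l j + q l j) v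
      = C.bivector p v + C.bivector q v := by
    intro p q v
    simp only [SpinorModule.bivector, add_smul, Finset.sum_add_distrib, smul_add,
      LinearMap.add_apply]
  simp only [hbiv, map_add, Finset.sum_add_distrib]
  abel

lemma IsSmoothSection.component_translate (hψ : IsSmoothSection S E C W ψ) (L : LocalFrame S E)
    (a : SpinGrp d) (u : Matrix.unitaryGroup (Fin N) ℂ) (hx : x ∈ L.U) (hxW : x ∈ W) (b : Fin N) :
    ψ (L.spin x) (L.flat x) b = ∑ b', (u : Matrix (Fin N) (Fin N) ℂ) b b' •
      C.repL a (ψ ((L.translate a u).spin x) ((L.translate a u).flat x) b') :=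
  hψ.equivariant _ _ (L.proj_spin_eq_proj_flat hx) (by rwa [L.spin_proj x hx]) a u b

lemma twistedDiracInFrame_translate (hψ : IsSmoothSection S E C W ψ) (hW : IsOpen W)
    (hxW : x ∈ W) (η : MixedForm I M) (L : LocalFrame S E) (hx : x ∈ L.U) (a : SpinGrp d)
    (u : Matrix.unitaryGroup (Fin N) ℂ) (b : Fin N) :
    twistedDiracInFrame S E C η L ψ x b = ∑ b', (u : Matrix (Fin N) (Fin N) ℂ) b b' •
      C.rep (a : CliffordAlgebra (cliffForm d))
        (twistedDiracInFrame S E C η (L.translate a u) ψ x b') := by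
  set L' := L.translate a u with hL'
  have hx' : x ∈ L'.U := hx
  rw [twistedDiracInFrame_apply hψ hW hxW η L hx b]
  simp only [twistedDiracInFrame_apply hψ hW hxW η L' hx']
  set A := LocalFrame.transMatrix a with hA
  set R := C.rep (a : CliffordAlgebra (cliffForm d)) with hR
  let f' : Fin N → M → Δ := fun b' y => ψ (L'.spin y) (L'.flat y) b'
  have hf' : ∀ b', MDifferentiableAt I 𝓘(ℝ, Δ) (f' b') x :=
    fun b' => hψ.mdifferentiableAt_apply hW hxW L' hx' b'
  let T : Fin N → Δ →L[ℝ] Δ := fun b' =>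
    ((u : Matrix (Fin N) (Fin N) ℂ) b b' • C.repL a).restrictScalars ℝ
  have hcomp : (fun y => ψ (L.spin y) (L.flat y) b) =ᶠ[nhds x] fun y => ∑ b', T b' (f' b' y) := by
    filter_upwards [L.isOpen_U.mem_nhds hx, hW.mem_nhds hxW] with y hy hyW
    exact hψ.component_translate L a u hy hyW b
  have hder : ∀ V : ∀ x : M, TangentSpace I x,
      dirDeriv I (fun y => ψ (L.spin y) (L.flat y) b) V x
        = ∑ b', (u : Matrix (Fin N) (Fin N) ℂ) b b' • R (dirDeriv I (f' b') V x) := by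
    intro V
    rw [dirDeriv_congr hcomp]
    refine (dirDeriv_sum Finset.univ (f := fun b' y => T b' (f' b' y)) fun b' _ =>
      (T b').differentiableAt.comp_mdifferentiableAt (hf' b')).trans ?_
    exact Finset.sum_congr rfl fun b' _ => dirDeriv_clm (T b') (hf' b')
  have hvec : ∀ i b', dirDeriv I (f' b') (L'.vec i) x
      = ∑ p, A p i • dirDeriv I (f' b') (L.vec p) x := fun i b' =>
    dirDeriv_vec_sum Finset.univ (f' b') (fun p => A p i) L.vec rfl
  have hfirst : ∀ b', R (∑ i, C.gen i (dirDeriv I (f' b') (L'.vec i) x))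
      = ∑ i, C.gen i (R (dirDeriv I (f' b') (L.vec i) x)) := by
    intro b'
    rw [map_sum]
    have h1 : ∀ i v, R (C.gen i v) = ∑ p, A p i • C.gen p (R v) := by
      intro i v
      have := congrArg (fun T : Module.End ℂ Δ => T v)
        (rep_mul_gen (C := C) (LocalFrame.isSpinLift_transMatrix a) i)
      simpa only [Module.End.mul_apply, LinearMap.sum_apply, LinearMap.smul_apply] using this
    have hRr : ∀ (r : ℝ) v, R (r • v) = r • R v := fun r v => LinearMap.map_smul_of_tower R r v
    have hGr : ∀ p (r : ℝ) v, C.gen p (r • v) = r • C.gen p v := fun p r v =>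
      LinearMap.map_smul_of_tower (C.gen p) r v
    have h3 : ∀ i, R (C.gen i (dirDeriv I (f' b') (L'.vec i) x))
        = ∑ p, ∑ q, (A p i * A q i) • C.gen p (R (dirDeriv I (f' b') (L.vec q) x)) := by
      intro i
      rw [h1, hvec]
      refine Finset.sum_congr rfl fun p _ => ?_
      rw [map_sum, map_sum, Finset.smul_sum]
      exact Finset.sum_congr rfl fun q _ => by rw [hRr, hGr, smul_smul]
    have hrow : ∀ p q, ∑ i, A p i * A q i = if p = q then 1 else 0 :=
      row_orthonormal (L.transMatrix_orthonormal hx a)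
    simp only [h3]
    rw [Finset.sum_comm]
    refine Finset.sum_congr rfl fun p _ => ?_
    rw [Finset.sum_comm]
    simp only [← Finset.sum_smul, hrow]
    simp
  have hzero : ∀ v, R (diracZeroth g C η L'.vec x v) = diracZeroth g C η L.vec x (R v) := fun v =>
    congrArg (fun T : Module.End ℂ Δ => T v) (diracZeroth_translate C η L a u hx)
  rw [hψ.component_translate L a u hx hxW b]
  simp only [hder, map_add, map_sum, map_smul, smul_add, Finset.sum_add_distrib]
  congr 1
  · rw [Finset.sum_comm]
    refine Finset.sum_congr rfl fun b' _ => ?_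
    rw [← Finset.smul_sum, ← hfirst b', map_sum]
  · refine Finset.sum_congr rfl fun b' _ => ?_
    rw [hzero]
    rfl

/-- Any change of frame at `x` is a constant change followed by one that is trivial at `x`, so the
two previous cases suffice. -/
lemma twistedDiracInFrame_of_act (hd : 0 < d) (hψ : IsSmoothSection S E C W ψ) (hW : IsOpen W)
    (hxW : x ∈ W) (η : MixedForm I M) {L L' : LocalFrame S E} (hx : x ∈ L.U) (hx' : x ∈ L'.U)
    {a : SpinGrp d} {u : Matrix.unitaryGroup (Fin N) ℂ} (hs : S.act (L.spin x) a = L'.spin x)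
    (hf : E.act (L.flat x) u = L'.flat x) (b : Fin N) :
    twistedDiracInFrame S E C η L ψ x b = ∑ b', (u : Matrix (Fin N) (Fin N) ℂ) b b' •
      C.rep (a : CliffordAlgebra (cliffForm d)) (twistedDiracInFrame S E C η L' ψ x b') := by
  rw [twistedDiracInFrame_translate hψ hW hxW η L hx a u b,
    twistedDiracInFrame_of_spin_eq hd hψ hW hxW η (L := L.translate a u) (L' := L') hx hx' hs hf]

/-- The components of the twisted Dirac operator can be computed in any local frame. -/
lemma twistedDirac_apply (hd : 0 < d) (hψ : IsSmoothSection S E C W ψ) (hW : IsOpen W)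
    (η : MixedForm I M) {L : LocalFrame S E} {q : Q} {f : P} (hqW : S.proj q ∈ W)
    (hx : S.proj q ∈ L.U) (hs : L.spin (S.proj q) = q) (hf : L.flat (S.proj q) = f) :
    twistedDirac S E C η ψ q f = twistedDiracInFrame S E C η L ψ (S.proj q) := by
  have h : ∃ L : LocalFrame S E, S.proj q ∈ L.U ∧ L.spin (S.proj q) = q ∧
      L.flat (S.proj q) = f := ⟨L, hx, hs, hf⟩
  rw [twistedDirac, dif_pos h]
  obtain ⟨h1, h2, h3⟩ := h.choose_spec
  exact twistedDiracInFrame_of_spin_eq hd hψ hW hqW η h1 hx (h2.trans hs.symm) (h3.trans hf.symm)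

lemma twistedDirac_localFrame (hd : 0 < d) (hψ : IsSmoothSection S E C W ψ) (hW : IsOpen W)
    (η : MixedForm I M) (L : LocalFrame S E) (hxW : x ∈ W) (hx : x ∈ L.U) :
    twistedDirac S E C η ψ (L.spin x) (L.flat x) = twistedDiracInFrame S E C η L ψ x := by
  have hp := L.spin_proj x hx
  have := twistedDirac_apply hd hψ hW η (L := L) (q := L.spin x) (f := L.flat x) (by rwa [hp])
    (by rwa [hp]) (by rw [hp]) (by rw [hp])
  rwa [hp] at this

lemma twistedDirac_equivariant (hd : 0 < d) (hψ : IsSmoothSection S E C W ψ) (hW : IsOpen W)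
    (η : MixedForm I M) {q : Q} {f : P} (h : S.proj q = E.proj f) (hqW : S.proj q ∈ W)
    (a : SpinGrp d) (u : Matrix.unitaryGroup (Fin N) ℂ) (b : Fin N) :
    twistedDirac S E C η ψ q f b = ∑ b', (u : Matrix (Fin N) (Fin N) ℂ) b b' •
      C.rep (a : CliffordAlgebra (cliffForm d))
        (twistedDirac S E C η ψ (S.act q a) (E.act f u) b') := by
  obtain ⟨L, hL, hs, hf⟩ := LocalFrame.exists_through S E q f h
  obtain ⟨L', hL', hs', hf'⟩ := LocalFrame.exists_through S E (S.act q a) (E.act f u)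
    (by rw [S.proj_act, E.proj_act, h])
  rw [twistedDirac_apply hd hψ hW η hqW hL hs hf,
    twistedDirac_apply hd hψ hW η (by rwa [S.proj_act]) hL' hs' hf']
  rw [S.proj_act] at hL' hs' hf' ⊢
  exact twistedDiracInFrame_of_act hd hψ hW hqW η hL hL' (by rw [hs, hs']) (by rw [hf, hf']) b

end Frames

/-! ### Leibniz rule, ellipticity, pointwise symmetry -/

/-- Distinct generators anticommute, so reversal costs one sign for each pair of letters. -/
lemma cliffWord_reverse {d : ℕ} {w : List (Fin d)} (hw : w.Nodup) :
    cliffWord w.reverse = (-1 : ℝ) ^ (w.length * (w.length - 1) / 2) • cliffWord w := by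
  induction w with
  | nil => simp
  | cons i w ih =>
    have hi : i ∉ w := (List.nodup_cons.1 hw).1
    have h1 := cliffE_mul_cliffWord i w
    rw [List.count_eq_zero_of_not_mem hi, add_zero] at h1
    have h2 : cliffWord w * cliffE i = (-1 : ℝ) ^ w.length • (cliffE i * cliffWord w) := by
      rw [h1, smul_smul, ← pow_add, Even.neg_one_pow ⟨_, rfl⟩, one_smul]
    have h3 : (w.length + 1) * w.length / 2 = w.length * (w.length - 1) / 2 + w.length := by
      rcases w.length with _ | k
      · simp
      · have : (k + 1 + 1) * (k + 1) = (k + 1) * k + (k + 1) * 2 := by ring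
        rw [this, Nat.add_mul_div_right _ _ two_pos, Nat.add_sub_cancel]
    rw [List.reverse_cons, cliffWord_append, ih (List.nodup_cons.1 hw).2, smul_mul_assoc,
      show cliffWord [i] = cliffE i by simp [cliffWord], h2, smul_smul, List.length_cons,
      Nat.add_sub_cancel, h3, pow_add]
    congr 1

namespace SpinorModule

variable {d : ℕ} {Δ : Type*} [NormedAddCommGroup Δ] [InnerProductSpace ℂ Δ] (C : SpinorModule d Δ)

lemma rep_cliffWord (w : List (Fin d)) : C.rep (cliffWord w) = (w.map C.gen).prod := by
  rw [cliffWord, map_list_prod, List.map_map]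
  congr 2
  funext i
  exact C.rep_cliffE i

lemma inner_word (w : List (Fin d)) (u v : Δ) :
    inner ℂ ((w.map C.gen).prod u) v = (-1) ^ w.length * inner ℂ u ((w.reverse.map C.gen).prod v) := by
  induction w generalizing u v with
  | nil => simp
  | cons i w ih =>
    rw [List.map_cons, List.prod_cons, Module.End.mul_apply, C.gen_skew, ih, List.reverse_cons,
      List.map_append, List.prod_append, Module.End.mul_apply, List.length_cons, pow_succ]
    simp

/-- One sign for each skew factor and one for each pair reversed give `(-1)^(k(k+1)/2)`. Among odd
`k` this is `+1` for `k ≡ 3` and `-1` for `k ≡ 1` modulo `4`, which explains the reality conditions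
on the flux. -/
lemma inner_nodup_word {w : List (Fin d)} (hw : w.Nodup) (u v : Δ) :
    inner ℂ ((w.map C.gen).prod u) v
      = (-1) ^ (w.length + w.length * (w.length - 1) / 2)
        * inner ℂ u ((w.map C.gen).prod v) := by
  rw [inner_word, ← C.rep_cliffWord w.reverse, cliffWord_reverse hw, map_smul, C.rep_cliffWord,
    LinearMap.smul_apply, ← Complex.coe_smul, inner_smul_right, pow_add]
  push_cast
  ring

lemma c_eq_zero {v : Fin d → ℝ} {u : Δ} (h : C.c v u = 0) (hv : v ≠ 0) : u = 0 := by
  have h1 := congrArg (fun T : Module.End ℂ Δ => T u) (C.sq v)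
  rw [Module.End.mul_apply, h, map_zero, Module.algebraMap_end_apply, cliffForm_apply] at h1
  refine (smul_eq_zero.1 h1.symm).resolve_left ?_
  rw [neg_eq_zero]
  intro h0
  apply hv
  funext i
  have := (Finset.sum_eq_zero_iff_of_nonneg fun i _ => mul_self_nonneg (v i)).1 h0 i
    (Finset.mem_univ i)
  simpa using this

end SpinorModule

section Frames

variable {d : ℕ} {H : Type*} [TopologicalSpace H]
  {I : ModelWithCorners ℝ (EuclideanSpace ℝ (Fin d)) H}
  {M : Type*} [TopologicalSpace M] [ChartedSpace H M] [IsManifold I ∞ M]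
  {g : RiemMetric I M} {x : M}
  {Q : Type*} [TopologicalSpace Q] {N : ℕ} {P : Type*}
  [TopologicalSpace P] {S : SpinStructure g Q} {E : FlatHermitianBundle M N P}
  {Δ : Type*} [NormedAddCommGroup Δ] [InnerProductSpace ℂ Δ]
  {C : SpinorModule d Δ} {W : Set M} {ψ φ : SpinorField Q P Δ N}

/-- The product of a function on `M` and a spinor field. -/
def spinorSmul (S : SpinStructure g Q) (h : M → ℝ) (φ : SpinorField Q P Δ N) :
    SpinorField Q P Δ N := fun q f b => h (S.proj q) • φ q f b

lemma IsSmoothSection.spinorSmul (hφ : IsSmoothSection S E C W φ) {h : M → ℝ}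
    (hh : ContMDiff I 𝓘(ℝ, ℝ) ∞ h) : IsSmoothSection S E C W (spinorSmul S h φ) where
  equivariant q f hqf hW a u b := by
    simp only [_root_.spinorSmul, S.proj_act]
    rw [hφ.equivariant q f hqf hW a u b, Finset.smul_sum]
    refine Finset.sum_congr rfl fun b' _ => ?_
    rw [LinearMap.map_smul_of_tower, smul_comm]
  smooth L := by
    have h1 : ContMDiffOn I 𝓘(ℝ, Fin N → Δ) ∞
        (fun x => h x • φ (L.spin x) (L.flat x)) (L.U ∩ W) := hh.contMDiffOn.smul (hφ.smooth L)
    refine h1.congr fun y hy => ?_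
    funext b
    simp only [_root_.spinorSmul, L.spin_proj y hy.1, Pi.smul_apply]

/-- Leibniz rule for the twisted Dirac operator. -/
lemma twistedDiracInFrame_spinorSmul (hφ : IsSmoothSection S E C W φ) (hW : IsOpen W)
    (hxW : x ∈ W) (η : MixedForm I M) (L : LocalFrame S E) (hx : x ∈ L.U) {h : M → ℝ}
    (hh : ContMDiff I 𝓘(ℝ, ℝ) ∞ h) (b : Fin N) :
    twistedDiracInFrame S E C η L (spinorSmul S h φ) x b
      = h x • twistedDiracInFrame S E C η L φ x b
        + C.c (fun i => dirDeriv I h (L.vec i) x) (φ (L.spin x) (L.flat x) b) := by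
  rw [twistedDiracInFrame_apply (hφ.spinorSmul hh) hW hxW η L hx,
    twistedDiracInFrame_apply hφ hW hxW η L hx]
  have hc : ∀ y ∈ L.U, spinorSmul S h φ (L.spin y) (L.flat y) b
      = h y • φ (L.spin y) (L.flat y) b := fun y hy => by simp [spinorSmul, L.spin_proj y hy]
  have h1 : ∀ V : ∀ x : M, TangentSpace I x,
      dirDeriv I (fun y => spinorSmul S h φ (L.spin y) (L.flat y) b) V x
        = dirDeriv I h V x • φ (L.spin x) (L.flat x) b
          + h x • dirDeriv I (fun y => φ (L.spin y) (L.flat y) b) V x := by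
    intro V
    rw [← dirDeriv_smul (hh.mdifferentiableAt (by simp))
      (hφ.mdifferentiableAt_apply hW hxW L hx b)]
    refine dirDeriv_congr ?_
    filter_upwards [L.isOpen_U.mem_nhds hx] with y hy using hc y hy
  rw [hc x hx]
  simp only [h1, map_add, LinearMap.map_smul_of_tower, Finset.sum_add_distrib, smul_add,
    Finset.smul_sum, C.c_eq_sum, LinearMap.sum_apply, LinearMap.smul_apply]
  abel

/-- By the Leibniz rule the principal symbol at `dh` is Clifford multiplication by the frame
components of `dh`, injective because `c(v)² = -|v|²`. The terms of order zero are irrelevant, since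
`h` vanishes at the point. -/
lemma isEllipticFirstOrder_twistedDirac (hd : 0 < d) (η : MixedForm I M) :
    IsEllipticFirstOrder S E C (twistedDirac S E C η) := by
  intro φ hφ h hh q f hqf h0 hdh hD
  obtain ⟨L, hL, hs, hf⟩ := LocalFrame.exists_through S E q f hqf
  change twistedDirac S E C η (spinorSmul S h φ) q f = 0 at hD
  rw [twistedDirac_apply hd (hφ.spinorSmul hh) isOpen_univ η (mem_univ _) hL hs hf] at hD
  funext b
  have h1 := congrFun hD b
  rw [twistedDiracInFrame_spinorSmul hφ isOpen_univ (mem_univ _) η L hL hh, h0, zero_smul,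
    zero_add, hs, hf] at h1
  refine C.c_eq_zero h1 fun hv => hdh ?_
  ext v
  rw [orthonormal_expansion (fun i j => L.inner_vec hL i j) v, map_sum]
  refine Finset.sum_eq_zero fun i _ => ?_
  rw [map_smul]
  have h2 : mfderiv I 𝓘(ℝ, ℝ) h (S.proj q) (L.vec i (S.proj q)) = 0 := congrFun hv i
  rw [h2, smul_zero]

lemma sum_inner_unitary {A : Matrix (Fin N) (Fin N) ℂ} (hA : A ∈ Matrix.unitaryGroup (Fin N) ℂ)
    (v w : Fin N → Δ) :
    ∑ b, inner ℂ (∑ b', A b b' • v b') (∑ b', A b b' • w b') = ∑ b, inner ℂ (v b) (w b) := by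
  have hU : ∀ b' b'', ∑ b, (starRingEnd ℂ) (A b b') * A b b'' = if b' = b'' then 1 else 0 := by
    intro b' b''
    have h := congrArg (fun B : Matrix (Fin N) (Fin N) ℂ => B b' b'')
      (Matrix.mem_unitaryGroup_iff'.1 hA)
    simpa [Matrix.mul_apply, Matrix.star_apply, Matrix.one_apply] using h
  have h1 : ∀ b, inner ℂ (∑ b', A b b' • v b') (∑ b', A b b' • w b')
      = ∑ b', ∑ b'', ((starRingEnd ℂ) (A b b') * A b b'') * inner ℂ (v b') (w b'') := by
    intro b
    rw [sum_inner]
    refine Finset.sum_congr rfl fun b' _ => ?_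
    rw [inner_smul_left, inner_sum, Finset.mul_sum]
    exact Finset.sum_congr rfl fun b'' _ => by rw [inner_smul_right, mul_assoc]
  simp only [h1]
  rw [Finset.sum_comm]
  refine Finset.sum_congr rfl fun b' _ => ?_
  rw [Finset.sum_comm]
  simp only [← Finset.sum_mul, hU]
  simp

/-- The pairing of two equivariant fields can be computed in any frames. -/
lemma spinorPairing_eq {q : Q} {f : P} (hq : S.proj q = x) (hf : E.proj f = x)
    (hφ : ∀ q f, S.proj q = E.proj f → ∀ (a : SpinGrp d) (u : Matrix.unitaryGroup (Fin N) ℂ)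
      (b : Fin N), φ q f b = ∑ b', (u : Matrix (Fin N) (Fin N) ℂ) b b' •
        C.rep (a : CliffordAlgebra (cliffForm d)) (φ (S.act q a) (E.act f u) b'))
    (hψ : ∀ q f, S.proj q = E.proj f → ∀ (a : SpinGrp d) (u : Matrix.unitaryGroup (Fin N) ℂ)
      (b : Fin N), ψ q f b = ∑ b', (u : Matrix (Fin N) (Fin N) ℂ) b b' •
        C.rep (a : CliffordAlgebra (cliffForm d)) (ψ (S.act q a) (E.act f u) b')) :
    spinorPairing S E φ ψ x = ∑ b, inner ℂ (φ q f b) (ψ q f b) := by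
  have h1 : S.proj (Function.surjInv S.surjective x) = x := Function.surjInv_eq _ _
  have h2 : E.proj (Function.surjInv E.surjective x) = x := Function.surjInv_eq _ _
  obtain ⟨a, ha, -⟩ := S.simply_transitive q (Function.surjInv S.surjective x) (hq.trans h1.symm)
  obtain ⟨u, hu, -⟩ := E.simply_transitive f (Function.surjInv E.surjective x) (hf.trans h2.symm)
  rw [spinorPairing]
  simp only [hφ q f (hq.trans hf.symm) a u, hψ q f (hq.trans hf.symm) a u, ha, hu]
  rw [sum_inner_unitary u.2]
  simp only [C.inner_rep_spin]

/-- Clifford multiplication by forms in `Ω^{4•+3}(ℝ) ⊕ i Ω^{4•+1}(ℝ)` is symmetric. -/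
lemma inner_cliffMul {η : MixedForm I M} (hodd : ∀ k, Even k → ∀ x, η k x = 0)
    (hre : ∀ k, k % 4 = 3 → ∀ x v, (η k x v).im = 0)
    (him : ∀ k, k % 4 = 1 → ∀ x v, (η k x v).re = 0)
    (e : Fin d → ∀ x : M, TangentSpace I x) (u v : Δ) :
    inner ℂ (cliffMul C η e x u) v = inner ℂ u (cliffMul C η e x v) := by
  simp only [cliffMul, LinearMap.sum_apply, LinearMap.smul_apply, sum_inner, inner_sum,
    inner_smul_left, inner_smul_right]
  refine Finset.sum_congr rfl fun k _ => ?_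
  congr 1
  · simp
  refine Finset.sum_congr rfl fun i _ => ?_
  -- For distinct indices the sign of `inner_nodup_word` compensates the conjugation of the
  -- coefficient of `η`; with a repeated index the alternating form vanishes.
  by_cases hi : Function.Injective i
  · have hw : (List.ofFn i).Nodup := List.nodup_ofFn.2 hi
    have h1 := C.inner_nodup_word hw u v
    rw [List.map_ofFn, List.length_ofFn] at h1
    change inner ℂ ((List.ofFn fun j => C.gen (i j)).prod u) v = _ * inner ℂ u
      ((List.ofFn fun j => C.gen (i j)).prod v) at h1
    rw [h1, ← mul_assoc]
    congr 1
    rcases Nat.even_or_odd k with hk | hk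
    · rw [hodd k hk]
      simp
    · have h4 : k % 4 = 1 ∨ k % 4 = 3 := by
        have := Nat.odd_iff.1 hk
        omega
      rcases h4 with h4 | h4
      · have hz := him k h4 x (fun j => e (i j) x)
        have hs : Odd (k + k * (k - 1) / 2) := by
          obtain ⟨t, rfl⟩ : ∃ t, k = 4 * t + 1 := ⟨k / 4, by omega⟩
          have : (4 * t + 1) * (4 * t + 1 - 1) / 2 = (4 * t + 1) * (2 * t) := by
            rw [Nat.add_sub_cancel, show (4 * t + 1) * (4 * t) = (4 * t + 1) * (2 * t) * 2 by ring,
              Nat.mul_div_cancel _ two_pos]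
          rw [this]
          exact ⟨2 * t + (4 * t + 1) * t, by ring⟩
        rw [hs.neg_one_pow]
        apply Complex.ext <;> simp [hz]
      · have hz := hre k h4 x (fun j => e (i j) x)
        have hs : Even (k + k * (k - 1) / 2) := by
          obtain ⟨t, rfl⟩ : ∃ t, k = 4 * t + 3 := ⟨k / 4, by omega⟩
          have : (4 * t + 3) * (4 * t + 3 - 1) / 2 = (4 * t + 3) * (2 * t + 1) := by
            rw [show 4 * t + 3 - 1 = 4 * t + 2 by omega,
              show (4 * t + 3) * (4 * t + 2) = (4 * t + 3) * (2 * t + 1) * 2 by ring,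
              Nat.mul_div_cancel _ two_pos]
          rw [this]
          exact ⟨(4 * t + 3) * (t + 1), by ring⟩
        rw [hs.neg_one_pow]
        apply Complex.ext <;> simp [hz]
  · obtain ⟨a, b, hab, hne⟩ : ∃ a b, i a = i b ∧ a ≠ b := by
      simpa [Function.Injective] using hi
    have : η k x (fun j => e (i j) x) = 0 :=
      (η k x).map_eq_zero_of_eq _ (by simp only [hab]) hne
    rw [this]
    simp

end Frames

/-! ### Divergence in Euclidean space -/

section Euclidean

variable {d : ℕ}

/-- The determinant of `d` vectors in `ℝ^d`. -/
def detForm (d : ℕ) : ContinuousMultilinearMap ℝ (fun _ : Fin d => EuclideanSpace ℝ (Fin d)) ℝ where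
  toMultilinearMap := (Matrix.detRowAlternating.compLinearMap
    (WithLp.linearEquiv 2 ℝ (Fin d → ℝ)).toLinearMap).toMultilinearMap
  cont := by
    change Continuous fun v : Fin d → EuclideanSpace ℝ (Fin d) =>
      Matrix.det (Matrix.of fun i j => v i j)
    exact Continuous.matrix_det (by fun_prop)

/-- All terms but the `j`-th repeat a vector and vanish. With a full basis this yields both linear
independence and the derivative of the determinant. -/
lemma detForm_update (v : Fin d → EuclideanSpace ℝ (Fin d)) (j : Fin d) (c : Fin d → ℝ) :
    detForm d (Function.update v j (∑ k, c k • v k)) = c j * detForm d v := by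
  have h := (Matrix.detRowAlternating.compLinearMap
    (WithLp.linearEquiv 2 ℝ (Fin d → ℝ)).toLinearMap).map_update_sum Finset.univ j
      (fun k => c k • v k) v
  refine h.trans ?_
  rw [Finset.sum_eq_single j]
  · rw [AlternatingMap.map_update_smul, Function.update_eq_self]
    rfl
  · intro k _ hk
    rw [AlternatingMap.map_update_smul, AlternatingMap.map_update_self _ _ hk.symm, smul_zero]
  · simp

/-- The divergence of a vector field on `ℝ^d`. -/
def eDiv (X : EuclideanSpace ℝ (Fin d) → EuclideanSpace ℝ (Fin d))
    (z : EuclideanSpace ℝ (Fin d)) : ℝ :=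
  ∑ a, fderiv ℝ X z (EuclideanSpace.single a 1) a

lemma sum_single_coord (T : EuclideanSpace ℝ (Fin d) →L[ℝ] EuclideanSpace ℝ (Fin d))
    (B : Module.Basis (Fin d) ℝ (EuclideanSpace ℝ (Fin d))) :
    ∑ a, T (EuclideanSpace.single a 1) a = ∑ j, B.repr (T (B j)) j := by
  have h1 := LinearMap.trace_eq_matrix_trace ℝ (EuclideanSpace.basisFun (Fin d) ℝ).toBasis
    (T : EuclideanSpace ℝ (Fin d) →ₗ[ℝ] EuclideanSpace ℝ (Fin d))
  have h2 := LinearMap.trace_eq_matrix_trace ℝ B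
    (T : EuclideanSpace ℝ (Fin d) →ₗ[ℝ] EuclideanSpace ℝ (Fin d))
  rw [h1] at h2
  simpa [Matrix.trace, LinearMap.toMatrix_apply] using h2

/-- The divergence of the fields of a frame `E`, with the density of the metric for which `E` is
orthonormal, is the trace of the bracket. -/
lemma eDiv_frame {E : Fin d → EuclideanSpace ℝ (Fin d) → EuclideanSpace ℝ (Fin d)}
    {w : EuclideanSpace ℝ (Fin d) → ℝ} {z : EuclideanSpace ℝ (Fin d)}
    (hE : ∀ j, DifferentiableAt ℝ (E j) z)
    (hw : ∀ᶠ y in nhds z, w y * |detForm d fun j => E j y| = 1) (l : Fin d) {c : Fin d → Fin d → ℝ}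
    (hc : ∀ j, fderiv ℝ (E l) z (E j z) - fderiv ℝ (E j) z (E l z) = ∑ k, c j k • E k z) :
    DifferentiableAt ℝ w z ∧ eDiv (fun y => w y • E l y) z = w z * ∑ j, c j j := by
  set D : EuclideanSpace ℝ (Fin d) → ℝ := fun y => detForm d fun j => E j y with hD
  have hwz : w z * |D z| = 1 := hw.self_of_nhds
  have hDz : D z ≠ 0 := fun h => by rw [h] at hwz; simp at hwz
  have hli : LinearIndependent ℝ fun j => E j z := by
    rw [Fintype.linearIndependent_iff]
    intro s hs i
    have h1 := detForm_update (fun j => E j z) i s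
    rw [hs] at h1
    have h2 := h1.symm.trans ((detForm d).toMultilinearMap.map_update_zero _ i)
    exact (mul_eq_zero.1 h2).resolve_right hDz
  have : Nonempty (Fin d) := ⟨l⟩
  let B : Module.Basis (Fin d) ℝ (EuclideanSpace ℝ (Fin d)) :=
    basisOfLinearIndependentOfCardEqFinrank hli (by simp)
  have hB : ∀ j, B j = E j z := fun j => by simp [B]
  have hEd : HasFDerivAt (fun y => fun j => E j y)
      (ContinuousLinearMap.pi fun j => fderiv ℝ (E j) z) z :=
    hasFDerivAt_pi.2 fun j => (hE j).hasFDerivAt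
  have hDd : HasFDerivAt D (((detForm d).linearDeriv fun j => E j z).comp
      (ContinuousLinearMap.pi fun j => fderiv ℝ (E j) z)) z :=
    ((detForm d).hasFDerivAt _).comp z hEd
  -- Jacobi's formula: the logarithmic derivative of the determinant of the frame along `E l` is the
  -- trace, in the frame basis, of the derivatives of the `E j` along `E l`.
  have hDl : fderiv ℝ D z (E l z) = D z * ∑ j, B.repr (fderiv ℝ (E j) z (E l z)) j := by
    rw [hDd.fderiv, ContinuousLinearMap.comp_apply, ContinuousMultilinearMap.linearDeriv_apply,
      Finset.mul_sum]
    refine Finset.sum_congr rfl fun j _ => ?_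
    have h1 := detForm_update (fun j => E j z) j
      (fun k => B.repr (fderiv ℝ (E j) z (E l z)) k)
    have h2 : ∑ k, B.repr (fderiv ℝ (E j) z (E l z)) k • E k z = fderiv ℝ (E j) z (E l z) := by
      simp only [← hB]
      exact B.sum_repr _
    rw [h2] at h1
    rw [mul_comm]
    exact h1
  -- The density is the inverse of the absolute determinant, so its logarithmic derivative is minus
  -- that trace.
  have hwe : w =ᶠ[nhds z] fun y => |D y|⁻¹ := by
    filter_upwards [hw] with y hy
    exact eq_inv_of_mul_eq_one_left hy
  have habs : HasFDerivAt (fun y => |D y|) ((SignType.sign (D z) : ℝ) • fderiv ℝ D z) z :=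
    (hasStrictDerivAt_abs hDz).hasDerivAt.comp_hasFDerivAt z hDd.differentiableAt.hasFDerivAt
  have hwd := ((hasDerivAt_inv (abs_ne_zero.2 hDz)).comp_hasFDerivAt z habs).congr_of_eventuallyEq
    hwe
  have hwl : fderiv ℝ w z (E l z) = -(w z * ∑ j, B.repr (fderiv ℝ (E j) z (E l z)) j) := by
    rw [hwd.fderiv, smul_apply, smul_apply, hDl, hwe.self_of_nhds]
    have hs : (SignType.sign (D z) : ℝ) * D z = |D z| := sign_mul_self _
    have ha : |D z| ≠ 0 := abs_ne_zero.2 hDz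
    simp only [smul_eq_mul]
    rw [← mul_assoc (SignType.sign (D z) : ℝ), hs]
    field_simp
  refine ⟨hwd.differentiableAt, ?_⟩
  have hX := hwd.differentiableAt.hasFDerivAt.smul (hE l).hasFDerivAt
  rw [eDiv]
  have h1 : fderiv ℝ (fun y => w y • E l y) z
      = w z • fderiv ℝ (E l) z + (fderiv ℝ w z).smulRight (E l z) := hX.fderiv
  rw [h1]
  have h2 : ∑ a, ((fderiv ℝ w z).smulRight (E l z)) (EuclideanSpace.single a 1) a
      = fderiv ℝ w z (E l z) := by
    conv_rhs => rw [← (EuclideanSpace.basisFun (Fin d) ℝ).sum_repr (E l z), map_sum]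
    refine Finset.sum_congr rfl fun a _ => ?_
    simp [mul_comm]
  -- The divergence of `E l` is the trace of its derivative, computed here in the frame basis. By
  -- `hc` it exceeds the trace from Jacobi's formula by the trace of `c`, and the derivative of the
  -- density removes the rest.
  have h3 := sum_single_coord (fderiv ℝ (E l) z) B
  have h4 : ∀ j, B.repr (fderiv ℝ (E l) z (B j)) j
      = c j j + B.repr (fderiv ℝ (E j) z (E l z)) j := by
    intro j
    rw [← sub_eq_iff_eq_add, ← Finsupp.sub_apply, ← map_sub, hB, hc j]
    simp only [← hB]
    rw [map_sum, Finsupp.finsetSum_apply]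
    simp [Finsupp.single_apply]
  simp only [add_apply, smul_apply, PiLp.add_apply, PiLp.smul_apply, smul_eq_mul,
    Finset.sum_add_distrib, ← Finset.mul_sum]
  rw [h2, h3, hwl]
  simp only [h4, Finset.sum_add_distrib]
  ring

/-- The integral of the divergence of a compactly supported vector field vanishes. -/
lemma setIntegral_divergence {O K : Set (EuclideanSpace ℝ (Fin d))} (hO : IsOpen O)
    (hK : IsCompact K) (hKO : K ⊆ O) {f : EuclideanSpace ℝ (Fin d) → ℂ}
    {X : EuclideanSpace ℝ (Fin d) → EuclideanSpace ℝ (Fin d)} (hf : ContDiffOn ℝ 1 f O)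
    (hX : ContDiffOn ℝ 1 X O) (hfK : ∀ z ∈ O, z ∉ K → f z = 0) :
    IntegrableOn (fun z => fderiv ℝ f z (X z) + eDiv X z • f z) O ∧
      ∫ z in O, (fderiv ℝ f z (X z) + eDiv X z • f z) = 0 := by
  classical
  -- The field `f X` extended by zero; it is `C¹` on the whole space because `f` vanishes on `O` off
  -- the compact set `K`.
  let G : Fin d → EuclideanSpace ℝ (Fin d) → ℂ := fun a => O.indicator fun z => X z a • f z
  have hXa : ∀ a, ContDiffOn ℝ 1 (fun z => X z a) O := fun a =>
    (contDiffOn_euclidean.1 hX) a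
  have hout : ∀ a, ∀ z ∉ K, G a z = 0 := by
    intro a z hz
    by_cases hzO : z ∈ O
    · simp [G, hzO, hfK z hzO hz]
    · simp [G, hzO]
  have hG : ∀ a, ContDiff ℝ 1 (G a) := by
    intro a
    rw [contDiff_iff_contDiffAt]
    intro z
    by_cases hz : z ∈ O
    · have h1 : ContDiffAt ℝ 1 (fun z => X z a • f z) z :=
        ((hXa a).smul hf).contDiffAt (hO.mem_nhds hz)
      refine h1.congr_of_eventuallyEq ?_
      filter_upwards [hO.mem_nhds hz] with y hy
      simp [G, hy]
    · have h1 : G a =ᶠ[nhds z] fun _ => 0 := by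
        filter_upwards [hK.isClosed.isOpen_compl.mem_nhds fun h => hz (hKO h)] with y hy
        exact hout a y hy
      exact contDiffAt_const.congr_of_eventuallyEq h1
  have hGc : ∀ a, HasCompactSupport (G a) := fun a => HasCompactSupport.intro hK (hout a)
  have hG'c : ∀ a, HasCompactSupport fun z => fderiv ℝ (G a) z (EuclideanSpace.single a 1) :=
    fun a => (hGc a).fderiv_apply ℝ _
  have hint : ∀ a, Integrable fun z => fderiv ℝ (G a) z (EuclideanSpace.single a 1) := fun a =>
    Continuous.integrable_of_hasCompactSupport
      (((hG a).continuous_fderiv one_ne_zero).clm_apply continuous_const) (hG'c a)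
  have hzero : ∀ a, ∫ z, fderiv ℝ (G a) z (EuclideanSpace.single a 1) = 0 := by
    intro a
    -- Integration by parts against the constant function `1`.
    have h := integral_mul_fderiv_eq_neg_fderiv_mul_of_integrable (μ := volume)
      (f := fun _ : EuclideanSpace ℝ (Fin d) => (1 : ℂ)) (g := G a)
      (v := EuclideanSpace.single a (1 : ℝ)) (by simp) (by simpa using hint a)
      (by simpa using (hG a).continuous.integrable_of_hasCompactSupport (hGc a))
      (fun z _ => differentiableAt_const _)
      (fun z _ => (hG a).differentiable one_ne_zero z)
    simpa using h
  have hin : ∀ z ∈ O, fderiv ℝ f z (X z) + eDiv X z • f z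
      = ∑ a, fderiv ℝ (G a) z (EuclideanSpace.single a 1) := by
    intro z hz
    have hfz : DifferentiableAt ℝ f z := (hf.contDiffAt (hO.mem_nhds hz)).differentiableAt one_ne_zero
    have hXz : DifferentiableAt ℝ X z := (hX.contDiffAt (hO.mem_nhds hz)).differentiableAt one_ne_zero
    have h1 : ∀ a, fderiv ℝ (G a) z (EuclideanSpace.single a 1)
        = X z a • fderiv ℝ f z (EuclideanSpace.single a 1)
          + fderiv ℝ X z (EuclideanSpace.single a 1) a • f z := by
      intro a
      have e1 : G a =ᶠ[nhds z] fun z => X z a • f z := by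
        filter_upwards [hO.mem_nhds hz] with y hy
        simp [G, hy]
      have e2 : HasFDerivAt (fun z => X z a)
          ((EuclideanSpace.proj a : EuclideanSpace ℝ (Fin d) →L[ℝ] ℝ).comp (fderiv ℝ X z)) z :=
        (EuclideanSpace.proj a : EuclideanSpace ℝ (Fin d) →L[ℝ] ℝ).hasFDerivAt.comp z
          hXz.hasFDerivAt
      have e3 : fderiv ℝ (fun z => X z a • f z) z = _ := (e2.smul hfz.hasFDerivAt).fderiv
      rw [e1.fderiv_eq, e3]
      rfl
    have h2 : fderiv ℝ f z (X z) = ∑ a, X z a • fderiv ℝ f z (EuclideanSpace.single a 1) := by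
      conv_lhs => rw [← (EuclideanSpace.basisFun (Fin d) ℝ).sum_repr (X z), map_sum]
      refine Finset.sum_congr rfl fun a _ => ?_
      rw [map_smul]
      simp
    simp only [h1, Finset.sum_add_distrib, ← Finset.sum_smul, h2]
    rfl
  have hoff : ∀ z ∉ O, ∑ a, fderiv ℝ (G a) z (EuclideanSpace.single a 1) = 0 := by
    intro z hz
    refine Finset.sum_eq_zero fun a _ => ?_
    have h1 : G a =ᶠ[nhds z] fun _ => 0 := by
      filter_upwards [hK.isClosed.isOpen_compl.mem_nhds fun h => hz (hKO h)] with y hy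
      exact hout a y hy
    rw [h1.fderiv_eq]
    simp
  refine ⟨((integrable_finsetSum _ fun a _ => hint a).integrableOn.congr_fun
    (fun z hz => (hin z hz).symm) hO.measurableSet), ?_⟩
  rw [setIntegral_congr_fun hO.measurableSet hin,
    setIntegral_eq_integral_of_forall_compl_eq_zero hoff,
    integral_finsetSum _ fun a _ => hint a]
  exact Finset.sum_eq_zero fun a _ => hzero a

end Euclidean

/-! ### Green's formula for the twisted Dirac operator, pointwise form -/

section Frames

variable {d : ℕ} {H : Type*} [TopologicalSpace H]
  {I : ModelWithCorners ℝ (EuclideanSpace ℝ (Fin d)) H}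
  {M : Type*} [TopologicalSpace M] [ChartedSpace H M] [IsManifold I ∞ M]
  {g : RiemMetric I M} {x : M}
  {Q : Type*} [TopologicalSpace Q] {N : ℕ} {P : Type*}
  [TopologicalSpace P] {S : SpinStructure g Q} {E : FlatHermitianBundle M N P}
  {Δ : Type*} [NormedAddCommGroup Δ] [InnerProductSpace ℂ Δ]
  {C : SpinorModule d Δ} {W : Set M} {ψ φ : SpinorField Q P Δ N}

lemma dirDeriv_inner {f f' : M → Δ} {V : ∀ x : M, TangentSpace I x}
    (hf : MDifferentiableAt I 𝓘(ℝ, Δ) f x) (hf' : MDifferentiableAt I 𝓘(ℝ, Δ) f' x) :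
    dirDeriv I (fun y => inner ℂ (f y) (f' y)) V x
      = inner ℂ (dirDeriv I f V x) (f' x) + inner ℂ (f x) (dirDeriv I f' V x) := by
  have hp := hf.prodMk_space hf'
  have h1 := dirDeriv_comp (V := V) hp
    (φ := fun p : Δ × Δ => inner ℂ p.1 p.2) (differentiableAt_fst.inner ℂ differentiableAt_snd)
  have h3 : dirDeriv I (fun y => (f y, f' y)) V x = (dirDeriv I f V x, dirDeriv I f' V x) := by
    have e1 := dirDeriv_clm (V := V) (.fst ℝ Δ Δ) hp
    have e2 := dirDeriv_clm (V := V) (.snd ℝ Δ Δ) hp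
    exact Prod.ext e1.symm e2.symm
  rw [h1, fderiv_inner_apply ℂ differentiableAt_fst differentiableAt_snd, h3, fderiv_fst,
    fderiv_snd]
  exact add_comm _ _

/-- Compatibility of the connection with the metric, read off from the Koszul formula. -/
lemma leviCivitaCoeff_antisymm (e : Fin d → ∀ x : M, TangentSpace I x) (i j l : Fin d) :
    leviCivitaCoeff g e x i j l = -leviCivitaCoeff g e x i l j := by
  simp only [leviCivitaCoeff]
  rw [VectorField.mlieBracket_swap_apply (V := e i) (W := e l),
    VectorField.mlieBracket_swap_apply (V := e l) (W := e j),
    VectorField.mlieBracket_swap_apply (V := e j) (W := e i)]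
  simp only [map_neg, neg_apply]
  ring

/-- The divergence of the `l`-th vector field of an orthonormal frame. -/
def frameDiv (g : RiemMetric I M) (e : Fin d → ∀ x : M, TangentSpace I x) (l : Fin d) (x : M) : ℝ :=
  ∑ j, g.inner x (e j x) (VectorField.mlieBracket I (e j) (e l) x)

lemma leviCivitaCoeff_self (e : Fin d → ∀ x : M, TangentSpace I x) (i l : Fin d) :
    leviCivitaCoeff g e x i i l = -g.inner x (e i x) (VectorField.mlieBracket I (e i) (e l) x) := by
  simp only [leviCivitaCoeff]
  rw [VectorField.mlieBracket_swap_apply (V := e l) (W := e i), VectorField.mlieBracket_self,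
    g.symm x (e i x)]
  simp only [map_neg, neg_apply, Pi.zero_apply, map_zero, zero_apply]
  ring

/-- The flux term is symmetric and drops out. With `ω_i` the skew bivectors, the defect of `c_i ω_i`
is the commutator of `ω_i` with `c_i`, whose sum over `i` is the divergence of the frame. -/
lemma inner_diracZeroth {η : MixedForm I M} (hodd : ∀ k, Even k → ∀ x, η k x = 0)
    (hre : ∀ k, k % 4 = 3 → ∀ x v, (η k x v).im = 0)
    (him : ∀ k, k % 4 = 1 → ∀ x v, (η k x v).re = 0)
    (e : Fin d → ∀ x : M, TangentSpace I x) (u v : Δ) :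
    inner ℂ (diracZeroth g C η e x u) v - inner ℂ u (diracZeroth g C η e x v)
      = ∑ l, (frameDiv g e l x : ℂ) * inner ℂ (C.gen l u) v := by
  have hanti : ∀ i, ∀ j l, leviCivitaCoeff g e x i j l = -leviCivitaCoeff g e x i l j :=
    fun i j l => leviCivitaCoeff_antisymm e i j l
  have h1 : ∀ i, inner ℂ (C.gen i (C.bivector (fun l j => leviCivitaCoeff g e x i j l) u)) v
      - inner ℂ u (C.gen i (C.bivector (fun l j => leviCivitaCoeff g e x i j l) v))
      = ∑ l, ((g.inner x (e i x) (VectorField.mlieBracket I (e i) (e l) x) : ℝ) : ℂ)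
        * inner ℂ (C.gen l u) v := by
    intro i
    have h2 := congrArg (fun T : Module.End ℂ Δ => T v)
      (C.bivector_commutator (b := fun l j => leviCivitaCoeff g e x i j l)
        (fun j l => hanti i j l) i)
    simp only [LinearMap.sub_apply, Module.End.mul_apply, LinearMap.sum_apply,
      LinearMap.smul_apply] at h2
    rw [C.gen_skew, C.inner_bivector (fun j l => hanti i j l), neg_neg, ← inner_sub_right, h2,
      inner_sum]
    refine Finset.sum_congr rfl fun l _ => ?_
    rw [leviCivitaCoeff_self, ← Complex.coe_smul, inner_smul_right, C.gen_skew]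
    push_cast
    ring
  simp only [diracZeroth, LinearMap.add_apply, LinearMap.sum_apply, Module.End.mul_apply,
    inner_add_left, inner_add_right, sum_inner, inner_sum]
  rw [inner_cliffMul hodd hre him, add_sub_add_right_eq_sub, ← Finset.sum_sub_distrib]
  simp only [h1]
  rw [Finset.sum_comm]
  refine Finset.sum_congr rfl fun l _ => ?_
  rw [frameDiv, Complex.ofReal_sum, Finset.sum_mul]

/-- The components in the frame `L` of the vector field in Green's formula. -/
def greenField (C : SpinorModule d Δ) (L : LocalFrame S E) (φ ψ : SpinorField Q P Δ N) (l : Fin d)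
    (y : M) : ℂ :=
  ∑ b, inner ℂ (C.gen l (φ (L.spin y) (L.flat y) b)) (ψ (L.spin y) (L.flat y) b)

lemma contMDiffOn_greenField (hφ : IsSmoothSection S E C univ φ) (hψ : IsSmoothSection S E C univ ψ)
    (L : LocalFrame S E) (l : Fin d) :
    ContMDiffOn I 𝓘(ℝ, ℂ) ∞ (greenField C L φ ψ l) L.U := by
  intro x hx
  have h1 : ∀ b, ContMDiffAt I 𝓘(ℝ, ℂ) ∞ (fun y =>
      inner ℂ (C.genL l (φ (L.spin y) (L.flat y) b)) (ψ (L.spin y) (L.flat y) b)) x := by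
    intro b
    have e1 := hφ.contMDiffAt_apply isOpen_univ (mem_univ x) L hx b
    have e2 := hψ.contMDiffAt_apply isOpen_univ (mem_univ x) L hx b
    have e3 : ContDiff ℝ ∞ fun p : Δ × Δ => inner ℂ (C.genL l p.1) p.2 :=
      ContDiff.inner ℂ (((C.genL l).restrictScalars ℝ).contDiff.comp contDiff_fst) contDiff_snd
    exact e3.contMDiff.contMDiffAt.comp x (e1.prodMk_space e2)
  have h2 : ContMDiffAt I 𝓘(ℝ, ℂ) ∞ (greenField C L φ ψ l) x := by
    have := ContMDiffAt.sum (t := Finset.univ) fun b _ => h1 b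
    refine this.congr_of_eventuallyEq (Filter.Eventually.of_forall fun y => ?_)
    simp [greenField]
  exact h2.contMDiffWithinAt

/-- The right side is the divergence of `∑_l ⟨c_l φ, ψ⟩ e_l`. The product rule and skewness of `c_l`
account for the derivatives, and the connection terms supply exactly the divergences of the frame
fields. -/
lemma green_formula {η : MixedForm I M} (hodd : ∀ k, Even k → ∀ x, η k x = 0)
    (hre : ∀ k, k % 4 = 3 → ∀ x v, (η k x v).im = 0)
    (him : ∀ k, k % 4 = 1 → ∀ x v, (η k x v).re = 0)
    (hφ : IsSmoothSection S E C univ φ) (hψ : IsSmoothSection S E C univ ψ)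
    (L : LocalFrame S E) (hx : x ∈ L.U) :
    ∑ b, inner ℂ (twistedDiracInFrame S E C η L φ x b) (ψ (L.spin x) (L.flat x) b)
      - ∑ b, inner ℂ (φ (L.spin x) (L.flat x) b) (twistedDiracInFrame S E C η L ψ x b)
      = ∑ l, (dirDeriv I (greenField C L φ ψ l) (L.vec l) x
        + frameDiv g L.vec l x • greenField C L φ ψ l x) := by
  have hφd := fun b => hφ.mdifferentiableAt_apply isOpen_univ (mem_univ x) L hx b
  have hψd := fun b => hψ.mdifferentiableAt_apply isOpen_univ (mem_univ x) L hx b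
  have hgd : ∀ l b, MDifferentiableAt I 𝓘(ℝ, Δ)
      (fun y => C.genL l (φ (L.spin y) (L.flat y) b)) x := fun l b =>
    ((C.genL l).restrictScalars ℝ).differentiableAt.comp_mdifferentiableAt (hφd b)
  have h1 : ∀ l, dirDeriv I (greenField C L φ ψ l) (L.vec l) x
      = ∑ b, (inner ℂ (C.gen l (dirDeriv I (fun y => φ (L.spin y) (L.flat y) b) (L.vec l) x))
          (ψ (L.spin x) (L.flat x) b)
        + inner ℂ (C.gen l (φ (L.spin x) (L.flat x) b))
          (dirDeriv I (fun y => ψ (L.spin y) (L.flat y) b) (L.vec l) x)) := by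
    intro l
    have hd : ∀ b, MDifferentiableAt I 𝓘(ℝ, ℂ) (fun y =>
        inner ℂ (C.genL l (φ (L.spin y) (L.flat y) b)) (ψ (L.spin y) (L.flat y) b)) x := by
      intro b
      have e3 : Differentiable ℝ fun p : Δ × Δ => inner ℂ p.1 p.2 :=
        (contDiff_inner (𝕜 := ℂ) (n := 1)).differentiable one_ne_zero
      exact (e3 _).comp_mdifferentiableAt ((hgd l b).prodMk_space (hψd b))
    have e0 := dirDeriv_sum Finset.univ (V := L.vec l) (f := fun b y =>
      inner ℂ (C.genL l (φ (L.spin y) (L.flat y) b)) (ψ (L.spin y) (L.flat y) b))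
      fun b _ => hd b
    have e1 : greenField C L φ ψ l = fun y => ∑ b,
      inner ℂ (C.genL l (φ (L.spin y) (L.flat y) b)) (ψ (L.spin y) (L.flat y) b) := by
      funext y
      simp [greenField]
    rw [e1, e0]
    refine Finset.sum_congr rfl fun b _ => ?_
    rw [dirDeriv_inner (hgd l b) (hψd b)]
    have e2 := dirDeriv_clm (V := L.vec l) ((C.genL l).restrictScalars ℝ) (hφd b)
    have e3 : dirDeriv I (fun y => C.genL l (φ (L.spin y) (L.flat y) b)) (L.vec l) x
      = C.genL l (dirDeriv I (fun y => φ (L.spin y) (L.flat y) b) (L.vec l) x) := e2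
    rw [e3]
    simp
  have h2 : ∀ b, inner ℂ (twistedDiracInFrame S E C η L φ x b) (ψ (L.spin x) (L.flat x) b)
      - inner ℂ (φ (L.spin x) (L.flat x) b) (twistedDiracInFrame S E C η L ψ x b)
      = ∑ l, (inner ℂ (C.gen l (dirDeriv I (fun y => φ (L.spin y) (L.flat y) b) (L.vec l) x))
          (ψ (L.spin x) (L.flat x) b)
        + inner ℂ (C.gen l (φ (L.spin x) (L.flat x) b))
          (dirDeriv I (fun y => ψ (L.spin y) (L.flat y) b) (L.vec l) x)
        + (frameDiv g L.vec l x : ℂ) * inner ℂ (C.gen l (φ (L.spin x) (L.flat x) b))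
          (ψ (L.spin x) (L.flat x) b)) := by
    intro b
    rw [twistedDiracInFrame_apply hφ isOpen_univ (mem_univ x) η L hx,
      twistedDiracInFrame_apply hψ isOpen_univ (mem_univ x) η L hx, inner_add_left,
      inner_add_right, add_sub_add_comm, inner_diracZeroth hodd hre him, sum_inner, inner_sum,
      ← Finset.sum_sub_distrib, ← Finset.sum_add_distrib]
    refine Finset.sum_congr rfl fun l _ => ?_
    rw [C.gen_skew l (φ (L.spin x) (L.flat x) b)
      (dirDeriv I (fun y => ψ (L.spin y) (L.flat y) b) (L.vec l) x), sub_eq_add_neg]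
  rw [← Finset.sum_sub_distrib]
  simp only [h1, h2]
  rw [Finset.sum_comm]
  refine Finset.sum_congr rfl fun l _ => ?_
  rw [Finset.sum_add_distrib, greenField, Finset.smul_sum]
  simp only [Complex.real_smul]

lemma contMDiffOn_leviCivitaCoeff (L : LocalFrame S E) (i j l : Fin d) :
    ContMDiffOn I 𝓘(ℝ, ℝ) ∞ (fun x => leviCivitaCoeff g L.vec x i j l) L.U := by
  have h : ∀ i j l, ContMDiffOn I 𝓘(ℝ, ℝ) ∞ (fun x =>
      g.inner x (VectorField.mlieBracket I (L.vec i) (L.vec j) x) (L.vec l x)) L.U := fun i j l =>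
    g.contMDiffOn_inner (SmoothVF.mlieBracket L.isOpen_U (L.vec_smooth i) (L.vec_smooth j))
      (L.vec_smooth l)
  exact (((h i j l).sub (h j l i)).add (h l i j)).div_const 2

lemma continuousOn_diracZeroth {η : MixedForm I M} (L : LocalFrame S E)
    (hη : ∀ (k : ℕ) (i : Fin k → Fin d),
      ContinuousOn (fun x => η k x fun j => L.vec (i j) x) L.U)
    {u : M → Δ} (hu : ContinuousOn u L.U) :
    ContinuousOn (fun x => diracZeroth g C η L.vec x (u x)) L.U := by
  have hT : ∀ T : Module.End ℂ Δ, ContinuousOn (fun x => T (u x)) L.U := fun T => by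
    have := C.finiteDimensional
    exact T.continuous_of_finiteDimensional.comp_continuousOn hu
  simp only [diracZeroth, cliffMul, SpinorModule.bivector, LinearMap.add_apply, LinearMap.sum_apply,
    LinearMap.smul_apply, mul_smul_comm, Finset.mul_sum]
  refine ContinuousOn.add ?_ ?_
  · refine continuousOn_finsetSum _ fun i _ => ContinuousOn.const_smul ?_ _
    refine continuousOn_finsetSum _ fun j _ => continuousOn_finsetSum _ fun l _ => ?_
    exact (contMDiffOn_leviCivitaCoeff L i j l).continuousOn.smul (hT _)
  · refine continuousOn_finsetSum _ fun k _ => ContinuousOn.const_smul ?_ _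
    exact continuousOn_finsetSum _ fun i _ => (hη k i).smul (hT _)

lemma continuousOn_twistedDiracInFrame {η : MixedForm I M} (L : LocalFrame S E)
    (hη : ∀ (k : ℕ) (i : Fin k → Fin d),
      ContinuousOn (fun x => η k x fun j => L.vec (i j) x) L.U)
    (hφ : IsSmoothSection S E C univ φ) (b : Fin N) :
    ContinuousOn (fun x => twistedDiracInFrame S E C η L φ x b) L.U := by
  have h0 : ContMDiffOn I 𝓘(ℝ, Δ) ∞ (fun y => φ (L.spin y) (L.flat y) b) L.U := fun x hx =>
    (hφ.contMDiffAt_apply isOpen_univ (mem_univ x) L hx b).contMDiffWithinAt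
  have h1 : ContinuousOn (fun x => ∑ i, C.genL i
      (dirDeriv I (fun y => φ (L.spin y) (L.flat y) b) (L.vec i) x)
      + diracZeroth g C η L.vec x (φ (L.spin x) (L.flat x) b)) L.U := by
    refine ContinuousOn.add (continuousOn_finsetSum _ fun i _ => ?_)
      (continuousOn_diracZeroth L hη h0.continuousOn)
    exact (C.genL i).continuous.comp_continuousOn
      (contMDiffOn_dirDeriv L.isOpen_U h0 (L.vec_smooth i)).continuousOn
  refine h1.congr fun x hx => ?_
  rw [twistedDiracInFrame_apply hφ isOpen_univ (mem_univ x) η L hx]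
  simp

lemma spinorPairing_dirac (hd : 0 < d) (η : MixedForm I M) (hφ : IsSmoothSection S E C univ φ)
    (hψ : IsSmoothSection S E C univ ψ) (L : LocalFrame S E) (hx : x ∈ L.U) :
    spinorPairing S E (twistedDirac S E C η φ) ψ x
      = ∑ b, inner ℂ (twistedDiracInFrame S E C η L φ x b) (ψ (L.spin x) (L.flat x) b) := by
  rw [spinorPairing_eq (C := C) (L.spin_proj x hx) (L.flat_proj x hx)
    (fun q f h a u b => twistedDirac_equivariant hd hφ isOpen_univ η h (mem_univ _) a u b)
    (fun q f h a u b => hψ.equivariant q f h (mem_univ _) a u b),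
    twistedDirac_localFrame hd hφ isOpen_univ η L (mem_univ x) hx]

lemma conj_spinorPairing (φ ψ : SpinorField Q P Δ N) (x : M) :
    (starRingEnd ℂ) (spinorPairing S E φ ψ x) = spinorPairing S E ψ φ x := by
  simp only [spinorPairing, map_sum, inner_conj_symm]

lemma spinorPairing_dirac' (hd : 0 < d) (η : MixedForm I M) (hφ : IsSmoothSection S E C univ φ)
    (hψ : IsSmoothSection S E C univ ψ) (L : LocalFrame S E) (hx : x ∈ L.U) :
    spinorPairing S E φ (twistedDirac S E C η ψ) x
      = ∑ b, inner ℂ (φ (L.spin x) (L.flat x) b) (twistedDiracInFrame S E C η L ψ x b) := by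
  rw [← conj_spinorPairing, spinorPairing_dirac hd η hψ hφ L hx, map_sum]
  simp only [inner_conj_symm]

lemma exists_localFrame_at (S : SpinStructure g Q) (E : FlatHermitianBundle M N P) (x : M) :
    ∃ L : LocalFrame S E, x ∈ L.U := by
  obtain ⟨q, hq⟩ := S.surjective x
  obtain ⟨f, hf⟩ := E.surjective x
  obtain ⟨L, hL, -⟩ := LocalFrame.exists_through S E q f (hq.trans hf.symm)
  exact ⟨L, hq ▸ hL⟩

lemma continuous_spinorPairing_dirac (hd : 0 < d) {η : MixedForm I M}
    (hη : ∀ (L : LocalFrame S E) (k : ℕ) (i : Fin k → Fin d),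
      ContinuousOn (fun x => η k x fun j => L.vec (i j) x) L.U)
    (hφ : IsSmoothSection S E C univ φ) (hψ : IsSmoothSection S E C univ ψ) :
    Continuous (spinorPairing S E (twistedDirac S E C η φ) ψ) := by
  rw [continuous_iff_continuousAt]
  intro x
  obtain ⟨L, hx⟩ := exists_localFrame_at S E x
  have h1 : ContinuousOn (fun x => ∑ b, inner ℂ (twistedDiracInFrame S E C η L φ x b)
      (ψ (L.spin x) (L.flat x) b)) L.U := by
    refine continuousOn_finsetSum _ fun b _ => ContinuousOn.inner
      (continuousOn_twistedDiracInFrame L (hη L) hφ b) fun y hy => ?_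
    exact (hψ.contMDiffAt_apply isOpen_univ (mem_univ y) L hy b).continuousAt.continuousWithinAt
  refine (h1.continuousAt (L.isOpen_U.mem_nhds hx)).congr ?_
  filter_upwards [L.isOpen_U.mem_nhds hx] with y hy
  exact (spinorPairing_dirac hd η hφ hψ L hy).symm

lemma continuous_spinorPairing_dirac' (hd : 0 < d) {η : MixedForm I M}
    (hη : ∀ (L : LocalFrame S E) (k : ℕ) (i : Fin k → Fin d),
      ContinuousOn (fun x => η k x fun j => L.vec (i j) x) L.U)
    (hφ : IsSmoothSection S E C univ φ) (hψ : IsSmoothSection S E C univ ψ) :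
    Continuous (spinorPairing S E φ (twistedDirac S E C η ψ)) := by
  have h := Complex.continuous_conj.comp (continuous_spinorPairing_dirac hd hη hψ hφ)
  refine h.congr fun x => ?_
  exact conj_spinorPairing _ _ x

end Frames

/-! ### Integration by parts on compact manifolds without boundary -/

section Closed

variable {d : ℕ} {M : Type*} [TopologicalSpace M] [ChartedSpace (EuclideanSpace ℝ (Fin d)) M]
  [IsManifold (𝓡 d) ∞ M]
  {g : RiemMetric (𝓡 d) M} {x₀ : M} {z : EuclideanSpace ℝ (Fin d)}
  {Q : Type*} [TopologicalSpace Q] {N : ℕ} {P : Type*}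
  [TopologicalSpace P] {S : SpinStructure g Q} {E : FlatHermitianBundle M N P}
  {Δ : Type*} [NormedAddCommGroup Δ] [InnerProductSpace ℂ Δ]
  {C : SpinorModule d Δ} {W : Set M} {ψ φ : SpinorField Q P Δ N}

/-- The differential of the inverse of the chart at `x₀`. -/
def chartDiff (x₀ : M) (z : EuclideanSpace ℝ (Fin d)) :
    EuclideanSpace ℝ (Fin d) →L[ℝ] TangentSpace (𝓡 d) ((extChartAt (𝓡 d) x₀).symm z) :=
  mfderivWithin 𝓘(ℝ, EuclideanSpace ℝ (Fin d)) (𝓡 d) (extChartAt (𝓡 d) x₀).symm (range (𝓡 d)) z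

/-- The density of the Riemannian volume in the chart at `x₀`. -/
def volDensity (g : RiemMetric (𝓡 d) M) (x₀ : M) (z : EuclideanSpace ℝ (Fin d)) : ℝ :=
  Real.sqrt (Matrix.det (Matrix.of fun i j : Fin d => g.inner ((extChartAt (𝓡 d) x₀).symm z)
    (chartDiff x₀ z (EuclideanSpace.single i (1 : ℝ)))
    (chartDiff x₀ z (EuclideanSpace.single j (1 : ℝ)))))

/-- The vectors of a local frame in the chart at `x₀`. -/
def chartFrame (L : LocalFrame S E) (x₀ : M) (j : Fin d) (z : EuclideanSpace ℝ (Fin d)) :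
    EuclideanSpace ℝ (Fin d) :=
  dirDeriv (𝓡 d) (extChartAt (𝓡 d) x₀) (L.vec j) ((extChartAt (𝓡 d) x₀).symm z)

lemma chartDiff_chartFrame (L : LocalFrame S E) (hz : z ∈ (extChartAt (𝓡 d) x₀).target)
    (j : Fin d) :
    chartDiff x₀ z (chartFrame L x₀ j z) = L.vec j ((extChartAt (𝓡 d) x₀).symm z) :=
  congrArg (fun T => T (L.vec j ((extChartAt (𝓡 d) x₀).symm z)))
    (mfderivWithin_extChartAt_symm_comp_mfderiv_extChartAt hz)

/-- If `B` holds the chart coordinates of an orthonormal frame and `G` is the Gram matrix of the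
chart, then `B G Bᵀ = 1`. So the density is `1 / |det B|`, which gives its smoothness and its
derivative. -/
lemma volDensity_mul_det (L : LocalFrame S E) (hz : z ∈ (extChartAt (𝓡 d) x₀).target)
    (hzU : (extChartAt (𝓡 d) x₀).symm z ∈ L.U) :
    volDensity g x₀ z * |detForm d fun j => chartFrame L x₀ j z| = 1 := by
  set G : Matrix (Fin d) (Fin d) ℝ := Matrix.of fun i j : Fin d =>
    g.inner ((extChartAt (𝓡 d) x₀).symm z) (chartDiff x₀ z (EuclideanSpace.single i (1 : ℝ)))
      (chartDiff x₀ z (EuclideanSpace.single j (1 : ℝ))) with hG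
  set B : Matrix (Fin d) (Fin d) ℝ := Matrix.of fun i j => chartFrame L x₀ i z j with hB
  have hexp : ∀ v : EuclideanSpace ℝ (Fin d), chartDiff x₀ z v
      = ∑ a, v a • chartDiff x₀ z (EuclideanSpace.single a (1 : ℝ)) := by
    intro v
    conv_lhs => rw [← (EuclideanSpace.basisFun (Fin d) ℝ).sum_repr v, map_sum]
    refine Finset.sum_congr rfl fun a _ => ?_
    rw [map_smul]
    simp
  have h1 : B * G * B.transpose = 1 := by
    ext j k
    rw [Matrix.one_apply, ← L.inner_vec hzU j k, ← chartDiff_chartFrame L hz j,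
      ← chartDiff_chartFrame L hz k, hexp (chartFrame L x₀ j z), hexp (chartFrame L x₀ k z)]
    simp only [Matrix.mul_apply, map_sum, map_smul, sum_apply, smul_apply, smul_eq_mul,
      Matrix.transpose_apply, Finset.sum_mul, Finset.mul_sum]
    refine Finset.sum_congr rfl fun a _ => Finset.sum_congr rfl fun b _ => ?_
    simp only [hB, hG, Matrix.of_apply]
    ring
  have h2 : B.det ^ 2 * G.det = 1 := by
    have := congrArg Matrix.det h1
    rw [Matrix.det_mul, Matrix.det_mul, Matrix.det_transpose, Matrix.det_one] at this
    linear_combination this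
  have h3 : volDensity g x₀ z = Real.sqrt G.det := rfl
  have h4 : (detForm d fun j => chartFrame L x₀ j z) = B.det := rfl
  have h5 : 0 < G.det := by
    by_contra h
    have := mul_nonpos_of_nonneg_of_nonpos (sq_nonneg B.det) (not_lt.1 h)
    linarith
  rw [h3, h4, ← Real.sqrt_sq_eq_abs, ← Real.sqrt_mul h5.le, mul_comm, h2, Real.sqrt_one]

lemma fderiv_comp_chart_symm {F : Type*} [NormedAddCommGroup F] [NormedSpace ℝ F] {f : M → F}
    (L : LocalFrame S E) (hz : z ∈ (extChartAt (𝓡 d) x₀).target)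
    (hf : MDifferentiableAt (𝓡 d) 𝓘(ℝ, F) f ((extChartAt (𝓡 d) x₀).symm z)) (j : Fin d) :
    fderiv ℝ (fun y => f ((extChartAt (𝓡 d) x₀).symm y)) z (chartFrame L x₀ j z)
      = dirDeriv (𝓡 d) f (L.vec j) ((extChartAt (𝓡 d) x₀).symm z) := by
  have h2 : MDifferentiableWithinAt 𝓘(ℝ, EuclideanSpace ℝ (Fin d)) (𝓡 d)
      (extChartAt (𝓡 d) x₀).symm (range (𝓡 d)) z := mdifferentiableWithinAt_extChartAt_symm hz
  have h3 := mfderiv_comp_mfderivWithin (I := 𝓘(ℝ, EuclideanSpace ℝ (Fin d))) (I' := 𝓡 d)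
    (I'' := 𝓘(ℝ, F)) (f := (extChartAt (𝓡 d) x₀).symm) (g := f) (s := range (𝓡 d)) z hf h2
    ((𝓡 d).uniqueMDiffOn z (extChartAt_target_subset_range x₀ hz))
  rw [mfderivWithin_eq_fderivWithin, ModelWithCorners.range_eq_univ, fderivWithin_univ] at h3
  have h4 := congrArg (fun T => T (chartFrame L x₀ j z)) h3
  refine h4.trans ?_
  have h5 := chartDiff_chartFrame L hz j
  unfold chartDiff at h5
  rw [ModelWithCorners.range_eq_univ] at h5
  exact congrArg (mfderiv (𝓡 d) 𝓘(ℝ, F) f ((extChartAt (𝓡 d) x₀).symm z)) h5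

/-- The part of the chart at `x₀` over the domain of a local frame. -/
def chartDomain (L : LocalFrame S E) (x₀ : M) : Set (EuclideanSpace ℝ (Fin d)) :=
  (extChartAt (𝓡 d) x₀).target ∩ (extChartAt (𝓡 d) x₀).symm ⁻¹' L.U

lemma isOpen_chartDomain (L : LocalFrame S E) (x₀ : M) : IsOpen (chartDomain L x₀) :=
  (continuousOn_extChartAt_symm x₀).isOpen_inter_preimage (isOpen_extChartAt_target x₀) L.isOpen_U

lemma contDiffOn_comp_chart_symm {F : Type*} [NormedAddCommGroup F] [NormedSpace ℝ F] {f : M → F}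
    {L : LocalFrame S E} (hf : ContMDiffOn (𝓡 d) 𝓘(ℝ, F) ∞ f (L.U ∩ (chartAt (EuclideanSpace ℝ (Fin d)) x₀).source)) :
    ContDiffOn ℝ ∞ (fun y => f ((extChartAt (𝓡 d) x₀).symm y)) (chartDomain L x₀) := by
  rw [← contMDiffOn_iff_contDiffOn]
  refine hf.comp ((contMDiffOn_extChartAt_symm x₀).mono inter_subset_left) fun z hz => ⟨hz.2, ?_⟩
  rw [← extChartAt_source (I := 𝓡 d)]
  exact (extChartAt (𝓡 d) x₀).map_target hz.1

lemma contMDiffOn_dirDeriv_chart (L : LocalFrame S E) (x₀ : M) (j : Fin d) :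
    ContMDiffOn (𝓡 d) 𝓘(ℝ, EuclideanSpace ℝ (Fin d)) ∞
      (dirDeriv (𝓡 d) (extChartAt (𝓡 d) x₀) (L.vec j)) (L.U ∩ (chartAt (EuclideanSpace ℝ (Fin d)) x₀).source) :=
  contMDiffOn_dirDeriv (L.isOpen_U.inter (chartAt (EuclideanSpace ℝ (Fin d)) x₀).open_source)
    (contMDiffOn_extChartAt.mono inter_subset_right) ((L.vec_smooth j).mono inter_subset_left)

lemma contDiffOn_chartFrame (L : LocalFrame S E) (x₀ : M) (j : Fin d) :
    ContDiffOn ℝ ∞ (chartFrame L x₀ j) (chartDomain L x₀) :=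
  contDiffOn_comp_chart_symm (contMDiffOn_dirDeriv_chart L x₀ j)

lemma volDensity_eventually (L : LocalFrame S E) (hz : z ∈ chartDomain L x₀) :
    ∀ᶠ y in nhds z, volDensity g x₀ y * |detForm d fun j => chartFrame L x₀ j y| = 1 := by
  filter_upwards [(isOpen_chartDomain L x₀).mem_nhds hz] with y hy
  exact volDensity_mul_det L hy.1 hy.2

lemma contDiffOn_volDensity (L : LocalFrame S E) (x₀ : M) :
    ContDiffOn ℝ ∞ (volDensity g x₀) (chartDomain L x₀) := by
  intro z hz
  have hO := (isOpen_chartDomain L x₀).mem_nhds hz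
  have h1 : ContDiffAt ℝ ∞ (fun y => detForm d fun j => chartFrame L x₀ j y) z :=
    (detForm d).contDiff.contDiffAt.comp z (contDiffAt_pi.2 fun j =>
      (contDiffOn_chartFrame L x₀ j).contDiffAt hO)
  have h2 : (detForm d fun j => chartFrame L x₀ j z) ≠ 0 := by
    intro h
    have := volDensity_mul_det (g := g) L hz.1 hz.2
    rw [h] at this
    simp at this
  have h3 := (h1.abs h2).inv (abs_ne_zero.2 h2)
  refine (h3.congr_of_eventuallyEq ?_).contDiffWithinAt
  filter_upwards [volDensity_eventually L hz] with y hy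
  exact eq_inv_of_mul_eq_one_left hy

/-- `eDiv_frame` applied to the coordinate frame; its commutators are the coordinates of the
brackets on `M`, whose trace is `frameDiv`. -/
lemma eDiv_chartFrame (L : LocalFrame S E) (hz : z ∈ chartDomain L x₀) (l : Fin d) :
    eDiv (fun y => volDensity g x₀ y • chartFrame L x₀ l y) z
      = volDensity g x₀ z * frameDiv g L.vec l ((extChartAt (𝓡 d) x₀).symm z) := by
  have hO := (isOpen_chartDomain L x₀).mem_nhds hz
  set x := (extChartAt (𝓡 d) x₀).symm z with hx
  have hxs : x ∈ (chartAt (EuclideanSpace ℝ (Fin d)) x₀).source := by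
    rw [← extChartAt_source (I := 𝓡 d)]
    exact (extChartAt (𝓡 d) x₀).map_target hz.1
  have hoU := L.isOpen_U.inter (chartAt (EuclideanSpace ℝ (Fin d)) x₀).open_source
  refine (eDiv_frame (E := chartFrame L x₀)
    (fun j => ((contDiffOn_chartFrame L x₀ j).contDiffAt hO).differentiableAt (by simp))
    (volDensity_eventually L hz) l
    (c := fun j k => g.inner x (L.vec k x)
      (VectorField.mlieBracket (𝓡 d) (L.vec j) (L.vec l) x)) fun j => ?_).2
  have hd : ∀ j, MDifferentiableAt (𝓡 d) 𝓘(ℝ, EuclideanSpace ℝ (Fin d))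
      (dirDeriv (𝓡 d) (extChartAt (𝓡 d) x₀) (L.vec j)) x := fun j =>
    mdifferentiableAt_of_contMDiffOn (contMDiffOn_dirDeriv_chart L x₀ j) hoU ⟨hz.2, hxs⟩
  have h1 : ∀ l j, fderiv ℝ (chartFrame L x₀ l) z (chartFrame L x₀ j z)
      = dirDeriv (𝓡 d) (dirDeriv (𝓡 d) (extChartAt (𝓡 d) x₀) (L.vec l)) (L.vec j) x :=
    fun l j => fderiv_comp_chart_symm L hz.1 (hd l) j
  rw [h1, h1, ← mfderiv_mlieBracket hoU ⟨hz.2, hxs⟩ (contMDiffOn_extChartAt.mono inter_subset_right)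
    ((L.vec_smooth j).mono inter_subset_left) ((L.vec_smooth l).mono inter_subset_left)]
  exact dirDeriv_vec_sum Finset.univ (extChartAt (𝓡 d) x₀) _ L.vec
    (orthonormal_expansion (fun i j => L.inner_vec hz.2 i j) _)

/-! ### The Riemannian volume measure in charts -/

section Volume

variable [MeasurableSpace M] [BorelSpace M] {μ : Measure M}

lemma aemeasurable_volDensity (S : SpinStructure g Q) (E : FlatHermitianBundle M N P) (x₀ : M) :
    AEMeasurable (volDensity g x₀) (volume.restrict (extChartAt (𝓡 d) x₀).target) := by
  have : ContinuousOn (volDensity g x₀) (extChartAt (𝓡 d) x₀).target := by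
    intro z hz
    obtain ⟨L, hL⟩ := exists_localFrame_at S E ((extChartAt (𝓡 d) x₀).symm z)
    exact ((contDiffOn_volDensity L x₀).contDiffAt
      ((isOpen_chartDomain L x₀).mem_nhds ⟨hz, hL⟩)).continuousAt.continuousWithinAt
  exact this.aemeasurable (isOpen_extChartAt_target x₀).measurableSet

lemma image_extChartAt_inter (x₀ : M) (A : Set M) :
    extChartAt (𝓡 d) x₀ '' (A ∩ (chartAt (EuclideanSpace ℝ (Fin d)) x₀).source)
      = (extChartAt (𝓡 d) x₀).target ∩ (extChartAt (𝓡 d) x₀).symm ⁻¹' A := by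
  rw [← extChartAt_source (I := 𝓡 d), inter_comm]
  exact (extChartAt (𝓡 d) x₀).image_source_inter_eq' A

/-- The volume is prescribed only on subsets of single chart domains; rewritten as the push-forward
of a density, it gives integrals of functions supported in a chart. -/
lemma IsRiemannianVolume.restrict_source (hμ : IsRiemannianVolume g μ) (x₀ : M) :
    μ.restrict (chartAt (EuclideanSpace ℝ (Fin d)) x₀).source
      = (((volume.restrict (extChartAt (𝓡 d) x₀).target).withDensity
          fun z => ENNReal.ofReal (volDensity g x₀ z)).map (extChartAt (𝓡 d) x₀).symm) := by
  have hm : AEMeasurable (extChartAt (𝓡 d) x₀).symm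
      (volume.restrict (extChartAt (𝓡 d) x₀).target) :=
    (continuousOn_extChartAt_symm x₀).aemeasurable (isOpen_extChartAt_target x₀).measurableSet
  have hm' := hm.mono_ac (withDensity_absolutelyContinuous
    (volume.restrict (extChartAt (𝓡 d) x₀).target) fun z => ENNReal.ofReal (volDensity g x₀ z))
  ext A hA
  rw [Measure.restrict_apply hA, hμ x₀ _ inter_subset_right
    (hA.inter (chartAt (EuclideanSpace ℝ (Fin d)) x₀).open_source.measurableSet),
    Measure.map_apply_of_aemeasurable hm' hA, withDensity_apply', image_extChartAt_inter,
    Measure.restrict_restrict', inter_comm]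
  · rfl
  · exact (isOpen_extChartAt_target x₀).measurableSet

lemma IsRiemannianVolume.integral_eq (hμ : IsRiemannianVolume g μ) (S : SpinStructure g Q)
    (E : FlatHermitianBundle M N P) {u : M → ℂ} (hu : Continuous u)
    (h0 : ∀ x ∉ (chartAt (EuclideanSpace ℝ (Fin d)) x₀).source, u x = 0) :
    ∫ x, u x ∂μ = ∫ z in (extChartAt (𝓡 d) x₀).target,
      volDensity g x₀ z • u ((extChartAt (𝓡 d) x₀).symm z) := by
  have hm : AEMeasurable (extChartAt (𝓡 d) x₀).symm
      (volume.restrict (extChartAt (𝓡 d) x₀).target) :=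
    (continuousOn_extChartAt_symm x₀).aemeasurable (isOpen_extChartAt_target x₀).measurableSet
  have hm' := hm.mono_ac (withDensity_absolutelyContinuous
    (volume.restrict (extChartAt (𝓡 d) x₀).target) fun z => ENNReal.ofReal (volDensity g x₀ z))
  rw [← setIntegral_eq_integral_of_forall_compl_eq_zero h0, hμ.restrict_source x₀,
    integral_map hm' hu.aestronglyMeasurable,
    integral_withDensity_eq_integral_toReal_smul₀
      (aemeasurable_volDensity S E x₀).ennreal_ofReal (by simp)]
  refine integral_congr_ae (Filter.Eventually.of_forall fun z => ?_)
  simp only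
  rw [ENNReal.toReal_ofReal (show 0 ≤ volDensity g x₀ z from Real.sqrt_nonneg _)]

/-- The density is continuous, hence bounded near the centre of the chart. This is what makes
continuous functions on the compact manifold integrable. -/
lemma IsRiemannianVolume.isLocallyFiniteMeasure (hμ : IsRiemannianVolume g μ)
    (S : SpinStructure g Q) (E : FlatHermitianBundle M N P) : IsLocallyFiniteMeasure μ := by
  refine ⟨fun x₀ => ?_⟩
  obtain ⟨L, hL⟩ := exists_localFrame_at S E x₀
  have hx : x₀ ∈ (extChartAt (𝓡 d) x₀).source := mem_extChartAt_source x₀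
  have hz : extChartAt (𝓡 d) x₀ x₀ ∈ chartDomain L x₀ :=
    ⟨mem_extChartAt_target x₀, by rwa [mem_preimage, extChartAt_to_inv]⟩
  have hw := ((contDiffOn_volDensity (g := g) L x₀).contDiffAt
    ((isOpen_chartDomain L x₀).mem_nhds hz)).continuousAt
  obtain ⟨r, hr, hrO⟩ := Metric.nhds_basis_ball.mem_iff.1
    (Filter.inter_mem ((isOpen_extChartAt_target (I := 𝓡 d) x₀).mem_nhds (mem_extChartAt_target x₀))
      (hw (Metric.ball_mem_nhds _ one_pos)))
  set B := Metric.ball (extChartAt (𝓡 d) x₀ x₀) r with hB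
  set A := (extChartAt (𝓡 d) x₀).source ∩ extChartAt (𝓡 d) x₀ ⁻¹' B with hA
  have hAo : IsOpen A := (continuousOn_extChartAt x₀).isOpen_inter_preimage
    (isOpen_extChartAt_source x₀) Metric.isOpen_ball
  refine ⟨A, hAo.mem_nhds ⟨hx, Metric.mem_ball_self hr⟩, ?_⟩
  have hAB : extChartAt (𝓡 d) x₀ '' A ⊆ B := by
    rintro _ ⟨y, hy, rfl⟩
    exact hy.2
  rw [hμ x₀ A (by rw [← extChartAt_source (I := 𝓡 d)]; exact inter_subset_left) hAo.measurableSet]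
  have hb : ∀ z ∈ B, ENNReal.ofReal (volDensity g x₀ z)
      ≤ ENNReal.ofReal (volDensity g x₀ (extChartAt (𝓡 d) x₀ x₀) + 1) := by
    intro z hz
    refine ENNReal.ofReal_le_ofReal ?_
    have h1 : volDensity g x₀ z ∈ Metric.ball (volDensity g x₀ (extChartAt (𝓡 d) x₀ x₀)) 1 :=
      (hrO hz).2
    rw [Metric.mem_ball, Real.dist_eq] at h1
    have h2 := (abs_lt.1 h1).2
    linarith
  refine (lintegral_mono_set hAB).trans_lt ?_
  refine (setLIntegral_mono' Metric.isOpen_ball.measurableSet hb).trans_lt ?_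
  rw [setLIntegral_const]
  exact ENNReal.mul_lt_top ENNReal.ofReal_lt_top measure_ball_lt_top

end Volume

end Closed

/-! ### Formal self-adjointness of the twisted Dirac operator -/

section SelfAdjoint

variable {d : ℕ} {M : Type*} [TopologicalSpace M] [ChartedSpace (EuclideanSpace ℝ (Fin d)) M]
  [IsManifold (𝓡 d) ∞ M]
  {g : RiemMetric (𝓡 d) M} {x x₀ : M} {z : EuclideanSpace ℝ (Fin d)}
  {Q : Type*} [TopologicalSpace Q] {N : ℕ} {P : Type*}
  [TopologicalSpace P] {S : SpinStructure g Q} {E : FlatHermitianBundle M N P}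
  {Δ : Type*} [NormedAddCommGroup Δ] [InnerProductSpace ℂ Δ]
  {C : SpinorModule d Δ} {W : Set M} {ψ φ : SpinorField Q P Δ N}

/-- The pointwise defect of symmetry of the twisted Dirac operator. -/
def diracDefect (S : SpinStructure g Q) (E : FlatHermitianBundle M N P) (C : SpinorModule d Δ)
    (η : MixedForm (𝓡 d) M) (φ ψ : SpinorField Q P Δ N) (x : M) : ℂ :=
  spinorPairing S E (twistedDirac S E C η φ) ψ x - spinorPairing S E φ (twistedDirac S E C η ψ) x

lemma diracDefect_spinorSmul (hd : 0 < d) (η : MixedForm (𝓡 d) M)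
    (hφ : IsSmoothSection S E C univ φ) (hψ : IsSmoothSection S E C univ ψ) {ρ : M → ℝ}
    (hρ : ContMDiff (𝓡 d) 𝓘(ℝ, ℝ) ∞ ρ) (L : LocalFrame S E) (hx : x ∈ L.U) :
    diracDefect S E C η (spinorSmul S ρ φ) ψ x = ρ x • diracDefect S E C η φ ψ x
      + ∑ b, inner ℂ (C.c (fun i => dirDeriv (𝓡 d) ρ (L.vec i) x) (φ (L.spin x) (L.flat x) b))
        (ψ (L.spin x) (L.flat x) b) := by
  rw [diracDefect, diracDefect, spinorPairing_dirac hd η (hφ.spinorSmul hρ) hψ L hx,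
    spinorPairing_dirac' hd η (hφ.spinorSmul hρ) hψ L hx, spinorPairing_dirac hd η hφ hψ L hx,
    spinorPairing_dirac' hd η hφ hψ L hx]
  have h1 : ∀ b, spinorSmul S ρ φ (L.spin x) (L.flat x) b
      = (ρ x : ℂ) • φ (L.spin x) (L.flat x) b := fun b => by
    simp [spinorSmul, L.spin_proj x hx]
  simp only [twistedDiracInFrame_spinorSmul hφ isOpen_univ (mem_univ x) η L hx hρ, h1,
    inner_add_left, ← Complex.coe_smul, inner_smul_left, Complex.conj_ofReal,
    Finset.sum_add_distrib, smul_eq_mul, ← Finset.mul_sum]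
  ring

lemma diracDefect_spinorSmul_eq_zero (hd : 0 < d) (η : MixedForm (𝓡 d) M)
    (hφ : IsSmoothSection S E C univ φ) (hψ : IsSmoothSection S E C univ ψ) {ρ : M → ℝ}
    (hρ : ContMDiff (𝓡 d) 𝓘(ℝ, ℝ) ∞ ρ) (hx : x ∉ tsupport ρ) :
    diracDefect S E C η (spinorSmul S ρ φ) ψ x = 0 := by
  obtain ⟨L, hL⟩ := exists_localFrame_at S E x
  have h0 : ρ =ᶠ[nhds x] fun _ => (0 : ℝ) := notMem_tsupport_iff_eventuallyEq.1 hx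
  rw [diracDefect_spinorSmul hd η hφ hψ hρ L hL, h0.self_of_nhds]
  have h1 : ∀ i, dirDeriv (𝓡 d) ρ (L.vec i) x = 0 := fun i =>
    (dirDeriv_congr h0).trans (dirDeriv_const _ _)
  have h2 : (fun i => dirDeriv (𝓡 d) ρ (L.vec i) x) = (0 : Fin d → ℝ) := funext h1
  rw [h2]
  simp

/-- Each cut-off produces a symbol term `c(dρ_i)`; these add up to the symbol at `d(∑ ρ_i) = 0`.
Hence the defect may be localised. -/
lemma sum_diracDefect_spinorSmul (hd : 0 < d) (η : MixedForm (𝓡 d) M)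
    (hφ : IsSmoothSection S E C univ φ) (hψ : IsSmoothSection S E C univ ψ) {ι : Type*}
    {s : Finset ι} {ρ : ι → M → ℝ} (hρ : ∀ i, ContMDiff (𝓡 d) 𝓘(ℝ, ℝ) ∞ (ρ i))
    (hsum : ∀ y, ∑ i ∈ s, ρ i y = 1) (x : M) :
    ∑ i ∈ s, diracDefect S E C η (spinorSmul S (ρ i) φ) ψ x = diracDefect S E C η φ ψ x := by
  obtain ⟨L, hL⟩ := exists_localFrame_at S E x
  have hd0 : ∀ j, ∑ i ∈ s, dirDeriv (𝓡 d) (ρ i) (L.vec j) x = 0 := by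
    intro j
    refine (dirDeriv_sum s (f := ρ) fun i _ => (hρ i).mdifferentiableAt (by simp)).symm.trans ?_
    refine (dirDeriv_congr (f' := fun _ => (1 : ℝ)) (Filter.Eventually.of_forall hsum)).trans ?_
    exact dirDeriv_const _ _
  simp only [fun i => diracDefect_spinorSmul hd η hφ hψ (hρ i) L hL, Finset.sum_add_distrib,
    ← Finset.sum_smul, hsum, one_smul]
  rw [Finset.sum_comm, add_eq_left]
  refine Finset.sum_eq_zero fun b _ => ?_
  rw [← sum_inner]
  have h1 : ∑ i ∈ s, C.c (fun j => dirDeriv (𝓡 d) (ρ i) (L.vec j) x)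
      (φ (L.spin x) (L.flat x) b) = 0 := by
    rw [← LinearMap.sum_apply, ← map_sum]
    have h2 : ∑ i ∈ s, (fun j => dirDeriv (𝓡 d) (ρ i) (L.vec j) x) = (0 : Fin d → ℝ) := by
      funext j
      rw [Finset.sum_apply]
      exact hd0 j
    rw [h2]
    simp
  rw [h1, inner_zero_left]

lemma continuous_diracDefect (hd : 0 < d) {η : MixedForm (𝓡 d) M}
    (hη : ∀ (L : LocalFrame S E) (k : ℕ) (i : Fin k → Fin d),
      ContinuousOn (fun x => η k x fun j => L.vec (i j) x) L.U)
    (hφ : IsSmoothSection S E C univ φ) (hψ : IsSmoothSection S E C univ ψ) :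
    Continuous (diracDefect S E C η φ ψ) :=
  (continuous_spinorPairing_dirac hd hη hφ hψ).sub (continuous_spinorPairing_dirac' hd hη hφ hψ)

/-- Green's formula in chart coordinates, in the shape to which `setIntegral_divergence` applies. -/
lemma volDensity_smul_diracDefect (hd : 0 < d) {η : MixedForm (𝓡 d) M}
    (hodd : ∀ k, Even k → ∀ x, η k x = 0)
    (hre : ∀ k, k % 4 = 3 → ∀ x v, (η k x v).im = 0)
    (him : ∀ k, k % 4 = 1 → ∀ x v, (η k x v).re = 0)
    (hφ : IsSmoothSection S E C univ φ) (hψ : IsSmoothSection S E C univ ψ) (L : LocalFrame S E)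
    (hz : z ∈ chartDomain L x₀) :
    volDensity g x₀ z • diracDefect S E C η φ ψ ((extChartAt (𝓡 d) x₀).symm z)
      = ∑ l, (fderiv ℝ (fun y => greenField C L φ ψ l ((extChartAt (𝓡 d) x₀).symm y)) z
          (volDensity g x₀ z • chartFrame L x₀ l z)
        + eDiv (fun y => volDensity g x₀ y • chartFrame L x₀ l y) z
          • greenField C L φ ψ l ((extChartAt (𝓡 d) x₀).symm z)) := by
  rw [diracDefect, spinorPairing_dirac hd η hφ hψ L hz.2, spinorPairing_dirac' hd η hφ hψ L hz.2,
    green_formula hodd hre him hφ hψ L hz.2, Finset.smul_sum]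
  refine Finset.sum_congr rfl fun l _ => ?_
  have hf := mdifferentiableAt_of_contMDiffOn (contMDiffOn_greenField hφ hψ L l) L.isOpen_U hz.2
  rw [map_smul, fderiv_comp_chart_symm L hz.1 hf, eDiv_chartFrame L hz, smul_add, mul_smul]

variable [MeasurableSpace M] [BorelSpace M] {μ : Measure M}

/-- After the cut-off the defect is supported in one chart and one frame domain, where it is the
Euclidean divergence of compactly supported fields. -/
lemma integral_diracDefect_spinorSmul [CompactSpace M] (hμ : IsRiemannianVolume g μ) (hd : 0 < d)
    {η : MixedForm (𝓡 d) M} (hodd : ∀ k, Even k → ∀ x, η k x = 0)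
    (hre : ∀ k, k % 4 = 3 → ∀ x v, (η k x v).im = 0)
    (him : ∀ k, k % 4 = 1 → ∀ x v, (η k x v).re = 0)
    (hη : ∀ (L : LocalFrame S E) (k : ℕ) (i : Fin k → Fin d),
      ContinuousOn (fun x => η k x fun j => L.vec (i j) x) L.U)
    (hφ : IsSmoothSection S E C univ φ) (hψ : IsSmoothSection S E C univ ψ) (L : LocalFrame S E)
    {ρ : M → ℝ} (hρ : ContMDiff (𝓡 d) 𝓘(ℝ, ℝ) ∞ ρ)
    (hs : tsupport ρ ⊆ L.U ∩ (chartAt (EuclideanSpace ℝ (Fin d)) x₀).source) :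
    ∫ x, diracDefect S E C η (spinorSmul S ρ φ) ψ x ∂μ = 0 := by
  have hφ' := hφ.spinorSmul (S := S) hρ
  have h0 : ∀ x ∉ tsupport ρ, diracDefect S E C η (spinorSmul S ρ φ) ψ x = 0 := fun x hx =>
    diracDefect_spinorSmul_eq_zero hd η hφ hψ hρ hx
  rw [hμ.integral_eq S E (x₀ := x₀) (continuous_diracDefect hd hη hφ' hψ)
    fun x hx => h0 x fun hx' => hx (hs hx').2]
  have hsub : chartDomain L x₀ ⊆ (extChartAt (𝓡 d) x₀).target := inter_subset_left
  rw [setIntegral_eq_of_subset_of_forall_sdiff_eq_zero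
    (isOpen_extChartAt_target x₀).measurableSet hsub fun z hz => by
      rw [h0 _ fun hx' => hz.2 ⟨hz.1, (hs hx').1⟩, smul_zero]]
  rw [setIntegral_congr_fun (isOpen_chartDomain L x₀).measurableSet fun z hz =>
    volDensity_smul_diracDefect hd hodd hre him hφ' hψ L hz]
  have hK : IsCompact (extChartAt (𝓡 d) x₀ '' tsupport ρ) :=
    (isClosed_tsupport ρ).isCompact.image_of_continuousOn ((continuousOn_extChartAt x₀).mono
      fun x hx => by rw [extChartAt_source]; exact (hs hx).2)
  have hinv : ∀ x ∈ tsupport ρ, (extChartAt (𝓡 d) x₀).symm (extChartAt (𝓡 d) x₀ x) = x :=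
    fun x hx => (extChartAt (𝓡 d) x₀).left_inv (by rw [extChartAt_source]; exact (hs hx).2)
  have hKO : extChartAt (𝓡 d) x₀ '' tsupport ρ ⊆ chartDomain L x₀ := by
    rintro _ ⟨x, hx, rfl⟩
    refine ⟨(extChartAt (𝓡 d) x₀).map_source (by rw [extChartAt_source]; exact (hs hx).2), ?_⟩
    rw [mem_preimage, hinv x hx]
    exact (hs hx).1
  have hmain := fun l => setIntegral_divergence (isOpen_chartDomain L x₀) hK hKO
    (f := fun z => greenField C L (spinorSmul S ρ φ) ψ l ((extChartAt (𝓡 d) x₀).symm z))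
    (X := fun z => volDensity g x₀ z • chartFrame L x₀ l z)
    ((contDiffOn_comp_chart_symm ((contMDiffOn_greenField hφ' hψ L l).mono
      inter_subset_left)).of_le (by simp))
    (((contDiffOn_volDensity L x₀).smul (contDiffOn_chartFrame L x₀ l)).of_le (by simp))
    fun z hz hzK => by
      have hρ0 : ρ ((extChartAt (𝓡 d) x₀).symm z) = 0 := by
        by_contra h
        exact hzK ⟨_, subset_tsupport ρ h, (extChartAt (𝓡 d) x₀).right_inv hz.1⟩
      have : S.proj (L.spin ((extChartAt (𝓡 d) x₀).symm z)) = (extChartAt (𝓡 d) x₀).symm z :=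
        L.spin_proj _ hz.2
      simp only [greenField, spinorSmul, this, hρ0, zero_smul, map_zero, inner_zero_left,
        Finset.sum_const_zero]
  rw [integral_finsetSum _ fun l _ => (hmain l).1]
  exact Finset.sum_eq_zero fun l _ => (hmain l).2

/-- A partition of unity subordinate to the domains of frames inside charts reduces this to the
localised statement. Compactness makes the partition finite and the continuous pairings integrable.
-/
theorem isFormallySelfAdjoint_twistedDirac [CompactSpace M] [T2Space M]
    (hμ : IsRiemannianVolume g μ) (hd : 0 < d)
    {η : MixedForm (𝓡 d) M} (hodd : ∀ k, Even k → ∀ x, η k x = 0)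
    (hre : ∀ k, k % 4 = 3 → ∀ x v, (η k x v).im = 0)
    (him : ∀ k, k % 4 = 1 → ∀ x v, (η k x v).re = 0)
    (hη : ∀ (L : LocalFrame S E) (k : ℕ) (i : Fin k → Fin d),
      ContinuousOn (fun x => η k x fun j => L.vec (i j) x) L.U) :
    IsFormallySelfAdjoint S E C μ (twistedDirac S E C η) := by
  intro φ ψ hφ hψ
  have := hμ.isLocallyFiniteMeasure S E
  have hint : ∀ {u : M → ℂ}, Continuous u → Integrable u μ := fun hu =>
    integrableOn_univ.1 (hu.continuousOn.integrableOn_compact isCompact_univ)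
  choose L hL using exists_localFrame_at S E
  obtain ⟨ρ, hρ⟩ := SmoothPartitionOfUnity.exists_isSubordinate (𝓡 d) isClosed_univ
    (fun x => (L x).U ∩ (chartAt (EuclideanSpace ℝ (Fin d)) x).source)
    (fun x => (L x).isOpen_U.inter (chartAt (EuclideanSpace ℝ (Fin d)) x).open_source)
    (fun x _ => mem_iUnion.2 ⟨x, hL x, mem_chart_source _ x⟩)
  have hfin := ρ.locallyFinite.finite_nonempty_of_compact
  have hsum : ∀ y, ∑ i ∈ hfin.toFinset, ρ i y = 1 := by
    intro y
    rw [← ρ.sum_eq_one (mem_univ y)]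
    refine (finsum_eq_sum_of_support_subset _ fun i hi => ?_).symm
    rw [Finite.coe_toFinset]
    exact ⟨y, hi⟩
  rw [← sub_eq_zero, ← integral_sub (hint (continuous_spinorPairing_dirac hd hη hφ hψ))
    (hint (continuous_spinorPairing_dirac' hd hη hφ hψ))]
  change ∫ x, diracDefect S E C η φ ψ x ∂μ = 0
  have hρs : ∀ i, ContMDiff (𝓡 d) 𝓘(ℝ, ℝ) ∞ (ρ i) := fun i => (ρ i).contMDiff
  simp only [← sum_diracDefect_spinorSmul hd η hφ hψ hρs hsum]
  rw [integral_finsetSum _ fun i _ =>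
    hint (continuous_diracDefect hd hη (hφ.spinorSmul (hρs i)) hψ)]
  exact Finset.sum_eq_zero fun i _ =>
    integral_diracDefect_spinorSmul hμ hd hodd hre him hη hφ hψ (L i) (hρs i) (hρ i)

end SelfAdjoint

/-! ### Vector fields along maps -/

section Along

variable {d : ℕ} {H : Type*} [TopologicalSpace H]
  {I : ModelWithCorners ℝ (EuclideanSpace ℝ (Fin d)) H}
  {M : Type*} [TopologicalSpace M] [ChartedSpace H M] [IsManifold I ∞ M]
  {E' H' : Type*} [NormedAddCommGroup E'] [NormedSpace ℝ E'] [TopologicalSpace H']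
  {I' : ModelWithCorners ℝ E' H'} {M' : Type*} [TopologicalSpace M'] [ChartedSpace H' M']
  {A : Type*} [TopologicalSpace A]

lemma RiemMetric.contMDiffOn_inner_along (g : RiemMetric I M) {b : M' → M} {U : Set M'}
    (hb : ContMDiffOn I' I ∞ b U) {v w : ∀ x, TangentSpace I (b x)}
    (hv : ContMDiffOn I' I.tangent ∞ (fun x => (⟨b x, v x⟩ : TangentBundle I M)) U)
    (hw : ContMDiffOn I' I.tangent ∞ (fun x => (⟨b x, w x⟩ : TangentBundle I M)) U) :
    ContMDiffOn I' 𝓘(ℝ, ℝ) ∞ (fun x => g.inner (b x) (v x) (w x)) U := by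
  have h := ContMDiffOn.clm_bundle_apply₂ (E₁ := fun x : M => TangentSpace I x)
    (E₂ := fun x : M => TangentSpace I x) (E₃ := Bundle.Trivial M ℝ) (F₃ := ℝ) (b := b)
    (ψ := fun x => g.inner (b x)) (g.contMDiff.comp_contMDiffOn hb) hv hw
  intro x hx
  have := h x hx
  simp only [Bundle.contMDiffWithinAt_totalSpace] at this
  exact this.2

lemma RiemMetric.continuousAt_inner_along (g : RiemMetric I M) {b : A → M} {a : A}
    (hb : ContinuousAt b a) {v w : ∀ x, TangentSpace I (b x)}
    (hv : ContinuousAt (fun x => (⟨b x, v x⟩ : TangentBundle I M)) a)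
    (hw : ContinuousAt (fun x => (⟨b x, w x⟩ : TangentBundle I M)) a) :
    ContinuousAt (fun x => g.inner (b x) (v x) (w x)) a := by
  have h := ContinuousAt.clm_bundle_apply₂ (E₁ := fun x : M => TangentSpace I x)
    (E₂ := fun x : M => TangentSpace I x) (E₃ := Bundle.Trivial M ℝ) (F₃ := ℝ) (b := b)
    (ψ := fun x => g.inner (b x))
    (ContinuousAt.comp (f := b) (g.contMDiff.continuous.continuousAt) hb) hv hw
  rw [FiberBundle.continuousAt_totalSpace] at h
  exact h.2

lemma continuousAt_mk_sum {ι : Type*} [Fintype ι] {b : A → M} {a : A} (hb : ContinuousAt b a)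
    {c : ι → A → ℝ} {V : ι → ∀ x, TangentSpace I (b x)} (hc : ∀ i, ContinuousAt (c i) a)
    (hV : ∀ i, ContinuousAt (fun x => (⟨b x, V i x⟩ : TangentBundle I M)) a) :
    ContinuousAt (fun x => (⟨b x, ∑ i, c i x • V i x⟩ : TangentBundle I M)) a := by
  refine (FiberBundle.continuousAt_totalSpace (EuclideanSpace ℝ (Fin d))
    (E := fun x : M => TangentSpace I x) _).2 ⟨hb, ?_⟩
  set τ := trivializationAt (EuclideanSpace ℝ (Fin d)) (fun x : M => TangentSpace I x) (b a) with hτ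
  have h1 : ContinuousAt (fun x => ∑ i, c i x • (τ ⟨b x, V i x⟩).2) a :=
    tendsto_finsetSum _ fun i _ => (hc i).smul
      ((FiberBundle.continuousAt_totalSpace (EuclideanSpace ℝ (Fin d))
        (E := fun x : M => TangentSpace I x) _).1 (hV i)).2
  refine h1.congr ?_
  have h2 : τ.baseSet ∈ nhds (b a) :=
    τ.open_baseSet.mem_nhds (FiberBundle.mem_baseSet_trivializationAt' (b a))
  filter_upwards [hb h2] with x hx
  have h3 : ∀ v : TangentSpace I (b x), (τ ⟨b x, v⟩).2 = τ.linearMapAt ℝ (b x) v := fun v => by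
    rw [Bundle.Trivialization.coe_linearMapAt_of_mem (R := ℝ) τ hx]
  rw [h3, map_sum]
  simp only [h3, map_smul]

end Along

/-! ### Lifts of tangent vectors to a collar -/

section Collar

variable {n : ℕ} {X : Type*} [TopologicalSpace X] [ChartedSpace (EuclideanHalfSpace (n + 1)) X]
  [IsManifold (𝓡∂ (n + 1)) ∞ X]
  {Y : Type*} [TopologicalSpace Y] [ChartedSpace (EuclideanSpace ℝ (Fin n)) Y]
  [IsManifold (𝓡 n) ∞ Y]
  {col : Collar n X Y} {gX : RiemMetric (𝓡∂ (n + 1)) X} {gY : RiemMetric (𝓡 n) Y}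
  {QX QY : Type*} [TopologicalSpace QX] [TopologicalSpace QY] {x : X} {U : Set X}

namespace Collar

/-- The tangent vector of `X` with given images under `dr` and `dp`. -/
def lift (col : Collar n X Y) (x : X) (s : ℝ) (w : TangentSpace (𝓡 n) (col.p x)) :
    TangentSpace (𝓡∂ (n + 1)) x :=
  Function.invFun (fun v => (col.dr x v, col.dp x v)) (s, w)

/-- A difference killed by `dr` and `dp` has length zero for the product metric. -/
lemma eq_of_dr_dp (hg : IsProductMetric col gX gY) (hx : x ∈ col.W)
    {v w : TangentSpace (𝓡∂ (n + 1)) x} (h1 : col.dr x v = col.dr x w)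
    (h2 : col.dp x v = col.dp x w) : v = w := by
  by_contra h
  have h3 := gX.pos x (v - w) (sub_ne_zero.2 h)
  rw [hg x hx, map_sub, map_sub, h1, h2, sub_self, sub_self] at h3
  simp at h3

/-- Injectivity of `(dr, dp)` and equality of dimensions give surjectivity, uniformly at interior
and boundary points. -/
lemma lift_spec (hg : IsProductMetric col gX gY) (hx : x ∈ col.W) (s : ℝ)
    (w : TangentSpace (𝓡 n) (col.p x)) :
    col.dr x (col.lift x s w) = s ∧ col.dp x (col.lift x s w) = w := by
  let T : EuclideanSpace ℝ (Fin (n + 1)) →ₗ[ℝ] ℝ × EuclideanSpace ℝ (Fin n) :=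
    ((col.dr x).prod (col.dp x)).toLinearMap
  have hT : Function.Injective T := fun v w h =>
    eq_of_dr_dp hg hx (congrArg Prod.fst h) (congrArg Prod.snd h)
  have hfr : Module.finrank ℝ (EuclideanSpace ℝ (Fin (n + 1)))
      = Module.finrank ℝ (ℝ × EuclideanSpace ℝ (Fin n)) := by
    rw [Module.finrank_prod, finrank_euclideanSpace_fin, finrank_euclideanSpace_fin,
      Module.finrank_self, add_comm]
  obtain ⟨v, hv⟩ := (LinearMap.injective_iff_surjective_of_finrank_eq_finrank hfr).1 hT (s, w)
  have h := Function.invFun_eq (f := fun v : TangentSpace (𝓡∂ (n + 1)) x =>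
    (col.dr x v, col.dp x v)) (b := (s, w)) ⟨v, hv⟩
  exact ⟨congrArg Prod.fst h, congrArg Prod.snd h⟩

lemma dr_lift (hg : IsProductMetric col gX gY) (hx : x ∈ col.W) (s : ℝ)
    (w : TangentSpace (𝓡 n) (col.p x)) : col.dr x (col.lift x s w) = s := (lift_spec hg hx s w).1

lemma dp_lift (hg : IsProductMetric col gX gY) (hx : x ∈ col.W) (s : ℝ)
    (w : TangentSpace (𝓡 n) (col.p x)) : col.dp x (col.lift x s w) = w := (lift_spec hg hx s w).2

lemma eq_lift (hg : IsProductMetric col gX gY) (hx : x ∈ col.W)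
    {v : TangentSpace (𝓡∂ (n + 1)) x} {s : ℝ} {w : TangentSpace (𝓡 n) (col.p x)}
    (h1 : col.dr x v = s) (h2 : col.dp x v = w) : v = col.lift x s w :=
  eq_of_dr_dp hg hx (h1.trans (dr_lift hg hx s w).symm) (h2.trans (dp_lift hg hx s w).symm)

/-- `lift` is defined by a choice of preimage; its coefficients in an orthonormal frame are
explicit, and this is the source of its continuity and smoothness. -/
lemma lift_eq_sum (hg : IsProductMetric col gX gY) (hx : x ∈ col.W)
    {e : Fin (n + 1) → TangentSpace (𝓡∂ (n + 1)) x}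
    (he : ∀ i j, gX.inner x (e i) (e j) = if i = j then 1 else 0) (s : ℝ)
    (w : TangentSpace (𝓡 n) (col.p x)) :
    col.lift x s w
      = ∑ j, (col.dr x (e j) * s + gY.inner (col.p x) (col.dp x (e j)) w) • e j := by
  conv_lhs => rw [orthonormal_expansion he (col.lift x s w)]
  refine Finset.sum_congr rfl fun j _ => ?_
  rw [hg x hx, dr_lift hg hx, dp_lift hg hx]

lemma mdifferentiableAt_r (col : Collar n X Y) (hx : x ∈ col.W) :
    MDifferentiableAt (𝓡∂ (n + 1)) 𝓘(ℝ, ℝ) col.r x :=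
  mdifferentiableAt_of_contMDiffOn col.r_smooth col.isOpen_W hx

lemma mdifferentiableAt_p (col : Collar n X Y) (hx : x ∈ col.W) :
    MDifferentiableAt (𝓡∂ (n + 1)) (𝓡 n) col.p x :=
  (col.p_smooth.contMDiffAt (col.isOpen_W.mem_nhds hx)).mdifferentiableAt (by simp)

lemma contMDiffOn_dp (col : Collar n X Y) {V : ∀ x : X, TangentSpace (𝓡∂ (n + 1)) x}
    (hV : SmoothVF (𝓡∂ (n + 1)) V U) (hU : U ⊆ col.W) :
    ContMDiffOn (𝓡∂ (n + 1)) (𝓡 n).tangent ∞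
      (fun x => (⟨col.p x, col.dp x (V x)⟩ : TangentBundle (𝓡 n) Y)) U := by
  have h1 := col.p_smooth.contMDiffOn_tangentMapWithin (m := ∞) (by simp)
    col.isOpen_W.uniqueMDiffOn
  have h2 : ContMDiffOn (𝓡∂ (n + 1)) (𝓡 n).tangent ∞ (fun x =>
      tangentMapWithin (𝓡∂ (n + 1)) (𝓡 n) col.p col.W
        (⟨x, V x⟩ : TangentBundle (𝓡∂ (n + 1)) X)) U := h1.comp hV (fun x hx => hU hx)
  refine h2.congr fun x hx => ?_
  simp only [tangentMapWithin, Collar.dp]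
  rw [mfderivWithin_of_isOpen col.isOpen_W (hU hx)]

lemma smoothVF_lift (hg : IsProductMetric col gX gY) (SX : SpinStructure gX QX) (hU : IsOpen U)
    (hUW : U ⊆ col.W) {s : X → ℝ} (hs : ContMDiffOn (𝓡∂ (n + 1)) 𝓘(ℝ, ℝ) ∞ s U)
    {w : ∀ x, TangentSpace (𝓡 n) (col.p x)}
    (hw : ContMDiffOn (𝓡∂ (n + 1)) (𝓡 n).tangent ∞
      (fun x => (⟨col.p x, w x⟩ : TangentBundle (𝓡 n) Y)) U) :
    SmoothVF (𝓡∂ (n + 1)) (fun x => col.lift x (s x) (w x)) U := by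
  intro x hx
  -- The spin structure serves here only as a supply of smooth local orthonormal frames.
  obtain ⟨q, hq⟩ := SX.surjective x
  obtain ⟨U', σ, e, hU', hxU', -, -, he, hσ⟩ := SX.exists_section q
  rw [hq] at hxU'
  have ho : ∀ y ∈ U', ∀ i j, gX.inner y (e i y) (e j y) = if i = j then 1 else 0 := by
    intro y hy i j
    rw [← SX.orthonormal (σ y) i j]
    exact (inner_eq_of_mk_eq ((hσ y hy).2 i) ((hσ y hy).2 j)).symm
  have hO := hU.inter hU'
  have h1 : SmoothVF (𝓡∂ (n + 1)) (fun x => ∑ j, (col.dr x (e j x) * s x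
      + gY.inner (col.p x) (col.dp x (e j x)) (w x)) • e j x) (U ∩ U') := by
    refine SmoothVF.sum_smul (fun j => ?_) fun j => (he j).mono inter_subset_right
    have he' := (he j).mono (inter_subset_right (s := U))
    refine ContMDiffOn.add (ContMDiffOn.mul ?_ (hs.mono inter_subset_left)) ?_
    · exact contMDiffOn_dirDeriv hO (col.r_smooth.mono (inter_subset_left.trans hUW)) he'
    · exact gY.contMDiffOn_inner_along (col.p_smooth.mono (inter_subset_left.trans hUW))
        (col.contMDiffOn_dp he' (inter_subset_left.trans hUW)) (hw.mono inter_subset_left)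
  have h2 : SmoothVF (𝓡∂ (n + 1)) (fun x => col.lift x (s x) (w x)) (U ∩ U') :=
    ContMDiffOn.congr h1 fun y hy =>
      congrArg (Bundle.TotalSpace.mk y) (lift_eq_sum hg (hUW hy.1) (ho y hy.2) _ _)
  exact (ContMDiffOn.contMDiffAt h2 (hO.mem_nhds ⟨hx, hxU'⟩)).contMDiffWithinAt

lemma continuousAt_lift {A : Type*} [TopologicalSpace A] (hg : IsProductMetric col gX gY)
    (SX : SpinStructure gX QX) {b : A → X} {a : A} (hb : ContinuousAt b a)
    (hbW : ∀ a, b a ∈ col.W) {s : A → ℝ} (hs : ContinuousAt s a)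
    {w : ∀ a, TangentSpace (𝓡 n) (col.p (b a))}
    (hw : ContinuousAt (fun a => (⟨col.p (b a), w a⟩ : TangentBundle (𝓡 n) Y)) a) :
    ContinuousAt (fun a => (⟨b a, col.lift (b a) (s a) (w a)⟩ : TangentBundle (𝓡∂ (n + 1)) X))
      a := by
  obtain ⟨q, hq⟩ := SX.surjective (b a)
  obtain ⟨U', σ, e, hU', hxU', -, -, he, hσ⟩ := SX.exists_section q
  rw [hq] at hxU'
  have ho : ∀ y ∈ U', ∀ i j, gX.inner y (e i y) (e j y) = if i = j then 1 else 0 := by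
    intro y hy i j
    rw [← SX.orthonormal (σ y) i j]
    exact (inner_eq_of_mk_eq ((hσ y hy).2 i) ((hσ y hy).2 j)).symm
  have hO := col.isOpen_W.inter hU'
  have haO : b a ∈ col.W ∩ U' := ⟨hbW a, hxU'⟩
  have he' := fun j => (he j).mono (inter_subset_right (s := col.W))
  have h0 : ContinuousAt (fun a => (⟨b a, ∑ j, (col.dr (b a) (e j (b a)) * s a
      + gY.inner (col.p (b a)) (col.dp (b a) (e j (b a))) (w a)) • e j (b a)⟩ :
      TangentBundle (𝓡∂ (n + 1)) X)) a := by
    refine continuousAt_mk_sum hb (c := fun j a => col.dr (b a) (e j (b a)) * s a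
      + gY.inner (col.p (b a)) (col.dp (b a) (e j (b a))) (w a))
      (V := fun j a => e j (b a)) (fun j => ?_) fun j => ?_
    · refine ContinuousAt.add (ContinuousAt.mul ?_ hs) ?_
      · exact ContinuousAt.comp (f := b) ((contMDiffOn_dirDeriv hO
          (col.r_smooth.mono inter_subset_left) (he' j)).continuousOn.continuousAt
          (hO.mem_nhds haO)) hb
      · refine gY.continuousAt_inner_along (b := fun a => col.p (b a)) ?_ ?_ hw
        · exact ContinuousAt.comp (f := b) (col.p_smooth.continuousOn.continuousAt
            (col.isOpen_W.mem_nhds (hbW a))) hb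
        · exact ContinuousAt.comp (f := b) ((col.contMDiffOn_dp (he' j)
            inter_subset_left).continuousOn.continuousAt (hO.mem_nhds haO)) hb
    · exact ContinuousAt.comp (f := b)
        (ContinuousOn.continuousAt (ContMDiffOn.continuousOn (he j)) (hU'.mem_nhds hxU')) hb
  refine h0.congr ?_
  filter_upwards [hb (hU'.mem_nhds hxU')] with a' ha'
  rw [lift_eq_sum hg (hbW a') (ho _ ha')]

end Collar

end Collar

/-! ### Product frames on a collar -/

section Collar

variable {n : ℕ} {X : Type*} [TopologicalSpace X] [ChartedSpace (EuclideanHalfSpace (n + 1)) X]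
  [IsManifold (𝓡∂ (n + 1)) ∞ X]
  {Y : Type*} [TopologicalSpace Y] [ChartedSpace (EuclideanSpace ℝ (Fin n)) Y]
  [IsManifold (𝓡 n) ∞ Y]
  {col : Collar n X Y} {gX : RiemMetric (𝓡∂ (n + 1)) X} {gY : RiemMetric (𝓡 n) Y}
  {QX QY : Type*} [TopologicalSpace QX] [TopologicalSpace QY] {x : X} {U : Set X}
  {F : Type*} [NormedAddCommGroup F] [NormedSpace ℝ F] {t : ℝ} {y : Y} {V : Set Y}

namespace Collar

lemma contMDiff_slice (col : Collar n X Y) (ht : t ∈ Ico 0 col.ε) :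
    ContMDiff (𝓡 n) (𝓡∂ (n + 1)) ∞ (col.Φ t) := by
  have h : ContMDiff (𝓡 n) (𝓘(ℝ, ℝ).prod (𝓡 n)) ∞ fun y : Y => (t, y) :=
    contMDiff_const.prodMk contMDiff_id
  exact col.Φ_smooth.comp_contMDiff h fun y => ⟨ht, mem_univ y⟩

lemma mdifferentiableAt_slice (col : Collar n X Y) (ht : t ∈ Ico 0 col.ε) (y : Y) :
    MDifferentiableAt (𝓡 n) (𝓡∂ (n + 1)) (col.Φ t) y :=
  (col.contMDiff_slice ht).mdifferentiable (by simp) y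

lemma mdifferentiableWithinAt_line (col : Collar n X Y) (ht : t ∈ Ico 0 col.ε) (y : Y) :
    MDifferentiableWithinAt 𝓘(ℝ, ℝ) (𝓡∂ (n + 1)) (fun s => col.Φ s y) (Ico 0 col.ε) t := by
  have h : ContMDiff 𝓘(ℝ, ℝ) (𝓘(ℝ, ℝ).prod (𝓡 n)) ∞ fun s : ℝ => (s, y) :=
    contMDiff_id.prodMk contMDiff_const
  have h2 : ContMDiffOn 𝓘(ℝ, ℝ) (𝓡∂ (n + 1)) ∞ (fun s => col.Φ s y) (Ico 0 col.ε) :=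
    col.Φ_smooth.comp h.contMDiffOn fun s hs => ⟨hs, mem_univ y⟩
  exact (h2.mdifferentiableOn (by simp)) t ht

lemma dr_slice (col : Collar n X Y) (ht : t ∈ Ico 0 col.ε) (w : TangentSpace (𝓡 n) y) :
    col.dr (col.Φ t y) (mfderiv (𝓡 n) (𝓡∂ (n + 1)) (col.Φ t) y w) = 0 := by
  have h1 := mfderiv_comp (I := 𝓡 n) (I' := 𝓡∂ (n + 1)) (I'' := 𝓘(ℝ, ℝ)) y
    (col.mdifferentiableAt_r (col.Φ_mem t ht y)) (col.mdifferentiableAt_slice ht y)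
  have h2 : col.r ∘ col.Φ t = fun _ => t := funext fun y => col.r_Φ t ht y
  have h3 := congrArg (fun T => T w) h1
  refine h3.symm.trans ?_
  rw [h2, mfderiv_const]
  rfl

lemma dp_slice (col : Collar n X Y) (ht : t ∈ Ico 0 col.ε) (w : TangentSpace (𝓡 n) y) :
    (⟨col.p (col.Φ t y), col.dp (col.Φ t y) (mfderiv (𝓡 n) (𝓡∂ (n + 1)) (col.Φ t) y w)⟩ :
      TangentBundle (𝓡 n) Y) = ⟨y, w⟩ := by
  have h1 := mfderiv_comp (I := 𝓡 n) (I' := 𝓡∂ (n + 1)) (I'' := 𝓡 n) y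
    (col.mdifferentiableAt_p (col.Φ_mem t ht y)) (col.mdifferentiableAt_slice ht y)
  have h2 : col.p ∘ col.Φ t = id := funext fun y => col.p_Φ t ht y
  have h3 := congrArg (fun T => (⟨col.p (col.Φ t y), T w⟩ : TangentBundle (𝓡 n) Y)) h1
  refine h3.symm.trans ?_
  have h4 := congrArg (fun f : Y → Y => (⟨f y, mfderiv (𝓡 n) (𝓡 n) f y w⟩ :
    TangentBundle (𝓡 n) Y)) h2
  refine h4.trans ?_
  rw [mfderiv_id]
  rfl

/-- The differential of `Φ t` lifts tangent vectors of `Y`. -/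
lemma mfderiv_slice (hg : IsProductMetric col gX gY) (ht : t ∈ Ico 0 col.ε)
    {w : TangentSpace (𝓡 n) y} {w' : TangentSpace (𝓡 n) (col.p (col.Φ t y))}
    (hw : (⟨col.p (col.Φ t y), w'⟩ : TangentBundle (𝓡 n) Y) = ⟨y, w⟩) :
    mfderiv (𝓡 n) (𝓡∂ (n + 1)) (col.Φ t) y w = col.lift (col.Φ t y) 0 w' := by
  refine eq_lift hg (col.Φ_mem t ht y) (col.dr_slice ht w) ?_
  exact (tangentBundle_mk_eq_iff.1 ((col.dp_slice ht w).trans hw.symm)).2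

/-- The line `s ↦ Φ s y` has `dr = 1` and `dp = 0`, so its velocity is the lift of `(1, 0)`.
Derivatives within `[0, ε)` are one-sided at `t = 0`, where the line starts on the boundary. -/
lemma derivWithin_line (hg : IsProductMetric col gX gY) (ht : t ∈ Ico 0 col.ε) {G : X → F}
    (hG : MDifferentiableAt (𝓡∂ (n + 1)) 𝓘(ℝ, F) G (col.Φ t y)) :
    derivWithin (fun s => G (col.Φ s y)) (Ico 0 col.ε) t
      = mfderiv (𝓡∂ (n + 1)) 𝓘(ℝ, F) G (col.Φ t y) (col.lift (col.Φ t y) 1 0) := by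
  have hu : UniqueMDiffWithinAt 𝓘(ℝ, ℝ) (Ico 0 col.ε) t :=
    (uniqueDiffOn_Ico 0 col.ε t ht).uniqueMDiffWithinAt
  have hx := col.Φ_mem t ht y
  have hl := col.mdifferentiableWithinAt_line ht y
  set ν : TangentSpace (𝓡∂ (n + 1)) (col.Φ t y) :=
    mfderivWithin 𝓘(ℝ, ℝ) (𝓡∂ (n + 1)) (fun s => col.Φ s y) (Ico 0 col.ε) t (1 : ℝ) with hν
  have hνr : col.dr (col.Φ t y) ν = 1 := by
    have h1 := mfderiv_comp_mfderivWithin (I := 𝓘(ℝ, ℝ)) (I' := 𝓡∂ (n + 1)) (I'' := 𝓘(ℝ, ℝ)) t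
      (f := fun s => col.Φ s y) (g := col.r) (col.mdifferentiableAt_r hx) hl hu
    have h2 : mfderivWithin 𝓘(ℝ, ℝ) 𝓘(ℝ, ℝ) (col.r ∘ fun s => col.Φ s y) (Ico 0 col.ε) t
        = mfderivWithin 𝓘(ℝ, ℝ) 𝓘(ℝ, ℝ) (fun s : ℝ => s) (Ico 0 col.ε) t :=
      mfderivWithin_congr (fun s hs => col.r_Φ s hs y) (col.r_Φ t ht y)
    have h3 := congrArg (fun T => T (1 : ℝ)) (h1.symm.trans h2)
    refine h3.trans ?_
    rw [mfderivWithin_eq_fderivWithin, fderivWithin_fun_id (uniqueDiffOn_Ico 0 col.ε t ht)]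
    rfl
  have hνp : col.dp (col.Φ t y) ν = 0 := by
    have h1 := mfderiv_comp_mfderivWithin (I := 𝓘(ℝ, ℝ)) (I' := 𝓡∂ (n + 1)) (I'' := 𝓡 n) t
      (f := fun s => col.Φ s y) (g := col.p) (col.mdifferentiableAt_p hx) hl hu
    have h2 : mfderivWithin 𝓘(ℝ, ℝ) (𝓡 n) (col.p ∘ fun s => col.Φ s y) (Ico 0 col.ε) t
        = mfderivWithin 𝓘(ℝ, ℝ) (𝓡 n) (fun _ : ℝ => y) (Ico 0 col.ε) t :=
      mfderivWithin_congr (fun s hs => col.p_Φ s hs y) (col.p_Φ t ht y)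
    have h3 := congrArg (fun T => T (1 : ℝ)) (h1.symm.trans h2)
    refine h3.trans ?_
    rw [mfderivWithin_const]
    rfl
  rw [← eq_lift hg hx hνr hνp]
  have h1 := mfderiv_comp_mfderivWithin (I := 𝓘(ℝ, ℝ)) (I' := 𝓡∂ (n + 1)) (I'' := 𝓘(ℝ, F)) t
    (f := fun s => col.Φ s y) (g := G) hG hl hu
  have h2 := congrArg (fun T => T (1 : ℝ)) h1
  refine Eq.trans ?_ h2
  rw [mfderivWithin_eq_fderivWithin]
  exact fderivWithin_derivWithin.symm

end Collar

/-- The fields `e_1, ..., e_n, 0`. -/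
def snocZero (e : Fin n → ∀ y : Y, TangentSpace (𝓡 n) y) (k : Fin (n + 1)) (y : Y) :
    TangentSpace (𝓡 n) y :=
  Fin.snoc (α := fun _ => TangentSpace (𝓡 n) y) (fun i => e i y) 0 k

lemma snocZero_castSucc (e : Fin n → ∀ y : Y, TangentSpace (𝓡 n) y) (i : Fin n) :
    snocZero e i.castSucc = e i := funext fun y => by rw [snocZero, Fin.snoc_castSucc]

lemma snocZero_last (e : Fin n → ∀ y : Y, TangentSpace (𝓡 n) y) :
    snocZero e (Fin.last n) = fun _ => 0 := funext fun y => by rw [snocZero, Fin.snoc_last]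

lemma smoothVF_snocZero {e : Fin n → ∀ y : Y, TangentSpace (𝓡 n) y}
    (he : ∀ i, SmoothVF (𝓡 n) (e i) V) (k : Fin (n + 1)) : SmoothVF (𝓡 n) (snocZero e k) V := by
  refine Fin.lastCases ?_ (fun i => ?_) k
  · rw [snocZero_last]
    exact (Bundle.contMDiff_zeroSection ℝ (fun y : Y => TangentSpace (𝓡 n) y)).contMDiffOn
  · rw [snocZero_castSucc]
    exact he i

namespace Collar

/-- The frame `e_1, ..., e_n, ∂/∂r` on the collar. -/
def frame (col : Collar n X Y) (e : Fin n → ∀ y : Y, TangentSpace (𝓡 n) y) (k : Fin (n + 1))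
    (x : X) : TangentSpace (𝓡∂ (n + 1)) x :=
  col.lift x (if k = Fin.last n then (1 : ℝ) else 0) (snocZero e k (col.p x))

variable {e : Fin n → ∀ y : Y, TangentSpace (𝓡 n) y}

lemma isOpen_over (col : Collar n X Y) (hV : IsOpen V) : IsOpen (col.W ∩ col.p ⁻¹' V) :=
  col.p_smooth.continuousOn.isOpen_inter_preimage col.isOpen_W hV

lemma smoothVF_frame (hg : IsProductMetric col gX gY) (SX : SpinStructure gX QX) (hV : IsOpen V)
    (he : ∀ i, SmoothVF (𝓡 n) (e i) V) (k : Fin (n + 1)) :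
    SmoothVF (𝓡∂ (n + 1)) (col.frame e k) (col.W ∩ col.p ⁻¹' V) :=
  smoothVF_lift hg SX (col.isOpen_over hV) inter_subset_left contMDiffOn_const
    (ContMDiffOn.comp (g := fun y => (⟨y, snocZero e k y⟩ : TangentBundle (𝓡 n) Y))
      (smoothVF_snocZero he k) (col.p_smooth.mono inter_subset_left) fun _ hx => hx.2)

lemma inner_frame (hg : IsProductMetric col gX gY) (hx : x ∈ col.W)
    (v : TangentSpace (𝓡∂ (n + 1)) x) (k : Fin (n + 1)) :
    gX.inner x v (col.frame e k x) = col.dr x v * (if k = Fin.last n then (1 : ℝ) else 0)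
      + gY.inner (col.p x) (col.dp x v) (snocZero e k (col.p x)) := by
  rw [hg x hx, frame, dr_lift hg hx, dp_lift hg hx]

/-- The frame fields are `p`-related to `snocZero e`, so `dp` of the bracket is the bracket on `Y`.
Since `dr` is constant on each field, the bracket has no normal component. -/
lemma inner_mlieBracket_frame (hg : IsProductMetric col gX gY) (SX : SpinStructure gX QX)
    (hV : IsOpen V) (he : ∀ i, SmoothVF (𝓡 n) (e i) V) (hx : x ∈ col.W) (hxV : col.p x ∈ V)
    (k l m : Fin (n + 1)) :
    gX.inner x (VectorField.mlieBracket (𝓡∂ (n + 1)) (col.frame e k) (col.frame e l) x)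
        (col.frame e m x)
      = gY.inner (col.p x) (VectorField.mlieBracket (𝓡 n) (snocZero e k) (snocZero e l) (col.p x))
        (snocZero e m (col.p x)) := by
  have hO := col.isOpen_over hV
  have hxO : x ∈ col.W ∩ col.p ⁻¹' V := ⟨hx, hxV⟩
  have h1 : col.dp x (VectorField.mlieBracket (𝓡∂ (n + 1)) (col.frame e k) (col.frame e l) x)
      = VectorField.mlieBracket (𝓡 n) (snocZero e k) (snocZero e l) (col.p x) :=
    mfderiv_mlieBracket_related hO hV hxO (fun x hx => hx.2) (col.p_smooth.mono inter_subset_left)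
      (smoothVF_frame hg SX hV he k) (smoothVF_frame hg SX hV he l) (smoothVF_snocZero he k)
      (smoothVF_snocZero he l) (fun y hy => dp_lift hg hy.1 _ _) fun y hy => dp_lift hg hy.1 _ _
  have h2 : col.dr x (VectorField.mlieBracket (𝓡∂ (n + 1)) (col.frame e k) (col.frame e l) x)
      = 0 := by
    refine (mfderiv_mlieBracket hO hxO (col.r_smooth.mono inter_subset_left)
      (smoothVF_frame hg SX hV he k) (smoothVF_frame hg SX hV he l)).trans ?_
    have h3 : ∀ m, dirDeriv (𝓡∂ (n + 1)) col.r (col.frame e m) =ᶠ[nhds x]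
        fun _ => (if m = Fin.last n then (1 : ℝ) else 0) := by
      intro m
      filter_upwards [col.isOpen_W.mem_nhds hx] with y hy
      exact dr_lift hg hy _ _
    rw [dirDeriv_congr (h3 l), dirDeriv_congr (h3 k), dirDeriv_const, dirDeriv_const, sub_self]
  rw [inner_frame hg hx, h1, h2, zero_mul, zero_add]

lemma leviCivitaCoeff_frame (hg : IsProductMetric col gX gY) (SX : SpinStructure gX QX)
    (hV : IsOpen V) (he : ∀ i, SmoothVF (𝓡 n) (e i) V) (hx : x ∈ col.W) (hxV : col.p x ∈ V)
    (i j l : Fin n) :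
    leviCivitaCoeff gX (col.frame e) x i.castSucc j.castSucc l.castSucc
      = leviCivitaCoeff gY e (col.p x) i j l := by
  simp only [leviCivitaCoeff, inner_mlieBracket_frame hg SX hV he hx hxV, snocZero_castSucc]

/-- The normal field projects to the zero field on `Y`, so every Koszul term that contains it
vanishes: the slices are totally geodesic and `∂/∂r` is parallel. -/
lemma leviCivitaCoeff_frame_last (hg : IsProductMetric col gX gY) (SX : SpinStructure gX QX)
    (hV : IsOpen V) (he : ∀ i, SmoothVF (𝓡 n) (e i) V) (hx : x ∈ col.W) (hxV : col.p x ∈ V)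
    {i j l : Fin (n + 1)} (h : i = Fin.last n ∨ j = Fin.last n ∨ l = Fin.last n) :
    leviCivitaCoeff gX (col.frame e) x i j l = 0 := by
  have hz : (fun y : Y => (0 : TangentSpace (𝓡 n) y)) = 0 := rfl
  simp only [leviCivitaCoeff, inner_mlieBracket_frame hg SX hV he hx hxV]
  rcases h with rfl | rfl | rfl <;>
    simp only [snocZero_last, hz, VectorField.mlieBracket_zero_left,
      VectorField.mlieBracket_zero_right, Pi.zero_apply, map_zero, zero_apply, sub_zero, add_zero,
      zero_div]

end Collar

lemma IsBoundaryCompatible.apply_frame {η : MixedForm (𝓡∂ (n + 1)) X}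
    (hη : IsBoundaryCompatible col η) (hg : IsProductMetric col gX gY) (hx : x ∈ col.W)
    (e : Fin n → ∀ y : Y, TangentSpace (𝓡 n) y) {k : ℕ} (i : Fin k → Fin (n + 1)) :
    η k x (fun j => col.frame e (i j) x)
      = restrictForm col η k (col.p x) fun j => snocZero e (i j) (col.p x) := by
  rw [hη k x hx]
  change restrictForm col η k (col.p x) (fun j => col.dp x (col.frame e (i j) x)) = _
  congr 1
  funext j
  exact Collar.dp_lift hg hx _ _

end Collar

/-! ### Lifting of families of lines to coverings -/

/-- Contracting `[0, ε)` to `0` by `(u, t) ↦ u t` turns the family into a homotopy over `[0,1] ×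
([0, ε) × A)`, starting from the known lift at `u = 0`. Its lift at `u = 1` is the one sought;
outside `[0, ε)` the value is arbitrary. -/
lemma IsCoveringMap.exists_lift_Ico {T B A : Type*} [TopologicalSpace T] [TopologicalSpace B]
    [TopologicalSpace A] {p : T → B} (hp : IsCoveringMap p) {ε : ℝ} (hε : 0 < ε)
    {G : Ico 0 ε × A → B} (hG : Continuous G) {f : A → T} (hf : Continuous f)
    (h0 : ∀ a, G (⟨0, le_rfl, hε⟩, a) = p (f a)) :
    ∃ τ : ℝ → A → T, ContinuousOn (fun z : ℝ × A => τ z.1 z.2) (Ico 0 ε ×ˢ univ) ∧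
      (∀ a, τ 0 a = f a) ∧ ∀ (t : ℝ) (ht : t ∈ Ico 0 ε) (a : A), p (τ t a) = G (⟨t, ht⟩, a) := by
  classical
  let scale : unitInterval × Ico 0 ε → Ico 0 ε := fun z => ⟨z.1 * z.2, by
    obtain ⟨⟨u, hu0, hu1⟩, ⟨t, ht0, ht1⟩⟩ := z
    exact ⟨mul_nonneg hu0 ht0, (mul_le_of_le_one_left ht0 hu1).trans_lt ht1⟩⟩
  have hscale : Continuous scale := by
    apply Continuous.subtype_mk
    fun_prop
  let K : C(unitInterval × (Ico 0 ε × A), B) :=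
    ⟨fun z => G (scale (z.1, z.2.1), z.2.2), by fun_prop⟩
  have hs0 : ∀ t, scale (0, t) = ⟨0, le_rfl, hε⟩ := fun t => Subtype.ext (zero_mul _)
  have hs1 : ∀ t, scale (1, t) = t := fun t => Subtype.ext (one_mul _)
  let f' : C(Ico 0 ε × A, T) := ⟨fun z => f z.2, by fun_prop⟩
  have hK0 : ∀ z, K (0, z) = p (f' z) := fun z => by
    change G (scale (0, z.1), z.2) = p (f z.2)
    rw [hs0, h0]
  let Λ := hp.liftHomotopy K f' hK0
  have hΛ : ∀ z, p (Λ z) = K z := fun z => congrFun (hp.liftHomotopy_lifts K f' hK0) z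
  have hΛ0 : ∀ z, Λ (0, z) = f' z := hp.liftHomotopy_zero K f' hK0
  refine ⟨fun t a => if h : t ∈ Ico 0 ε then Λ (1, (⟨t, h⟩, a)) else f a, ?_, fun a => ?_,
    fun t ht a => ?_⟩
  · rw [continuousOn_iff_continuous_domRestrict]
    have h1 : Continuous fun z : ↥(Ico 0 ε ×ˢ (univ : Set A)) =>
        Λ (1, (⟨z.1.1, z.2.1⟩, z.1.2)) := by
      refine Λ.continuous.comp (continuous_const.prodMk (Continuous.prodMk ?_ ?_))
      · exact Continuous.subtype_mk (by fun_prop) _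
      · fun_prop
    refine h1.congr fun z => ?_
    simp only [domRestrict_apply]
    rw [dif_pos z.2.1]
  · have h : (0 : ℝ) ∈ Ico 0 ε := ⟨le_rfl, hε⟩
    simp only
    rw [dif_pos h]
    -- At `t = 0` the contraction does not move, so the lifted path in `u` is constant and starts at
    -- `f a`.
    have h1 : Continuous fun u : unitInterval => Λ (u, ((⟨0, h⟩ : Ico 0 ε), a)) := by fun_prop
    have h2 := hp.const_of_comp h1 (fun u u' => by
      rw [hΛ, hΛ]
      change G (scale (u, _), a) = G (scale (u', _), a)
      have : ∀ u, scale (u, ⟨0, h⟩) = ⟨0, h⟩ := fun u => Subtype.ext (mul_zero _)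
      rw [this, this]) 1 0
    exact h2.trans (hΛ0 _)
  · simp only
    rw [dif_pos ht, hΛ]
    change G (scale (1, _), a) = _
    rw [hs1]

/-! ### Transport of spin frames along a collar -/

section Collar

variable {n : ℕ} {X : Type*} [TopologicalSpace X] [ChartedSpace (EuclideanHalfSpace (n + 1)) X]
  [IsManifold (𝓡∂ (n + 1)) ∞ X]
  {Y : Type*} [TopologicalSpace Y] [ChartedSpace (EuclideanSpace ℝ (Fin n)) Y]
  [IsManifold (𝓡 n) ∞ Y]
  {col : Collar n X Y} {gX : RiemMetric (𝓡∂ (n + 1)) X} {gY : RiemMetric (𝓡 n) Y}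
  {QX QY : Type*} [TopologicalSpace QX] [TopologicalSpace QY]
  {SX : SpinStructure gX QX} {SY : SpinStructure gY QY} {j : QY → QX}
  {N : ℕ} {PX PY : Type*} [TopologicalSpace PX] [TopologicalSpace PY]
  {EX : FlatHermitianBundle X N PX} {EY : FlatHermitianBundle Y N PY} {jE : PY → PX}
  {x : X} {t : ℝ} {y : Y} {q : QX} {q₀ : QY}

lemma Collar.zero_mem (col : Collar n X Y) : (0 : ℝ) ∈ Ico 0 col.ε := ⟨le_rfl, col.ε_pos⟩

/-- A tangent vector at `y` as a tangent vector at the point `p (Φ t y)`, which is `y`. -/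
def Collar.toSlice (col : Collar n X Y) (t : ℝ) (y : Y) (w : TangentSpace (𝓡 n) y) :
    TangentSpace (𝓡 n) (col.p (col.Φ t y)) := (show EuclideanSpace ℝ (Fin n) from w)

/-- The lift to `Φ t y` of a tangent vector at `y`. -/
def Collar.liftAt (col : Collar n X Y) (t : ℝ) (y : Y) (s : ℝ) (w : TangentSpace (𝓡 n) y) :
    TangentSpace (𝓡∂ (n + 1)) (col.Φ t y) :=
  col.lift (col.Φ t y) s (col.toSlice t y w)

lemma Collar.mk_toSlice (col : Collar n X Y) (ht : t ∈ Ico 0 col.ε) (w : TangentSpace (𝓡 n) y) :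
    (⟨col.p (col.Φ t y), col.toSlice t y w⟩ : TangentBundle (𝓡 n) Y)
      = ⟨y, w⟩ := tangentBundle_mk_eq_iff.2 ⟨col.p_Φ t ht y, rfl⟩

lemma Collar.mk_eq_liftAt_iff (hg : IsProductMetric col gX gY) (ht : t ∈ Ico 0 col.ε)
    (hx : x = col.Φ t y) {v : TangentSpace (𝓡∂ (n + 1)) x} {s : ℝ} {w : TangentSpace (𝓡 n) y} :
    (⟨x, v⟩ : TangentBundle (𝓡∂ (n + 1)) X) = ⟨col.Φ t y, col.liftAt t y s w⟩ ↔
      col.dr x v = s ∧ (⟨col.p x, col.dp x v⟩ : TangentBundle (𝓡 n) Y) = ⟨y, w⟩ := by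
  subst hx
  have hW := col.Φ_mem t ht y
  constructor
  · intro h
    have h1 : v = col.liftAt t y s w := (tangentBundle_mk_eq_iff.1 h).2
    rw [h1, liftAt, dr_lift hg hW, dp_lift hg hW]
    exact ⟨rfl, col.mk_toSlice ht w⟩
  · rintro ⟨h1, h2⟩
    refine congrArg (Bundle.TotalSpace.mk _) (eq_lift hg hW h1 ?_)
    exact (tangentBundle_mk_eq_iff.1 h2).2

/-- The vectors of the frame of `q`, followed by zero. -/
def frameSnoc (SY : SpinStructure gY QY) (q₀ : QY) (k : Fin (n + 1)) :
    TangentSpace (𝓡 n) (SY.proj q₀) :=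
  Fin.snoc (α := fun _ => TangentSpace (𝓡 n) (SY.proj q₀)) (SY.frame q₀) 0 k

/-- The vectors of the frame over `Φ t y` adapted to `q₀`. -/
def Collar.adaptedVec (col : Collar n X Y) (SY : SpinStructure gY QY) (t : ℝ) (q₀ : QY)
    (k : Fin (n + 1)) : TangentSpace (𝓡∂ (n + 1)) (col.Φ t (SY.proj q₀)) :=
  col.liftAt t (SY.proj q₀) (if k = Fin.last n then (1 : ℝ) else 0) (frameSnoc SY q₀ k)

/-- Replaces the conditions on `dr` and `dp` by equalities of tangent vectors, the form in which the
covering `frameMap` compares spin frames. -/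
lemma isAdapted_iff (hg : IsProductMetric col gX gY) (ht : t ∈ Ico 0 col.ε)
    (hq : SX.proj q = col.Φ t (SY.proj q₀)) :
    IsAdapted col SX SY q q₀ ↔ ∀ k, (⟨SX.proj q, SX.frame q k⟩ : TangentBundle (𝓡∂ (n + 1)) X)
      = ⟨col.Φ t (SY.proj q₀), col.adaptedVec SY t q₀ k⟩ := by
  have hp : col.p (SX.proj q) = SY.proj q₀ := by rw [hq, col.p_Φ t ht]
  have h1 : ∀ k, (⟨SX.proj q, SX.frame q k⟩ : TangentBundle (𝓡∂ (n + 1)) X)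
      = ⟨col.Φ t (SY.proj q₀), col.adaptedVec SY t q₀ k⟩ ↔ _ := fun k =>
    Collar.mk_eq_liftAt_iff hg ht hq
  simp only [h1]
  constructor
  · intro h k
    refine Fin.lastCases ?_ (fun i => ?_) k
    · refine ⟨by rw [if_pos rfl]; exact h.dr_last, ?_⟩
      rw [h.dp_last, frameSnoc, Fin.snoc_last]
      exact tangentBundle_mk_eq_iff.2 ⟨hp, rfl⟩
    · refine ⟨by rw [if_neg (Fin.castSucc_lt_last i).ne]; exact h.dr_frame i, ?_⟩
      rw [h.dp_frame, frameSnoc, Fin.snoc_castSucc]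
  · intro h
    refine ⟨fun i => ?_, fun i => ?_, ?_, ?_⟩
    · rw [(h i.castSucc).2, frameSnoc, Fin.snoc_castSucc]
    · rw [(h i.castSucc).1, if_neg (Fin.castSucc_lt_last i).ne]
    · have := (h (Fin.last n)).2
      rw [frameSnoc, Fin.snoc_last] at this
      exact (tangentBundle_mk_eq_iff.1 this).2
    · rw [(h (Fin.last n)).1, if_pos rfl]

lemma adaptedVec_orthonormal (hg : IsProductMetric col gX gY) (ht : t ∈ Ico 0 col.ε) (q₀ : QY)
    (k l : Fin (n + 1)) :
    gX.inner (col.Φ t (SY.proj q₀)) (col.adaptedVec SY t q₀ k) (col.adaptedVec SY t q₀ l)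
      = if k = l then 1 else 0 := by
  have hW := col.Φ_mem t ht (SY.proj q₀)
  rw [hg _ hW, Collar.adaptedVec, Collar.adaptedVec, Collar.liftAt, Collar.liftAt,
    Collar.dr_lift hg hW, Collar.dr_lift hg hW, Collar.dp_lift hg hW, Collar.dp_lift hg hW,
    inner_eq_of_mk_eq (col.mk_toSlice ht (frameSnoc SY q₀ k))
      (col.mk_toSlice ht (frameSnoc SY q₀ l))]
  refine Fin.lastCases ?_ (fun i => ?_) k <;> refine Fin.lastCases ?_ (fun j => ?_) l
  · simp [frameSnoc]
  · simp [frameSnoc, (Fin.castSucc_lt_last j).ne, (Fin.castSucc_lt_last j).ne']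
  · simp [frameSnoc, (Fin.castSucc_lt_last i).ne]
  · simp [frameSnoc, SY.orthonormal, (Fin.castSucc_lt_last i).ne, (Fin.castSucc_lt_last j).ne]

namespace SpinStructure

variable {d : ℕ} {H : Type*} [TopologicalSpace H]
  {I : ModelWithCorners ℝ (EuclideanSpace ℝ (Fin d)) H}
  {M : Type*} [TopologicalSpace M] [ChartedSpace H M] [IsManifold I ∞ M]
  {g : RiemMetric I M} {Q : Type*} [TopologicalSpace Q]

lemma continuous_frame (S : SpinStructure g Q) (i : Fin d) :
    Continuous fun q => (⟨S.proj q, S.frame q i⟩ : TangentBundle I M) := by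
  have h : Continuous (frameMap (I := I) S.proj S.frame) :=
    continuous_subtype_val.comp S.covering.continuous
  exact (continuous_apply i).comp h

/-- Read off from the base point of a frame vector, so at least one vector is needed. -/
lemma continuous_proj (hd : 0 < d) (S : SpinStructure g Q) : Continuous S.proj :=
  (FiberBundle.continuous_proj (EuclideanSpace ℝ (Fin d)) fun x : M => TangentSpace I x).comp
    (S.continuous_frame ⟨0, hd⟩)

end SpinStructure

lemma continuous_adaptedVec (hn : 0 < n) (hg : IsProductMetric col gX gY)
    (SX : SpinStructure gX QX) (SY : SpinStructure gY QY) (k : Fin (n + 1)) :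
    Continuous fun z : Ico 0 col.ε × QY => (⟨col.Φ z.1 (SY.proj z.2),
      col.adaptedVec SY z.1 z.2 k⟩ : TangentBundle (𝓡∂ (n + 1)) X) := by
  have hproj := SY.continuous_proj hn
  have hΦ : Continuous fun z : Ico 0 col.ε × QY => col.Φ z.1 (SY.proj z.2) :=
    col.Φ_smooth.continuousOn.comp_continuous (f := fun z : Ico 0 col.ε × QY =>
      ((z.1 : ℝ), SY.proj z.2)) (by fun_prop) fun z => ⟨z.1.2, mem_univ _⟩
  rw [continuous_iff_continuousAt]
  intro z
  refine Collar.continuousAt_lift hg SX hΦ.continuousAt (fun z => col.Φ_mem _ z.1.2 _)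
    continuousAt_const ?_
  have h : (fun z : Ico 0 col.ε × QY => (⟨col.p (col.Φ z.1 (SY.proj z.2)),
      col.toSlice z.1 (SY.proj z.2) (frameSnoc SY z.2 k)⟩ : TangentBundle (𝓡 n) Y))
      = fun z => ⟨SY.proj z.2, frameSnoc SY z.2 k⟩ := funext fun z => col.mk_toSlice z.1.2 _
  change ContinuousAt (fun z : Ico 0 col.ε × QY => (⟨col.p (col.Φ z.1 (SY.proj z.2)),
      col.toSlice z.1 (SY.proj z.2) (frameSnoc SY z.2 k)⟩ : TangentBundle (𝓡 n) Y)) z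
  rw [h]
  refine Continuous.continuousAt (Continuous.comp (g := fun q =>
    (⟨SY.proj q, frameSnoc SY q k⟩ : TangentBundle (𝓡 n) Y)) ?_ continuous_snd)
  refine Fin.lastCases ?_ (fun i => ?_) k
  · simp only [frameSnoc, Fin.snoc_last]
    exact (Bundle.contMDiff_zeroSection (IB := 𝓡 n) ℝ
      (fun y : Y => TangentSpace (𝓡 n) y) (n := ∞)).continuous.comp hproj
  · simp only [frameSnoc, Fin.snoc_castSucc]
    exact SY.continuous_frame i

end Collar

/-! ### Existence and equivariance of the transports -/

section Collar

variable {n : ℕ} {X : Type*} [TopologicalSpace X] [ChartedSpace (EuclideanHalfSpace (n + 1)) X]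
  [IsManifold (𝓡∂ (n + 1)) ∞ X]
  {Y : Type*} [TopologicalSpace Y] [ChartedSpace (EuclideanSpace ℝ (Fin n)) Y]
  [IsManifold (𝓡 n) ∞ Y]
  {col : Collar n X Y} {gX : RiemMetric (𝓡∂ (n + 1)) X} {gY : RiemMetric (𝓡 n) Y}
  {QX QY : Type*} [TopologicalSpace QX] [TopologicalSpace QY]
  {SX : SpinStructure gX QX} {SY : SpinStructure gY QY} {j : QY → QX}
  {N : ℕ} {PX PY : Type*} [TopologicalSpace PX] [TopologicalSpace PY]
  {EX : FlatHermitianBundle X N PX} {EY : FlatHermitianBundle Y N PY} {jE : PY → PX}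
  {x : X} {t : ℝ} {y : Y} {q : QX} {q₀ : QY} {T : ℝ → QY → QX} {τ : ℝ → PY → PX}

namespace LocalFrame

variable {d : ℕ} {H : Type*} [TopologicalSpace H]
  {I : ModelWithCorners ℝ (EuclideanSpace ℝ (Fin d)) H}
  {M : Type*} [TopologicalSpace M] [ChartedSpace H M] [IsManifold I ∞ M]
  {g : RiemMetric I M} {Q : Type*} [TopologicalSpace Q]
  {P : Type*} [TopologicalSpace P] {S : SpinStructure g Q} {E : FlatHermitianBundle M N P} {z : M}

/-- The frame of a translate of a spin frame in terms of a local frame. -/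
lemma frame_act_spin (L : LocalFrame S E) (hz : z ∈ L.U) {a : SpinGrp d} {A : Fin d → Fin d → ℝ}
    (hA : IsSpinLift a A) (i : Fin d) :
    (⟨S.proj (S.act (L.spin z) a), S.frame (S.act (L.spin z) a) i⟩ : TangentBundle I M)
      = ⟨z, ∑ j, A j i • L.vec j z⟩ := by
  rw [S.frame_act hA]
  have hf := fun j => (tangentBundle_mk_eq_iff.1 (L.frame_spin z hz j)).2
  refine tangentBundle_mk_eq_iff.2 ⟨L.spin_proj z hz, ?_⟩
  change ∑ j, A j i • (show EuclideanSpace ℝ (Fin d) from S.frame (L.spin z) j) = _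
  simp only [hf]
  rfl

lemma sum_inner_inner (L : LocalFrame S E) (hz : z ∈ L.U) (v w : TangentSpace I z) :
    ∑ j, g.inner z (L.vec j z) v * g.inner z (L.vec j z) w = g.inner z v w := by
  conv_rhs => rw [orthonormal_expansion (L.inner_vec hz) v]
  simp only [map_sum, map_smul, sum_apply, smul_apply, smul_eq_mul]

end LocalFrame

/-- The frames adapted to a spin frame `q₀` of `Y` at two near points of a line of the collar come
both from spin frames of `X`, or none of them does. -/
lemma eventually_exists_spin_adapted (hn : 0 < n) (hg : IsProductMetric col gX gY)
    (SX : SpinStructure gX QX) (EX : FlatHermitianBundle X N PX) (SY : SpinStructure gY QY)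
    (q₀ : QY) (t₀ : Ico 0 col.ε) :
    ∃ J ∈ nhds t₀, ∀ t₁ ∈ J, ∀ t ∈ J,
      (∃ q, ∀ k, (⟨SX.proj q, SX.frame q k⟩ : TangentBundle (𝓡∂ (n + 1)) X)
        = ⟨col.Φ t₁ (SY.proj q₀), col.adaptedVec SY t₁ q₀ k⟩) →
      ∃ q, ∀ k, (⟨SX.proj q, SX.frame q k⟩ : TangentBundle (𝓡∂ (n + 1)) X)
        = ⟨col.Φ t (SY.proj q₀), col.adaptedVec SY t q₀ k⟩ := by
  set y := SY.proj q₀ with hy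
  obtain ⟨L, hL⟩ := exists_localFrame_at SX EX (col.Φ t₀ y)
  -- The orthogonal matrix of the adapted frame relative to `L`; the sign of its determinant,
  -- locally constant in `t`, decides whether a spin frame lies above it.
  let A : Ico 0 col.ε → Matrix (Fin (n + 1)) (Fin (n + 1)) ℝ := fun t => Matrix.of fun i k =>
    gX.inner (col.Φ t y) (L.vec i (col.Φ t y)) (col.adaptedVec SY t q₀ k)
  have hcont : ∀ k, Continuous fun t : Ico 0 col.ε => (⟨col.Φ t y, col.adaptedVec SY t q₀ k⟩ :
      TangentBundle (𝓡∂ (n + 1)) X) := fun k =>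
    (continuous_adaptedVec hn hg SX SY k).comp (f := fun t : Ico 0 col.ε => (t, q₀)) (by fun_prop)
  have hΦ : Continuous fun t : Ico 0 col.ε => col.Φ t y :=
    (FiberBundle.continuous_proj (EuclideanSpace ℝ (Fin (n + 1)))
      fun x : X => TangentSpace (𝓡∂ (n + 1)) x).comp (hcont 0)
  have hA : ContinuousAt A t₀ := by
    refine continuousAt_pi.2 fun i => continuousAt_pi.2 fun k => ?_
    refine gX.continuousAt_inner_along (b := fun t : Ico 0 col.ε => col.Φ t y) hΦ.continuousAt ?_
      (hcont k).continuousAt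
    exact ContinuousAt.comp (f := fun t : Ico 0 col.ε => col.Φ t y)
      ((ContMDiffOn.continuousOn (L.vec_smooth i)).continuousAt (L.isOpen_U.mem_nhds hL))
      hΦ.continuousAt
  have horth : ∀ t : Ico 0 col.ε, col.Φ t y ∈ L.U → (A t).transpose * A t = 1 := by
    intro t ht
    ext k l
    rw [Matrix.mul_apply, Matrix.one_apply, ← adaptedVec_orthonormal hg t.2 q₀ k l,
      ← L.sum_inner_inner ht]
    rfl
  have hdet : ∀ t : Ico 0 col.ε, col.Φ t y ∈ L.U → (A t).det * (A t).det = 1 := by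
    intro t ht
    have := congrArg Matrix.det (horth t ht)
    rwa [Matrix.det_mul, Matrix.det_transpose, Matrix.det_one] at this
  have hdc : ContinuousAt (fun t => (A t).det * (A t₀).det) t₀ :=
    ContinuousAt.mul (ContinuousAt.comp (f := A) (Continuous.matrix_det
      continuous_id).continuousAt hA) continuousAt_const
  have hev : ∀ᶠ t : Ico 0 col.ε in nhds t₀, col.Φ t y ∈ L.U ∧ 0 < (A t).det * (A t₀).det :=
    Filter.Eventually.and (hΦ.continuousAt (L.isOpen_U.mem_nhds hL))
      (hdc (isOpen_Ioi.mem_nhds (show (0 : ℝ) < (A t₀).det * (A t₀).det by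
        rw [hdet t₀ hL]; exact one_pos)))
  refine ⟨_, hev, ?_⟩
  -- Both determinants are `±1`, so a positive product equals `1`.
  have hone : ∀ t : Ico 0 col.ε, col.Φ t y ∈ L.U ∧ 0 < (A t).det * (A t₀).det →
      (A t).det * (A t₀).det = 1 := by
    rintro t ⟨ht, hpos⟩
    have h1 : ((A t).det * (A t₀).det - 1) * ((A t).det * (A t₀).det + 1) = 0 := by
      linear_combination (A t).det * (A t).det * hdet t₀ hL + hdet t ht
    rcases mul_eq_zero.1 h1 with h | h <;> linarith
  rintro t₁ ht₁ t ht ⟨q, hq⟩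
  have hp1 : SX.proj (L.spin (col.Φ t₁ y)) = SX.proj q :=
    (L.spin_proj _ ht₁.1).trans (tangentBundle_mk_eq_iff.1 (hq 0)).1.symm
  obtain ⟨a, ha, -⟩ := SX.simply_transitive _ _ hp1
  obtain ⟨B, hB⟩ := exists_isSpinLift a
  have hBA : ∀ i k, B i k = A t₁ i k := by
    intro i k
    have h1 := L.frame_act_spin ht₁.1 hB k
    rw [ha, hq k] at h1
    have h2 : col.adaptedVec SY t₁ q₀ k = ∑ i, B i k • L.vec i (col.Φ t₁ y) :=
      (tangentBundle_mk_eq_iff.1 h1).2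
    change _ = gX.inner (col.Φ t₁ y) (L.vec i (col.Φ t₁ y)) (col.adaptedVec SY t₁ q₀ k)
    rw [h2]
    simp [map_sum, L.inner_vec ht₁.1]
  -- The element `a` produces the adapted frame at `t₁` from `L`, so at `t` it produces the frame
  -- with matrix `A t₁`. The discrepancy `D` from `A t` is a rotation and lifts to `a'`.
  set D := (A t₁).transpose * A t with hD
  have hDo : D.transpose * D = 1 := by
    rw [hD, Matrix.transpose_mul, Matrix.transpose_transpose, Matrix.mul_assoc,
      ← Matrix.mul_assoc (A t₁), mul_eq_one_comm.1 (horth t₁ ht₁.1), Matrix.one_mul,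
      horth t ht.1]
  have hDd : D.det = 1 := by
    rw [hD, Matrix.det_mul, Matrix.det_transpose]
    linear_combination (A t).det * (A t₀).det * hone t₁ ht₁ + hone t ht
      - (A t₁).det * (A t).det * hdet t₀ hL
  obtain ⟨a', ha'⟩ := exists_spin_of_orthogonal hDo hDd
  have hlift : IsSpinLift a' fun i k => D i k := by
    intro i
    rw [cliffE, ha', iota_eq_sum]
    simp [cliffE]
  refine ⟨SX.act (SX.act (L.spin (col.Φ t y)) a) a', fun k => ?_⟩
  rw [SX.frame_act hlift]
  have h1 := fun i => L.frame_act_spin ht.1 hB i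
  refine tangentBundle_mk_eq_iff.2 ⟨(tangentBundle_mk_eq_iff.1 (h1 0)).1, ?_⟩
  have h2 := fun i => (tangentBundle_mk_eq_iff.1 (h1 i)).2
  change ∑ i, D i k • (show EuclideanSpace ℝ (Fin (n + 1)) from
    SX.frame (SX.act (L.spin (col.Φ t y)) a) i) = _
  simp only [h2]
  have h3 : col.adaptedVec SY t q₀ k = ∑ i, A t i k • L.vec i (col.Φ t y) :=
    orthonormal_expansion (L.inner_vec ht.1) _
  have h4 : A t₁ * D = A t := by
    rw [hD, ← Matrix.mul_assoc, mul_eq_one_comm.1 (horth t₁ ht₁.1), Matrix.one_mul]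
  have h5 : ∀ i, A t i k = ∑ l, D l k * B i l := by
    intro i
    rw [← h4, Matrix.mul_apply]
    exact Finset.sum_congr rfl fun l _ => by rw [hBA, mul_comm]
  have h6 : ∀ V : Fin (n + 1) → EuclideanSpace ℝ (Fin (n + 1)),
      ∑ l, D l k • ∑ i, B i l • V i = ∑ i, A t i k • V i := by
    intro V
    simp only [h5, Finset.sum_smul, Finset.smul_sum, smul_smul]
    exact Finset.sum_comm
  exact (h6 fun i => L.vec i (col.Φ t y)).trans h3.symm

/-- The parameters whose adapted frame lifts to a spin frame form an open and closed subset of the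
connected interval `[0, ε)`, and `j` puts `0` into it. -/
lemma exists_spin_adapted (hn : 0 < n) (hg : IsProductMetric col gX gY)
    (EX : FlatHermitianBundle X N PX) (hj : IsInducedSpin col SX SY j) (q₀ : QY)
    (t : Ico 0 col.ε) :
    ∃ q, ∀ k, (⟨SX.proj q, SX.frame q k⟩ : TangentBundle (𝓡∂ (n + 1)) X)
        = ⟨col.Φ t (SY.proj q₀), col.adaptedVec SY t q₀ k⟩ := by
  set s : Set (Ico 0 col.ε) := {t | ∃ q, ∀ k,
    (⟨SX.proj q, SX.frame q k⟩ : TangentBundle (𝓡∂ (n + 1)) X)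
        = ⟨col.Φ t (SY.proj q₀), col.adaptedVec SY t q₀ k⟩} with hs
  have hJ := eventually_exists_spin_adapted hn hg SX EX SY q₀
  have hclopen : IsClopen s := by
    refine ⟨⟨isOpen_iff_mem_nhds.2 fun t₀ ht₀ => ?_⟩, isOpen_iff_mem_nhds.2 fun t₀ ht₀ => ?_⟩ <;>
      obtain ⟨J, hJm, hJs⟩ := hJ t₀ <;> filter_upwards [hJm] with t₁ ht₁
    · exact fun h => ht₀ (hJs t₁ ht₁ t₀ (mem_of_mem_nhds hJm) h)
    · exact hJs t₀ (mem_of_mem_nhds hJm) t₁ ht₁ ht₀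
  have : PreconnectedSpace (Ico 0 col.ε) := Subtype.preconnectedSpace isPreconnected_Ico
  have h0 : (⟨0, col.zero_mem⟩ : Ico 0 col.ε) ∈ s :=
    ⟨j q₀, (isAdapted_iff hg col.zero_mem (hj.proj_eq q₀)).1 (hj.adapted q₀)⟩
  have ht : t ∈ s := by
    rw [hclopen.eq_univ ⟨_, h0⟩]
    exact mem_univ t
  exact ht

/-- The adapted tangent frames depend continuously on `t` and `q` and lie in the image of
`frameMap`; lift them through this covering with initial value `j`. -/
theorem exists_isSpinTransport (hn : 0 < n) (hg : IsProductMetric col gX gY)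
    (EX : FlatHermitianBundle X N PX) (hj : IsInducedSpin col SX SY j) :
    ∃ T, IsSpinTransport col SX SY j T := by
  let G : Ico 0 col.ε × QY → range (frameMap (I := 𝓡∂ (n + 1)) SX.proj SX.frame) := fun z =>
    ⟨fun k => ⟨col.Φ z.1 (SY.proj z.2), col.adaptedVec SY z.1 z.2 k⟩, by
      obtain ⟨q, hq⟩ := exists_spin_adapted hn hg EX hj z.2 z.1
      exact ⟨q, funext hq⟩⟩
  have hG : Continuous G := Continuous.subtype_mk
    (continuous_pi fun k => continuous_adaptedVec hn hg SX SY k) _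
  obtain ⟨T, hT, hT0, hTG⟩ := SX.covering.exists_lift_Ico col.ε_pos hG hj.continuous fun q₀ =>
    Subtype.ext (funext fun k => ((isAdapted_iff hg col.zero_mem (hj.proj_eq q₀)).1
      (hj.adapted q₀) k).symm)
  have hTk : ∀ t ∈ Ico 0 col.ε, ∀ q k, (⟨SX.proj (T t q), SX.frame (T t q) k⟩ :
      TangentBundle (𝓡∂ (n + 1)) X) = ⟨col.Φ t (SY.proj q), col.adaptedVec SY t q k⟩ :=
    fun t ht q k => congrFun (congrArg Subtype.val (hTG t ht q)) k
  have hp : ∀ t ∈ Ico 0 col.ε, ∀ q, SX.proj (T t q) = col.Φ t (SY.proj q) := fun t ht q =>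
    (tangentBundle_mk_eq_iff.1 (hTk t ht q 0)).1
  exact ⟨T, hT, hT0, hp, fun t ht q => (isAdapted_iff hg ht (hp t ht q)).2 (hTk t ht q)⟩

lemma FlatHermitianBundle.continuous_proj {M P : Type*} [TopologicalSpace M] [TopologicalSpace P]
    (E : FlatHermitianBundle M N P) : Continuous E.proj := E.covering.continuous

theorem exists_isFlatTransport (hjE : IsRestrictedBundle col EX EY jE) :
    ∃ τ, IsFlatTransport col EX EY jE τ := by
  have hG : Continuous fun z : Ico 0 col.ε × PY => col.Φ z.1 (EY.proj z.2) := by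
    have := EY.continuous_proj
    exact col.Φ_smooth.continuousOn.comp_continuous (f := fun z : Ico 0 col.ε × PY =>
      ((z.1 : ℝ), EY.proj z.2)) (by fun_prop) fun z => ⟨z.1.2, mem_univ _⟩
  obtain ⟨τ, h1, h2, h3⟩ := EX.covering.exists_lift_Ico col.ε_pos hG hjE.continuous fun f =>
    (hjE.proj_eq f).symm
  exact ⟨τ, h1, h2, h3⟩

/-! ### Equivariance of the transports -/

/-- The last generator anticommutes with each vector of `ℝ^n`, hence commutes with even products of
them. -/
lemma cliffE_last_mul_incl {b : CliffordAlgebra (cliffForm n)}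
    (hb : b ∈ CliffordAlgebra.even (cliffForm n)) :
    cliffE (Fin.last n) * inclCliff n b = inclCliff n b * cliffE (Fin.last n) := by
  have h1 : ∀ v, cliffE (Fin.last n) * inclCliff n (CliffordAlgebra.ι _ v)
      = -(inclCliff n (CliffordAlgebra.ι _ v) * cliffE (Fin.last n)) := by
    intro v
    have h2 : inclCliff n (CliffordAlgebra.ι _ v) = CliffordAlgebra.ι _ (inclVec n v) :=
      CliffordAlgebra.map_apply_ι _ _
    rw [h2, cliffE, iota_mul_iota_swap]
    simp [inclVec, Pi.single_apply]
  induction b, hb using CliffordAlgebra.even_induction with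
  | algebraMap r => rw [AlgHom.commutes, Algebra.commutes]
  | add x y hx hy ihx ihy => rw [map_add, mul_add, add_mul, ihx, ihy]
  | ι_mul_ι_mul m₁ m₂ x hx ih =>
    rw [map_mul, map_mul, ← mul_assoc, ← mul_assoc, h1, neg_mul, mul_assoc _ (cliffE _), h1,
      mul_neg, neg_neg, mul_assoc, mul_assoc _ _ (inclCliff n x), ih]
    simp only [mul_assoc]

/-- `Spin(n)` fixes the last vector by the previous lemma, so the lifted matrix is the block sum of
`A` and `1`. -/
lemma isSpinLift_inclSpin {a : SpinGrp n} {A : Fin n → Fin n → ℝ} (hA : IsSpinLift a A) :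
    IsSpinLift (inclSpin n a) fun k l =>
      Fin.lastCases (motive := fun _ => ℝ) (if k = Fin.last n then 1 else 0)
        (fun i => Fin.lastCases (motive := fun _ => ℝ) 0 (fun m => A m i) k) l := by
  have hE : ∀ i : Fin n, cliffE (i.castSucc) = inclCliff n (cliffE i) := by
    intro i
    rw [cliffE, cliffE, inclCliff, CliffordAlgebra.map_apply_ι]
    congr 1
    funext k
    change _ = (Fin.snoc (Pi.single i 1) 0 : Fin (n + 1) → ℝ) k
    refine Fin.lastCases ?_ (fun m => ?_) k
    · simp [(Fin.castSucc_lt_last i).ne']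
    · simp [Pi.single_apply]
  intro l
  change inclCliff n (a : CliffordAlgebra (cliffForm n)) * _
    = _ * inclCliff n (a : CliffordAlgebra (cliffForm n))
  refine Fin.lastCases ?_ (fun i => ?_) l
  · simp only [Fin.lastCases_last, ite_smul, one_smul, zero_smul, Finset.sum_ite_eq',
      Finset.mem_univ, if_true]
    exact (cliffE_last_mul_incl (spinGroup.mem_even a.2)).symm
  · simp only [Fin.lastCases_castSucc, Fin.sum_univ_castSucc, Fin.lastCases_last, zero_smul,
      add_zero, hE, ← map_smul, ← map_sum, ← map_mul]
    rw [hA i]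

lemma IsAdapted.act (h : IsAdapted col SX SY q q₀) (a : SpinGrp n) :
    IsAdapted col SX SY (SX.act q (inclSpin n a)) (SY.act q₀ a) := by
  obtain ⟨A, hA⟩ := exists_isSpinLift a
  have hX := SX.frame_act (isSpinLift_inclSpin hA) q
  have hdr := fun k => congrArg (fun z : TangentBundle (𝓡∂ (n + 1)) X => col.dr z.1 z.2) (hX k)
  have hdp := fun k => congrArg (fun z : TangentBundle (𝓡∂ (n + 1)) X =>
    (⟨col.p z.1, col.dp z.1 z.2⟩ : TangentBundle (𝓡 n) Y)) (hX k)
  simp only [Fin.sum_univ_castSucc, map_add, map_sum, map_smul] at hdr hdp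
  refine ⟨fun i => ?_, fun i => ?_, ?_, ?_⟩
  · rw [hdp, SY.frame_act hA]
    have h2 := fun m => (tangentBundle_mk_eq_iff.1 (h.dp_frame m)).2
    refine tangentBundle_mk_eq_iff.2 ⟨(tangentBundle_mk_eq_iff.1 (h.dp_frame i)).1, ?_⟩
    simp only [Fin.lastCases_castSucc, Fin.lastCases_last, zero_smul, add_zero]
    change ∑ m, A m i • (show EuclideanSpace ℝ (Fin n) from
      col.dp (SX.proj q) (SX.frame q m.castSucc)) = _
    simp only [h2]
    rfl
  · rw [hdr]
    simp [h.dr_frame]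
  · have h1 : (⟨col.p (SX.proj (SX.act q (inclSpin n a))),
        col.dp _ (SX.frame (SX.act q (inclSpin n a)) (Fin.last n))⟩ : TangentBundle (𝓡 n) Y)
        = ⟨col.p (SX.proj q), 0⟩ := by
      refine (hdp (Fin.last n)).trans ?_
      simp [h.dp_last, (Fin.castSucc_lt_last _).ne]
    exact (tangentBundle_mk_eq_iff.1 h1).2
  · rw [hdr]
    simp [h.dr_last, (Fin.castSucc_lt_last _).ne]

/-- Both sides lie over the same path of tangent frames and agree at `r = 0` by equivariance of `j`;
lifts to a covering are unique. -/
lemma IsSpinTransport.act_eq (hT : IsSpinTransport col SX SY j T)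
    (hg : IsProductMetric col gX gY) (hj : IsInducedSpin col SX SY j) (q₀ : QY) (a : SpinGrp n)
    (ht : t ∈ Ico 0 col.ε) : T t (SY.act q₀ a) = SX.act (T t q₀) (inclSpin n a) := by
  have hc : ∀ q, ContinuousOn (fun t => T t q) (Ico 0 col.ε) := fun q =>
    hT.continuousOn.comp (f := fun t : ℝ => (t, q)) (by fun_prop) fun t ht => ⟨ht, mem_univ _⟩
  refine SX.covering.eqOn_of_comp_eqOn (g₁ := fun t => T t (SY.act q₀ a))
    (g₂ := fun t => SX.act (T t q₀) (inclSpin n a)) isPreconnected_Ico (hc _)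
    (SX.act_continuous.comp_continuousOn ((hc q₀).prodMk continuousOn_const))
    (fun s hs => Subtype.ext (funext fun k => ?_)) col.zero_mem ?_ ht
  · have h1 := (isAdapted_iff hg hs (hT.proj_eq s hs (SY.act q₀ a))).1
      (hT.adapted s hs (SY.act q₀ a)) k
    have h2 := (isAdapted_iff hg hs (q := SX.act (T s q₀) (inclSpin n a)) (q₀ := SY.act q₀ a)
      (by rw [SX.proj_act, SY.proj_act, hT.proj_eq s hs])).1 ((hT.adapted s hs q₀).act a) k
    exact h1.trans h2.symm
  · rw [hT.zero, hT.zero, hj.equivariant q₀ a (inclSpin n a) rfl]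

lemma IsFlatTransport.act_eq (hτ : IsFlatTransport col EX EY jE τ)
    (hjE : IsRestrictedBundle col EX EY jE) (f : PY) (u : Matrix.unitaryGroup (Fin N) ℂ)
    (ht : t ∈ Ico 0 col.ε) : τ t (EY.act f u) = EX.act (τ t f) u := by
  have hc : ∀ q, ContinuousOn (fun t => τ t q) (Ico 0 col.ε) := fun q =>
    hτ.continuousOn.comp (f := fun t : ℝ => (t, q)) (by fun_prop) fun t ht => ⟨ht, mem_univ _⟩
  refine EX.covering.eqOn_of_comp_eqOn (g₁ := fun t => τ t (EY.act f u))
    (g₂ := fun t => EX.act (τ t f) u) isPreconnected_Ico (hc _)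
    ((EX.act_continuous u).comp_continuousOn (hc f)) (fun s hs => ?_) col.zero_mem ?_ ht
  · simp only [Function.comp]
    rw [EX.proj_act, hτ.proj_eq s hs, hτ.proj_eq s hs, EY.proj_act]
  · rw [hτ.zero, hτ.zero, hjE.equivariant]

end Collar

/-! ### Spinors of a hypersurface -/

section Identification

variable {n : ℕ} {ΔX ΔY : Type*} [NormedAddCommGroup ΔX] [InnerProductSpace ℂ ΔX]
  [NormedAddCommGroup ΔY] [InnerProductSpace ℂ ΔY] {CX : SpinorModule (n + 1) ΔX}
  {CY : SpinorModule n ΔY} {κ : ΔY →ₗᵢ[ℂ] ΔX}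

lemma inclVec_single (i : Fin n) : inclVec n (Pi.single i 1) = Pi.single i.castSucc 1 := by
  funext k
  change (Fin.snoc (Pi.single i 1) 0 : Fin (n + 1) → ℝ) k = _
  refine Fin.lastCases ?_ (fun m => ?_) k
  · simp [(Fin.castSucc_lt_last i).ne']
  · simp [Pi.single_apply]

lemma vec_eq_inclVec_add (v : Fin (n + 1) → ℝ) :
    v = inclVec n (fun i => v i.castSucc) + v (Fin.last n) • Pi.single (Fin.last n) 1 := by
  funext k
  change v k = (Fin.snoc (fun i => v i.castSucc) 0 : Fin (n + 1) → ℝ) k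
    + v (Fin.last n) * (Pi.single (Fin.last n) 1 : Fin (n + 1) → ℝ) k
  refine Fin.lastCases ?_ (fun m => ?_) k
  · simp
  · simp [(Fin.castSucc_lt_last m).ne]

lemma normalMul_normalMul (CX : SpinorModule (n + 1) ΔX) (x : ΔX) :
    normalMul CX (normalMul CX x) = -x := by
  have := congrArg (fun T : Module.End ℂ ΔX => T x) (CX.gen_sq (Fin.last n))
  simpa [normalMul] using this

lemma c_inclVec_normalMul (CX : SpinorModule (n + 1) ΔX) (v : Fin n → ℝ) (x : ΔX) :
    CX.c (inclVec n v) (normalMul CX x) = -normalMul CX (CX.c (inclVec n v) x) := by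
  have h := iota_mul_iota_swap (inclVec n v) (Pi.single (Fin.last n) 1)
  have h2 : ∑ i, inclVec n v i * (Pi.single (Fin.last n) 1 : Fin (n + 1) → ℝ) i = 0 := by
    simp [inclVec, Pi.single_apply]
  rw [h2, mul_zero, map_zero, sub_zero] at h
  have h3 := congrArg (fun T : Module.End ℂ ΔX => T x) (congrArg CX.rep h)
  rw [map_mul, map_neg, map_mul, CX.rep_iota, CX.rep_iota] at h3
  exact h3

namespace IsSpinorIdentification

lemma c_inclVec (hκ : IsSpinorIdentification CX CY κ) (v : Fin n → ℝ) (x : ΔY) :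
    CX.c (inclVec n v) (κ x) = normalMul CX (κ (CY.c v x)) := by
  rw [hκ.intertwines, map_neg, normalMul_normalMul, neg_neg]

lemma gen_castSucc (hκ : IsSpinorIdentification CX CY κ) (i : Fin n) (x : ΔY) :
    CX.gen i.castSucc (κ x) = normalMul CX (κ (CY.gen i x)) := by
  rw [SpinorModule.gen, ← inclVec_single, hκ.c_inclVec]
  rfl

/-- Each tangential factor equals `σ` times its counterpart on `Y`; since `σ` anticommutes with
tangential multiplication and squares to `-1`, two factors leave no `σ`. -/
lemma c_inclVec_c_inclVec (hκ : IsSpinorIdentification CX CY κ) (v w : Fin n → ℝ) (x : ΔY) :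
    CX.c (inclVec n v) (CX.c (inclVec n w) (κ x)) = κ (CY.c v (CY.c w x)) := by
  rw [hκ.c_inclVec, c_inclVec_normalMul, hκ.c_inclVec, normalMul_normalMul, neg_neg]

lemma gen_gen (hκ : IsSpinorIdentification CX CY κ) (i j : Fin n) (x : ΔY) :
    CX.gen i.castSucc (CX.gen j.castSucc (κ x)) = κ (CY.gen i (CY.gen j x)) := by
  rw [SpinorModule.gen, SpinorModule.gen, ← inclVec_single, ← inclVec_single,
    hκ.c_inclVec_c_inclVec]
  rfl

lemma map_real_smul (κ : ΔY →ₗᵢ[ℂ] ΔX) (r : ℝ) (x : ΔY) : κ (r • x) = r • κ x :=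
  κ.toLinearMap.map_smul_of_tower r x

/-- The identification is equivariant under the even Clifford algebra of the hypersurface. -/
lemma map_rep (hκ : IsSpinorIdentification CX CY κ) {b : CliffordAlgebra (cliffForm n)}
    (hb : b ∈ CliffordAlgebra.even (cliffForm n)) (x : ΔY) :
    κ (CY.rep b x) = CX.rep (inclCliff n b) (κ x) := by
  induction b, hb using CliffordAlgebra.even_induction generalizing x with
  | algebraMap r =>
    simp only [AlgHom.commutes, Module.algebraMap_end_apply, map_real_smul]
  | add b b' _ _ ih ih' => simp only [map_add, LinearMap.add_apply, ih, ih']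
  | ι_mul_ι_mul v w b _ ih =>
    have h2 : ∀ v, inclCliff n (CliffordAlgebra.ι _ v) = CliffordAlgebra.ι _ (inclVec n v) :=
      fun v => CliffordAlgebra.map_apply_ι _ _
    simp only [map_mul, h2, Module.End.mul_apply, SpinorModule.rep_iota]
    rw [← ih, hκ.c_inclVec_c_inclVec]

lemma map_rep_spin (hκ : IsSpinorIdentification CX CY κ) (a : SpinGrp n) (x : ΔY) :
    κ (CY.rep (a : CliffordAlgebra (cliffForm n)) x)
      = CX.rep (inclSpin n a : CliffordAlgebra (cliffForm (n + 1))) (κ x) :=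
  hκ.map_rep (spinGroup.mem_even a.2) x

/-- Positive spinors are stable under the even Clifford algebra. -/
lemma rep_mem_range (hκ : IsSpinorIdentification CX CY κ)
    {b : CliffordAlgebra (cliffForm (n + 1))}
    (hb : b ∈ CliffordAlgebra.even (cliffForm (n + 1))) (x : ΔY) :
    CX.rep b (κ x) ∈ range κ := by
  induction b, hb using CliffordAlgebra.even_induction generalizing x with
  | algebraMap r =>
    exact ⟨r • x, by rw [AlgHom.commutes, Module.algebraMap_end_apply, map_real_smul]⟩
  | add b b' _ _ ih ih' =>
    obtain ⟨y, hy⟩ := ih x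
    obtain ⟨y', hy'⟩ := ih' x
    exact ⟨y + y', by rw [map_add, map_add, LinearMap.add_apply, hy, hy']⟩
  | ι_mul_ι_mul v w b _ ih =>
    obtain ⟨y, hy⟩ := ih x
    -- A vector maps the range of `κ` into `σ` times that range and, by `hc'`, back again; so pairs
    -- of vectors preserve it.
    have hc : ∀ (v : Fin (n + 1) → ℝ) (y : ΔY), CX.c v (κ y)
        = normalMul CX (κ (CY.c (fun i => v i.castSucc) y + v (Fin.last n) • y)) := by
      intro v y
      conv_lhs => rw [vec_eq_inclVec_add v]
      rw [map_add, map_smul, LinearMap.add_apply, LinearMap.smul_apply, hκ.c_inclVec, map_add,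
        map_add, map_real_smul, LinearMap.map_smul_of_tower]
      rfl
    have hc' : ∀ (v : Fin (n + 1) → ℝ) (y : ΔY), CX.c v (normalMul CX (κ y))
        = κ (CY.c (fun i => v i.castSucc) y - v (Fin.last n) • y) := by
      intro v y
      conv_lhs => rw [vec_eq_inclVec_add v]
      rw [map_add, map_smul, LinearMap.add_apply, LinearMap.smul_apply, c_inclVec_normalMul,
        hκ.c_inclVec, normalMul_normalMul, neg_neg, map_sub, map_real_smul, sub_eq_add_neg,
        ← smul_neg, ← normalMul_normalMul CX (κ y)]
      rfl
    rw [map_mul, map_mul, CX.rep_iota, CX.rep_iota, Module.End.mul_apply, Module.End.mul_apply,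
      ← hy, hc, hc']
    exact mem_range_self _

/-- Only the parity of the number of tangential factors matters: pairs transfer unchanged, and an
odd factor leaves one `σ`. This is the algebraic source of the overall factor `σ`. -/
lemma prod_gen (hκ : IsSpinorIdentification CX CY κ) (l : List (Fin n)) (x : ΔY) :
    (l.map fun i => CX.gen i.castSucc).prod (κ x)
      = if Even l.length then κ ((l.map CY.gen).prod x)
        else normalMul CX (κ ((l.map CY.gen).prod x)) := by
  induction l with
  | nil => simp
  | cons i l ih =>
    rw [List.map_cons, List.prod_cons, Module.End.mul_apply, ih, List.map_cons, List.prod_cons,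
      List.length_cons, Module.End.mul_apply]
    by_cases h : Even l.length
    · rw [if_pos h, if_neg (Nat.even_add_one.not.2 (not_not.2 h)), hκ.gen_castSucc]
    · rw [if_neg h, if_pos (Nat.even_add_one.2 h), SpinorModule.gen, ← inclVec_single, c_inclVec_normalMul,
        hκ.c_inclVec, normalMul_normalMul, neg_neg]
      rfl

end IsSpinorIdentification

/-! ### Zeroth-order terms of the Dirac operator on the collar -/

section Dirac

variable {X : Type*} [TopologicalSpace X] [ChartedSpace (EuclideanHalfSpace (n + 1)) X]
  [IsManifold (𝓡∂ (n + 1)) ∞ X]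
  {Y : Type*} [TopologicalSpace Y] [ChartedSpace (EuclideanSpace ℝ (Fin n)) Y]
  [IsManifold (𝓡 n) ∞ Y]
  {col : Collar n X Y} {gX : RiemMetric (𝓡∂ (n + 1)) X} {gY : RiemMetric (𝓡 n) Y}
  {QX : Type*} [TopologicalSpace QX] {x : X} {V : Set Y}
  {e : Fin n → ∀ y : Y, TangentSpace (𝓡 n) y}

/-- Clifford multiplication by a form of odd degrees, pulled back from the hypersurface. -/
lemma cliffMul_frame (hκ : IsSpinorIdentification CX CY κ) (hn : Odd n)
    {η : MixedForm (𝓡∂ (n + 1)) X} (hodd : ∀ k, Even k → ∀ x, η k x = 0)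
    (hη : IsBoundaryCompatible col η) (hg : IsProductMetric col gX gY) (hx : x ∈ col.W)
    (e : Fin n → ∀ y : Y, TangentSpace (𝓡 n) y) (v : ΔY) :
    cliffMul CX η (col.frame e) x (κ v)
      = normalMul CX (κ (cliffMul CY (restrictForm col η) e (col.p x) v)) := by
  have hk : ∀ k, ∑ i : Fin k → Fin (n + 1), η k x (fun j => col.frame e (i j) x) •
        (List.ofFn fun j => CX.gen (i j)).prod (κ v)
      = normalMul CX (κ (∑ i : Fin k → Fin n, restrictForm col η k (col.p x)
        (fun j => e (i j) (col.p x)) • (List.ofFn fun j => CY.gen (i j)).prod v)) := by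
    intro k
    rcases Nat.even_or_odd k with hk | hk
    · have h2 : ∀ y, restrictForm col η k y = 0 := fun y => by
        rw [restrictForm, hodd k hk]
        rfl
      simp [hodd k hk, h2]
    · simp only [hη.apply_frame hg hx]
      rw [map_sum, map_sum]
      -- The multi-indices of `Y` embed in those of `X`. Those left out contain the normal index,
      -- and the form vanishes on them because `∂/∂r` projects to zero.
      refine (Finset.sum_of_injOn (fun i : Fin k → Fin n => fun j => (i j).castSucc) ?_ ?_ ?_
        ?_).symm
      · intro i _ i' _ h
        funext j
        exact Fin.castSucc_injective n (congrFun h j)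
      · intro i _
        exact Finset.mem_coe.2 (Finset.mem_univ _)
      · intro i _ hi
        obtain ⟨j, hj⟩ : ∃ j, i j = Fin.last n := by
          by_contra hne
          push Not at hne
          refine hi ⟨fun j => (i j).castPred (hne j), by simp, ?_⟩
          funext j
          simp
        have : restrictForm col η k (col.p x) (fun j => snocZero e (i j) (col.p x)) = 0 :=
          (restrictForm col η k (col.p x)).toMultilinearMap.map_coord_zero j (by
            rw [hj, snocZero_last])
        rw [this, zero_smul]
      · intro i _
        simp only [snocZero_castSucc]
        rw [map_smul, map_smul]
        congr 1
        have h3 := hκ.prod_gen (List.ofFn i) v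
        rw [List.map_ofFn, List.map_ofFn, List.length_ofFn, if_neg (Nat.not_even_iff_odd.2 hk)] at h3
        exact h3.symm
  simp only [cliffMul, LinearMap.sum_apply, LinearMap.smul_apply]
  -- On `X` there is one more degree, `n + 1`, which is even because `n` is odd.
  rw [Finset.sum_range_succ, hodd (n + 1) hn.add_one]
  simp only [hk, map_sum, map_smul]
  simp

/-- Connection terms have three tangential factors and flux terms an odd number, so exactly one `σ`
comes out in front. Terms with a normal index vanish. -/
lemma diracZeroth_frame (hκ : IsSpinorIdentification CX CY κ) (hn : Odd n)
    {η : MixedForm (𝓡∂ (n + 1)) X} (hodd : ∀ k, Even k → ∀ x, η k x = 0)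
    (hη : IsBoundaryCompatible col η) (hg : IsProductMetric col gX gY)
    (SX : SpinStructure gX QX) (hV : IsOpen V) (he : ∀ i, SmoothVF (𝓡 n) (e i) V)
    (hx : x ∈ col.W) (hxV : col.p x ∈ V) (v : ΔY) :
    diracZeroth gX CX η (col.frame e) x (κ v)
      = normalMul CX (κ (diracZeroth gY CY (restrictForm col η) e (col.p x) v)) := by
  have h0 : ∀ {i j l : Fin (n + 1)}, (i = Fin.last n ∨ j = Fin.last n ∨ l = Fin.last n) →
      leviCivitaCoeff gX (col.frame e) x i j l = 0 := fun h =>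
    Collar.leviCivitaCoeff_frame_last hg SX hV he hx hxV h
  have h1 := Collar.leviCivitaCoeff_frame hg SX hV he hx hxV
  have hb : ∀ i : Fin n, CX.bivector (fun l j => leviCivitaCoeff gX (col.frame e) x i.castSucc j l)
      (κ v) = κ (CY.bivector (fun l j => leviCivitaCoeff gY e (col.p x) i j l) v) := by
    intro i
    simp only [SpinorModule.bivector, Fin.sum_univ_castSucc, h1,
      h0 (Or.inr (Or.inl rfl)), h0 (Or.inr (Or.inr rfl)), zero_smul, add_zero,
      Finset.sum_const_zero, LinearMap.smul_apply, LinearMap.sum_apply, Module.End.mul_apply,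
      hκ.gen_gen, map_sum, IsSpinorIdentification.map_real_smul]
  have hl : CX.bivector (fun l j => leviCivitaCoeff gX (col.frame e) x (Fin.last n) j l) = 0 := by
    simp only [SpinorModule.bivector, h0 (Or.inl rfl), zero_smul, Finset.sum_const_zero, smul_zero]
  simp only [diracZeroth, Fin.sum_univ_castSucc, hl, mul_zero, add_zero, LinearMap.add_apply,
    LinearMap.sum_apply, Module.End.mul_apply, hb, hκ.gen_castSucc, map_add, map_sum]
  rw [cliffMul_frame hκ hn hodd hη hg hx]

end Dirac

end Identification

/-! ### Twisted spinors under changes of frames -/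

section Frames

variable {d : ℕ} {H : Type*} [TopologicalSpace H]
  {I : ModelWithCorners ℝ (EuclideanSpace ℝ (Fin d)) H}
  {M : Type*} [TopologicalSpace M] [ChartedSpace H M] [IsManifold I ∞ M]
  {g : RiemMetric I M} {x : M}
  {Q : Type*} [TopologicalSpace Q] {N : ℕ} {P : Type*}
  [TopologicalSpace P] {S : SpinStructure g Q} {E : FlatHermitianBundle M N P}
  {Δ : Type*} [NormedAddCommGroup Δ] [InnerProductSpace ℂ Δ]
  {C : SpinorModule d Δ} {W : Set M} {ψ : SpinorField Q P Δ N}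

/-- The action of `Spin(d) × U(N)` on `Δ ⊗ ℂ^N`. -/
def twist (C : SpinorModule d Δ) (a : SpinGrp d) (u : Matrix.unitaryGroup (Fin N) ℂ)
    (v : Fin N → Δ) : Fin N → Δ :=
  fun b => ∑ b', (u : Matrix (Fin N) (Fin N) ℂ) b b' •
    C.rep (a : CliffordAlgebra (cliffForm d)) (v b')

lemma twist_mul (C : SpinorModule d Δ) (a a' : SpinGrp d) (u u' : Matrix.unitaryGroup (Fin N) ℂ)
    (v : Fin N → Δ) : twist C (a * a') (u * u') v = twist C a u (twist C a' u' v) := by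
  funext b
  simp only [twist, Submonoid.coe_mul, map_mul, Module.End.mul_apply, Matrix.mul_apply, map_sum,
    map_smul, Finset.sum_smul, Finset.smul_sum, smul_smul]
  exact Finset.sum_comm

lemma twist_one (C : SpinorModule d Δ) (v : Fin N → Δ) : twist C 1 1 v = v := by
  funext b
  simp [twist, Matrix.one_apply, ite_smul]

lemma twist_inv_twist (C : SpinorModule d Δ) (a : SpinGrp d) (u : Matrix.unitaryGroup (Fin N) ℂ)
    (v : Fin N → Δ) : twist C a⁻¹ u⁻¹ (twist C a u v) = v := by
  rw [← twist_mul, inv_mul_cancel, inv_mul_cancel, twist_one]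

lemma twist_twist_inv (C : SpinorModule d Δ) (a : SpinGrp d) (u : Matrix.unitaryGroup (Fin N) ℂ)
    (v : Fin N → Δ) : twist C a u (twist C a⁻¹ u⁻¹ v) = v := by
  rw [← twist_mul, mul_inv_cancel, mul_inv_cancel, twist_one]

lemma IsSmoothSection.act_eq (hψ : IsSmoothSection S E C W ψ) {q : Q} {f : P}
    (h : S.proj q = E.proj f) (hW : S.proj q ∈ W) (a : SpinGrp d)
    (u : Matrix.unitaryGroup (Fin N) ℂ) :
    ψ (S.act q a) (E.act f u) = twist C a⁻¹ u⁻¹ (ψ q f) := by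
  have : ψ q f = twist C a u (ψ (S.act q a) (E.act f u)) :=
    funext fun b => hψ.equivariant q f h hW a u b
  rw [this, twist_inv_twist]

/-- `twist` as a continuous linear map. -/
lemma exists_twist_clm (C : SpinorModule d Δ) (a : SpinGrp d)
    (u : Matrix.unitaryGroup (Fin N) ℂ) :
    ∃ K : (Fin N → Δ) →L[ℝ] (Fin N → Δ), ∀ v, K v = twist C a u v := by
  refine ⟨ContinuousLinearMap.pi fun b => ∑ b', ((u : Matrix (Fin N) (Fin N) ℂ) b b' •
    C.repL (a : CliffordAlgebra (cliffForm d))).restrictScalars ℝ ∘L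
      ContinuousLinearMap.proj b', fun v => ?_⟩
  funext b
  simp [twist]

/-- An equivariant field is a smooth section if it is smooth in one local frame at each point. -/
lemma IsSmoothSection.of_contMDiffAt (hd : 0 < d) (hW : IsOpen W)
    (heq : ∀ q f, S.proj q = E.proj f → S.proj q ∈ W →
      ∀ (a : SpinGrp d) (u : Matrix.unitaryGroup (Fin N) ℂ),
        ψ q f = twist C a u (ψ (S.act q a) (E.act f u)))
    (hsm : ∀ x ∈ W, ∃ L : LocalFrame S E, x ∈ L.U ∧
      ContMDiffAt I 𝓘(ℝ, Fin N → Δ) ∞ (fun y => ψ (L.spin y) (L.flat y)) x) :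
    IsSmoothSection S E C W ψ := by
  refine ⟨fun q f h hq a u b => congrFun (heq q f h hq a u) b, fun L' x hx => ?_⟩
  obtain ⟨hx', hxW⟩ := hx
  obtain ⟨L, hx, hL⟩ := hsm x hxW
  -- A constant change makes `L` agree with `L'` at `x`; the remaining change is `unitLift` of the
  -- transition matrix, smooth at `x`.
  obtain ⟨a, ha, -⟩ := S.simply_transitive (L.spin x) (L'.spin x) (by
    rw [L.spin_proj x hx, L'.spin_proj x hx'])
  obtain ⟨u, hu, -⟩ := E.simply_transitive (L.flat x) (L'.flat x) (by
    rw [L.flat_proj x hx, L'.flat_proj x hx'])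
  obtain ⟨K, hK⟩ := exists_twist_clm C a⁻¹ u⁻¹
  have hL1 : ContMDiffAt I 𝓘(ℝ, Fin N → Δ) ∞
      (fun y => ψ ((L.translate a u).spin y) ((L.translate a u).flat y)) x := by
    refine (K.contDiff.contMDiff.contMDiffAt.comp x hL).congr_of_eventuallyEq ?_
    filter_upwards [L.isOpen_U.mem_nhds hx, hW.mem_nhds hxW] with y hy hyW
    change ψ (S.act (L.spin y) a) (E.act (L.flat y) u) = K (ψ (L.spin y) (L.flat y))
    rw [hK, heq _ _ (L.proj_spin_eq_proj_flat hy) (by rwa [L.spin_proj y hy]) a u, twist_inv_twist]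
  obtain ⟨v₀, hv₀⟩ := C.exists_norm_one
  have hx1 : x ∈ (L.translate a u).U := hx
  have hs : L'.spin x = (L.translate a u).spin x := ha.symm
  have hf : L'.flat x = (L.translate a u).flat x := hu.symm
  obtain ⟨β, hβ⟩ := LocalFrame.exists_spin_transition hd C hx' hx1 hs hv₀
  have hR := (LocalFrame.dirDeriv_unitLift hd C hx' hx1 hs hv₀ fun y => (0 : TangentSpace I y)).1
  refine (contMDiffAt_pi_space.2 fun b => ?_).contMDiffWithinAt
  have h1 : ContMDiffAt I 𝓘(ℝ, Δ) ∞ (fun y => evalL Δ (C.unitLift v₀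
      (L'.transition (L.translate a u) y))
        (ψ ((L.translate a u).spin y) ((L.translate a u).flat y) b)) x :=
    ((evalL Δ).contMDiff.contMDiffAt.comp x hR).clm_apply (contMDiffAt_pi_space.1 hL1 b)
  refine h1.congr_of_eventuallyEq ?_
  filter_upwards [hβ, L'.flat_eventuallyEq (L.translate a u) hx' hx1 hf, hW.mem_nhds hxW]
    with y hy hfy hyW
  obtain ⟨h1, h2, h3, -, h4⟩ := hy
  have h5 := congrFun (heq _ _ (L'.proj_spin_eq_proj_flat h1) (by rwa [L'.spin_proj y h1]) (β y) 1) b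
  rw [h3, E.act_one, hfy] at h5
  rw [hfy, h5, evalL_apply, ← h4, C.repL_apply]
  simp [twist, Matrix.one_apply, ite_smul]

end Frames

/-! ### Sections over the collar -/

section Collar

variable {n : ℕ} {X : Type*} [TopologicalSpace X] [ChartedSpace (EuclideanHalfSpace (n + 1)) X]
  [IsManifold (𝓡∂ (n + 1)) ∞ X]
  {Y : Type*} [TopologicalSpace Y] [ChartedSpace (EuclideanSpace ℝ (Fin n)) Y]
  [IsManifold (𝓡 n) ∞ Y]
  {col : Collar n X Y} {gX : RiemMetric (𝓡∂ (n + 1)) X} {gY : RiemMetric (𝓡 n) Y}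
  {QX QY : Type*} [TopologicalSpace QX] [TopologicalSpace QY]
  {SX : SpinStructure gX QX} {SY : SpinStructure gY QY} {j : QY → QX}
  {N : ℕ} {PX PY : Type*} [TopologicalSpace PX] [TopologicalSpace PY]
  {EX : FlatHermitianBundle X N PX} {EY : FlatHermitianBundle Y N PY} {jE : PY → PX}
  {x : X} {t : ℝ} {y : Y} {T : ℝ → QY → QX} {τ : ℝ → PY → PX}
  {ΔX ΔY : Type*} [NormedAddCommGroup ΔX] [InnerProductSpace ℂ ΔX]
  [NormedAddCommGroup ΔY] [InnerProductSpace ℂ ΔY] {CX : SpinorModule (n + 1) ΔX}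
  {CY : SpinorModule n ΔY} {κ : ΔY →ₗᵢ[ℂ] ΔX}
  {φ : ℝ → SpinorField QY PY ΔY N} {ψ : SpinorField QX PX ΔX N}

namespace LocalFrame

lemma mk_frame_collar (hg : IsProductMetric col gX gY) (hT : IsSpinTransport col SX SY j T)
    (L : LocalFrame SY EY) (hx : x ∈ col.W) (hxU : col.p x ∈ L.U) (k : Fin (n + 1)) :
    (⟨SX.proj (T (col.r x) (L.spin (col.p x))), SX.frame (T (col.r x) (L.spin (col.p x))) k⟩ :
      TangentBundle (𝓡∂ (n + 1)) X) = ⟨x, col.frame L.vec k x⟩ := by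
  have ht := col.r_mem x hx
  have hp := L.spin_proj _ hxU
  have hpx : x = col.Φ (col.r x) (SY.proj (L.spin (col.p x))) := by rw [hp, col.Φ_r_p x hx]
  refine ((isAdapted_iff hg ht (hT.proj_eq _ ht _)).1 (hT.adapted _ ht _) k).trans
    (Eq.symm ((Collar.mk_eq_liftAt_iff hg ht hpx).2 ⟨Collar.dr_lift hg hx _ _, ?_⟩))
  refine (congrArg (fun w => (⟨col.p x, w⟩ : TangentBundle (𝓡 n) Y))
    (Collar.dp_lift hg hx _ _)).trans ?_
  refine Fin.lastCases ?_ (fun i => ?_) k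
  · refine tangentBundle_mk_eq_iff.2 ⟨hp.symm, ?_⟩
    rw [snocZero_last, frameSnoc, Fin.snoc_last]
    rfl
  · rw [snocZero_castSucc, frameSnoc, Fin.snoc_castSucc]
    exact (L.frame_spin _ hxU i).symm

/-- The local frame on the collar that extends a local frame of the boundary. -/
def collar (L : LocalFrame SY EY) (hg : IsProductMetric col gX gY)
    (hT : IsSpinTransport col SX SY j T) (hτ : IsFlatTransport col EX EY jE τ) :
    LocalFrame SX EX where
  U := col.W ∩ col.p ⁻¹' L.U
  isOpen_U := col.isOpen_over L.isOpen_U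
  spin x := T (col.r x) (L.spin (col.p x))
  flat x := τ (col.r x) (L.flat (col.p x))
  vec := col.frame L.vec
  spin_continuous := hT.continuousOn.comp (f := fun x => (col.r x, L.spin (col.p x)))
    ((col.r_smooth.continuousOn.mono inter_subset_left).prodMk (L.spin_continuous.comp
      (col.p_smooth.continuousOn.mono inter_subset_left) fun _ hx => hx.2))
    fun x hx => ⟨col.r_mem x hx.1, mem_univ _⟩
  flat_continuous := hτ.continuousOn.comp (f := fun x => (col.r x, L.flat (col.p x)))
    ((col.r_smooth.continuousOn.mono inter_subset_left).prodMk (L.flat_continuous.comp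
      (col.p_smooth.continuousOn.mono inter_subset_left) fun _ hx => hx.2))
    fun x hx => ⟨col.r_mem x hx.1, mem_univ _⟩
  vec_smooth := Collar.smoothVF_frame hg SX L.isOpen_U L.vec_smooth
  spin_proj x hx := by
    rw [hT.proj_eq _ (col.r_mem x hx.1), L.spin_proj _ hx.2, col.Φ_r_p x hx.1]
  flat_proj x hx := by
    rw [hτ.proj_eq _ (col.r_mem x hx.1), L.flat_proj _ hx.2, col.Φ_r_p x hx.1]
  frame_spin x hx k := L.mk_frame_collar hg hT hx.1 hx.2 k

end LocalFrame

/-- Every pair of frames over the collar is a translate of transported frames. -/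
lemma exists_transport_act (SY : SpinStructure gY QY) (EY : FlatHermitianBundle Y N PY)
    (hT : IsSpinTransport col SX SY j T)
    (hτ : IsFlatTransport col EX EY jE τ) {q : QX} {f : PX} (h : SX.proj q = EX.proj f)
    (hW : SX.proj q ∈ col.W) :
    ∃ t ∈ Ico 0 col.ε, ∃ q₀ f₀ a u, SY.proj q₀ = EY.proj f₀ ∧ SX.act (T t q₀) a = q ∧
      EX.act (τ t f₀) u = f := by
  have ht := col.r_mem _ hW
  obtain ⟨q₀, hq₀⟩ := SY.surjective (col.p (SX.proj q))
  obtain ⟨f₀, hf₀⟩ := EY.surjective (col.p (SX.proj q))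
  obtain ⟨a, ha, -⟩ := SX.simply_transitive (T (col.r (SX.proj q)) q₀) q (by
    rw [hT.proj_eq _ ht, hq₀, col.Φ_r_p _ hW])
  obtain ⟨u, hu, -⟩ := EX.simply_transitive (τ (col.r (SX.proj q)) f₀) f (by
    rw [hτ.proj_eq _ ht, hf₀, col.Φ_r_p _ hW, h])
  exact ⟨_, ht, q₀, f₀, a, u, hq₀.trans hf₀.symm, ha, hu⟩

lemma IsSpinorIdentification.map_twist (hκ : IsSpinorIdentification CX CY κ) (a : SpinGrp n)
    (u : Matrix.unitaryGroup (Fin N) ℂ) (v : Fin N → ΔY) :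
    (fun b => κ (twist CY a u v b)) = twist CX (inclSpin n a) u fun b => κ (v b) := by
  funext b
  simp only [twist, map_sum, map_smul, hκ.map_rep_spin]

/-- A family of sections over `Y` extends to an equivariant field over the collar. -/
lemma exists_equivariant_extension (hκ : IsSpinorIdentification CX CY κ)
    (hg : IsProductMetric col gX gY) (hj : IsInducedSpin col SX SY j)
    (hjE : IsRestrictedBundle col EX EY jE) (hT : IsSpinTransport col SX SY j T)
    (hτ : IsFlatTransport col EX EY jE τ)
    (hφ : ∀ t ∈ Ico 0 col.ε, IsSmoothSection SY EY CY univ (φ t)) :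
    ∃ ψ : SpinorField QX PX ΔX N, ∀ t ∈ Ico 0 col.ε, ∀ q₀ f₀, SY.proj q₀ = EY.proj f₀ →
      ∀ a u, ψ (SX.act (T t q₀) a) (EX.act (τ t f₀) u)
        = twist CX a⁻¹ u⁻¹ fun b => κ (φ t q₀ f₀ b) := by
  classical
  -- Well-definedness: the base point determines `t` and the point of `Y`, and two choices of frames
  -- over it differ by `Spin(n) × U(N)`. Equivariance of the transports and of `φ t` absorbs the
  -- difference.
  have key : ∀ t ∈ Ico 0 col.ε, ∀ t' ∈ Ico 0 col.ε, ∀ q₀ f₀ q₁ f₁ a u a' u',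
      SY.proj q₀ = EY.proj f₀ → SY.proj q₁ = EY.proj f₁ →
      SX.act (T t q₀) a = SX.act (T t' q₁) a' → EX.act (τ t f₀) u = EX.act (τ t' f₁) u' →
      (twist CX a⁻¹ u⁻¹ fun b => κ (φ t q₀ f₀ b))
        = twist CX a'⁻¹ u'⁻¹ fun b => κ (φ t' q₁ f₁ b) := by
    intro t ht t' ht' q₀ f₀ q₁ f₁ a u a' u' h0 h1 hq hf
    have hpr := congrArg SX.proj hq
    rw [SX.proj_act, SX.proj_act, hT.proj_eq t ht, hT.proj_eq t' ht'] at hpr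
    have htt : t = t' := by
      have := congrArg col.r hpr
      rwa [col.r_Φ t ht, col.r_Φ t' ht'] at this
    subst htt
    have hyy : SY.proj q₀ = SY.proj q₁ := by
      have := congrArg col.p hpr
      rwa [col.p_Φ t ht, col.p_Φ t ht] at this
    obtain ⟨c, hc, -⟩ := SY.simply_transitive q₀ q₁ hyy
    obtain ⟨w, hw, -⟩ := EY.simply_transitive f₀ f₁ (by rw [← h0, ← h1, hyy])
    rw [← hc, hT.act_eq hg hj q₀ c ht, ← SX.act_mul] at hq
    rw [← hw, hτ.act_eq hjE f₀ w ht, ← EX.act_mul] at hf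
    have ha : a = inclSpin n c * a' :=
      (SX.simply_transitive (T t q₀) _ (SX.proj_act _ _).symm).unique hq rfl
    have hu : u = w * u' :=
      (EX.simply_transitive (τ t f₀) _ (EX.proj_act _ _).symm).unique hf rfl
    have h2 : φ t q₀ f₀ = twist CY c w (φ t q₁ f₁) := by
      rw [← hc, ← hw]
      exact funext fun b => (hφ t ht).equivariant q₀ f₀ h0 (mem_univ _) c w b
    rw [h2, hκ.map_twist, ← twist_mul, ha, hu, mul_inv_rev, mul_inv_rev, mul_assoc, mul_assoc,
      inv_mul_cancel, inv_mul_cancel, mul_one, mul_one]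
  let R : QX → PX → (Fin N → ΔX) → Prop := fun q f v =>
    ∃ t ∈ Ico 0 col.ε, ∃ q₀ f₀ a u, SY.proj q₀ = EY.proj f₀ ∧ SX.act (T t q₀) a = q ∧
      EX.act (τ t f₀) u = f ∧ v = twist CX a⁻¹ u⁻¹ fun b => κ (φ t q₀ f₀ b)
  refine ⟨fun q f => if h : ∃ v, R q f v then h.choose else 0, fun t ht q₀ f₀ h0 a u => ?_⟩
  have h : ∃ v, R (SX.act (T t q₀) a) (EX.act (τ t f₀) u) v :=
    ⟨_, t, ht, q₀, f₀, a, u, h0, rfl, rfl, rfl⟩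
  simp only
  rw [dif_pos h]
  obtain ⟨t', ht', q₁, f₁, a', u', h1, hq, hf, hv⟩ := h.choose_spec
  rw [hv]
  exact key t' ht' t ht q₁ f₁ q₀ f₀ a' u' a u h1 h0 hq hf

end Collar

/-! ### Twisted spinors under changes of frames -/

/-! ### Positive spinors on the collar as families of spinors of the boundary -/

section Collar

variable {n : ℕ} {X : Type*} [TopologicalSpace X] [ChartedSpace (EuclideanHalfSpace (n + 1)) X]
  [IsManifold (𝓡∂ (n + 1)) ∞ X]
  {Y : Type*} [TopologicalSpace Y] [ChartedSpace (EuclideanSpace ℝ (Fin n)) Y]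
  [IsManifold (𝓡 n) ∞ Y]
  {col : Collar n X Y} {gX : RiemMetric (𝓡∂ (n + 1)) X} {gY : RiemMetric (𝓡 n) Y}
  {QX QY : Type*} [TopologicalSpace QX] [TopologicalSpace QY]
  {SX : SpinStructure gX QX} {SY : SpinStructure gY QY} {j : QY → QX}
  {N : ℕ} {PX PY : Type*} [TopologicalSpace PX] [TopologicalSpace PY]
  {EX : FlatHermitianBundle X N PX} {EY : FlatHermitianBundle Y N PY} {jE : PY → PX}
  {x : X} {t : ℝ} {y : Y} {T : ℝ → QY → QX} {τ : ℝ → PY → PX}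
  {ΔX ΔY : Type*} [NormedAddCommGroup ΔX] [InnerProductSpace ℂ ΔX]
  [NormedAddCommGroup ΔY] [InnerProductSpace ℂ ΔY] {CX : SpinorModule (n + 1) ΔX}
  {CY : SpinorModule n ΔY} {κ : ΔY →ₗᵢ[ℂ] ΔX}
  {φ : ℝ → SpinorField QY PY ΔY N} {ψ : SpinorField QX PX ΔX N}

/-- Positive sections over the collar come from families of sections over `Y`. -/
theorem IsPositiveSection.exists_family (hκ : IsSpinorIdentification CX CY κ)
    (hg : IsProductMetric col gX gY) (hj : IsInducedSpin col SX SY j)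
    (hjE : IsRestrictedBundle col EX EY jE) (hT : IsSpinTransport col SX SY j T)
    (hτ : IsFlatTransport col EX EY jE τ) (hψ : IsPositiveSection col SX EX CX ψ) :
    ∃ φ, IsSmoothFamily col.ε SY EY CY φ ∧ Corresponds col.ε SY EY T τ κ φ ψ := by
  have := CX.finiteDimensional
  -- Positivity of `ψ` puts its relevant values in the range of `κ`, so any linear left inverse
  -- recovers the family; its linearity gives smoothness.
  obtain ⟨G, hG⟩ := LinearMap.exists_leftInverse_of_injective κ.toLinearMap
    (LinearMap.ker_eq_bot.2 κ.injective)
  have hGκ : ∀ v, G (κ v) = v := fun v => LinearMap.congr_fun hG v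
  have hproj : ∀ t ∈ Ico 0 col.ε, ∀ q f, SY.proj q = EY.proj f →
      SX.proj (T t q) = EX.proj (τ t f) ∧ SX.proj (T t q) ∈ col.W := by
    intro t ht q f h
    rw [hT.proj_eq t ht, hτ.proj_eq t ht, h]
    exact ⟨rfl, col.Φ_mem t ht _⟩
  have hcor : Corresponds col.ε SY EY T τ κ (fun t q f b => G (ψ (T t q) (τ t f) b)) ψ := by
    intro t ht q f h b
    obtain ⟨h1, h2⟩ := hproj t ht q f h
    obtain ⟨v, hv⟩ := (hκ.range_eq _).2 (hψ.2 _ _ h1 h2 b)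
    simp only [← hv, hGκ]
  have hsm : ∀ L : LocalFrame SY EY, ContMDiffOn (𝓘(ℝ, ℝ).prod (𝓡 n)) 𝓘(ℝ, Fin N → ΔY) ∞
      (fun z : ℝ × Y => fun b => G (ψ (T z.1 (L.spin z.2)) (τ z.1 (L.flat z.2)) b))
      (Ico 0 col.ε ×ˢ L.U) := by
    intro L
    have h1 := (hψ.1.smooth (L.collar hg hT hτ)).comp (f := fun z : ℝ × Y => col.Φ z.1 z.2)
      (s := Ico 0 col.ε ×ˢ L.U) (col.Φ_smooth.mono (prod_mono_right (subset_univ _))) (by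
        rintro ⟨t, y⟩ ⟨ht, hy⟩
        refine ⟨⟨col.Φ_mem t ht y, ?_⟩, col.Φ_mem t ht y⟩
        change col.p (col.Φ t y) ∈ L.U
        rwa [col.p_Φ t ht])
    rw [contMDiffOn_pi_space]
    intro b
    have h2 := ((LinearMap.toContinuousLinearMap G).restrictScalars ℝ).contMDiff.comp_contMDiffOn
      (contMDiffOn_pi_space.1 h1 b)
    refine h2.congr ?_
    rintro ⟨t, y⟩ ⟨ht, hy⟩
    simp only [Function.comp, LocalFrame.collar, col.r_Φ t ht, col.p_Φ t ht]
    rfl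
  refine ⟨_, ⟨fun t ht => ⟨fun q f h _ a u b => ?_, fun L => ?_⟩, hsm⟩, hcor⟩
  · apply κ.injective
    obtain ⟨h1, h2⟩ := hproj t ht q f h
    have h3 := hcor t ht (SY.act q a) (EY.act f u) (by rw [SY.proj_act, EY.proj_act, h])
    have h4 := hψ.1.equivariant _ _ h1 h2 (inclSpin n a) u b
    rw [← hT.act_eq hg hj q a ht, ← hτ.act_eq hjE f u ht, hcor t ht q f h] at h4
    refine h4.trans ?_
    simp only [map_sum, map_smul, hκ.map_rep_spin]
    exact Finset.sum_congr rfl fun b' _ => congrArg _ (congrArg _ (h3 b'))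
  · have h1 : ContMDiff (𝓡 n) (𝓘(ℝ, ℝ).prod (𝓡 n)) ∞ fun y : Y => (t, y) :=
      contMDiff_const.prodMk contMDiff_id
    exact (hsm L).comp h1.contMDiffOn fun y hy => ⟨ht, hy.1⟩

/-- Families of sections over `Y` give positive sections over the collar. -/
theorem IsSmoothFamily.exists_section (hκ : IsSpinorIdentification CX CY κ)
    (hg : IsProductMetric col gX gY) (hj : IsInducedSpin col SX SY j)
    (hjE : IsRestrictedBundle col EX EY jE) (hT : IsSpinTransport col SX SY j T)
    (hτ : IsFlatTransport col EX EY jE τ) (hφ : IsSmoothFamily col.ε SY EY CY φ) :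
    ∃ ψ, IsPositiveSection col SX EX CX ψ ∧ Corresponds col.ε SY EY T τ κ φ ψ := by
  obtain ⟨ψ, hψ⟩ := exists_equivariant_extension hκ hg hj hjE hT hτ hφ.isSection
  have hcor : Corresponds col.ε SY EY T τ κ φ ψ := by
    intro t ht q f h b
    have := hψ t ht q f h 1 1
    rw [SX.act_one, EX.act_one, inv_one, inv_one, twist_one] at this
    rw [this]
  refine ⟨ψ, ⟨IsSmoothSection.of_contMDiffAt n.succ_pos col.isOpen_W ?_ fun x hx => ?_, ?_⟩, hcor⟩
  · intro q f h hW a u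
    obtain ⟨t, ht, q₀, f₀, a₀, u₀, h0, rfl, rfl⟩ := exists_transport_act SY EY hT hτ h hW
    rw [← SX.act_mul, ← EX.act_mul, hψ t ht q₀ f₀ h0, hψ t ht q₀ f₀ h0, mul_inv_rev, mul_inv_rev,
      twist_mul, twist_twist_inv]
  · obtain ⟨L, hL⟩ := exists_localFrame_at SY EY (col.p x)
    refine ⟨L.collar hg hT hτ, ⟨hx, hL⟩, ?_⟩
    have hO := (L.collar hg hT hτ).isOpen_U.mem_nhds (show x ∈ (L.collar hg hT hτ).U from ⟨hx, hL⟩)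
    have h1 : ContMDiffOn (𝓡∂ (n + 1)) 𝓘(ℝ, Fin N → ΔY) ∞
        (fun x => φ (col.r x) (L.spin (col.p x)) (L.flat (col.p x)))
        (L.collar hg hT hτ).U :=
      (hφ.smooth L).comp (f := fun x => (col.r x, col.p x))
        ((col.r_smooth.mono inter_subset_left).prodMk (col.p_smooth.mono inter_subset_left))
        fun x hx => ⟨col.r_mem x hx.1, hx.2⟩
    refine ContMDiffOn.contMDiffAt (contMDiffOn_pi_space.2 fun b => ?_) hO
    have h2 := (κ.toContinuousLinearMap.restrictScalars ℝ).contMDiff.comp_contMDiffOn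
      (contMDiffOn_pi_space.1 h1 b)
    refine h2.congr fun x hx => ?_
    exact hcor _ (col.r_mem x hx.1) _ _ (L.proj_spin_eq_proj_flat hx.2) b
  · intro q f h hW b
    obtain ⟨t, ht, q₀, f₀, a₀, u₀, h0, rfl, rfl⟩ := exists_transport_act SY EY hT hτ h hW
    rw [← hκ.range_eq, hψ t ht q₀ f₀ h0]
    choose g hg using fun b' => hκ.rep_mem_range (spinGroup.mem_even (a₀⁻¹).2) (φ t q₀ f₀ b')
    refine ⟨∑ b', ((u₀⁻¹ : Matrix.unitaryGroup (Fin N) ℂ) : Matrix (Fin N) (Fin N) ℂ) b b' •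
      g b', ?_⟩
    simp only [twist, map_sum, map_smul, hg]

/-- Every pair of frames over the collar is a translate of transported frames, where both sections
are determined by `φ`; equivariance does the rest. -/
theorem Corresponds.section_unique (hT : IsSpinTransport col SX SY j T)
    (hτ : IsFlatTransport col EX EY jE τ) {ψ' : SpinorField QX PX ΔX N}
    (hψ : IsPositiveSection col SX EX CX ψ) (hψ' : IsPositiveSection col SX EX CX ψ')
    (h : Corresponds col.ε SY EY T τ κ φ ψ) (h' : Corresponds col.ε SY EY T τ κ φ ψ')
    {q : QX} {f : PX} (hqf : SX.proj q = EX.proj f) (hW : SX.proj q ∈ col.W) :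
    ψ' q f = ψ q f := by
  obtain ⟨t, ht, q₀, f₀, a, u, h0, rfl, rfl⟩ := exists_transport_act SY EY hT hτ hqf hW
  have h1 : SX.proj (T t q₀) = EX.proj (τ t f₀) := by
    rw [hT.proj_eq t ht, hτ.proj_eq t ht, h0]
  rw [SX.proj_act] at hW
  rw [hψ.1.act_eq h1 hW, hψ'.1.act_eq h1 hW]
  congr 1
  funext b
  rw [h t ht q₀ f₀ h0, h' t ht q₀ f₀ h0]

/-- The twisted Dirac operator on the collar. -/
theorem twistedDirac_collar (hn : Odd n) (hκ : IsSpinorIdentification CX CY κ)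
    (hg : IsProductMetric col gX gY) (hT : IsSpinTransport col SX SY j T)
    (hτ : IsFlatTransport col EX EY jE τ) {η : MixedForm (𝓡∂ (n + 1)) X}
    (hodd : ∀ k, Even k → ∀ x, η k x = 0) (hη : IsBoundaryCompatible col η)
    (hφ : IsSmoothFamily col.ε SY EY CY φ) (hψ : IsPositiveSection col SX EX CX ψ)
    (h : Corresponds col.ε SY EY T τ κ φ ψ) (ht : t ∈ Ico 0 col.ε) {q : QY} {f : PY}
    (hqf : SY.proj q = EY.proj f) (b : Fin N) :
    twistedDirac SX EX CX η ψ (T t q) (τ t f) b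
      = normalMul CX (κ (derivWithin (fun s => φ s q f) (Ico 0 col.ε) t b
          + twistedDirac SY EY CY (restrictForm col η) (φ t) q f b)) := by
  obtain ⟨L, hyU, hLq, hLf⟩ := LocalFrame.exists_through SY EY q f hqf
  set y := SY.proj q with hy
  set L' := L.collar hg hT hτ with hL'
  have hx := col.Φ_mem t ht y
  have hxp := col.p_Φ t ht y
  have hxr := col.r_Φ t ht y
  have hxU : col.Φ t y ∈ L'.U := ⟨hx, by change col.p _ ∈ L.U; rwa [hxp]⟩
  have hq : T t q = L'.spin (col.Φ t y) := by
    change _ = T (col.r _) (L.spin (col.p _))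
    rw [hxp, hxr, hLq]
  have hf : τ t f = L'.flat (col.Φ t y) := by
    change _ = τ (col.r _) (L.flat (col.p _))
    rw [hxp, hxr, hLf]
  have hval : ψ (L'.spin (col.Φ t y)) (L'.flat (col.Φ t y)) b = κ (φ t q f b) := by
    rw [← hq, ← hf, h t ht q f hqf]
  have hDY : twistedDirac SY EY CY (restrictForm col η) (φ t) q f b
      = ∑ i, CY.gen i (dirDeriv (𝓡 n) (fun y => φ t (L.spin y) (L.flat y) b) (L.vec i) y)
        + diracZeroth gY CY (restrictForm col η) L.vec y (φ t q f b) := by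
    rw [← hLq, ← hLf, twistedDirac_localFrame hn.pos (hφ.isSection t ht) isOpen_univ _ L
      (mem_univ y) hyU, twistedDiracInFrame_apply (hφ.isSection t ht) isOpen_univ (mem_univ y) _ L
      hyU]
  have hG := hψ.1.mdifferentiableAt_apply col.isOpen_W hx L' hxU b
  have hzero : diracZeroth gX CX η L'.vec (col.Φ t y) (κ (φ t q f b))
      = normalMul CX (κ (diracZeroth gY CY (restrictForm col η) L.vec y (φ t q f b))) := by
    have := diracZeroth_frame hκ hn hodd hη hg SX L.isOpen_U L.vec_smooth hx hxU.2 (φ t q f b)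
    rwa [hxp] at this
  -- On the slice `r = t` the components of `ψ` are `κ` applied to those of `φ t`, and `dΦ_t`
  -- carries the frame of `Y` to the tangential frame vectors.
  have htan : ∀ i, dirDeriv (𝓡∂ (n + 1)) (fun x => ψ (L'.spin x) (L'.flat x) b)
      (L'.vec i.castSucc) (col.Φ t y)
      = κ (dirDeriv (𝓡 n) (fun y => φ t (L.spin y) (L.flat y) b) (L.vec i) y) := by
    intro i
    have h1 : κ (dirDeriv (𝓡 n) (fun y => φ t (L.spin y) (L.flat y) b) (L.vec i) y)
        = dirDeriv (𝓡 n) (fun y => κ (φ t (L.spin y) (L.flat y) b)) (L.vec i) y :=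
      (dirDeriv_clm (κ.toContinuousLinearMap.restrictScalars ℝ)
        ((hφ.isSection t ht).mdifferentiableAt_apply isOpen_univ (mem_univ y) L hyU b)).symm
    have h2 : (fun y => κ (φ t (L.spin y) (L.flat y) b)) =ᶠ[nhds y]
        (fun x => ψ (L'.spin x) (L'.flat x) b) ∘ col.Φ t := by
      filter_upwards [L.isOpen_U.mem_nhds hyU] with z hz
      change _ = ψ (T (col.r _) (L.spin (col.p _))) (τ (col.r _) (L.flat (col.p _))) b
      rw [col.p_Φ t ht, col.r_Φ t ht, h t ht _ _ (L.proj_spin_eq_proj_flat hz)]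
    rw [h1, dirDeriv_congr h2]
    have h3 := mfderiv_comp (I := 𝓡 n) (I' := 𝓡∂ (n + 1)) (I'' := 𝓘(ℝ, ΔX)) y hG
      (col.mdifferentiableAt_slice ht y)
    refine Eq.trans ?_ (congrArg (fun K => K (L.vec i y)) h3).symm
    refine congrArg (mfderiv (𝓡∂ (n + 1)) 𝓘(ℝ, ΔX) (fun x => ψ (L'.spin x) (L'.flat x) b)
      (col.Φ t y)) ?_
    have hw : (⟨col.p (col.Φ t y), snocZero L.vec i.castSucc (col.p (col.Φ t y))⟩ :
        TangentBundle (𝓡 n) Y) = ⟨y, L.vec i y⟩ := by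
      rw [snocZero_castSucc, hxp]
    refine Eq.trans ?_ (Collar.mfderiv_slice hg ht hw).symm
    change col.lift _ _ _ = _
    rw [if_neg (Fin.castSucc_lt_last i).ne]
  -- Along a line of the collar the transported frames keep `q` and `f` fixed, so the normal
  -- derivative of the components is the derivative of the family in `t`.
  have hnor : dirDeriv (𝓡∂ (n + 1)) (fun x => ψ (L'.spin x) (L'.flat x) b)
      (L'.vec (Fin.last n)) (col.Φ t y)
      = κ (derivWithin (fun s => φ s q f) (Ico 0 col.ε) t b) := by
    have h1 := Collar.derivWithin_line hg ht hG
    have h2 : L'.vec (Fin.last n) (col.Φ t y) = col.lift (col.Φ t y) 1 0 := by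
      change col.lift _ _ _ = _
      rw [if_pos rfl, snocZero_last]
    rw [dirDeriv, h2]
    refine h1.symm.trans ?_
    have hu := uniqueDiffOn_Ico 0 col.ε t ht
    have h3 : ContDiffOn ℝ ∞ (fun s => φ s q f) (Ico 0 col.ε) := by
      have h4 : ContMDiff 𝓘(ℝ, ℝ) (𝓘(ℝ, ℝ).prod (𝓡 n)) ∞ fun s : ℝ => (s, y) :=
        contMDiff_id.prodMk contMDiff_const
      have h5 := (hφ.smooth L).comp h4.contMDiffOn (s := Ico 0 col.ε) fun s hs => ⟨hs, hyU⟩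
      refine contMDiffOn_iff_contDiffOn.1 (h5.congr fun s hs => ?_)
      simp only [Function.comp, hLq, hLf]
    have h6 := (h3.differentiableOn (by simp) t ht).hasDerivWithinAt
    have h7 := (κ.toContinuousLinearMap.restrictScalars ℝ).hasFDerivAt.comp_hasDerivWithinAt t
      (hasDerivWithinAt_pi.1 h6 b)
    refine Eq.trans (derivWithin_congr (fun s hs => ?_) ?_) (h7.derivWithin hu) <;>
    · change ψ (T (col.r _) (L.spin (col.p _))) (τ (col.r _) (L.flat (col.p _))) b = κ _
      rw [col.p_Φ _ (by assumption), col.r_Φ _ (by assumption), hLq, hLf,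
        h _ (by assumption) q f hqf]
  rw [hq, hf, twistedDirac_localFrame n.succ_pos hψ.1 col.isOpen_W _ L' hx hxU,
    twistedDiracInFrame_apply hψ.1 col.isOpen_W hx _ L' hxU, hval, hzero, hDY,
    Fin.sum_univ_castSucc, hnor]
  simp only [htan, hκ.gen_castSucc, map_add, map_sum]
  rw [normalMul]
  abel

/-- The restricted form on `e` is the value of `η` on the lifted fields, smooth over the collar,
pulled back along `Φ 0`. Continuity is all that integrating the defect requires of the flux. -/
lemma SmoothForm.continuousOn_restrictForm {η : MixedForm (𝓡∂ (n + 1)) X} (hη : SmoothForm η)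
    (hg : IsProductMetric col gX gY) (SX : SpinStructure gX QX) {V : Set Y} (hV : IsOpen V)
    {e : Fin n → ∀ y : Y, TangentSpace (𝓡 n) y} (he : ∀ i, SmoothVF (𝓡 n) (e i) V) {k : ℕ}
    (i : Fin k → Fin n) :
    ContinuousOn (fun y => restrictForm col η k y fun l => e (i l) y) V := by
  have h1 := (hη k _ (col.isOpen_over hV) (fun l => col.frame e (i l).castSucc) fun l =>
    Collar.smoothVF_frame hg SX hV he _).continuousOn
  have h0 := col.zero_mem
  have h2 := h1.comp (f := col.Φ 0) (s := V) (col.contMDiff_slice h0).continuous.continuousOn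
    fun y hy => ⟨col.Φ_mem 0 h0 y, by change col.p _ ∈ V; rwa [col.p_Φ 0 h0]⟩
  refine h2.congr fun y hy => ?_
  change η k (col.Φ 0 y) _ = η k (col.Φ 0 y) _
  congr 1
  funext l
  have hw : (⟨col.p (col.Φ 0 y), snocZero e (i l).castSucc (col.p (col.Φ 0 y))⟩ :
      TangentBundle (𝓡 n) Y) = ⟨y, e (i l) y⟩ := by
    rw [snocZero_castSucc, col.p_Φ 0 h0]
  refine (Collar.mfderiv_slice hg h0 hw).trans ?_
  rw [Collar.frame, if_neg (Fin.castSucc_lt_last (i l)).ne]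

end Collar

end

/-! ### Assembly of the theorem -/

theorem mainTheorem8
    (m N : ℕ)
    {X : Type*} [TopologicalSpace X] [T2Space X] [CompactSpace X]
    [ChartedSpace (EuclideanHalfSpace (2 * m + 1 + 1)) X]
    [IsManifold (𝓡∂ (2 * m + 1 + 1)) ∞ X]
    {Y : Type*} [TopologicalSpace Y] [T2Space Y] [CompactSpace Y]
    [ChartedSpace (EuclideanSpace ℝ (Fin (2 * m + 1))) Y]
    [IsManifold (𝓡 (2 * m + 1)) ∞ Y]
    [MeasurableSpace Y] [BorelSpace Y]
    (gX : RiemMetric (𝓡∂ (2 * m + 1 + 1)) X) (gY : RiemMetric (𝓡 (2 * m + 1)) Y)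
    (col : Collar (2 * m + 1) X Y) (hg : IsProductMetric col gX gY)
    {QX QY : Type*} [TopologicalSpace QX] [TopologicalSpace QY]
    (SX : SpinStructure gX QX) (SY : SpinStructure gY QY)
    (j : QY → QX) (hj : IsInducedSpin col SX SY j)
    {PX PY : Type*} [TopologicalSpace PX] [TopologicalSpace PY]
    (EX : FlatHermitianBundle X N PX) (EY : FlatHermitianBundle Y N PY)
    (jE : PY → PX) (hjE : IsRestrictedBundle col EX EY jE)
    {ΔX ΔY : Type*} [NormedAddCommGroup ΔX] [InnerProductSpace ℂ ΔX]
    [NormedAddCommGroup ΔY] [InnerProductSpace ℂ ΔY]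
    (CX : SpinorModule (2 * m + 1 + 1) ΔX) (CY : SpinorModule (2 * m + 1) ΔY)
    (κ : ΔY →ₗᵢ[ℂ] ΔX) (hκ : IsSpinorIdentification CX CY κ)
    (η : MixedForm (𝓡∂ (2 * m + 1 + 1)) X) (hη : IsFluxForm η)
    (hηb : IsBoundaryCompatible col η) :
    -- the identification over the boundary extends to the collar
    (∃ T, IsSpinTransport col SX SY j T) ∧ (∃ τ, IsFlatTransport col EX EY jE τ) ∧
    (∀ T τ, IsSpinTransport col SX SY j T → IsFlatTransport col EX EY jE τ →
      -- it identifies the sections of `𝒮⁺ ⊗ ℰ` over the collar with those of `p^*(𝒮_Y ⊗ ℰ|_Y)`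
      (∀ ψ, IsPositiveSection col SX EX CX ψ →
        ∃ φ, IsSmoothFamily col.ε SY EY CY φ ∧ Corresponds col.ε SY EY T τ κ φ ψ) ∧
      (∀ φ, IsSmoothFamily col.ε SY EY CY φ →
        ∃ ψ, IsPositiveSection col SX EX CX ψ ∧ Corresponds col.ε SY EY T τ κ φ ψ ∧
          ∀ ψ', IsPositiveSection col SX EX CX ψ' → Corresponds col.ε SY EY T τ κ φ ψ' →
            ∀ q f, SX.proj q = EX.proj f → SX.proj q ∈ col.W → ψ' q f = ψ q f) ∧
      -- and the twisted Dirac operator of `X` with `σ (∂/∂r + D_Y)`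
      (∀ φ ψ, IsSmoothFamily col.ε SY EY CY φ → IsPositiveSection col SX EX CX ψ →
        Corresponds col.ε SY EY T τ κ φ ψ →
        ∀ t ∈ Ico 0 col.ε, ∀ q f, SY.proj q = EY.proj f → ∀ b,
          twistedDirac SX EX CX η ψ (T t q) (τ t f) b =
            normalMul CX (κ (derivWithin (fun s => φ s q f) (Ico 0 col.ε) t b
              + twistedDirac SY EY CY (restrictForm col η) (φ t) q f b)))) ∧
    -- the operator `D_Y` is self-adjoint and elliptic
    (∀ μ : Measure Y, IsRiemannianVolume gY μ →
      IsFormallySelfAdjoint SY EY CY μ (twistedDirac SY EY CY (restrictForm col η))) ∧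
    IsEllipticFirstOrder SY EY CY (twistedDirac SY EY CY (restrictForm col η)) := by
  have hn : Odd (2 * m + 1) := ⟨m, rfl⟩
  have hodd : ∀ k, Even k → ∀ y, restrictForm col η k y = 0 := fun k hk y => by
    rw [restrictForm, hη.odd k hk]
    rfl
  have hcont : ∀ (L : LocalFrame SY EY) (k : ℕ) (i : Fin k → Fin (2 * m + 1)),
      ContinuousOn (fun y => restrictForm col η k y fun l => L.vec (i l) y) L.U := fun L k i =>
    hη.smooth.continuousOn_restrictForm hg SX L.isOpen_U L.vec_smooth i
  refine ⟨exists_isSpinTransport hn.pos hg EX hj, exists_isFlatTransport hjE,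
    fun T τ hT hτ => ⟨fun ψ hψ => hψ.exists_family hκ hg hj hjE hT hτ, fun φ hφ => ?_,
      fun φ ψ hφ hψ h t ht q f hqf b =>
        twistedDirac_collar hn hκ hg hT hτ hη.odd hηb hφ hψ h ht hqf b⟩,
    fun μ hμ => isFormallySelfAdjoint_twistedDirac hμ hn.pos hodd
      (fun k hk y v => hη.real_part k hk _ _) (fun k hk y v => hη.imag_part k hk _ _) hcont,
    isEllipticFirstOrder_twistedDirac hn.pos _⟩
  obtain ⟨ψ, hψ, h⟩ := hφ.exists_section hκ hg hj hjE hT hτ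
  exact ⟨ψ, hψ, h, fun ψ' hψ' h' q f hqf hW =>
    Corresponds.section_unique hT hτ hψ hψ' h h' hqf hW⟩
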